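/- Let $\mathbf S$ be a site. A \emph{strictly commutative Picard stack} over a site is a stack in groupoids $\mathcal P$ with a morphism of stacks $+:\mathcal P\times\mathcal P\to\mathcal P$ and natural associativity and commutativity isomorphisms making every $\mathcal P(U)$ a strictly commutative Picard category: $\mathcal P(U)$ is non-empty, the pentagon and hexagon axioms hold, $\mathsf c_{Y,X}\circ\mathsf c_{X,Y}=\mathrm{id}$, $\mathsf c_{X,X}=\mathrm{id}$, and every translation $X+(-)$ is an equivalence. Let $\mathbb P\mathrm{icard}$ be the fibred 2-category (2-stack) over $\mathbf S$ whose objects over $U$ are the strictly commutative Picard stacks over $\mathbf S_{/U}$, whose 1-arrows over $U\to V$ are additive functors to the restriction along $U\to V$ (that is, cartesian functors $F$ with natural isomorphisms $F(X+Y)\cong F(X)+F(Y)$ compatible with the associativity and commutativity isomorphisms), and whose 2-arrows are the morphisms of additive functors. Let $\mathbb T_{\mathbf 1}$ be the (constant) 2-stack whose objects are the powers $\mathbf 1^n$, $n\ge 0$, of the trivial Picard stack, whose 1-arrows $\mathbf 1^n\to\mathbf 1^k$ are the integer matrices with $k$ rows and $n$ columns, composed by the product of matrices, and whose only 2-arrows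 are identities (so there is no 2-arrow between distinct matrices). A 2-algebra for $\mathbb T_{\mathbf 1}$ over $U$ is a 2-functor (pseudofunctor) from $\mathbb T_{\mathbf 1}$ to the 2-category of stacks over $\mathbf S_{/U}$ which preserves finite products, including the empty one. Let $\mathrm{Alg}\,\mathbb T_{\mathbf 1}$ be the fibred 2-category (2-stack) over $\mathbf S$ whose objects over $U$ are the 2-algebras over $U$, whose 1-arrows over $U\to V$ are the pseudonatural transformations to the restriction along $U\to V$, and whose 2-arrows are the modifications. Then $\mathbb P\mathrm{icard}$ and $\mathrm{Alg}\,\mathbb T_{\mathbf 1}$ are fibred 2-categories over $\mathbf S$ and they are 2-equivalent: there is a cartesian 2-functor $\mathbb P\mathrm{icard}\to\mathrm{Alg}\,\mathbb T_{\mathbf 1}$ over $\mathbf S$ such that every 2-algebra over any $U$ is equivalent, over $U$, to the image of a Picard stack over $\mathbf S_{/U}$, and which induces equivalences on the categories of 1-arrows lying over each arrow of $\mathbf S$ (hence equivalences on the fibred categories of 1-arrows). It may be chosen so as to send every Picard stack $\mathcal P$ over $\mathbf S_{/U}$ to a 2-algebra equivalent to $\mathbf 1^n\mapsto\mathcal P^n$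 on which a matrix $(p_{ij})$ acts, up to isomorphism, by $(X_1,\dots,X_n)\mapsto\bigl(\sum_j p_{1j}X_j,\dots,\sum_j p_{kj}X_j\bigr)$. -/

import Mathlib

open CategoryTheory Bicategory
open scoped Pseudofunctor.StrongTrans

universe w w' w₁ w₂ v u v' u' v'' u''

namespace PicardMatrix

/-! ### Stacks over a site, as fibred categories -/

section Stacks

variable {B : Type u} [Category.{v} B] {X : Type w} [Category.{w'} X]

/-- A fibred category `p : X ⥤ B` is a stack for the topology `K` if arrows glue (the presheaves of
arrows are sheaves) and descent is effective for objects. Restrictions along the arrows of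
a covering sieve `R` are treated without choosing pullbacks. -/
structure IsStack (K : GrothendieckTopology B) (p : X ⥤ B) : Prop where
  fibered : p.IsFibered
  /-- Let `x`, `y` be two objects over the same object of `B`. A section over a covering sieve `R`
  of the presheaf of arrows from `x` to `y` is a compatible family `g` indexed by the arrows
  `φ : z ⟶ x` lying over an arrow of `R`; it comes from a unique arrow `x ⟶ y` over the identity. -/
  glue_arrows : ∀ (x y : X) (_ : p.obj y = p.obj x) (R : Sieve (p.obj x)), R ∈ K (p.obj x) →
    ∀ g : ∀ (z : X) (φ : z ⟶ x), R (p.map φ) → (z ⟶ y),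
      (∀ z φ hφ, p.IsHomLift (p.map φ) (g z φ hφ)) →
      (∀ (z z' : X) (ψ : z' ⟶ z) (φ : z ⟶ x) (hφ : R (p.map φ)) (hψ : R (p.map (ψ ≫ φ))),
        g z' (ψ ≫ φ) hψ = ψ ≫ g z φ hφ) →
      ∃! γ : x ⟶ y, p.IsHomLift (𝟙 (p.obj x)) γ ∧ ∀ z φ hφ, φ ≫ γ = g z φ hφ
  /-- A descent datum relative to a covering sieve `R` of `U` is a cartesian functor `D` from `R`
  (as a full subcategory of `B/U`) to `X` over `B`; it comes from an object over `U`. -/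
  glue_objects : ∀ (U : B) (R : Sieve U), R ∈ K U → ∀ D : R.arrows.category ⥤ X,
    (∀ {f f' : R.arrows.category} (h : f ⟶ f'),
      p.IsStronglyCartesian h.hom.left (D.map h)) →
    ∃ (x : X) (κ : ∀ f : R.arrows.category, D.obj f ⟶ x), p.obj x = U ∧
      (∀ f, p.IsStronglyCartesian f.obj.hom (κ f)) ∧
      (∀ {f f' : R.arrows.category} (h : f ⟶ f'), D.map h ≫ κ f' = κ f)

end Stacks

/-! ### Cartesian functors and vertical transformations -/

section Functors

variable {B : Type u} [Category.{v} B] {X : Type w} [Category.{w'} X]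
  {B' : Type u'} [Category.{v'} B'] {X' : Type w₁} [Category.{w₂} X']
  {B'' : Type*} [Category* B''] {X'' : Type*} [Category* X'']

/-- A cartesian functor from `p : X ⥤ B` to `q : X' ⥤ B'` lying over `G : B ⥤ B'`. -/
structure CartFunctor (G : B ⥤ B') (p : X ⥤ B) (q : X' ⥤ B') where
  F : X ⥤ X'
  w : F ⋙ q = p ⋙ G
  cart : ∀ {x y : X} (φ : x ⟶ y), p.IsStronglyCartesian (p.map φ) φ →
    q.IsStronglyCartesian (q.map (F.map φ)) (F.map φ)

/-- A natural transformation all of whose components lie over identities. -/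
def IsVertical {E : Type*} [Category* E] (q : X ⥤ B) {F F' : E ⥤ X} (τ : F ⟶ F') : Prop :=
  ∀ x, q.IsHomLift (𝟙 (q.obj (F.obj x))) (τ.app x)

theorem isHomLift_map_of_eq {p : X ⥤ B} {E : Type*} [Category* E] {F : E ⥤ X} {e : E ⥤ B}
    (w : F ⋙ p = e) {x y : E} (φ : x ⟶ y) : p.IsHomLift (e.map φ) (F.map φ) := by
  subst w
  exact IsHomLift.map p (F.map φ)

theorem isHomLift_congr {p : X ⥤ B} {a b : X} {T T' : B} (φ : a ⟶ b)
    (h : p.IsHomLift (𝟙 T) φ) (ha : p.obj a = T') : p.IsHomLift (𝟙 T') φ := by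
  have h1 := IsHomLift.domain_eq p (𝟙 T) φ
  obtain rfl : T = T' := h1.symm.trans ha
  exact h

namespace CartFunctor

variable {G : B ⥤ B'} {p : X ⥤ B} {q : X' ⥤ B'}

theorem obj_eq (F : CartFunctor G p q) (x : X) : q.obj (F.F.obj x) = G.obj (p.obj x) :=
  Functor.congr_obj F.w x

theorem lift_id (F : CartFunctor G p q) {T : B} {T' : B'} (hT : G.obj T = T') {a b : X}
    (φ : a ⟶ b) (h : p.IsHomLift (𝟙 T) φ) : q.IsHomLift (𝟙 T') (F.F.map φ) := by
  subst hT
  have h1 : q.IsHomLift ((p ⋙ G).map φ) (F.F.map φ) := isHomLift_map_of_eq F.w φ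
  obtain rfl := IsHomLift.domain_eq p (𝟙 T) φ
  have hb := IsHomLift.codomain_eq p (𝟙 (p.obj a)) φ
  have h2 := IsHomLift.fac' p (𝟙 (p.obj a)) φ
  have h3 := IsHomLift.fac' q ((p ⋙ G).map φ) (F.F.map φ)
  have ha' := F.obj_eq a
  have hb' := (F.obj_eq b).trans (congrArg G.obj hb)
  refine IsHomLift.of_fac' q _ _ ha' hb' ?_
  rw [h3]
  simp [h2, eqToHom_map]

/-- Composition of cartesian functors. -/
def comp {G' : B' ⥤ B''} {r : X'' ⥤ B''} {G'' : B ⥤ B''} (hG : G ⋙ G' = G'')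
    (F : CartFunctor G p q) (F' : CartFunctor G' q r) : CartFunctor G'' p r where
  F := F.F ⋙ F'.F
  w := by rw [Functor.assoc, F'.w, ← Functor.assoc, F.w, Functor.assoc, hG]
  cart φ h := F'.cart _ (F.cart φ h)

/-- The identity cartesian functor. -/
def id {G : B ⥤ B} (hG : G = 𝟭 B) (p : X ⥤ B) : CartFunctor G p p where
  F := 𝟭 X
  w := by subst hG; rfl
  cart _ h := h

end CartFunctor

namespace IsVertical

variable {E : Type*} [Category* E] {q : X ⥤ B}

theorem id (F : E ⥤ X) : IsVertical q (𝟙 F) := fun x => by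
  exact IsHomLift.id (p := q) (a := F.obj x) rfl

theorem obj_eq {F F' : E ⥤ X} {τ : F ⟶ F'} (h : IsVertical q τ) (x : E) :
    q.obj (F'.obj x) = q.obj (F.obj x) :=
  have := h x
  IsHomLift.codomain_eq q (𝟙 (q.obj (F.obj x))) (τ.app x)

theorem comp {F F' F'' : E ⥤ X} {τ : F ⟶ F'} {τ' : F' ⟶ F''} (h : IsVertical q τ)
    (h' : IsVertical q τ') : IsVertical q (τ ≫ τ') := fun x => by
  have h1 := h x
  have h2 := isHomLift_congr (τ'.app x) (h' x) (h.obj_eq x)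
  simpa using IsHomLift.comp_of_lift_id q (q.obj (F.obj x)) (τ.app x) (τ'.app x)

theorem whiskerLeft {E' : Type*} [Category* E'] (H : E' ⥤ E) {F F' : E ⥤ X} {τ : F ⟶ F'}
    (h : IsVertical q τ) : IsVertical q (Functor.whiskerLeft H τ) := fun x => h (H.obj x)

theorem whiskerRight {F F' : E ⥤ X} {τ : F ⟶ F'} (h : IsVertical q τ) {G : B ⥤ B'}
    {r : X' ⥤ B'} (H : CartFunctor G q r) : IsVertical r (Functor.whiskerRight τ H.F) :=
  fun x => H.lift_id (H.obj_eq _).symm (τ.app x) (h x)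

end IsVertical

end Functors

/-! ### The 2-category of stacks over a site -/

/-- A stack over the site `(B, K)`. -/
structure Stk {B : Type u} [Category.{v} B] (K : GrothendieckTopology B) where
  X : Type w
  [cat : Category.{w'} X]
  p : X ⥤ B
  isStack : IsStack K p

attribute [instance] Stk.cat

namespace Stk

variable {B : Type u} [Category.{v} B] {K : GrothendieckTopology B}

/-- Morphisms of stacks are cartesian functors. -/
instance : CategoryStruct (Stk.{w, w'} K) where
  Hom S S' := CartFunctor (𝟭 B) S.p S'.p
  id S := CartFunctor.id rfl S.p
  comp F F' := F.comp rfl F'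

/-- Morphisms of cartesian functors are vertical natural transformations. -/
@[ext]
structure Hom₂ {S S' : Stk.{w, w'} K} (F F' : S ⟶ S') where
  τ : F.F ⟶ F'.F
  vert : IsVertical S'.p τ

instance (S S' : Stk.{w, w'} K) : Category (S ⟶ S') where
  Hom F F' := Hom₂ F F'
  id F := ⟨𝟙 F.F, IsVertical.id _⟩
  comp a b := ⟨a.τ ≫ b.τ, a.vert.comp b.vert⟩

@[ext]
theorem hom₂_ext {S S' : Stk.{w, w'} K} {F F' : S ⟶ S'} {a b : F ⟶ F'} (h : ∀ x, a.τ.app x = b.τ.app x) :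
    a = b := Hom₂.ext (NatTrans.ext (funext h))

@[simp] theorem id_app {S S' : Stk.{w, w'} K} (F : S ⟶ S') (x : S.X) :
    (Hom₂.τ (𝟙 F)).app x = 𝟙 (F.F.obj x) := rfl

@[simp] theorem comp_app {S S' : Stk.{w, w'} K} {F F' F'' : S ⟶ S'} (a : F ⟶ F') (b : F' ⟶ F'')
    (x : S.X) : (Hom₂.τ (a ≫ b)).app x = a.τ.app x ≫ b.τ.app x := rfl

/-- A vertical natural isomorphism is an invertible 2-arrow. -/
@[simps]
def isoMk {S S' : Stk.{w, w'} K} {F F' : S ⟶ S'} (e : F.F ≅ F'.F) (h : IsVertical S'.p e.hom)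
    (h' : IsVertical S'.p e.inv) : F ≅ F' where
  hom := Hom₂.mk e.hom h
  inv := Hom₂.mk e.inv h'

/-- The 2-category of stacks over a site. -/
instance : Bicategory (Stk.{w, w'} K) where
  homCategory := inferInstance
  whiskerLeft F _ _ a := Hom₂.mk (Functor.whiskerLeft F.F a.τ) (a.vert.whiskerLeft F.F)
  whiskerRight a H := Hom₂.mk (Functor.whiskerRight a.τ H.F) (a.vert.whiskerRight H)
  associator F F' F'' := isoMk (Functor.associator F.F F'.F F''.F) (IsVertical.id _) (IsVertical.id _)
  leftUnitor F := isoMk F.F.leftUnitor (IsVertical.id _) (IsVertical.id _)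
  rightUnitor F := isoMk F.F.rightUnitor (IsVertical.id _) (IsVertical.id _)
  whiskerLeft_id _ _ := by ext x; rfl
  whiskerLeft_comp _ _ _ _ _ _ := by ext x; rfl
  id_whiskerLeft _ := by
    ext x; exact ((Category.id_comp _).trans (Category.comp_id _)).symm
  comp_whiskerLeft _ _ _ _ _ := by
    ext x; exact ((Category.id_comp _).trans (Category.comp_id _)).symm
  id_whiskerRight _ H := by ext x; exact H.F.map_id _
  comp_whiskerRight _ _ H := by ext x; exact H.F.map_comp _ _
  whiskerRight_id _ := by
    ext x; exact ((Category.id_comp _).trans (Category.comp_id _)).symm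
  whiskerRight_comp _ _ _ := by
    ext x; exact ((Category.id_comp _).trans (Category.comp_id _)).symm
  whisker_assoc _ _ _ _ _ := by
    ext x; exact ((Category.id_comp _).trans (Category.comp_id _)).symm
  whisker_exchange a b := by ext x; exact (b.τ.naturality (a.τ.app x)).symm
  pentagon _ _ _ H := by
    ext x
    exact (congrArg (· ≫ _) (H.F.map_id _)).trans
      ((Category.id_comp _).trans ((Category.id_comp _).trans (Category.id_comp _).symm))
  triangle _ H := by ext x; exact (Category.id_comp _).trans (H.F.map_id _).symm

end Stk

/-! ### The fibred 2-category of stacks -/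

section StackTot

variable {C : Type u} [Category.{v} C]

/-- An object of the fibred 2-category of stacks over the site `(C, J)`: an object `base` of `C`
and a stack over the site `C/base`. -/
structure StackTot (J : GrothendieckTopology C) where
  base : C
  stk : Stk.{max u v w₁, max v w₂} (J.over base)

namespace StackTot

variable {J : GrothendieckTopology C}

/-- An arrow over `base : U ⟶ V`: a cartesian functor over `C/U ⥤ C/V`, or equivalently
a morphism of stacks over `C/U` to the restriction of the target. -/
structure Hom (S S' : StackTot.{w₁, w₂} J) where
  base : S.base ⟶ S'.base
  fn : CartFunctor (Over.map base) S.stk.p S'.stk.p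

instance : CategoryStruct (StackTot.{w₁, w₂} J) where
  Hom S S' := Hom S S'
  id S := ⟨𝟙 S.base, CartFunctor.id (Over.mapId_eq S.base) S.stk.p⟩
  comp F F' := ⟨F.base ≫ F'.base, F.fn.comp (Over.mapComp_eq F.base F'.base).symm F'.fn⟩

/-- A 2-arrow between arrows over the same arrow of `C`: a vertical natural transformation. -/
@[ext]
structure Hom₂ {S S' : StackTot.{w₁, w₂} J} (F F' : S ⟶ S') where
  base_eq : F.base = F'.base
  τ : F.fn.F ⟶ F'.fn.F
  vert : IsVertical S'.stk.p τ

instance (S S' : StackTot.{w₁, w₂} J) : Category (S ⟶ S') where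
  Hom F F' := Hom₂ F F'
  id F := ⟨rfl, 𝟙 F.fn.F, IsVertical.id _⟩
  comp a b := ⟨a.base_eq.trans b.base_eq, a.τ ≫ b.τ, a.vert.comp b.vert⟩

@[ext]
theorem hom₂_ext {S S' : StackTot.{w₁, w₂} J} {F F' : S ⟶ S'} {a b : F ⟶ F'}
    (h : ∀ x, a.τ.app x = b.τ.app x) : a = b :=
  Hom₂.ext (NatTrans.ext (funext h))

/-- A vertical natural isomorphism is an invertible 2-arrow. -/
@[simps]
def isoMk {S S' : StackTot.{w₁, w₂} J} {F F' : S ⟶ S'} (hb : F.base = F'.base)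
    (e : F.fn.F ≅ F'.fn.F) (h : IsVertical S'.stk.p e.hom) (h' : IsVertical S'.stk.p e.inv) :
    F ≅ F' where
  hom := Hom₂.mk hb e.hom h
  inv := Hom₂.mk hb.symm e.inv h'
  hom_inv_id := hom₂_ext fun x => e.hom_inv_id_app x
  inv_hom_id := hom₂_ext fun x => e.inv_hom_id_app x

instance : Bicategory (StackTot.{w₁, w₂} J) where
  homCategory := inferInstance
  whiskerLeft F _ _ a := Hom₂.mk (congrArg (F.base ≫ ·) a.base_eq)
    (Functor.whiskerLeft F.fn.F a.τ) (a.vert.whiskerLeft F.fn.F)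
  whiskerRight a H := Hom₂.mk (congrArg (· ≫ H.base) a.base_eq)
    (Functor.whiskerRight a.τ H.fn.F) (a.vert.whiskerRight H.fn)
  associator F F' F'' := isoMk (Category.assoc F.base F'.base F''.base)
    (Functor.associator F.fn.F F'.fn.F F''.fn.F) (IsVertical.id _) (IsVertical.id _)
  leftUnitor F := isoMk (Category.id_comp F.base) F.fn.F.leftUnitor
    (IsVertical.id _) (IsVertical.id _)
  rightUnitor F := isoMk (Category.comp_id F.base) F.fn.F.rightUnitor
    (IsVertical.id _) (IsVertical.id _)
  whiskerLeft_id _ _ := by ext x; rfl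
  whiskerLeft_comp _ _ _ _ _ _ := by ext x; rfl
  id_whiskerLeft _ := by
    ext x; exact ((Category.id_comp _).trans (Category.comp_id _)).symm
  comp_whiskerLeft _ _ _ _ _ := by
    ext x; exact ((Category.id_comp _).trans (Category.comp_id _)).symm
  id_whiskerRight _ H := by ext x; exact H.fn.F.map_id _
  comp_whiskerRight _ _ H := by ext x; exact H.fn.F.map_comp _ _
  whiskerRight_id _ := by
    ext x; exact ((Category.id_comp _).trans (Category.comp_id _)).symm
  whiskerRight_comp _ _ _ := by
    ext x; exact ((Category.id_comp _).trans (Category.comp_id _)).symm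
  whisker_assoc _ _ _ _ _ := by
    ext x; exact ((Category.id_comp _).trans (Category.comp_id _)).symm
  whisker_exchange a b := by ext x; exact (b.τ.naturality (a.τ.app x)).symm
  pentagon _ _ _ H := by
    ext x
    exact (congrArg (· ≫ _) (H.fn.F.map_id _)).trans
      ((Category.id_comp _).trans ((Category.id_comp _).trans (Category.id_comp _).symm))
  triangle _ H := by ext x; exact (Category.id_comp _).trans (H.fn.F.map_id _).symm

/-- The inclusion of the 2-category of stacks over `C/U` as a fibre. -/
def incl (J : GrothendieckTopology C) (U : C) :
    Stk.{max u v w₁, max v w₂} (J.over U) ⥤ᵖ StackTot.{w₁, w₂} J where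
  obj S := ⟨U, S⟩
  map F := Hom.mk (𝟙 U) ⟨F.F, F.w.trans (by rw [Over.mapId_eq]), F.cart⟩
  map₂ a := Hom₂.mk rfl a.τ a.vert
  mapId S := isoMk rfl (Iso.refl (𝟭 S.X)) (IsVertical.id _) (IsVertical.id _)
  mapComp F F' := isoMk (Category.id_comp _).symm (Iso.refl (F.F ⋙ F'.F)) (IsVertical.id _)
    (IsVertical.id _)
  map₂_id _ := rfl
  map₂_comp _ _ := rfl
  map₂_whisker_left _ _ _ _ := by
    ext x; exact ((Category.id_comp _).trans (Category.comp_id _)).symm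
  map₂_whisker_right _ _ := by
    ext x; exact ((Category.id_comp _).trans (Category.comp_id _)).symm
  map₂_associator F F' F'' := by
    ext x
    let o := F''.F.obj (F'.F.obj (F.F.obj x))
    change 𝟙 o = 𝟙 o ≫ F''.F.map (𝟙 _) ≫ 𝟙 o ≫ 𝟙 o ≫ 𝟙 o
    simp [o]
  map₂_left_unitor F := by
    ext x
    let o := F.F.obj x
    change 𝟙 o = 𝟙 o ≫ F.F.map (𝟙 _) ≫ 𝟙 o
    simp [o]
  map₂_right_unitor F := by
    ext x
    let o := F.F.obj x
    change 𝟙 o = 𝟙 o ≫ 𝟙 o ≫ 𝟙 o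
    simp

end StackTot

end StackTot

/-! ### Fibred 2-categories and their 2-equivalences -/

section Fibred

/-- A projection of the 2-category `D` to the category `C`, where `C` is regarded as a 2-category
with only identity 2-arrows. -/
class Over2 (C : outParam (Type u)) [Category.{v} C] (D : Type u') [Bicategory.{w', v'} D] where
  base : D → C
  proj {x y : D} : (x ⟶ y) → (base x ⟶ base y)
  proj_id (x : D) : proj (𝟙 x) = 𝟙 (base x)
  proj_comp {x y z : D} (φ : x ⟶ y) (ψ : y ⟶ z) : proj (φ ≫ ψ) = proj φ ≫ proj ψ
  proj_eq {x y : D} {φ ψ : x ⟶ y} : (φ ⟶ ψ) → proj φ = proj ψ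

open Over2

variable {C : Type u} [Category.{v} C] {D : Type u'} [Bicategory.{w', v'} D] [Over2 C D]
  {D' : Type u''} [Bicategory.{w₁, w₂} D'] [Over2 C D']

/-- The category of arrows from `x` to `y` lying over `f`, and all 2-arrows between them. -/
abbrev HomOver (x y : D) (f : base x ⟶ base y) :=
  ObjectProperty.FullSubcategory (fun φ : x ⟶ y => proj φ = f)

/-- Composition with `φ : x ⟶ y`, from arrows over `g` to arrows over `g ≫ proj φ`. -/
def postcompOver {x y : D} (φ : x ⟶ y) (z : D) (g : base z ⟶ base x) :
    HomOver z x g ⥤ HomOver z y (g ≫ proj φ) :=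
  ObjectProperty.lift _ (ObjectProperty.ι _ ⋙ postcomp z φ)
    (fun χ => (proj_comp χ.obj φ).trans (congrArg (· ≫ proj φ) χ.property))

/-- Cartesian arrows of a 2-category over `C`. -/
def IsCartesianArrow {x y : D} (φ : x ⟶ y) : Prop :=
  ∀ (z : D) (g : base z ⟶ base x), (postcompOver φ z g).IsEquivalence

variable (D) in
/-- `D` is a fibred 2-category over `C`: every arrow `U ⟶ base y` of `C` has a cartesian lift. -/
def IsFibred2 : Prop :=
  ∀ (y : D) (U : C) (f : U ⟶ base y), ∃ (x : D) (h : base x = U) (φ : x ⟶ y),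
    proj φ = eqToHom h ≫ f ∧ IsCartesianArrow φ

variable (D D') in
/-- A cartesian 2-functor over `C`: a pseudofunctor which commutes with the projections to `C`
and preserves cartesian arrows. -/
structure CartPseudofunctor extends D ⥤ᵖ D' where
  base_obj (x : D) : base (obj x) = base x
  proj_map {x y : D} (φ : x ⟶ y) :
    proj (map φ) = eqToHom (base_obj x) ≫ proj φ ≫ eqToHom (base_obj y).symm
  cart {x y : D} (φ : x ⟶ y) : IsCartesianArrow φ → IsCartesianArrow (map φ)

namespace CartPseudofunctor

/-- The functor induced on the categories of arrows over `f`. -/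
def mapOver (Φ : CartPseudofunctor D D') (x y : D) (f : base x ⟶ base y) :
    HomOver x y f ⥤ HomOver (Φ.obj x) (Φ.obj y)
      (eqToHom (Φ.base_obj x) ≫ f ≫ eqToHom (Φ.base_obj y).symm) :=
  ObjectProperty.lift _ (ObjectProperty.ι _ ⋙ Φ.mapFunctor x y)
    (fun φ => (Φ.proj_map φ.obj).trans
      (congrArg (fun t => eqToHom _ ≫ t ≫ eqToHom _) φ.property))

/-- A 2-equivalence of fibred 2-categories over `C`: every object `y` of a fibre of the target is
equivalent, in that fibre, to the image of an object of the source, and the functors induced on the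
categories of arrows over each arrow `f` of `C` are equivalences. When `x` is the restriction along
`f : U ⟶ V` of an object `x'` over `V`, the arrows over `f` from `x` to `y` are
the sections over `f` of the fibred category of arrows from `x'` to `y`, so that the second
condition says that the functors between fibred categories of arrows are equivalences. -/
structure IsTwoEquivalence (Φ : CartPseudofunctor D D') : Prop where
  ess_surj (y : D') : ∃ (x : D) (h : base (Φ.obj x) = base y) (e : Φ.obj x ≌ y),
    proj e.hom = eqToHom h
  hom_equiv (x y : D) (f : base x ⟶ base y) : (Φ.mapOver x y f).IsEquivalence

end CartPseudofunctor

end Fibred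

/-! ### Strictly commutative Picard stacks -/

section Picard

variable {B : Type u} [Category.{v} B] {X : Type w} [Category.{w'} X]

/-- Arrows over `b` between objects of the fibres. -/
abbrev FibHom (p : X ⥤ B) {T T' : B} (b : T ⟶ T') (x : p.Fiber T) (y : p.Fiber T') :=
  { φ : x.1 ⟶ y.1 // p.IsHomLift b φ }

namespace FibHom

variable {p : X ⥤ B}

def id {T : B} (x : p.Fiber T) : FibHom p (𝟙 T) x x := ⟨𝟙 x.1, IsHomLift.id x.2⟩

def comp {T T' T'' : B} {b : T ⟶ T'} {b' : T' ⟶ T''} {x : p.Fiber T} {y : p.Fiber T'}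
    {z : p.Fiber T''} (φ : FibHom p b x y) (ψ : FibHom p b' y z) : FibHom p (b ≫ b') x z :=
  ⟨φ.1 ≫ ψ.1, have := φ.2; have := ψ.2; IsHomLift.comp p b b' φ.1 ψ.1⟩

end FibHom

/-- A law of composition on `p : X ⥤ B`, i.e. a functor over `B` from the fibre product of `p` with
itself to `p`: it adds two objects over the same object of `B`, and two arrows over the same arrow
of `B`. -/
structure Law (p : X ⥤ B) where
  add {T : B} : p.Fiber T → p.Fiber T → p.Fiber T
  map {T T' : B} {b : T ⟶ T'} {x y : p.Fiber T} {x' y' : p.Fiber T'} :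
    FibHom p b x x' → FibHom p b y y' → FibHom p b (add x y) (add x' y')
  map_id {T : B} (x y : p.Fiber T) : map (FibHom.id x) (FibHom.id y) = FibHom.id (add x y)
  map_comp {T T' T'' : B} {b : T ⟶ T'} {b' : T' ⟶ T''} {x y : p.Fiber T} {x' y' : p.Fiber T'}
    {x'' y'' : p.Fiber T''} (φ : FibHom p b x x') (ψ : FibHom p b y y')
    (φ' : FibHom p b' x' x'') (ψ' : FibHom p b' y' y'') :
    map (φ.comp φ') (ψ.comp ψ') = (map φ ψ).comp (map φ' ψ')

namespace Law

variable {p : X ⥤ B} (P : Law p)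

theorem map_congr {T T' : B} {b b' : T ⟶ T'} (hb : b = b') {x y : p.Fiber T} {x' y' : p.Fiber T'}
    {φ : FibHom p b x x'} {ψ : FibHom p b y y'} {φ' : FibHom p b' x x'} {ψ' : FibHom p b' y y'}
    (hφ : φ.1 = φ'.1) (hψ : ψ.1 = ψ'.1) : (P.map φ ψ).1 = (P.map φ' ψ').1 := by
  subst hb
  rw [Subtype.ext hφ, Subtype.ext hψ]

/-- The sum of two arrows of a fibre. -/
def sum {T : B} {x y x' y' : p.Fiber T} (f : x ⟶ x') (g : y ⟶ y') : P.add x y ⟶ P.add x' y' :=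
  P.map (b := 𝟙 T) f g

@[simp]
theorem sum_id {T : B} (x y : p.Fiber T) : P.sum (𝟙 x) (𝟙 y) = 𝟙 (P.add x y) :=
  P.map_id x y

theorem sum_comp {T : B} {x y x' y' x'' y'' : p.Fiber T} (f : x ⟶ x') (g : y ⟶ y')
    (f' : x' ⟶ x'') (g' : y' ⟶ y'') : P.sum (f ≫ f') (g ≫ g') = P.sum f g ≫ P.sum f' g' :=
  Subtype.ext ((P.map_congr (Category.comp_id (𝟙 T)).symm rfl rfl).trans
    (congrArg Subtype.val (P.map_comp (b := 𝟙 T) (b' := 𝟙 T) f g f' g')))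

theorem sum_comp_id {V : Type*} [Category* V] {T : B} (H : V ⥤ p.Fiber T) (a : V)
    {x x' x'' : p.Fiber T} (f : x ⟶ x') (f' : x' ⟶ x'') :
    P.sum (f ≫ f') (𝟙 (H.obj a)) = P.sum f (H.map (𝟙 a)) ≫ P.sum f' (𝟙 (H.obj a)) := by
  rw [← P.sum_comp, H.map_id, Category.id_comp]

theorem id_sum_comp {V : Type*} [Category* V] {T : B} (H : V ⥤ p.Fiber T) (a : V)
    {x x' x'' : p.Fiber T} (f : x ⟶ x') (f' : x' ⟶ x'') :
    P.sum (𝟙 (H.obj a)) (f ≫ f') = P.sum (H.map (𝟙 a)) f ≫ P.sum (𝟙 (H.obj a)) f' := by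
  rw [← P.sum_comp, H.map_id, Category.id_comp]

/-- The translation by `x`, from the fibre over `T` to itself. -/
def translation {T : B} (x : p.Fiber T) : p.Fiber T ⥤ p.Fiber T where
  obj y := P.add x y
  map g := P.sum (𝟙 x) g
  map_id y := P.sum_id x y
  map_comp g g' := by rw [← P.sum_comp, Category.comp_id]

end Law

/-- The structure of a strictly commutative Picard stack on `p : X ⥤ B`: the fibres are groupoids,
and a law of composition with natural associativity and commutativity constraints makes every
fibre a strictly commutative Picard category. -/
structure PicardStr (p : X ⥤ B) extends Law p where
  groupoid {T : B} {x y : p.Fiber T} (f : x ⟶ y) : IsIso f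
  assoc {T : B} (x y z : p.Fiber T) : add (add x y) z ≅ add x (add y z)
  comm {T : B} (x y : p.Fiber T) : add x y ≅ add y x
  assoc_nat {T T' : B} {b : T ⟶ T'} {x y z : p.Fiber T} {x' y' z' : p.Fiber T'}
    (φ : FibHom p b x x') (ψ : FibHom p b y y') (χ : FibHom p b z z') :
    (map (map φ ψ) χ).1 ≫ (assoc x' y' z').hom.1 = (assoc x y z).hom.1 ≫ (map φ (map ψ χ)).1
  comm_nat {T T' : B} {b : T ⟶ T'} {x y : p.Fiber T} {x' y' : p.Fiber T'}
    (φ : FibHom p b x x') (ψ : FibHom p b y y') :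
    (map φ ψ).1 ≫ (comm x' y').hom.1 = (comm x y).hom.1 ≫ (map ψ φ).1
  pentagon {T : B} (x y z t : p.Fiber T) :
    toLaw.sum (assoc x y z).hom (𝟙 t) ≫ (assoc x (add y z) t).hom ≫
      toLaw.sum (𝟙 x) (assoc y z t).hom =
    (assoc (add x y) z t).hom ≫ (assoc x y (add z t)).hom
  hexagon {T : B} (x y z : p.Fiber T) :
    (assoc x y z).hom ≫ (comm x (add y z)).hom ≫ (assoc y z x).hom =
    toLaw.sum (comm x y).hom (𝟙 z) ≫ (assoc y x z).hom ≫ toLaw.sum (𝟙 y) (comm x z).hom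
  comm_comm {T : B} (x y : p.Fiber T) : (comm x y).hom ≫ (comm y x).hom = 𝟙 (add x y)
  strict {T : B} (x : p.Fiber T) : (comm x x).hom = 𝟙 (add x x)
  nonempty (T : B) : Nonempty (p.Fiber T)
  translation_equiv {T : B} (x : p.Fiber T) : (toLaw.translation x).IsEquivalence

/-! ### Additive functors -/

variable {B' : Type u'} [Category.{v'} B'] {X' : Type w₁} [Category.{w₂} X']

namespace CartFunctor

variable {G : B ⥤ B'} {p : X ⥤ B} {q : X' ⥤ B'}

/-- The functor induced on the fibres. -/
def fib (F : CartFunctor G p q) {T : B} {T' : B'} (h : G.obj T = T') : p.Fiber T ⥤ q.Fiber T' where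
  obj x := ⟨F.F.obj x.1, (F.obj_eq x.1).trans ((congrArg G.obj x.2).trans h)⟩
  map f := ⟨F.F.map f.1, F.lift_id h f.1 f.2⟩
  map_id x := Subtype.ext (F.F.map_id x.1)
  map_comp f g := Subtype.ext (F.F.map_comp f.1 g.1)

theorem lift_map (F : CartFunctor G p q) {T T' : B} {b : T ⟶ T'} {x y : X} (φ : x ⟶ y)
    (h : p.IsHomLift b φ) : q.IsHomLift (G.map b) (F.F.map φ) := by
  cases h
  exact isHomLift_map_of_eq F.w φ

/-- The action on the arrows over `b`. -/
def fibMap (F : CartFunctor G p q) {T T' : B} {b : T ⟶ T'} {x : p.Fiber T} {y : p.Fiber T'}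
    (φ : FibHom p b x y) : FibHom q (G.map b) ((F.fib rfl).obj x) ((F.fib rfl).obj y) :=
  ⟨F.F.map φ.1, F.lift_map φ.1 φ.2⟩

end CartFunctor

/-- The component at an object of a fibre of a vertical transformation. -/
def IsVertical.fibApp {G G' : B ⥤ B'} {p : X ⥤ B} {q : X' ⥤ B'} {F : CartFunctor G p q}
    {F' : CartFunctor G' p q} {τ : F.F ⟶ F'.F} (hτ : IsVertical q τ) {T : B} {T' : B'}
    (h : G.obj T = T') (h' : G'.obj T = T') (x : p.Fiber T) :
    (F.fib h).obj x ⟶ (F'.fib h').obj x :=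
  ⟨τ.app x.1, isHomLift_congr (τ.app x.1) (hτ x.1) ((F.fib h).obj x).2⟩

/-- The structure of an additive functor on a cartesian functor `F` between Picard stacks:
a natural isomorphism `F (x + y) ≅ F x + F y` compatible with the associativity and
commutativity constraints. -/
structure AddStr {G : B ⥤ B'} {p : X ⥤ B} {q : X' ⥤ B'} (P : PicardStr p) (Q : PicardStr q)
    (F : CartFunctor G p q) where
  σ {T : B} {T' : B'} (h : G.obj T = T') (x y : p.Fiber T) :
    (F.fib h).obj (P.add x y) ≅ Q.add ((F.fib h).obj x) ((F.fib h).obj y)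
  nat {T₁ T₂ : B} {T₁' T₂' : B'} (h₁ : G.obj T₁ = T₁') (h₂ : G.obj T₂ = T₂') {b : T₁ ⟶ T₂}
    {b' : T₁' ⟶ T₂'} {x₁ y₁ : p.Fiber T₁} {x₂ y₂ : p.Fiber T₂}
    (φ : FibHom p b x₁ x₂) (ψ : FibHom p b y₁ y₂)
    (φ' : FibHom q b' ((F.fib h₁).obj x₁) ((F.fib h₂).obj x₂))
    (ψ' : FibHom q b' ((F.fib h₁).obj y₁) ((F.fib h₂).obj y₂))
    (hφ : φ'.1 = F.F.map φ.1) (hψ : ψ'.1 = F.F.map ψ.1) :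
    F.F.map (P.map φ ψ).1 ≫ (σ h₂ x₂ y₂).hom.1 = (σ h₁ x₁ y₁).hom.1 ≫ (Q.map φ' ψ').1
  assoc {T : B} {T' : B'} (h : G.obj T = T') (x y z : p.Fiber T) :
    (F.fib h).map (P.assoc x y z).hom ≫ (σ h x (P.add y z)).hom ≫ Q.sum (𝟙 _) (σ h y z).hom =
    (σ h (P.add x y) z).hom ≫ Q.sum (σ h x y).hom (𝟙 _) ≫ (Q.assoc _ _ _).hom
  comm {T : B} {T' : B'} (h : G.obj T = T') (x y : p.Fiber T) :
    (F.fib h).map (P.comm x y).hom ≫ (σ h y x).hom = (σ h x y).hom ≫ (Q.comm _ _).hom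

/-- Compatibility of a vertical transformation with additive structures. -/
structure IsAdditive {G G' : B ⥤ B'} {p : X ⥤ B} {q : X' ⥤ B'} {P : PicardStr p} {Q : PicardStr q}
    {F : CartFunctor G p q} {F' : CartFunctor G' p q} (s : AddStr P Q F) (s' : AddStr P Q F')
    {τ : F.F ⟶ F'.F} (hτ : IsVertical q τ) : Prop where
  eq {T : B} {T' : B'} (h : G.obj T = T') (h' : G'.obj T = T') (x y : p.Fiber T) :
    (s.σ h x y).hom ≫ Q.sum (hτ.fibApp h h' x) (hτ.fibApp h h' y) =
      hτ.fibApp h h' (P.add x y) ≫ (s'.σ h' x y).hom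

namespace AddStr

variable {G : B ⥤ B'} {p : X ⥤ B} {q : X' ⥤ B'} {P : PicardStr p} {Q : PicardStr q}
  {F : CartFunctor G p q}

/-- Naturality of the isomorphism `F (x + y) ≅ F x + F y` in the fibres. -/
theorem nat_fib (s : AddStr P Q F) {T : B} {T' : B'} (h : G.obj T = T') {x y x' y' : p.Fiber T}
    (f : x ⟶ x') (g : y ⟶ y') :
    (F.fib h).map (P.sum f g) ≫ (s.σ h x' y').hom =
      (s.σ h x y).hom ≫ Q.sum ((F.fib h).map f) ((F.fib h).map g) :=
  Subtype.ext (s.nat h h (b := 𝟙 T) (b' := 𝟙 T') f g ((F.fib h).map f) ((F.fib h).map g) rfl rfl)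

theorem comp_nat_aux {V : Type*} [Category* V] {W : Type*} [Category* W] (H : V ⥤ W)
    {a b c d : V} {f : a ⟶ b} {g : b ⟶ c} {h : a ⟶ d} {i : d ⟶ c} (k₁ : f ≫ g = h ≫ i)
    {x y : W} {j : H.obj c ⟶ x} {k : H.obj d ⟶ y} {l : y ⟶ x} (k₂ : H.map i ≫ j = k ≫ l) :
    H.map f ≫ H.map g ≫ j = (H.map h ≫ k) ≫ l := by
  rw [← Category.assoc, ← H.map_comp, k₁, H.map_comp, Category.assoc, Category.assoc, k₂]

theorem comp_assoc_aux {V : Type*} [Category* V] {W : Type*} [Category* W] (H : V ⥤ W)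
    {a b c d e e' : V} {f : a ⟶ b} {g : b ⟶ c} {h : c ⟶ d} {f' : a ⟶ e} {g' : e ⟶ e'}
    {h' : e' ⟶ d} (k : f ≫ g ≫ h = f' ≫ g' ≫ h') {x₁ x₂ x₃ x₄ x₅ x₆ : W}
    {s₁ : H.obj c ⟶ x₁} {s₂ : H.obj d ⟶ x₂} {s₃ : H.obj e ⟶ x₃} {s₄ : H.obj e' ⟶ x₄}
    {i : x₁ ⟶ x₂} {j : x₂ ⟶ x₅} {l : x₁ ⟶ x₅} {i' : x₃ ⟶ x₄} {j' : x₄ ⟶ x₆} {l' : x₃ ⟶ x₆}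
    {t : x₆ ⟶ x₅} (k' : H.map h' ≫ s₂ ≫ j = s₄ ≫ j' ≫ t) (n : H.map h ≫ s₂ = s₁ ≫ i)
    (n' : H.map g' ≫ s₄ = s₃ ≫ i') (hl : l = i ≫ j) (hl' : l' = i' ≫ j') :
    H.map f ≫ (H.map g ≫ s₁) ≫ l = (H.map f' ≫ s₃) ≫ l' ≫ t := by
  have k₂ := congrArg H.map k
  simp only [Functor.map_comp] at k₂
  subst hl hl'
  simp only [Category.assoc]
  rw [← reassoc_of% n, ← reassoc_of% n', ← k', reassoc_of% k₂]

theorem lift_unique {p : X ⥤ B} {T T' : B} {b b' : T ⟶ T'} {x y : X} {φ : x ⟶ y}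
    (h : p.IsHomLift b φ) (h' : p.IsHomLift b' φ) : b = b' :=
  (IsHomLift.fac p b φ).trans (IsHomLift.fac p b' φ).symm

/-- The identity functor is additive. -/
def id {G : B ⥤ B} (hG : G = 𝟭 B) {p : X ⥤ B} (P : PicardStr p) :
    AddStr P P (CartFunctor.id hG p) where
  σ {T T'} h x y := eqToIso (by subst hG; cases h; rfl)
  nat h₁ h₂ b b' x₁ y₁ x₂ y₂ φ ψ φ' ψ' hφ hψ := by
    subst hG
    cases h₁
    cases h₂
    refine (Category.comp_id _).trans (Eq.trans ?_ (Category.id_comp _).symm)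
    have h' : p.IsHomLift b' φ.1 := by
      have h := φ'.2
      rw [hφ] at h
      exact h
    exact P.map_congr (lift_unique φ.2 h') hφ.symm hψ.symm
  assoc h x y z := by
    subst hG
    cases h
    apply Subtype.ext
    change (P.assoc x y z).hom.1 ≫ 𝟙 _ ≫ (P.sum (𝟙 x) (𝟙 (P.add y z))).1 =
      𝟙 _ ≫ (P.sum (𝟙 (P.add x y)) (𝟙 z)).1 ≫ (P.assoc x y z).hom.1
    rw [P.sum_id, P.sum_id]
    exact (congrArg _ (Category.id_comp _)).trans ((Category.comp_id _).trans
      ((Category.id_comp _).trans (Category.id_comp _)).symm)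
  comm h x y := by
    subst hG
    cases h
    exact (Category.comp_id _).trans (Category.id_comp _).symm

section Comp

variable {B'' : Type*} [Category* B''] {X'' : Type*} [Category* X''] {G' : B' ⥤ B''}
  {r : X'' ⥤ B''} {R : PicardStr r} {F' : CartFunctor G' q r} {G'' : B ⥤ B''}

/-- The composite of additive functors is additive. -/
def comp (hG : G ⋙ G' = G'') (s : AddStr P Q F) (s' : AddStr Q R F') :
    AddStr P R (F.comp hG F') where
  σ {T T'} h x y :=
    have h' : G'.obj (G.obj T) = T' := (Functor.congr_obj hG T).trans h
    (F'.fib h').mapIso (s.σ rfl x y) ≪≫ s'.σ h' ((F.fib rfl).obj x) ((F.fib rfl).obj y)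
  nat {T₁ T₂ T₁' T₂'} h₁ h₂ b b' x₁ y₁ x₂ y₂ φ ψ φ' ψ' hφ hψ := by
    have e₁ : G'.obj (G.obj T₁) = T₁' := (Functor.congr_obj hG T₁).trans h₁
    have e₂ : G'.obj (G.obj T₂) = T₂' := (Functor.congr_obj hG T₂).trans h₂
    have k₁ := s.nat rfl rfl φ ψ (F.fibMap φ) (F.fibMap ψ) rfl rfl
    have k₂ := s'.nat e₁ e₂ (F.fibMap φ) (F.fibMap ψ) φ' ψ' hφ hψ
    exact comp_nat_aux F'.F k₁ k₂
  assoc {T T'} h x y z := by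
    have e : G'.obj (G.obj T) = T' := (Functor.congr_obj hG T).trans h
    exact comp_assoc_aux (F'.fib e) (s.assoc rfl x y z)
      (s'.assoc e ((F.fib rfl).obj x) ((F.fib rfl).obj y) ((F.fib rfl).obj z))
      (s'.nat_fib e (𝟙 ((F.fib rfl).obj x)) (s.σ rfl y z).hom)
      (s'.nat_fib e (s.σ rfl x y).hom (𝟙 ((F.fib rfl).obj z)))
      (R.id_sum_comp (F'.fib e) ((F.fib rfl).obj x) ((F'.fib e).map (s.σ rfl y z).hom)
        (s'.σ e ((F.fib rfl).obj y) ((F.fib rfl).obj z)).hom)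
      (R.sum_comp_id (F'.fib e) ((F.fib rfl).obj z) ((F'.fib e).map (s.σ rfl x y).hom)
        (s'.σ e ((F.fib rfl).obj x) ((F.fib rfl).obj y)).hom)
  comm {T T'} h x y := by
    have e : G'.obj (G.obj T) = T' := (Functor.congr_obj hG T).trans h
    exact comp_nat_aux (F'.fib e) (s.comm rfl x y) (s'.comm e ((F.fib rfl).obj x) ((F.fib rfl).obj y))

end Comp

end AddStr

theorem comp_aux {V : Type*} [Category* V] {a b c d e f : V} {i : a ⟶ b} {j : b ⟶ c} {k : c ⟶ d}
    {l : b ⟶ e} {m : e ⟶ d} {n : a ⟶ f} {o : f ⟶ e} (h : i ≫ l = n ≫ o) (h' : j ≫ k = l ≫ m) :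
    (i ≫ j) ≫ k = n ≫ o ≫ m := by
  rw [Category.assoc, h', reassoc_of% h]

theorem comp_aux' {V : Type*} [Category* V] {a b c d e f : V} {i : a ⟶ b} {j : b ⟶ c} {k : c ⟶ d}
    {l : b ⟶ e} {m : e ⟶ d} {n : a ⟶ f} {o : f ⟶ e} (h' : l ≫ m = j ≫ k) (h : i ≫ l = n ≫ o) :
    (i ≫ j) ≫ k = n ≫ o ≫ m :=
  comp_aux h h'.symm

namespace IsAdditive

variable {G G' G'' : B ⥤ B'} {p : X ⥤ B} {q : X' ⥤ B'} {P : PicardStr p} {Q : PicardStr q}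
  {F : CartFunctor G p q} {F' : CartFunctor G' p q} {F'' : CartFunctor G'' p q}
  {s : AddStr P Q F} {s' : AddStr P Q F'} {s'' : AddStr P Q F''}

theorem comp {τ : F.F ⟶ F'.F} {τ' : F'.F ⟶ F''.F} {hτ : IsVertical q τ} {hτ' : IsVertical q τ'}
    (hG : G = G') (h : IsAdditive s s' hτ) (h' : IsAdditive s' s'' hτ') :
    IsAdditive s s'' (hτ.comp hτ') := by
  refine ⟨fun {T T'} e e' x y => ?_⟩
  have e₁ : G'.obj T = T' := hG ▸ e
  have k := h.eq e e₁ x y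
  have k' := h'.eq e₁ e' x y
  change _ ≫ Q.sum (hτ.fibApp e e₁ x ≫ hτ'.fibApp e₁ e' x)
    (hτ.fibApp e e₁ y ≫ hτ'.fibApp e₁ e' y) =
    (hτ.fibApp e e₁ (P.add x y) ≫ hτ'.fibApp e₁ e' (P.add x y)) ≫ _
  rw [Law.sum_comp, ← Category.assoc, k, Category.assoc, k', Category.assoc]

/-- A transformation with identity components is additive when the two structures agree. -/
theorem of_eq {τ : F.F ⟶ F'.F} {hτ : IsVertical q τ} (hF : F.F = F'.F)
    (hτ' : ∀ x, τ.app x = eqToHom (Functor.congr_obj hF x))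
    (h : ∀ {T : B} {T' : B'} (h : G.obj T = T') (h' : G'.obj T = T') (x y : p.Fiber T),
      HEq (s.σ h x y).hom.1 (s'.σ h' x y).hom.1) : IsAdditive s s' hτ := by
  refine ⟨fun {T T'} e e' x y => ?_⟩
  apply Subtype.ext
  obtain ⟨F, w, c⟩ := F
  obtain ⟨F', w', c'⟩ := F'
  cases hF
  have k := eq_of_heq (h e e' x y)
  have hx : ∀ x, hτ.fibApp e e' x = 𝟙 (((CartFunctor.mk F w c).fib e).obj x) :=
    fun x => Subtype.ext (hτ' x.1)
  have hx' : Q.sum (hτ.fibApp e e' x) (hτ.fibApp e e' y) =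
      𝟙 (Q.add (((CartFunctor.mk F w c).fib e).obj x) (((CartFunctor.mk F w c).fib e).obj y)) := by
    rw [hx, hx]
    exact Q.sum_id _ _
  exact (congrArg (fun t => (s.σ e x y).hom.1 ≫ t.1) hx').trans ((Category.comp_id _).trans
    (k.trans ((congrArg (fun t => t.1 ≫ (s'.σ e' x y).hom.1) (hx (P.add x y))).trans
      (Category.id_comp _)).symm))

section Comp

variable {B'' : Type*} [Category* B''] {X'' : Type*} [Category* X''] {r : X'' ⥤ B''}
  {R : PicardStr r} {H H' : B' ⥤ B''} {L L' : B ⥤ B''}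

theorem whiskerLeft {E : CartFunctor H q r} {E' : CartFunctor H' q r} {t : AddStr Q R E}
    {t' : AddStr Q R E'} {τ : E.F ⟶ E'.F} {hτ : IsVertical r τ} (s : AddStr P Q F)
    (hL : G ⋙ H = L) (hL' : G ⋙ H' = L') (h : IsAdditive t t' hτ) :
    IsAdditive (τ := Functor.whiskerLeft F.F τ) (s.comp hL t) (s.comp hL' t')
      (hτ.whiskerLeft F.F) := by
  refine ⟨fun {T T'} e e' x y => ?_⟩
  have e₁ : H.obj (G.obj T) = T' := (Functor.congr_obj hL T).trans e
  have e₁' : H'.obj (G.obj T) = T' := (Functor.congr_obj hL' T).trans e'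
  have k := h.eq e₁ e₁' ((F.fib rfl).obj x) ((F.fib rfl).obj y)
  have n : (E.fib e₁).map (s.σ rfl x y).hom ≫
      hτ.fibApp e₁ e₁' (Q.add ((F.fib rfl).obj x) ((F.fib rfl).obj y)) =
      hτ.fibApp e₁ e₁' ((F.fib rfl).obj (P.add x y)) ≫ (E'.fib e₁').map (s.σ rfl x y).hom :=
    Subtype.ext (τ.naturality (s.σ rfl x y).hom.1)
  exact comp_aux n k

theorem whiskerRight {τ : F.F ⟶ F'.F} {hτ : IsVertical q τ} (hG : G = G')
    (h : IsAdditive s s' hτ) {E : CartFunctor H q r} (t : AddStr Q R E) (hL : G ⋙ H = L)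
    (hL' : G' ⋙ H = L') :
    IsAdditive (τ := Functor.whiskerRight τ E.F) (s.comp hL t) (s'.comp hL' t)
      (hτ.whiskerRight E) := by
  subst hG
  refine ⟨fun {T T'} e e' x y => ?_⟩
  have e₁ : H.obj (G.obj T) = T' := (Functor.congr_obj hL T).trans e
  have k := congrArg (E.fib e₁).map (h.eq rfl rfl x y)
  have n := t.nat_fib e₁ (hτ.fibApp rfl rfl x) (hτ.fibApp rfl rfl y)
  rw [Functor.map_comp, Functor.map_comp] at k
  exact comp_aux' n k

theorem assoc_hom {B₃ : Type*} [Category* B₃] {X₃ : Type*} [Category* X₃] {r' : X₃ ⥤ B₃}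
    {R' : PicardStr r'} {E : CartFunctor H q r} {K : B'' ⥤ B₃} {E₂ : CartFunctor K r r'}
    {L₁ : B ⥤ B''} {L₂ : B' ⥤ B₃} {M M' : B ⥤ B₃}
    (s : AddStr P Q F) (t : AddStr Q R E) (t₂ : AddStr R R' E₂)
    (h₁ : G ⋙ H = L₁) (h₂ : L₁ ⋙ K = M) (h₃ : H ⋙ K = L₂) (h₄ : G ⋙ L₂ = M')
    {T : B} {T' : B₃} (e : M.obj T = T') (e' : M'.obj T = T') (x y : p.Fiber T) :
    (((s.comp h₁ t).comp h₂ t₂).σ e x y).hom.1 = ((s.comp h₄ (t.comp h₃ t₂)).σ e' x y).hom.1 := by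
  subst h₁ h₂ h₃ h₄
  exact (congrArg (· ≫ _) (E₂.F.map_comp _ _)).trans (Category.assoc _ _ _)

theorem id_comp_σ {G : B ⥤ B} (hG : G = 𝟭 B) {H : B ⥤ B'} {L : B ⥤ B'} {F : CartFunctor H p q}
    (s : AddStr P Q F) (hL : G ⋙ H = L)
    {T : B} {T' : B'} (e : L.obj T = T') (e' : H.obj T = T') (x y : p.Fiber T) :
    (((AddStr.id hG P).comp hL s).σ e x y).hom.1 = (s.σ e' x y).hom.1 := by
  subst hG hL
  exact (congrArg (· ≫ _) (F.F.map_id _)).trans (Category.id_comp _)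

theorem comp_id_σ {H : B' ⥤ B'} (hH : H = 𝟭 B') {L : B ⥤ B'} 
    (s : AddStr P Q F) (hL : G ⋙ H = L)
    {T : B} {T' : B'} (e : L.obj T = T') (e' : G.obj T = T') (x y : p.Fiber T) :
    ((s.comp hL (AddStr.id hH Q)).σ e x y).hom.1 = (s.σ e' x y).hom.1 := by
  subst hH hL
  cases e'
  exact Category.comp_id _

end Comp

end IsAdditive

end Picard

/-! ### The fibred 2-category of Picard stacks -/

/-- A strictly commutative Picard stack over the site `(B, K)`. -/
structure PicardStack {B : Type u} [Category.{v} B] (K : GrothendieckTopology B) extends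
    Stk.{w, w'} K where
  str : PicardStr p

/-- An object of the fibred 2-category of Picard stacks over the site `(C, J)`: an object `base`
of `C` and a Picard stack over `C/base`. -/
structure Picard {C : Type u} [Category.{v} C] (J : GrothendieckTopology C) where
  base : C
  pic : PicardStack.{max u v w₁, max v w₂} (J.over base)

namespace Picard

variable {C : Type u} [Category.{v} C] {J : GrothendieckTopology C}

/-- The underlying stack. -/
abbrev tot (P : Picard.{w₁, w₂} J) : StackTot.{w₁, w₂} J := ⟨P.base, P.pic.toStk⟩

/-- An arrow: an additive functor lying over an arrow of `C`. -/
structure Hom (P Q : Picard.{w₁, w₂} J) where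
  hom : P.tot ⟶ Q.tot
  add : AddStr P.pic.str Q.pic.str hom.fn

instance : CategoryStruct (Picard.{w₁, w₂} J) where
  Hom P Q := Hom P Q
  id P := ⟨𝟙 P.tot, AddStr.id (Over.mapId_eq P.base) P.pic.str⟩
  comp F F' := ⟨F.hom ≫ F'.hom,
    F.add.comp (Over.mapComp_eq F.hom.base F'.hom.base).symm F'.add⟩

/-- A 2-arrow: a morphism of additive functors. -/
@[ext]
structure Hom₂ {P Q : Picard.{w₁, w₂} J} (F F' : P ⟶ Q) where
  hom : F.hom ⟶ F'.hom
  add : IsAdditive F.add F'.add hom.vert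

theorem isAdditive_id {P Q : Picard.{w₁, w₂} J} (F : P ⟶ Q) :
    IsAdditive F.add F.add (StackTot.Hom₂.vert (𝟙 F.hom)) :=
  IsAdditive.of_eq rfl (fun _ => rfl) (fun _ _ _ _ => HEq.rfl)

instance (P Q : Picard.{w₁, w₂} J) : Category (P ⟶ Q) where
  Hom F F' := Hom₂ F F'
  id F := ⟨𝟙 F.hom, isAdditive_id F⟩
  comp a b := ⟨a.hom ≫ b.hom, a.add.comp (congrArg Over.map a.hom.base_eq) b.add⟩
  id_comp a := Hom₂.ext (Category.id_comp a.hom)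
  comp_id a := Hom₂.ext (Category.comp_id a.hom)
  assoc a b c := Hom₂.ext (Category.assoc a.hom b.hom c.hom)

@[ext]
theorem hom₂_ext {P Q : Picard.{w₁, w₂} J} {F F' : P ⟶ Q} {a b : F ⟶ F'} (h : a.hom = b.hom) :
    a = b := Hom₂.ext h

/-- An invertible 2-arrow of stacks which is additive. -/
@[simps]
def isoMk {P Q : Picard.{w₁, w₂} J} {F F' : P ⟶ Q} (e : F.hom ≅ F'.hom)
    (h : IsAdditive F.add F'.add e.hom.vert) (h' : IsAdditive F'.add F.add e.inv.vert) :
    F ≅ F' where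
  hom := Hom₂.mk e.hom h
  inv := Hom₂.mk e.inv h'
  hom_inv_id := hom₂_ext e.hom_inv_id
  inv_hom_id := hom₂_ext e.inv_hom_id

instance : Bicategory (Picard.{w₁, w₂} J) where
  homCategory := inferInstance
  whiskerLeft F _ _ a := Hom₂.mk (F.hom ◁ a.hom) (IsAdditive.whiskerLeft F.add _ _ a.add)
  whiskerRight a H := Hom₂.mk (a.hom ▷ H.hom)
    (a.add.whiskerRight (congrArg Over.map a.hom.base_eq) H.add _ _)
  associator F F' F'' := isoMk (α_ F.hom F'.hom F''.hom)
    (IsAdditive.of_eq rfl (fun _ => rfl) (fun e e' x y => heq_of_eq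
      (IsAdditive.assoc_hom F.add F'.add F''.add _ _ _ _ e e' x y)))
    (IsAdditive.of_eq rfl (fun _ => rfl) (fun e e' x y => heq_of_eq
      (IsAdditive.assoc_hom F.add F'.add F''.add _ _ _ _ e' e x y).symm))
  leftUnitor F := isoMk (λ_ F.hom)
    (IsAdditive.of_eq rfl (fun _ => rfl) (fun e e' x y => heq_of_eq
      (IsAdditive.id_comp_σ _ F.add _ e e' x y)))
    (IsAdditive.of_eq rfl (fun _ => rfl) (fun e e' x y => heq_of_eq
      (IsAdditive.id_comp_σ _ F.add _ e' e x y).symm))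
  rightUnitor F := isoMk (ρ_ F.hom)
    (IsAdditive.of_eq rfl (fun _ => rfl) (fun e e' x y => heq_of_eq
      (IsAdditive.comp_id_σ _ F.add _ e e' x y)))
    (IsAdditive.of_eq rfl (fun _ => rfl) (fun e e' x y => heq_of_eq
      (IsAdditive.comp_id_σ _ F.add _ e' e x y).symm))
  whiskerLeft_id F F' := hom₂_ext (whiskerLeft_id F.hom F'.hom)
  whiskerLeft_comp F _ _ _ a b := hom₂_ext (whiskerLeft_comp F.hom a.hom b.hom)
  id_whiskerLeft a := hom₂_ext (id_whiskerLeft a.hom)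
  comp_whiskerLeft F F' _ _ a := hom₂_ext (comp_whiskerLeft F.hom F'.hom a.hom)
  id_whiskerRight F F' := hom₂_ext (id_whiskerRight F.hom F'.hom)
  comp_whiskerRight a b H := hom₂_ext (comp_whiskerRight a.hom b.hom H.hom)
  whiskerRight_id a := hom₂_ext (whiskerRight_id a.hom)
  whiskerRight_comp a F F' := hom₂_ext (whiskerRight_comp a.hom F.hom F'.hom)
  whisker_assoc F _ _ a F' := hom₂_ext (whisker_assoc F.hom a.hom F'.hom)
  whisker_exchange a b := hom₂_ext (whisker_exchange a.hom b.hom)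
  pentagon F G H K := hom₂_ext (pentagon F.hom G.hom H.hom K.hom)
  triangle F G := hom₂_ext (triangle F.hom G.hom)

/-- The projection of a Picard stack over `C/U` to `U`. -/
instance : Over2 C (Picard.{w₁, w₂} J) where
  base P := P.base
  proj F := F.hom.base
  proj_id _ := rfl
  proj_comp _ _ := rfl
  proj_eq a := a.hom.base_eq

end Picard

/-! ### The theory of matrices and its 2-algebras -/

/-- The powers `1ⁿ`, for `n : ℕ`, of the trivial Picard stack. -/
structure PowOne where
  exp : ℕ

/-- Arrows from `1ⁿ` to `1ᵏ` are the integral matrices with `k` rows and `n` columns. -/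
instance : Category PowOne where
  Hom m n := Matrix (Fin n.exp) (Fin m.exp) ℤ
  id n := (1 : Matrix (Fin n.exp) (Fin n.exp) ℤ)
  comp {m n k} (P : Matrix (Fin n.exp) (Fin m.exp) ℤ) (Q : Matrix (Fin k.exp) (Fin n.exp) ℤ) :=
    (Q * P : Matrix (Fin k.exp) (Fin m.exp) ℤ)
  id_comp P := Matrix.mul_one P
  comp_id P := Matrix.one_mul P
  assoc P Q R := (Matrix.mul_assoc R Q P).symm

/-- The theory `T₁`, with only identity 2-arrows. -/
abbrev TOne := LocallyDiscrete PowOne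

/-- The object `1ⁿ` of `T₁`. -/
def TOne.pow (n : ℕ) : TOne := ⟨⟨n⟩⟩

/-- The arrow of `T₁` defined by a matrix. -/
def TOne.arrow {n k : ℕ} (M : Matrix (Fin k) (Fin n) ℤ) : TOne.pow n ⟶ TOne.pow k := ⟨M⟩

section Products

variable {D : Type u} [Bicategory.{w, v} D] {D' : Type u'} [Bicategory.{w', v'} D']

/-- The arrows `π i : x ⟶ y i` exhibit `x` as a product of the objects `y i` in
the 2-category `D`. -/
def IsProduct {ι : Type} {x : D} {y : ι → D} (π : ∀ i, x ⟶ y i) : Prop :=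
  ∀ z : D, (Functor.pi' fun i => postcomp z (π i) : (z ⟶ x) ⥤ ∀ i, (z ⟶ y i)).IsEquivalence

/-- A pseudofunctor which preserves finite products. -/
def PreservesFiniteProducts (A : D ⥤ᵖ D') : Prop :=
  ∀ (n : ℕ) (x : D) (y : Fin n → D) (π : ∀ i, x ⟶ y i),
    IsProduct π → IsProduct fun i => A.map (π i)

end Products

/-- A 2-algebra for `T₁` over the site `(B, K)`. -/
structure TwoAlgebra {B : Type u} [Category.{v} B] (K : GrothendieckTopology B) where
  A : TOne ⥤ᵖ Stk.{w, w'} K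
  preserves : PreservesFiniteProducts A

/-- An object of the fibred 2-category of 2-algebras for `T₁` over the site `(C, J)`: an object
`base` of `C` and a 2-algebra for `T₁` over `C/base`. -/
structure Alg {C : Type u} [Category.{v} C] (J : GrothendieckTopology C) where
  base : C
  alg : TwoAlgebra.{max u v w₁, max v w₂} (J.over base)

namespace Alg

variable {C : Type u} [Category.{v} C] {J : GrothendieckTopology C}

/-- A 2-algebra, as a pseudofunctor with values in the fibre over `base` of the fibred 2-category
of stacks. -/
abbrev tot (A : Alg.{w₁, w₂} J) : TOne ⥤ᵖ StackTot.{w₁, w₂} J :=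
  A.alg.A.comp (StackTot.incl J A.base)

/-- An arrow over `base : U ⟶ V`: a strong transformation whose components lie over `base`. -/
structure Hom (A A' : Alg.{w₁, w₂} J) where
  base : A.base ⟶ A'.base
  hom : A.tot ⟶ A'.tot
  lies (t : TOne) : (hom.app t).base = base

instance : CategoryStruct (Alg.{w₁, w₂} J) where
  Hom A A' := Hom A A'
  id A := ⟨𝟙 A.base, 𝟙 A.tot, fun _ => rfl⟩
  comp α β := ⟨α.base ≫ β.base, α.hom ≫ β.hom,
    fun t => congrArg₂ (· ≫ ·) (α.lies t) (β.lies t)⟩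

/-- A 2-arrow: a modification. -/
@[ext]
structure Hom₂ {A A' : Alg.{w₁, w₂} J} (α α' : A ⟶ A') where
  hom : α.hom ⟶ α'.hom

instance (A A' : Alg.{w₁, w₂} J) : Category (A ⟶ A') where
  Hom α α' := Hom₂ α α'
  id α := ⟨𝟙 α.hom⟩
  comp a b := ⟨a.hom ≫ b.hom⟩
  id_comp a := Hom₂.ext (Category.id_comp a.hom)
  comp_id a := Hom₂.ext (Category.comp_id a.hom)
  assoc a b c := Hom₂.ext (Category.assoc a.hom b.hom c.hom)

@[ext]
theorem hom₂_ext {A A' : Alg.{w₁, w₂} J} {α α' : A ⟶ A'} {a b : α ⟶ α'} (h : a.hom = b.hom) :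
    a = b := Hom₂.ext h

@[simps]
def isoMk {A A' : Alg.{w₁, w₂} J} {α α' : A ⟶ A'} (e : α.hom ≅ α'.hom) : α ≅ α' where
  hom := Hom₂.mk e.hom
  inv := Hom₂.mk e.inv
  hom_inv_id := hom₂_ext e.hom_inv_id
  inv_hom_id := hom₂_ext e.inv_hom_id

instance : Bicategory (Alg.{w₁, w₂} J) where
  homCategory := inferInstance
  whiskerLeft F _ _ a := Hom₂.mk (F.hom ◁ a.hom)
  whiskerRight a H := Hom₂.mk (a.hom ▷ H.hom)
  associator F F' F'' := isoMk (α_ F.hom F'.hom F''.hom)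
  leftUnitor F := isoMk (λ_ F.hom)
  rightUnitor F := isoMk (ρ_ F.hom)
  whiskerLeft_id F F' := hom₂_ext (whiskerLeft_id F.hom F'.hom)
  whiskerLeft_comp F _ _ _ a b := hom₂_ext (whiskerLeft_comp F.hom a.hom b.hom)
  id_whiskerLeft a := hom₂_ext (id_whiskerLeft a.hom)
  comp_whiskerLeft F F' _ _ a := hom₂_ext (comp_whiskerLeft F.hom F'.hom a.hom)
  id_whiskerRight F F' := hom₂_ext (id_whiskerRight F.hom F'.hom)
  comp_whiskerRight a b H := hom₂_ext (comp_whiskerRight a.hom b.hom H.hom)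
  whiskerRight_id a := hom₂_ext (whiskerRight_id a.hom)
  whiskerRight_comp a F F' := hom₂_ext (whiskerRight_comp a.hom F.hom F'.hom)
  whisker_assoc F _ _ a F' := hom₂_ext (whisker_assoc F.hom a.hom F'.hom)
  whisker_exchange a b := hom₂_ext (whisker_exchange a.hom b.hom)
  pentagon F G H K := hom₂_ext (pentagon F.hom G.hom H.hom K.hom)
  triangle F G := hom₂_ext (triangle F.hom G.hom)

/-- The projection of a 2-algebra over `C/U` to `U`. -/
instance : Over2 C (Alg.{w₁, w₂} J) where
  base A := A.base
  proj α := α.base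
  proj_id _ := rfl
  proj_comp _ _ := rfl
  proj_eq {_ _ α β} a :=
    ((α.lies (TOne.pow 0)).symm.trans (a.hom.as.app (TOne.pow 0)).base_eq).trans
      (β.lies (TOne.pow 0))

end Alg

/-! ### Powers of a Picard stack and integral linear combinations -/

section Powers

variable {B : Type u} [Category.{v} B] {X : Type w} [Category.{w'} X]

/-- The objects of the `n`-th power of `p : X ⥤ B` over `B`. -/
structure Pow (p : X ⥤ B) (n : ℕ) where
  base : B
  pt : Fin n → p.Fiber base

namespace Pow

variable {p : X ⥤ B} {n : ℕ}

/-- An arrow: a family of arrows over the same arrow of `B`. -/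
@[ext]
structure Hom (x y : Pow p n) where
  base : x.base ⟶ y.base
  arr (i : Fin n) : (x.pt i).1 ⟶ (y.pt i).1
  lies (i : Fin n) : p.IsHomLift base (arr i)

@[simps]
instance : Category (Pow p n) where
  Hom x y := Hom x y
  id x := ⟨𝟙 x.base, fun i => 𝟙 (x.pt i).1, fun i => IsHomLift.id (x.pt i).2⟩
  comp f g := ⟨f.base ≫ g.base, fun i => f.arr i ≫ g.arr i, fun i =>
    have := f.lies i; have := g.lies i; IsHomLift.comp p f.base g.base (f.arr i) (g.arr i)⟩

variable (p n) in
/-- The projection of `pⁿ` to `B`. -/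
def proj : Pow p n ⥤ B where
  obj x := x.base
  map f := f.base

end Pow

/-- Functors over `B`. -/
structure OverFunctor {E : Type*} [Category* E] (e : E ⥤ B) (p : X ⥤ B) where
  F : E ⥤ X
  w : F ⋙ p = e

namespace OverFunctor

variable {E : Type*} [Category* E] {e : E ⥤ B} {p : X ⥤ B}

/-- The value at an object, in a fibre. -/
def fibObj (L : OverFunctor e p) (z : E) : p.Fiber (e.obj z) :=
  ⟨L.F.obj z, Functor.congr_obj L.w z⟩

/-- The value at an arrow. -/
def fibMap (L : OverFunctor e p) {z z' : E} (f : z ⟶ z') :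
    FibHom p (e.map f) (L.fibObj z) (L.fibObj z') :=
  ⟨L.F.map f, isHomLift_map_of_eq L.w f⟩

/-- The composite of functors over `B`. -/
def comp {X' : Type*} [Category* X'] {q : X' ⥤ B} (L : OverFunctor e p) (L' : OverFunctor p q) :
    OverFunctor e q where
  F := L.F ⋙ L'.F
  w := by rw [Functor.assoc, L'.w, L.w]

/-- The sum of two functors with respect to a law of composition. -/
def add (P : Law p) (L L' : OverFunctor e p) : OverFunctor e p where
  F :=
    { obj z := (P.add (L.fibObj z) (L'.fibObj z)).1
      map f := (P.map (L.fibMap f) (L'.fibMap f)).1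
      map_id z := (P.map_congr (e.map_id z) (L.F.map_id z) (L'.F.map_id z)).trans
        (congrArg Subtype.val (P.map_id (L.fibObj z) (L'.fibObj z)))
      map_comp f g := (P.map_congr (e.map_comp f g) (L.F.map_comp f g) (L'.F.map_comp f g)).trans
        (congrArg Subtype.val
          (P.map_comp (L.fibMap f) (L'.fibMap f) (L.fibMap g) (L'.fibMap g))) }
  w := by
    refine CategoryTheory.Functor.ext (fun z => (P.add (L.fibObj z) (L'.fibObj z)).2) (fun z z' f => ?_)
    have h := (P.map (L.fibMap f) (L'.fibMap f)).2
    exact IsHomLift.fac' p (e.map f) (P.map (L.fibMap f) (L'.fibMap f)).1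

/-- Two functors over `B` are isomorphic over `B`. -/
def Isom (L L' : OverFunctor e p) : Prop :=
  ∃ i : L.F ≅ L'.F, IsVertical p i.hom

end OverFunctor

/-- The `j`-th projection of `pⁿ` to `p`. -/
def Pow.pr (p : X ⥤ B) (n : ℕ) (j : Fin n) : OverFunctor (Pow.proj p n) p where
  F :=
    { obj x := (x.pt j).1
      map f := f.arr j }
  w := by
    refine CategoryTheory.Functor.ext (fun x => (x.pt j).2) (fun x y f => ?_)
    have h := f.lies j
    exact IsHomLift.fac' p f.base (f.arr j)

/-- `IsLinComb P m L` says that the functor `L : pⁿ ⥤ p` is, up to isomorphism, the integral linear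
combination `(X₁, …, Xₙ) ↦ m₁ X₁ + ⋯ + mₙ Xₙ`: it is obtained from the projections by
sums, by a neutral object (characterized by `L + L ≅ L`), and by opposites (`L + L'` neutral). -/
inductive IsLinComb {p : X ⥤ B} (P : Law p) {n : ℕ} :
    (Fin n → ℤ) → OverFunctor (Pow.proj p n) p → Prop
  | pr (j : Fin n) : IsLinComb P (Pi.single j 1) (Pow.pr p n j)
  | zero {L} : (L.add P L).Isom L → IsLinComb P 0 L
  | add {m m' L L'} : IsLinComb P m L → IsLinComb P m' L' → IsLinComb P (m + m') (L.add P L')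
  | neg {m L L'} : IsLinComb P m L → IsLinComb P 0 (L.add P L') → IsLinComb P (-m) L'
  | iso {m L L'} : L.Isom L' → IsLinComb P m L → IsLinComb P m L'

end Powers

/-- The 2-algebra `A` is, up to equivalence, the algebra `1ⁿ ↦ Pⁿ` on which every integral matrix
acts by the corresponding integral linear combinations. -/
def IsMatrixAlgebra {B : Type u} [Category.{v} B] {K : GrothendieckTopology B}
    (P : PicardStack.{w, w'} K) (A : TwoAlgebra.{w, w'} K) : Prop :=
  ∃ E : ∀ n : ℕ, OverFunctor (Pow.proj P.p n) (A.A.obj (TOne.pow n)).p,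
    (∀ n, (E n).F.IsEquivalence) ∧
    ∀ (n k : ℕ) (M : Matrix (Fin k) (Fin n) ℤ),
      ∃ L : OverFunctor (Pow.proj P.p n) (Pow.proj P.p k),
        (∀ i, IsLinComb P.str.toLaw (M i) (L.comp (Pow.pr P.p k i))) ∧
        ((E n).comp ⟨(A.A.map (TOne.arrow M)).F, (A.A.map (TOne.arrow M)).w⟩).Isom (L.comp (E k))

end PicardMatrix

/-!
A strictly commutative Picard stack is a module over the integers up to coherent isomorphism, and a
product-preserving 2-functor on the category of integral matrices is a module in the sense of
functorial semantics. The two notions are compared through *additive families*. A family indexed by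
`ℤⁿ` consists of objects `pt r` of a fibre, for `r : ℤⁿ`, and of isomorphisms
`pt (r + s) ≅ pt r + pt s` compatible with the associativity and commutativity isomorphisms
(`FamAt`, `Fam`).

Families and their morphisms are determined by arbitrary values at a basis
(`AddFam.exists_family`, `Fam.exists_hom`, `Fam.hom_ext_basis`). Objects are constructed in a
symmetric monoidal category in which translations are equivalences and the symmetry of `X ⊗ X` is
trivial. One vector is handled by recursion over `ℤ` in both directions, where strictness is what
makes the family of multiples compatible with commutativity; several vectors are handled by adding
families. So the families indexed by `ℤⁿ` form a stack equivalent to `Pⁿ`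
(`SmallFam.eval_isFibEquiv`). The gain over `Pⁿ` is that a matrix acts on families by restriction
along the homomorphism of its rows (`rowHom`), so that no choice of linear combinations, and no
coherence for such choices, is needed: this is the pseudofunctor `PicardStack.famPseudofunctor`. It
preserves products because a product cone of powers in the category of matrices amounts to a
decomposition of a basis (`TOne.exists_basis`). Evaluating a family at `r` is a linear combination
of its values at the standard basis (`SmallFam.isLinComb_evalAt`), so a matrix acts as expected. The
families are kept in the universe of the given stack by presenting them as restrictions of families
spanned by tuples (`SmallFam`).

Additive functors push families forward, which gives `Picard.toAlgPseudofunctor`. It is a local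
equivalence. A transformation of algebras of families gives a functor by its values on families
indexed by `ℤ`. The images of the families indexed by `ℤ²` and `ℤ³` provide the additive structure
of this functor and its compatibility with associativity and commutativity (`ofAlg`,
`toAlgMapOfAlg`). Similarly, a modification gives a morphism of additive functors, additivity being
naturality on families (`exists_isAdditive`, `exists_toAlgMap₂`).

Every 2-algebra is in the essential image. Write the value at the `n`-th power as a stack on which
evaluation at any basis is an equivalence with a power of the value at `1` (`MatrixAction`). The
matrix `(1 1)` defines a sum on the value at `1`. Since objects of exponent `n` are determined by
their values at a basis, and the values at `r`, `s` and `r + s` of an object are restrictions of it,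
every object of exponent `n` has an additive family of values. This characterizes the constraints
(`assoc_univ`, `comm_univ`), forces the pentagon, the hexagon and strictness, and makes translations
equivalences because `e₀`, `e₀ + e₁` is a basis of `ℤ²`; the coefficient `-1` makes the fibres
groupoids (`isIso_hom`). Sending an object to its family of values is then an arrow of 2-algebras
(`TwoAlgebra.toFamilies`) whose components are equivalences, and such an arrow is an equivalence
(`Alg.exists_equivalence`).

Finally, Picard stacks have inverse images along the arrows of the site, with cartesian projections
(`Pull`, `isCartesianAt_pullFst`), so that `Picard` is fibred. A local equivalence that is
essentially surjective over the base carries cartesian arrows to cartesian arrows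
(`IsLocalEquiv.isCartesianArrow`), so that 2-algebras are fibred as well and the comparison is
cartesian.
-/

namespace PicardMatrix

/-! ### Lifts of arrows and strongly cartesian arrows -/

section Lifts

variable {B : Type*} [Category* B] {X : Type*} [Category* X] {p : X ⥤ B}

theorem exists_base {x y : X} (φ : x ⟶ y) {S T : B} (hx : p.obj x = S) (hy : p.obj y = T) :
    ∃ b : S ⟶ T, p.IsHomLift b φ := by
  subst hx hy
  exact ⟨p.map φ, IsHomLift.map p φ⟩

theorem isHomLift_comp_eq {R S T : B} {f : R ⟶ S} {g : S ⟶ T} {h : R ⟶ T} (e : f ≫ g = h)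
    {x y z : X} {φ : x ⟶ y} {ψ : y ⟶ z} (hφ : p.IsHomLift f φ) (hψ : p.IsHomLift g ψ) :
    p.IsHomLift h (φ ≫ ψ) := e ▸ IsHomLift.comp p f g φ ψ

theorem isHomLift_id_comp {R T : B} {g : R ⟶ T}
    {x y z : X} {φ : x ⟶ y} {ψ : y ⟶ z} (hφ : p.IsHomLift (𝟙 R) φ) (hψ : p.IsHomLift g ψ) :
    p.IsHomLift g (φ ≫ ψ) := isHomLift_comp_eq (Category.id_comp g) hφ hψ

theorem isHomLift_comp_id {R T : B} {g : R ⟶ T}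
    {x y z : X} {φ : x ⟶ y} {ψ : y ⟶ z} (hφ : p.IsHomLift g φ) (hψ : p.IsHomLift (𝟙 T) ψ) :
    p.IsHomLift g (φ ≫ ψ) := isHomLift_comp_eq (Category.comp_id g) hφ hψ

theorem isHomLift_inv {R : B} {x y : X} (i : x ≅ y) (h : p.IsHomLift (𝟙 R) i.hom) :
    p.IsHomLift (𝟙 R) i.inv := IsHomLift.lift_id_inv p R i

theorem base_comp_eq {R S T : B} {f : R ⟶ S} {g : S ⟶ T} {h : R ⟶ T}
    {x y z : X} {φ : x ⟶ y} {ψ : y ⟶ z} (hφ : p.IsHomLift f φ) (hψ : p.IsHomLift g ψ)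
    (hc : p.IsHomLift h (φ ≫ ψ)) : f ≫ g = h :=
  AddStr.lift_unique (IsHomLift.comp p f g φ ψ) hc

theorem isStronglyCartesian_of_isHomLift {S T S' T' : B} {f : S ⟶ T} {f' : S' ⟶ T'} {x y : X}
    {φ : x ⟶ y} (h : p.IsStronglyCartesian f φ) (h' : p.IsHomLift f' φ) :
    p.IsStronglyCartesian f' φ := by
  have h1 := h.toIsHomLift
  cases h1
  cases h'
  exact h

theorem isHomLift_transfer {E : Type*} [Category* E] {q : E ⥤ B} {S T S' T' : B} {f : S ⟶ T}
    {f' : S' ⟶ T'} {x y : X} {x' y' : E} {φ : x ⟶ y} {ψ : x' ⟶ y'} (h : p.IsHomLift f φ)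
    (h' : p.IsHomLift f' φ) (k : q.IsHomLift f ψ) : q.IsHomLift f' ψ := by
  cases h
  cases h'
  exact k

@[simp] theorem fiber_hom_inv {T : B} {x y : p.Fiber T} (i : x ≅ y) :
    i.hom.1 ≫ i.inv.1 = 𝟙 x.1 := congrArg Subtype.val i.hom_inv_id

@[simp] theorem fiber_inv_hom {T : B} {x y : p.Fiber T} (i : x ≅ y) :
    i.inv.1 ≫ i.hom.1 = 𝟙 y.1 := congrArg Subtype.val i.inv_hom_id

@[simp] theorem fiber_hom_inv_assoc {T : B} {x y : p.Fiber T} (i : x ≅ y) {z : X} (f : x.1 ⟶ z) :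
    i.hom.1 ≫ i.inv.1 ≫ f = f := by rw [← Category.assoc, fiber_hom_inv, Category.id_comp]

/-- An isomorphism of a fibre, as an isomorphism of the total category. -/
def fiberIsoVal {T : B} {x y : p.Fiber T} (i : x ≅ y) : x.1 ≅ y.1 where
  hom := i.hom.1
  inv := i.inv.1

/-- An isomorphism of the total category lying over an identity, as an isomorphism of a fibre. -/
def fiberIsoMk {T : B} {x y : p.Fiber T} (i : x.1 ≅ y.1) (h : p.IsHomLift (𝟙 T) i.hom) :
    x ≅ y where
  hom := ⟨i.hom, h⟩
  inv := ⟨i.inv, isHomLift_inv i h⟩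
  hom_inv_id := Subtype.ext i.hom_inv_id
  inv_hom_id := Subtype.ext i.inv_hom_id

theorem exists_lift (hp : p.IsFibered) {T T' : B} (b : T ⟶ T') (y : p.Fiber T') :
    ∃ (x : p.Fiber T) (φ : x.1 ⟶ y.1), p.IsStronglyCartesian b φ := by
  obtain ⟨x, φ, h⟩ := IsPreFibered.exists_isCartesian p y.2 b
  exact ⟨⟨x, IsHomLift.domain_eq p b φ⟩, φ, inferInstance⟩

/-- Factorization through a strongly cartesian arrow. -/
theorem exists_factor {R S T : B} {g : R ⟶ S} {f : S ⟶ T} {h : R ⟶ T} (e : g ≫ f = h) {x y z : X}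
    {φ : x ⟶ y} (hφ : p.IsStronglyCartesian f φ) {ψ : z ⟶ y} (hψ : p.IsHomLift h ψ) :
    ∃ χ : z ⟶ x, p.IsHomLift g χ ∧ χ ≫ φ = ψ :=
  ⟨Functor.IsStronglyCartesian.map p f φ e.symm ψ, inferInstance,
    Functor.IsStronglyCartesian.fac p f φ e.symm ψ⟩

theorem cart_ext {R S T : B} {g : R ⟶ S} {f : S ⟶ T} {x y z : X} {φ : x ⟶ y}
    (hφ : p.IsStronglyCartesian f φ) {ψ ψ' : z ⟶ x} (h : p.IsHomLift g ψ) (h' : p.IsHomLift g ψ')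
    (e : ψ ≫ φ = ψ' ≫ φ) : ψ = ψ' :=
  Functor.IsStronglyCartesian.ext p f φ g e

theorem isStronglyCartesian_comp {R S T : B} {f : R ⟶ S} {g : S ⟶ T} {h : R ⟶ T} (e : f ≫ g = h)
    {x y z : X} {φ : x ⟶ y} {ψ : y ⟶ z} (hφ : p.IsStronglyCartesian f φ)
    (hψ : p.IsStronglyCartesian g ψ) : p.IsStronglyCartesian h (φ ≫ ψ) :=
  e ▸ Functor.IsStronglyCartesian.comp (p := p) (f := f) (g := g) (φ := φ) (ψ := ψ)

theorem isStronglyCartesian_mk {x y : X} {φ : x ⟶ y} {S T : B} {f : S ⟶ T} (h : p.IsHomLift f φ)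
    (H : ∀ (z : X) (R : B) (g : R ⟶ S) (ψ : z ⟶ y), p.IsHomLift (g ≫ f) ψ →
      ∃! χ : z ⟶ x, p.IsHomLift g χ ∧ χ ≫ φ = ψ) : p.IsStronglyCartesian f φ :=
  { toIsHomLift := h
    universal_property' := fun g ψ hψ => H _ _ g ψ hψ }

/-- If the fibres are groupoids, all arrows of a fibred category are strongly cartesian. -/
theorem isStronglyCartesian_of_groupoid (hp : p.IsFibered)
    (hg : ∀ {T : B} {x y : p.Fiber T} (f : x ⟶ y), IsIso f)
    {S T : B} {f : S ⟶ T} {x y : X} {φ : x ⟶ y} (h : p.IsHomLift f φ) :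
    p.IsStronglyCartesian f φ := by
  have hx := IsHomLift.domain_eq p f φ
  have hy := IsHomLift.codomain_eq p f φ
  obtain ⟨z, c, hc⟩ := exists_lift hp f ⟨y, hy⟩
  obtain ⟨χ, hχ, e⟩ := exists_factor (Category.id_comp f) hc h
  have h1 := hg (x := ⟨x, hx⟩) (y := z) ⟨χ, hχ⟩
  let i : x ≅ z.1 := fiberIsoVal (asIso (C := p.Fiber S) (X := ⟨x, hx⟩) (Y := z) ⟨χ, hχ⟩)
  have hi : p.IsHomLift (𝟙 S) i.hom := hχ
  have h2 : p.IsStronglyCartesian (𝟙 S) χ :=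
    Functor.IsStronglyCartesian.of_iso p (𝟙 S) i
  have h3 : p.IsStronglyCartesian (𝟙 S ≫ f) (χ ≫ c) := inferInstance
  rw [e] at h3
  exact isStronglyCartesian_of_isHomLift h3 h

end Lifts

/-! ### Equivalences over the base and transfer of descent -/

section FibEquiv

variable {B : Type*} [Category* B] {X : Type*} [Category* X] {E : Type*} [Category* E]
  {p : X ⥤ B} {e : E ⥤ B}

/-- A functor over `B` which is an equivalence over `B`: it is fully faithful, and every object
of a fibre of the target is isomorphic, in the fibre, to the image of an object. -/
structure IsFibEquiv (L : OverFunctor e p) : Prop where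
  full : L.F.Full
  faithful : L.F.Faithful
  surj : ∀ {T : B} (x : p.Fiber T), ∃ (z : e.Fiber T) (i : L.F.obj z.1 ≅ x.1),
    p.IsHomLift (𝟙 T) i.hom

namespace OverFunctor

variable (L : OverFunctor e p)

theorem obj_eq (z : E) : p.obj (L.F.obj z) = e.obj z := Functor.congr_obj L.w z

theorem isHomLift_iff {S T : B} {b : S ⟶ T} {x y : E} {φ : x ⟶ y} :
    p.IsHomLift b (L.F.map φ) ↔ e.IsHomLift b φ := by
  obtain ⟨F, w⟩ := L
  subst w
  constructor
  · intro h
    cases h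
    exact IsHomLift.map (F ⋙ p) φ
  · intro h
    cases h
    exact IsHomLift.map p (F.map φ)

/-- The functor induced on a fibre. -/
def fiberFunctor (T : B) : e.Fiber T ⥤ p.Fiber T where
  obj z := ⟨L.F.obj z.1, (L.obj_eq z.1).trans z.2⟩
  map f := ⟨L.F.map f.1, L.isHomLift_iff.2 f.2⟩
  map_id z := Subtype.ext (L.F.map_id z.1)
  map_comp f g := Subtype.ext (L.F.map_comp f.1 g.1)

end OverFunctor

namespace IsFibEquiv

variable {L : OverFunctor e p} (h : IsFibEquiv L)

include h

theorem exists_map {x y : E} (ψ : L.F.obj x ⟶ L.F.obj y) : ∃ φ : x ⟶ y, L.F.map φ = ψ := by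
  have := h.full
  exact ⟨L.F.preimage ψ, L.F.map_preimage ψ⟩

theorem map_inj {x y : E} {φ φ' : x ⟶ y} (k : L.F.map φ = L.F.map φ') : φ = φ' := by
  have := h.faithful
  exact L.F.map_injective k

theorem exists_obj {T : B} {x : X} (hx : p.obj x = T) : ∃ (z : E) (i : L.F.obj z ≅ x),
    e.obj z = T ∧ p.IsHomLift (𝟙 T) i.hom := by
  obtain ⟨z, i, hi⟩ := h.surj (⟨x, hx⟩ : p.Fiber T)
  exact ⟨z.1, i, z.2, hi⟩

theorem cart_of_map {S T : B} {b : S ⟶ T} {x y : E} {φ : x ⟶ y}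
    (hφ : p.IsStronglyCartesian b (L.F.map φ)) : e.IsStronglyCartesian b φ := by
  refine isStronglyCartesian_mk (L.isHomLift_iff.1 hφ.toIsHomLift) fun z R g ψ hψ => ?_
  obtain ⟨χ, hχ, k⟩ := exists_factor rfl hφ (L.isHomLift_iff.2 hψ)
  obtain ⟨χ, rfl⟩ := h.exists_map χ
  refine ⟨χ, ⟨L.isHomLift_iff.1 hχ, h.map_inj (by rw [L.F.map_comp, k])⟩, fun χ' hχ' => ?_⟩
  exact h.map_inj (cart_ext hφ (L.isHomLift_iff.2 hχ'.1) hχ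
    (by rw [k, ← L.F.map_comp, hχ'.2]))

theorem map_cart {S T : B} {b : S ⟶ T} {x y : E} {φ : x ⟶ y}
    (hφ : e.IsStronglyCartesian b φ) : p.IsStronglyCartesian b (L.F.map φ) := by
  refine isStronglyCartesian_mk (L.isHomLift_iff.2 hφ.toIsHomLift) fun z R g ψ hψ => ?_
  obtain ⟨z', i, -, hi⟩ := h.exists_obj (IsHomLift.domain_eq p (g ≫ b) ψ)
  obtain ⟨ψ', hψ'⟩ := h.exists_map (i.hom ≫ ψ)
  have h1 : e.IsHomLift (g ≫ b) ψ' := by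
    rw [← L.isHomLift_iff, hψ']
    exact isHomLift_id_comp hi hψ
  obtain ⟨χ, hχ, k⟩ := exists_factor rfl hφ h1
  refine ⟨i.inv ≫ L.F.map χ, ⟨isHomLift_id_comp (isHomLift_inv i hi) (L.isHomLift_iff.2 hχ), ?_⟩,
    fun χ' hχ' => ?_⟩
  · rw [Category.assoc, ← L.F.map_comp, k, hψ', Iso.inv_hom_id_assoc]
  · obtain ⟨χ'', hχ''⟩ := h.exists_map (i.hom ≫ χ')
    rw [Iso.eq_inv_comp, ← hχ'']
    congr 1
    refine cart_ext hφ (L.isHomLift_iff.1 ?_) hχ (h.map_inj ?_)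
    · rw [hχ'']
      exact isHomLift_id_comp hi hχ'.1
    · rw [L.F.map_comp, hχ'', Category.assoc, hχ'.2, k, hψ']

theorem isEquivalence : L.F.IsEquivalence := by
  have := h.full
  have := h.faithful
  have : L.F.EssSurj := ⟨fun x => by
    obtain ⟨z, i, -⟩ := h.exists_obj (x := x) rfl
    exact ⟨z, ⟨i⟩⟩⟩
  exact {}

/-- A fibred category which is equivalent over the base to a stack is a stack. -/
theorem isStack {K : GrothendieckTopology B} (hp : IsStack K p) : IsStack K e where
  fibered := by
    have hf := hp.fibered
    refine Functor.IsFibered.of_exists_isStronglyCartesian fun a R f => ?_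
    obtain ⟨x, φ, hφ⟩ := exists_lift hf f ⟨L.F.obj a, L.obj_eq a⟩
    obtain ⟨z, i, hi⟩ := h.surj x
    obtain ⟨ψ, hψ⟩ := h.exists_map (i.hom ≫ φ)
    refine ⟨z.1, ψ, h.cart_of_map ?_⟩
    rw [hψ]
    have : p.IsStronglyCartesian (𝟙 R ≫ f) (i.hom ≫ φ) := inferInstance
    rwa [Category.id_comp] at this
  glue_arrows := by
    have hs := h
    obtain ⟨F, w⟩ := L
    subst w
    intro x y hxy R hR g hg hc
    -- the family is transported to the stack along chosen isomorphisms `F.obj (o z) ≅ z`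
    choose o i _ hi using fun z : X => hs.exists_obj (x := z) rfl
    have hpre : ∀ (z : X) (φ : z ⟶ F.obj x), ∃ φ' : o z ⟶ x, F.map φ' = (i z).hom ≫ φ :=
      fun z φ => hs.exists_map _
    choose q hq using hpre
    have hR' : ∀ (z : X) (φ : z ⟶ F.obj x), R (p.map φ) → R ((F ⋙ p).map (q z φ)) := by
      intro z φ hφ
      change R (p.map (F.map (q z φ)))
      rw [hq, p.map_comp]
      exact R.downward_closed hφ _
    obtain ⟨γ, ⟨hγ, hγ'⟩, hu⟩ := hp.glue_arrows (F.obj x) (F.obj y) hxy R hR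
      (fun z φ hφ => (i z).inv ≫ F.map (g (o z) (q z φ) (hR' z φ hφ)))
      (fun z φ hφ => by
        refine isHomLift_id_comp (isHomLift_inv (i z) (hi z)) ?_
        have h2 := hg (o z) (q z φ) (hR' z φ hφ)
        have h3 := (OverFunctor.isHomLift_iff (p := p) ⟨F, rfl⟩).2 h2
        have h4 : p.IsHomLift (p.map φ) (F.map (q z φ)) := by
          rw [hq]
          exact isHomLift_id_comp (hi z) inferInstance
        have h5 : p.IsHomLift ((F ⋙ p).map (q z φ)) (F.map (q z φ)) :=
          IsHomLift.map p (F.map (q z φ))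
        exact isHomLift_transfer h5 h4 h3)
      (fun z z' ψ φ hφ hψ => by
        obtain ⟨ψ', hψ'⟩ := hs.exists_map ((i z').hom ≫ ψ ≫ (i z).inv)
        have h1 : q z' (ψ ≫ φ) = ψ' ≫ q z φ := by
          apply hs.map_inj
          change F.map _ = F.map _
          rw [F.map_comp, hq, hq, hψ']
          simp
        have h2 : R ((F ⋙ p).map (ψ' ≫ q z φ)) := by
          rw [← h1]
          exact hR' z' _ hψ
        have h3 := hc (o z) (o z') ψ' (q z φ) (hR' z φ hφ) h2
        have h4 : g (o z') (q z' (ψ ≫ φ)) (hR' z' _ hψ) = g (o z') (ψ' ≫ q z φ) h2 := by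
          congr 1
        change (i z').inv ≫ F.map _ = _
        rw [h4, h3, F.map_comp, hψ']
        simp)
    obtain ⟨γ, rfl⟩ := hs.exists_map γ
    have key : ∀ (z : E) (φ : z ⟶ x) (hφ : R ((F ⋙ p).map φ)),
        (i (F.obj z)).inv ≫ F.map (g (o (F.obj z)) (q _ (F.map φ)) (hR' _ (F.map φ) hφ)) =
          F.map (g z φ hφ) := by
      intro z φ hφ
      obtain ⟨ψ, hψ⟩ := hs.exists_map (i (F.obj z)).hom
      change F.map ψ = _ at hψ
      have h1 : q _ (F.map φ) = ψ ≫ φ := by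
        apply hs.map_inj
        change F.map _ = F.map _
        rw [hq, F.map_comp, hψ]
      have h2 : R ((F ⋙ p).map (ψ ≫ φ)) := by
        rw [← h1]
        exact hR' _ _ hφ
      have h4 : g (o (F.obj z)) (q _ (F.map φ)) (hR' _ _ hφ) = g (o (F.obj z)) (ψ ≫ φ) h2 := by
        congr 1
      rw [h4, hc _ _ ψ φ hφ h2, F.map_comp, hψ, Iso.inv_hom_id_assoc]
    refine ⟨γ, ⟨(OverFunctor.isHomLift_iff (p := p) ⟨F, rfl⟩).1 hγ, fun z φ hφ => ?_⟩, ?_⟩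
    · apply hs.map_inj
      have := hγ' (F.obj z) (F.map φ) hφ
      change F.map _ = F.map _
      rw [F.map_comp]
      exact this.trans (key z φ hφ)
    · intro γ' hγ'
      apply hs.map_inj
      refine hu _ ⟨(OverFunctor.isHomLift_iff (p := p) ⟨F, rfl⟩).2 hγ'.1, fun z φ hφ => ?_⟩
      change φ ≫ F.map γ' = _
      rw [Iso.eq_inv_comp, ← Category.assoc, ← hq, ← F.map_comp, hγ'.2]
  glue_objects := by
    intro U R hR D hD
    obtain ⟨x, κ, hx, hκ, hc⟩ := hp.glue_objects U R hR (D ⋙ L.F)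
      (fun k => h.map_cart (hD k))
    obtain ⟨z, i, hz, hi⟩ := h.exists_obj hx
    choose κ' hκ' using fun f => h.exists_map (κ f ≫ i.inv)
    refine ⟨z, κ', hz, fun f => h.cart_of_map ?_, fun {f f'} k => h.map_inj ?_⟩
    · rw [hκ']
      have := hκ f
      have hi' : p.IsHomLift (𝟙 U) i.symm.hom := isHomLift_inv i hi
      have h1 : p.IsStronglyCartesian (𝟙 U) i.inv :=
        Functor.IsStronglyCartesian.of_iso p (𝟙 U) i.symm
      have h2 : p.IsStronglyCartesian (f.obj.hom ≫ 𝟙 U) (κ f ≫ i.inv) := inferInstance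
      rwa [Category.comp_id] at h2
    · rw [L.F.map_comp, hκ', hκ', ← hc k, Category.assoc]
      rfl

/-- An equivalence over the base has a quasi-inverse over the base. -/
theorem exists_inverse : ∃ (M : OverFunctor p e) (η : M.F ⋙ L.F ≅ 𝟭 X),
    IsVertical p η.hom ∧ ∀ x, p.IsHomLift (𝟙 (p.obj x)) (η.hom.app x) := by
  choose o i ho hi using fun x : X => h.exists_obj (x := x) rfl
  have hpre : ∀ {x y : X} (φ : x ⟶ y), ∃ φ' : o x ⟶ o y,
      L.F.map φ' = (i x).hom ≫ φ ≫ (i y).inv := fun φ => h.exists_map _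
  choose q hq using @hpre
  let M : X ⥤ E :=
    { obj := o
      map := q
      map_id x := h.map_inj (by rw [hq]; simp)
      map_comp f g := h.map_inj (by rw [L.F.map_comp, hq, hq, hq]; simp) }
  have hl : ∀ {x y : X} (φ : x ⟶ y), e.IsHomLift (p.map φ) (q φ) := fun {x y} φ => by
    rw [← L.isHomLift_iff, hq]
    exact isHomLift_id_comp (hi x) (isHomLift_comp_id (IsHomLift.map p φ)
      (isHomLift_inv (i y) (hi y)))
  refine ⟨⟨M, CategoryTheory.Functor.ext ho fun x y φ =>
    have := hl φ
    IsHomLift.fac' e (p.map φ) (q φ)⟩, NatIso.ofComponents i fun φ => ?_, fun x => ?_, hi⟩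
  · change L.F.map (q φ) ≫ _ = (i _).hom ≫ φ
    rw [hq]
    simp
  · exact isHomLift_congr (i x).hom (hi x) ((L.obj_eq (o x)).trans ((ho x).trans rfl) |>.trans
      ((L.obj_eq (o x)).trans (ho x)).symm)

end IsFibEquiv

end FibEquiv

end PicardMatrix

namespace PicardMatrix

/-! ### Pullbacks of powers of a fibred category -/

section Pull

variable {B : Type u} [Category.{v} B] {B' : Type u'} [Category.{v'} B']
  {X : Type w} [Category.{w'} X]

/-- The pullback along `G : B ⥤ B'` of the `ι`-th power over `B'` of `p : X ⥤ B'`: its objects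
over `T` are the families, indexed by `ι`, of objects over `G.obj T`. -/
structure Pull (G : B ⥤ B') (p : X ⥤ B') (ι : Type) where
  base : B
  pt : ι → p.Fiber (G.obj base)

namespace Pull

variable {G : B ⥤ B'} {p : X ⥤ B'} {ι : Type}

/-- An arrow over `b`: a family of arrows over `G.map b`. -/
@[ext]
structure Hom (x y : Pull G p ι) where
  base : x.base ⟶ y.base
  arr (i : ι) : (x.pt i).1 ⟶ (y.pt i).1
  lies (i : ι) : p.IsHomLift (G.map base) (arr i)

instance : Category (Pull G p ι) where
  Hom x y := Hom x y
  id x := ⟨𝟙 x.base, fun i => 𝟙 (x.pt i).1, fun i =>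
    (G.map_id x.base).symm ▸ IsHomLift.id (x.pt i).2⟩
  comp f g := ⟨f.base ≫ g.base, fun i => f.arr i ≫ g.arr i, fun i =>
    isHomLift_comp_eq (G.map_comp _ _).symm (f.lies i) (g.lies i)⟩

theorem comp_arr {x y z : Pull G p ι} (f : x ⟶ y) (g : y ⟶ z) (i : ι) :
    (f ≫ g).arr i = f.arr i ≫ g.arr i := rfl

theorem comp_base {x y z : Pull G p ι} (f : x ⟶ y) (g : y ⟶ z) :
    (f ≫ g).base = f.base ≫ g.base := rfl

theorem hom_ext {x y : Pull G p ι} {f g : x ⟶ y} (h : f.base = g.base)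
    (h' : ∀ i, f.arr i = g.arr i) : f = g := Hom.ext h (funext h')

variable (G p ι) in
/-- The projection to `B`. -/
def proj : Pull G p ι ⥤ B where
  obj x := x.base
  map f := f.base

theorem isHomLift_base {x y : Pull G p ι} (f : x ⟶ y) : (proj G p ι).IsHomLift f.base f :=
  IsHomLift.map (proj G p ι) f

theorem base_eq_of_isHomLift {x y : Pull G p ι} {f : x ⟶ y} {b : x.base ⟶ y.base}
    (h : (proj G p ι).IsHomLift b f) : f.base = b :=
  AddStr.lift_unique (isHomLift_base f) h

theorem cart_of_arr {x y : Pull G p ι} (f : x ⟶ y)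
    (h : ∀ i, p.IsStronglyCartesian (G.map f.base) (f.arr i)) :
    (proj G p ι).IsStronglyCartesian f.base f := by
  refine isStronglyCartesian_mk (isHomLift_base f) fun z R g ψ hψ => ?_
  obtain rfl : z.base = R := IsHomLift.domain_eq (proj G p ι) (g ≫ f.base) ψ
  have hb : ψ.base = g ≫ f.base := base_eq_of_isHomLift hψ
  choose χ hχ hχ' using fun i => exists_factor (by rw [hb, G.map_comp]) (h i) (ψ.lies i)
  let χ' : z ⟶ x := ⟨g, χ, hχ⟩
  refine ⟨χ', ⟨isHomLift_base χ', hom_ext hb.symm hχ'⟩, fun τ hτ => ?_⟩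
  have hτb : τ.base = g := base_eq_of_isHomLift hτ.1
  refine hom_ext hτb fun i => cart_ext (h i) (g := G.map g) ?_ (hχ i) ?_
  · rw [← hτb]
    exact τ.lies i
  · rw [hχ', ← hτ.2]
    rfl

theorem exists_cart_lift (hp : p.IsFibered) {T : B} (y : Pull G p ι) (b : T ⟶ y.base) :
    ∃ (x : ι → p.Fiber (G.obj T)) (f : (⟨T, x⟩ : Pull G p ι) ⟶ y), f.base = b ∧
      ∀ i, p.IsStronglyCartesian (G.map b) (f.arr i) := by
  choose x φ hφ using fun i => exists_lift hp (G.map b) (y.pt i)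
  exact ⟨x, ⟨b, φ, fun i => (hφ i).toIsHomLift⟩, rfl, hφ⟩

theorem isFibered (hp : p.IsFibered) : (proj G p ι).IsFibered := by
  refine Functor.IsFibered.of_exists_isStronglyCartesian fun y T b => ?_
  obtain ⟨x, f, rfl, hf⟩ := exists_cart_lift hp y b
  exact ⟨_, f, cart_of_arr f hf⟩

theorem arr_cart (hp : p.IsFibered) {x y : Pull G p ι} {f : x ⟶ y}
    (h : (proj G p ι).IsStronglyCartesian f.base f) (i : ι) :
    p.IsStronglyCartesian (G.map f.base) (f.arr i) := by
  obtain ⟨z, c, hb, hc⟩ := exists_cart_lift hp y f.base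
  have hc' : (proj G p ι).IsStronglyCartesian f.base c := by
    rw [← hb]
    exact cart_of_arr c fun j => hb ▸ hc j
  obtain ⟨s, hs, hs'⟩ := exists_factor (Category.id_comp _) hc' h.toIsHomLift
  obtain ⟨t, ht, ht'⟩ := exists_factor (Category.id_comp _) h hc'.toIsHomLift
  have hsb : s.base = 𝟙 x.base := base_eq_of_isHomLift hs
  have htb : t.base = 𝟙 x.base := base_eq_of_isHomLift ht
  have hst : s ≫ t = 𝟙 x := cart_ext h (isHomLift_comp_id hs ht)
    (IsHomLift.id (p := proj G p ι) (a := x) rfl) (by rw [Category.assoc, ht', hs', Category.id_comp])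
  have hts : t ≫ s = 𝟙 _ := cart_ext hc' (isHomLift_comp_id ht hs)
    (IsHomLift.id (p := proj G p ι) (a := ⟨x.base, z⟩) rfl)
    (by rw [Category.assoc, hs', ht', Category.id_comp])
  let e : (x.pt i).1 ≅ (z i).1 := ⟨s.arr i, t.arr i, congrArg (fun k => Hom.arr k i) hst,
    congrArg (fun k => Hom.arr k i) hts⟩
  have he : p.IsHomLift (𝟙 (G.obj x.base)) e.hom := by
    have := s.lies i
    rw [hsb, G.map_id] at this
    exact this
  have h1 := Functor.IsStronglyCartesian.of_iso p (𝟙 (G.obj x.base)) e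
  have h2 := hc i
  have h3 : p.IsStronglyCartesian (𝟙 _ ≫ G.map f.base) (e.hom ≫ c.arr i) := inferInstance
  rw [Category.id_comp] at h3
  have h4 : e.hom ≫ c.arr i = f.arr i := congrArg (fun k => Hom.arr k i) hs'
  rwa [h4] at h3

end Pull

/-- A functor between sites which is a discrete fibration preserving covering sieves, such as
`Over.map f : Over U ⥤ Over V`; stacks pull back along it. -/
structure IsLocalizing (G : B ⥤ B') (K : GrothendieckTopology B)
    (K' : GrothendieckTopology B') : Prop where
  inj {S T : B} {f f' : S ⟶ T} : G.map f = G.map f' → f = f'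
  lift {T : B} {S : B'} (h : S ⟶ G.obj T) : ∃ (S' : B) (h' : S' ⟶ T), G.IsHomLift h h'
  full {S S' T : B} (f : S ⟶ T) (f' : S' ⟶ T) (k : G.obj S ⟶ G.obj S') :
    k ≫ G.map f' = G.map f → ∃ k' : S ⟶ S', k' ≫ f' = f ∧ G.map k' = k
  cover {T : B} {R : Sieve T} : R ∈ K T → R.functorPushforward G ∈ K' (G.obj T)

theorem IsLocalizing.id (K : GrothendieckTopology B) : IsLocalizing (𝟭 B) K K where
  inj h := h
  lift h := ⟨_, h, IsHomLift.map (𝟭 B) h⟩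
  full _ _ k h := ⟨k, h, rfl⟩
  cover h := by rwa [Sieve.functorPushforward_id]

/-- The functor `S/U ⥤ S/V` given by an arrow `U ⟶ V` satisfies the conditions used to take inverse
images of stacks: it is a discrete fibration, and it carries covering sieves to covering sieves. -/
theorem IsLocalizing.overMap {C : Type u} [Category.{v} C] (J : GrothendieckTopology C) {U V : C}
    (f : U ⟶ V) : IsLocalizing (Over.map f) (J.over U) (J.over V) where
  inj h := Over.OverMorphism.ext (congrArg (fun k => k.left) h)
  lift {T S} h := by
    obtain ⟨S, ⟨⟨⟩⟩, s⟩ := S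
    have e : s = (h.left ≫ T.hom) ≫ f := by
      rw [Category.assoc]
      exact (Over.w h).symm
    have ha : (Over.map f).obj (Over.mk (h.left ≫ T.hom)) = Over.mk s := by
      change Over.mk ((h.left ≫ T.hom) ≫ f) = _
      rw [← e]
    exact ⟨Over.mk (h.left ≫ T.hom), Over.homMk h.left rfl, IsHomLift.of_fac' _ _ _ ha rfl
      (Over.OverMorphism.ext (by simp))⟩
  full {S S' T} g g' k h := by
    have hk : k.left ≫ g'.left = g.left := congrArg (fun k => k.left) h
    refine ⟨Over.homMk k.left ?_, Over.OverMorphism.ext hk, Over.OverMorphism.ext rfl⟩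
    rw [← Over.w g', ← Over.w g, reassoc_of% hk]
  cover {T R} h := (GrothendieckTopology.over_map_coverPreserving J f).cover_preserve h

namespace IsLocalizing

variable {G : B ⥤ B'} {K : GrothendieckTopology B} {K' : GrothendieckTopology B'} {p : X ⥤ B'}
  (hG : IsLocalizing G K K')

include hG

theorem exists_mem {T : B} {R : Sieve T} {S : B'} {f : S ⟶ G.obj T}
    (h : R.functorPushforward G f) : ∃ (S' : B) (f' : S' ⟶ T), R f' ∧ G.IsHomLift f f' := by
  obtain ⟨Z, g, k, hg, rfl⟩ := h
  obtain ⟨S', k', hk⟩ := hG.lift k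
  exact ⟨S', k' ≫ g, R.downward_closed hg k', IsHomLift.comp G k (G.map g) k' g⟩

/-- A factorization of arrows above arrows of the image of `G` comes from a factorization in the
source of `G`, because arrows with values in the image lift uniquely. -/
theorem exists_lift_factor {S S' T : B} (f : S ⟶ T) (f' : S' ⟶ T) {z : X} {z' : X}
    {x : X} {φ : z ⟶ x} {φ' : z' ⟶ x} {ψ : z ⟶ z'} (h : ψ ≫ φ' = φ)
    (hφ : p.IsHomLift (G.map f) φ) (hφ' : p.IsHomLift (G.map f') φ') :
    ∃ k : S ⟶ S', k ≫ f' = f ∧ p.IsHomLift (G.map k) ψ := by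
  obtain ⟨l, hl⟩ := exists_base ψ (IsHomLift.domain_eq p (G.map f) φ)
    (IsHomLift.domain_eq p (G.map f') φ')
  subst h
  obtain ⟨k, hk, rfl⟩ := hG.full f f' l (base_comp_eq hl hφ' hφ)
  exact ⟨k, hk, hl⟩

end IsLocalizing

namespace IsStack

variable {K : GrothendieckTopology B} {p : X ⥤ B}

/-- Gluing of arrows of a stack, formulated in a fibre. -/
theorem glue_hom (hp : IsStack K p) {T : B} (x y : p.Fiber T) {R : Sieve T} (hR : R ∈ K T)
    (g : ∀ (z : X) (φ : z ⟶ x.1), (∃ (S : B) (f : S ⟶ T), R f ∧ p.IsHomLift f φ) → (z ⟶ y.1))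
    (hg : ∀ (z : X) (φ : z ⟶ x.1) (hφ) (S : B) (f : S ⟶ T), p.IsHomLift f φ →
      p.IsHomLift f (g z φ hφ))
    (hc : ∀ (z z' : X) (ψ : z' ⟶ z) (φ : z ⟶ x.1) (hφ) (hψ),
      g z' (ψ ≫ φ) hψ = ψ ≫ g z φ hφ) :
    ∃! γ : x ⟶ y, ∀ z φ hφ, φ ≫ γ.1 = g z φ hφ := by
  obtain ⟨x, rfl⟩ := x
  have hm : ∀ {z} (φ : z ⟶ x), R (p.map φ) → ∃ (S : B) (f : S ⟶ p.obj x), R f ∧ p.IsHomLift f φ :=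
    fun φ hφ => ⟨_, _, hφ, IsHomLift.map p φ⟩
  have hm' : ∀ {z} (φ : z ⟶ x), (∃ (S : B) (f : S ⟶ p.obj x), R f ∧ p.IsHomLift f φ) →
      R (p.map φ) := by
    rintro z φ ⟨S, f, hf, h⟩
    obtain rfl := IsHomLift.domain_eq p f φ
    rwa [← IsHomLift.eq_of_isHomLift p f φ]
  obtain ⟨γ, ⟨hγ, hγ'⟩, hu⟩ := hp.glue_arrows x y.1 y.2 R hR (fun z φ hφ => g z φ (hm φ hφ))
    (fun z φ hφ => hg z φ _ _ _ (IsHomLift.map p φ)) (fun z z' ψ φ hφ hψ => hc z z' ψ φ _ _)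
  refine ⟨⟨γ, hγ⟩, fun z φ hφ => hγ' z φ (hm' φ hφ), fun γ' hγ' => Subtype.ext ?_⟩
  exact hu γ'.1 ⟨γ'.2, fun z φ hφ => hγ' z φ _⟩

end IsStack

namespace Pull

variable {G : B ⥤ B'} {K : GrothendieckTopology B} {K' : GrothendieckTopology B'} {p : X ⥤ B'}
  {ι : Type}

section Arrows

variable {x y : Pull G p ι} {R : Sieve x.base}
  (g : ∀ (z : Pull G p ι) (φ : z ⟶ x), R φ.base → (z ⟶ y))

/-- The component at `i` of a compatible family of arrows, read off through a factorization of `φ`,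
does not depend on the factorization: two factorizations are compared on a common cartesian lift. -/
theorem glue_arrows_aux (hG : IsLocalizing G K K') (hp : p.IsFibered)
    (hc : ∀ (z z' : Pull G p ι) (ψ : z' ⟶ z) (φ : z ⟶ x) (hφ : R φ.base) (hψ : R (ψ ≫ φ).base),
      g z' (ψ ≫ φ) hψ = ψ ≫ g z φ hφ)
    {i : ι} {z : X} {φ : z ⟶ (x.pt i).1} {w w' : Pull G p ι} {f : w ⟶ x} {f' : w' ⟶ x}
    (hf : R f.base) (hf' : R f'.base)
    (hcart : ∀ j, p.IsStronglyCartesian (G.map f'.base) (f'.arr j))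
    {ζ : z ⟶ (w.pt i).1} {ζ' : z ⟶ (w'.pt i).1} (hζ : ζ ≫ f.arr i = φ) (hζ' : ζ' ≫ f'.arr i = φ) :
    ζ ≫ (g w f hf).arr i = ζ' ≫ (g w' f' hf').arr i := by
  obtain ⟨S, hS⟩ : ∃ S, p.obj z = S := ⟨_, rfl⟩
  obtain ⟨l, hl⟩ := exists_base ζ hS (w.pt i).2
  obtain ⟨T₀, k, hk⟩ := hG.lift l
  obtain rfl := IsHomLift.domain_eq G l k
  obtain rfl := IsHomLift.eq_of_isHomLift G l k
  have hφ : p.IsHomLift (G.map (k ≫ f.base)) φ :=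
    hζ ▸ isHomLift_comp_eq (G.map_comp _ _).symm hl (f.lies i)
  obtain ⟨k', hkk, hk'⟩ := hG.exists_lift_factor (k ≫ f.base) f'.base hζ' hφ (f'.lies i)
  -- `v` is the pullback of `w` along `k`; it maps to `w'` because `f'` is cartesian
  obtain ⟨v, c, rfl, hc'⟩ := exists_cart_lift hp w k
  choose d hd hd' using fun j => exists_factor (p := p) (g := G.map k')
    (f := G.map f'.base) rfl (hcart j)
    (ψ := c.arr j ≫ f.arr j) (by
      rw [← G.map_comp, hkk, G.map_comp]
      exact isHomLift_comp_eq rfl (c.lies j) (f.lies j))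
  let D : (⟨T₀, v⟩ : Pull G p ι) ⟶ w' := ⟨k', d, hd⟩
  have hD : c ≫ f = D ≫ f' := hom_ext hkk.symm fun j => (hd' j).symm
  have h1 : R (c ≫ f).base := R.downward_closed hf _
  have h2 : R (D ≫ f').base := R.downward_closed hf' _
  have h3 : c ≫ g w f hf = D ≫ g w' f' hf' := by
    rw [← hc w _ c f hf h1, ← hc w' _ D f' hf' h2]
    congr 1
  obtain ⟨ζ₀, hζ₀, rfl⟩ := exists_factor (Category.id_comp _) (hc' i) hl
  have h4 : ζ₀ ≫ d i = ζ' := by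
    refine cart_ext (hcart i) (isHomLift_id_comp hζ₀ (hd i)) hk' ?_
    rw [hζ', Category.assoc, hd', ← hζ, Category.assoc]
  rw [← h4, Category.assoc, Category.assoc]
  exact congrArg (fun k => ζ₀ ≫ Hom.arr k i) h3

/-- Arrows into an object over the same base glue. The components are glued separately in the stack
`p`: by `glue_arrows_aux` the given family induces a compatible family on each of them. -/
theorem glue_arrows_at (hG : IsLocalizing G K K') (hp : IsStack K' p)
    {y : Pull G p ι} (hxy : y.base = x.base) (hR : R ∈ K x.base)
    (g : ∀ (z : Pull G p ι) (φ : z ⟶ x), R φ.base → (z ⟶ y))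
    (hg : ∀ z φ hφ, (proj G p ι).IsHomLift φ.base (g z φ hφ))
    (hc : ∀ (z z' : Pull G p ι) (ψ : z' ⟶ z) (φ : z ⟶ x) (hφ : R φ.base) (hψ : R (ψ ≫ φ).base),
      g z' (ψ ≫ φ) hψ = ψ ≫ g z φ hφ) :
    ∃! γ : x ⟶ y, (proj G p ι).IsHomLift (𝟙 x.base) γ ∧ ∀ z φ hφ, φ ≫ γ = g z φ hφ := by
  obtain ⟨T, y⟩ := y
  obtain rfl : T = x.base := hxy
  have hgb : ∀ z φ hφ, (g z φ hφ).base = φ.base := fun z φ hφ => base_eq_of_isHomLift (hg z φ hφ)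
  have hex : ∀ i (z : X) (φ : z ⟶ (x.pt i).1),
      (∃ (S : B') (f : S ⟶ G.obj x.base), R.functorPushforward G f ∧ p.IsHomLift f φ) →
      ∃ (w : Pull G p ι) (f : w ⟶ x) (_ : R f.base) (ζ : z ⟶ (w.pt i).1),
        (∀ j, p.IsStronglyCartesian (G.map f.base) (f.arr j)) ∧ ζ ≫ f.arr i = φ ∧
          p.IsHomLift (𝟙 (G.obj w.base)) ζ := by
    rintro i z φ ⟨S, f, hf, hφ⟩
    obtain ⟨S', f', hf', hl⟩ := hG.exists_mem hf
    obtain rfl := IsHomLift.domain_eq G f f'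
    obtain rfl := IsHomLift.eq_of_isHomLift G f f'
    obtain ⟨w, c, rfl, hw⟩ := exists_cart_lift hp.fibered x f'
    obtain ⟨ζ, hζ, hζ'⟩ := exists_factor (Category.id_comp _) (hw i) hφ
    exact ⟨_, c, hf', ζ, hw, hζ', hζ⟩
  choose w f hf ζ hcart hζ hζ1 using hex
  have key : ∀ i, ∃! γ : x.pt i ⟶ y i, ∀ z φ hφ, φ ≫ γ.1 =
      ζ i z φ hφ ≫ (g (w i z φ hφ) (f i z φ hφ) (hf i z φ hφ)).arr i := by
    intro i
    refine hp.glue_hom (x.pt i) (y i) (hG.cover hR) _ (fun z φ hφ S b hb => ?_)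
      (fun z z' ψ φ hφ hψ => ?_)
    · refine isHomLift_transfer (f := G.map (f i z φ hφ).base) (φ := φ) ?_ hb ?_
      · have h1 := isHomLift_id_comp (hζ1 i z φ hφ) ((f i z φ hφ).lies i)
        rwa [hζ] at h1
      · refine isHomLift_id_comp (hζ1 i z φ hφ) ?_
        rw [← hgb _ _ (hf i z φ hφ)]
        exact (g _ _ (hf i z φ hφ)).lies i
    · rw [← Category.assoc]
      exact (glue_arrows_aux g hG hp.fibered hc (hf i z φ hφ) (hf i z' (ψ ≫ φ) hψ)
        (hcart i z' (ψ ≫ φ) hψ) (by rw [Category.assoc, hζ]) (hζ i z' (ψ ≫ φ) hψ)).symm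
  choose γ hγ hu using key
  let Γ : x ⟶ (⟨x.base, y⟩ : Pull G p ι) := ⟨𝟙 _, fun i => (γ i).1, fun i => by
    rw [G.map_id]
    exact (γ i).2⟩
  refine ⟨Γ, ⟨isHomLift_base Γ, fun z φ hφ => hom_ext ?_ fun i => ?_⟩, fun Γ' hΓ' => ?_⟩
  · exact (Category.comp_id _).trans (hgb z φ hφ).symm
  · have hm : ∃ (S : B') (f : S ⟶ G.obj x.base), R.functorPushforward G f ∧
        p.IsHomLift f (φ.arr i) :=
      ⟨_, _, Sieve.image_mem_functorPushforward G R hφ, φ.lies i⟩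
    refine (hγ i _ (φ.arr i) hm).trans ?_
    have := glue_arrows_aux g hG hp.fibered hc hφ (hf i _ (φ.arr i) hm) (hcart i _ (φ.arr i) hm)
      (ζ := 𝟙 _) (Category.id_comp _) (hζ i _ (φ.arr i) hm)
    rw [← this, Category.id_comp]
  · have hb : Γ'.base = 𝟙 _ := base_eq_of_isHomLift hΓ'.1
    have hl : ∀ i, p.IsHomLift (𝟙 (G.obj x.base)) (Γ'.arr i) := fun i => by
      have := Γ'.lies i
      rwa [hb, G.map_id] at this
    refine hom_ext hb fun i => congrArg Subtype.val (hu i ⟨Γ'.arr i, hl i⟩ fun z φ hφ => ?_)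
    refine (congrArg (· ≫ Γ'.arr i) (hζ i z φ hφ).symm).trans ?_
    rw [Category.assoc]
    exact congrArg (fun k => ζ i z φ hφ ≫ Hom.arr k i) (hΓ'.2 _ _ (hf i z φ hφ))

end Arrows

theorem lies_of {x y : Pull G p ι} {f : x ⟶ y} {S T : B} {b : S ⟶ T}
    (h : (proj G p ι).IsHomLift b f) (i : ι) : p.IsHomLift (G.map b) (f.arr i) := by
  cases h
  exact f.lies i

/-- Descent data in the inverse image glue: the components of the data are descent data for the
sieve generated by the image of `R`, and the glued objects are assembled into one of the inverse
image. -/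
theorem glue_objects_at (hG : IsLocalizing G K K') (hp : IsStack K' p) {U : B} {R : Sieve U}
    (hR : R ∈ K U) (D : R.arrows.category ⥤ Pull G p ι)
    (hD : ∀ {f f' : R.arrows.category} (h : f ⟶ f'),
      (proj G p ι).IsStronglyCartesian h.hom.left (D.map h)) :
    ∃ (x : Pull G p ι) (κ : ∀ f : R.arrows.category, D.obj f ⟶ x), x.base = U ∧
      (∀ f, (proj G p ι).IsStronglyCartesian f.obj.hom (κ f)) ∧
      (∀ {f f' : R.arrows.category} (h : f ⟶ f'), D.map h ≫ κ f' = κ f) := by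
  let R' := R.functorPushforward G
  have hbase : ∀ f, (D.obj f).base = f.obj.left := fun f =>
    have := hD (𝟙 f)
    IsHomLift.domain_eq (proj G p ι) (𝟙 f : f ⟶ f).hom.left (D.map (𝟙 f))
  have hDi : ∀ {f f' : R.arrows.category} (h : f ⟶ f') (i : ι),
      p.IsStronglyCartesian (G.map h.hom.left) ((D.map h).arr i) := fun h i =>
    isStronglyCartesian_of_isHomLift (arr_cart hp.fibered
      (isStronglyCartesian_of_isHomLift (hD h) (isHomLift_base _)) i) (lies_of (hD h).toIsHomLift i)
  -- the sieve `R'` generated by the image of `R` consists of arrows which lift uniquely to `R`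
  choose S₀ l hl hlift using fun f : R'.arrows.category => hG.exists_mem f.property
  have he : ∀ f, G.obj (S₀ f) = f.obj.left := fun f =>
    have := hlift f
    IsHomLift.domain_eq G f.obj.hom (l f)
  have hGl : ∀ f, G.map (l f) = eqToHom (he f) ≫ f.obj.hom := fun f => by
    have := hlift f
    exact (IsHomLift.fac' G f.obj.hom (l f)).trans (congrArg _ (Category.comp_id f.obj.hom))
  choose k hk hGk using fun {f f' : R'.arrows.category} (h : f ⟶ f') =>
    hG.full (l f) (l f') (eqToHom (he f) ≫ h.hom.left ≫ eqToHom (he f').symm) (by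
      rw [hGl, hGl, Category.assoc, Category.assoc, eqToHom_trans_assoc, eqToHom_refl,
        Category.id_comp, Over.w])
  let Lf : R'.arrows.category ⥤ R.arrows.category :=
    { obj f := ⟨Over.mk (l f), hl f⟩
      map h := ObjectProperty.homMk (Over.homMk (k h) (hk h))
      map_id f := by
        ext
        exact hG.inj (by simp [hGk])
      map_comp h h' := by
        ext
        exact hG.inj (by simp [hGk]) }
  let Di (i : ι) : R'.arrows.category ⥤ X :=
    { obj f := ((D.obj (Lf.obj f)).pt i).1
      map h := (D.map (Lf.map h)).arr i
      map_id f := by rw [Lf.map_id, D.map_id]; rfl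
      map_comp h h' := by rw [Lf.map_comp, D.map_comp]; rfl }
  choose x κ hx hκ hκc using fun i => hp.glue_objects (G.obj U) R' (hG.cover hR) (Di i)
    (fun {f f'} h => isStronglyCartesian_of_isHomLift (hDi (Lf.map h) i) (by
      have h1 := (hDi (Lf.map h) i).toIsHomLift
      change p.IsHomLift (G.map (k h)) _ at h1
      rwa [hGk, IsHomLift.lift_eqToHom_comp_iff, IsHomLift.lift_comp_eqToHom_iff] at h1))
  let im (f : R.arrows.category) : R'.arrows.category :=
    ⟨Over.mk (G.map f.obj.hom), Sieve.image_mem_functorPushforward G R f.property⟩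
  choose q hq hGq using fun f : R.arrows.category =>
    hG.full f.obj.hom (l (im f)) (eqToHom (he (im f)).symm) (by
      rw [hGl, eqToHom_trans_assoc, eqToHom_refl, Category.id_comp]
      rfl)
  let ev (f : R.arrows.category) : f ⟶ Lf.obj (im f) :=
    ObjectProperty.homMk (Over.homMk (q f) (hq f))
  have hev : ∀ f i, p.IsStronglyCartesian (𝟙 (G.obj f.obj.left)) ((D.map (ev f)).arr i) :=
    fun f i => isStronglyCartesian_of_isHomLift (hDi (ev f) i) (by
      have h1 := (hDi (ev f) i).toIsHomLift
      change p.IsHomLift (G.map (q f)) _ at h1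
      rwa [hGq, ← Category.id_comp (eqToHom _), IsHomLift.lift_comp_eqToHom_iff] at h1)
  have hcomp : ∀ f i, p.IsStronglyCartesian (G.map f.obj.hom)
      ((D.map (ev f)).arr i ≫ κ i (im f)) := fun f i => by
    exact isStronglyCartesian_comp (Category.id_comp _) (hev f i) (hκ i (im f))
  let Q : Pull G p ι := ⟨U, fun i => ⟨x i, hx i⟩⟩
  let c (f : R.arrows.category) : D.obj f ⟶ Q := ⟨eqToHom (hbase f) ≫ f.obj.hom,
    fun i => (D.map (ev f)).arr i ≫ κ i (im f), fun i => by
      rw [G.map_comp, eqToHom_map, IsHomLift.lift_eqToHom_comp_iff]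
      exact (hcomp f i).toIsHomLift⟩
  refine ⟨Q, c, rfl, fun f => ?_, fun {f f'} h => hom_ext ?_ fun i => ?_⟩
  · refine isStronglyCartesian_of_isHomLift (cart_of_arr (c f) fun i =>
      isStronglyCartesian_of_isHomLift (hcomp f i) ((c f).lies i)) ?_
    rw [← IsHomLift.lift_eqToHom_comp_iff (h := hbase f)]
    exact isHomLift_base (c f)
  · have h1 := (hD h).toIsHomLift
    have h2 : (D.map h).base = eqToHom (hbase f) ≫ h.hom.left ≫ eqToHom (hbase f').symm :=
      IsHomLift.fac' (proj G p ι) h.hom.left (D.map h)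
    change (D.map h).base ≫ eqToHom (hbase f') ≫ f'.obj.hom = eqToHom (hbase f) ≫ f.obj.hom
    rw [h2, Category.assoc, Category.assoc, eqToHom_trans_assoc, eqToHom_refl,
      Category.id_comp, Over.w]
  · let h' : im f ⟶ im f' := ObjectProperty.homMk (Over.homMk (G.map h.hom.left) (by
      change G.map _ ≫ G.map _ = G.map _
      rw [← G.map_comp, Over.w]))
    have h1 : h ≫ ev f' = ev f ≫ Lf.map h' := by
      ext
      refine hG.inj ?_
      change G.map (h.hom.left ≫ q f') = G.map (q f ≫ k h')
      rw [G.map_comp, G.map_comp, hGq, hGq, hGk, eqToHom_trans_assoc, eqToHom_refl,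
        Category.id_comp]
      rfl
    have h2 := congrArg (fun t => Hom.arr (D.map t) i) h1
    simp only [D.map_comp, comp_arr] at h2
    change (D.map h).arr i ≫ (D.map (ev f')).arr i ≫ κ i (im f') = _ ≫ κ i (im f)
    rw [reassoc_of% h2, ← hκc i h']

/-- Powers of a stack, pulled back along a localization of sites, are stacks. -/
theorem isStack (hG : IsLocalizing G K K') (hp : IsStack K' p) :
    IsStack K (proj G p ι) where
  fibered := isFibered hp.fibered
  glue_arrows _ _ hxy _ hR g hg hc := glue_arrows_at hG hp hxy hR g hg hc
  glue_objects _ _ hR D hD := glue_objects_at hG hp hR D hD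

end Pull

namespace Pow

variable {K : GrothendieckTopology B} {p : X ⥤ B} {n : ℕ}

variable (p n) in
/-- A power of `p`, as the pullback of the corresponding power along the identity. -/
def toPull : OverFunctor (Pow.proj p n) (Pull.proj (𝟭 B) p (Fin n)) where
  F :=
    { obj x := ⟨x.base, x.pt⟩
      map f := ⟨f.base, f.arr, f.lies⟩ }
  w := rfl

theorem toPull_isFibEquiv : IsFibEquiv (toPull p n) := by
  refine ⟨⟨fun f => ⟨⟨f.base, f.arr, f.lies⟩, rfl⟩⟩, ⟨fun {x y f g} h => ?_⟩, fun {T} x => ?_⟩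
  · exact Pow.Hom.ext (congrArg Pull.Hom.base h) (congrArg Pull.Hom.arr h)
  · obtain ⟨x, rfl⟩ := x
    exact ⟨⟨⟨x.base, x.pt⟩, rfl⟩, Iso.refl _, IsHomLift.id (a := x) rfl⟩

/-- Powers of a stack are stacks. -/
theorem isStack (hp : IsStack K p) (n : ℕ) : IsStack K (Pow.proj p n) :=
  toPull_isFibEquiv.isStack (Pull.isStack (ι := Fin n) (IsLocalizing.id K) hp)

theorem isHomLift_base {x y : Pow p n} (f : x ⟶ y) : (Pow.proj p n).IsHomLift f.base f :=
  IsHomLift.map (Pow.proj p n) f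

theorem cart_of_arr {x y : Pow p n} (f : x ⟶ y) (h : ∀ i, p.IsStronglyCartesian f.base (f.arr i)) :
    (Pow.proj p n).IsStronglyCartesian f.base f :=
  toPull_isFibEquiv.cart_of_map (Pull.cart_of_arr ((toPull p n).F.map f) h)

theorem arr_cart (hp : p.IsFibered) {x y : Pow p n} {f : x ⟶ y}
    (h : (Pow.proj p n).IsStronglyCartesian f.base f) (i : Fin n) :
    p.IsStronglyCartesian f.base (f.arr i) :=
  Pull.arr_cart hp (toPull_isFibEquiv.map_cart h) i

end Pow

end Pull

end PicardMatrix

namespace PicardMatrix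

/-! ### Sums of arrows in a Picard stack -/

section Sums

variable {B : Type*} [Category* B] {X : Type*} [Category* X] {p : X ⥤ B}

namespace Law

variable (P : Law p)

theorem map_comp_of {T T' T'' : B} {b : T ⟶ T'} {b' : T' ⟶ T''} {b'' : T ⟶ T''}
    {x y : p.Fiber T} {x' y' : p.Fiber T'} {x'' y'' : p.Fiber T''} {φ : x.1 ⟶ x'.1}
    {ψ : y.1 ⟶ y'.1} {φ' : x'.1 ⟶ x''.1} {ψ' : y'.1 ⟶ y''.1} (hφ : p.IsHomLift b φ)
    (hψ : p.IsHomLift b ψ) (hφ' : p.IsHomLift b' φ') (hψ' : p.IsHomLift b' ψ')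
    (h : p.IsHomLift b'' (φ ≫ φ')) (h' : p.IsHomLift b'' (ψ ≫ ψ')) :
    (P.map (b := b'') (x := x) (y := y) (x' := x'') (y' := y'') ⟨φ ≫ φ', h⟩ ⟨ψ ≫ ψ', h'⟩).1 =
      (P.map (x := x) (y := y) ⟨φ, hφ⟩ ⟨ψ, hψ⟩).1 ≫
      (P.map (x := x') (y := y') (x' := x'') (y' := y'') ⟨φ', hφ'⟩ ⟨ψ', hψ'⟩).1 := by
  obtain rfl := base_comp_eq hφ hφ' h
  exact congrArg Subtype.val (P.map_comp ⟨φ, hφ⟩ ⟨ψ, hψ⟩ ⟨φ', hφ'⟩ ⟨ψ', hψ'⟩)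

/-- The sum of two isomorphisms of a fibre. -/
@[simps] def sumIso {T : B} {x y x' y' : p.Fiber T} (i : x ≅ x') (j : y ≅ y') :
    P.add x y ≅ P.add x' y' where
  hom := P.sum i.hom j.hom
  inv := P.sum i.inv j.inv
  hom_inv_id := by rw [← P.sum_comp, i.hom_inv_id, j.hom_inv_id, P.sum_id]
  inv_hom_id := by rw [← P.sum_comp, i.inv_hom_id, j.inv_hom_id, P.sum_id]

/-- Composition with an arrow of a fibre on the left of a sum of arrows. -/
theorem sum_comp_map {T T' : B} {b : T ⟶ T'} {x y x' y' : p.Fiber T} {x'' y'' : p.Fiber T'}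
    (f : x ⟶ x') (g : y ⟶ y') (φ : FibHom p b x' x'') (ψ : FibHom p b y' y'')
    (h : p.IsHomLift b (f.1 ≫ φ.1)) (h' : p.IsHomLift b (g.1 ≫ ψ.1)) :
    (P.sum f g).1 ≫ (P.map φ ψ).1 =
      (P.map (x := x) (y := y) ⟨f.1 ≫ φ.1, h⟩ ⟨g.1 ≫ ψ.1, h'⟩).1 :=
  (P.map_comp_of f.2 g.2 φ.2 ψ.2 h h').symm

/-- Composition with an arrow of a fibre on the right of a sum of arrows. -/
theorem map_comp_sum {T T' : B} {b : T ⟶ T'} {x y : p.Fiber T} {x' y' x'' y'' : p.Fiber T'}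
    (φ : FibHom p b x x') (ψ : FibHom p b y y') (f : x' ⟶ x'') (g : y' ⟶ y'')
    (h : p.IsHomLift b (φ.1 ≫ f.1)) (h' : p.IsHomLift b (ψ.1 ≫ g.1)) :
    (P.map φ ψ).1 ≫ (P.sum f g).1 =
      (P.map (x' := x'') (y' := y'') ⟨φ.1 ≫ f.1, h⟩ ⟨ψ.1 ≫ g.1, h'⟩).1 :=
  (P.map_comp_of φ.2 ψ.2 f.2 g.2 h h').symm

/-- The sum of two commutative squares is a commutative square. -/
theorem sum_map_square {T T' : B} {b : T ⟶ T'} {x y z t : p.Fiber T} {x' y' z' t' : p.Fiber T'}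
    {f : x ⟶ z} {g : y ⟶ t} {f' : x' ⟶ z'} {g' : y' ⟶ t'} {φ : FibHom p b x x'}
    {ψ : FibHom p b y y'} {φ' : FibHom p b z z'} {ψ' : FibHom p b t t'}
    (h : f.1 ≫ φ'.1 = φ.1 ≫ f'.1) (h' : g.1 ≫ ψ'.1 = ψ.1 ≫ g'.1) :
    (P.sum f g).1 ≫ (P.map φ' ψ').1 = (P.map φ ψ).1 ≫ (P.sum f' g').1 := by
  rw [P.sum_comp_map f g φ' ψ' (isHomLift_id_comp f.2 φ'.2) (isHomLift_id_comp g.2 ψ'.2),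
    P.map_comp_sum φ ψ f' g' (isHomLift_comp_id φ.2 f'.2) (isHomLift_comp_id ψ.2 g'.2)]
  exact P.map_congr rfl h h'

end Law

namespace PicardStr

variable (P : PicardStr p)

theorem cart (P : PicardStr p) (hp : p.IsFibered) {S T : B} {f : S ⟶ T} {x y : X} {φ : x ⟶ y}
    (h : p.IsHomLift f φ) : p.IsStronglyCartesian f φ :=
  isStronglyCartesian_of_groupoid hp (fun f => P.groupoid f) h

/-- Translations are full on the arrows over any arrow of the base. -/
theorem exists_map_eq (hp : p.IsFibered) {T T' : B} {f : T ⟶ T'} {x y : p.Fiber T}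
    {x' y' : p.Fiber T'} (τ : FibHom p f x x') (θ : FibHom p f (P.add x y) (P.add x' y')) :
    ∃ ψ : FibHom p f y y', P.map τ ψ = θ := by
  obtain ⟨z, c, hc⟩ := exists_lift hp f y'
  obtain ⟨χ, hχ, e⟩ := exists_factor (Category.id_comp f)
    (P.cart hp (P.map τ ⟨c, hc.toIsHomLift⟩).2) θ.2
  have := P.translation_equiv x
  obtain ⟨ψ, hψ⟩ := (P.translation x).map_surjective (X := y) (Y := z) ⟨χ, hχ⟩
  have h1 : P.sum (𝟙 x) ψ = ⟨χ, hχ⟩ := hψ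
  have hl : p.IsHomLift f (ψ.1 ≫ c) := isHomLift_id_comp ψ.2 hc.toIsHomLift
  refine ⟨⟨ψ.1 ≫ c, hl⟩, Subtype.ext (Eq.trans ?_ e)⟩
  have h2 := P.sum_comp_map (𝟙 x) ψ τ ⟨c, hc.toIsHomLift⟩ (isHomLift_id_comp (𝟙 x :).2 τ.2) hl
  rw [h1] at h2
  rw [h2]
  exact P.map_congr rfl (Category.id_comp _).symm rfl

/-- A zero object `a ≅ a + a` is neutral. -/
theorem nonempty_add_iso {T : B} {a : p.Fiber T} (i : a ≅ P.add a a) (z : p.Fiber T) :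
    Nonempty (P.add a z ≅ z) := by
  have := P.translation_equiv a
  have e : (P.translation a).obj (P.add a z) ≅ (P.translation a).obj z :=
    (P.assoc a a z).symm ≪≫ P.sumIso i.symm (Iso.refl z)
  exact ⟨(P.translation a).preimageIso e⟩

/-- Two zero objects of a Picard stack are related by an arrow over every arrow of the base. -/
theorem nonempty_fibHom_zero (hp : p.IsFibered) {T T' : B} (f : T ⟶ T') {a : p.Fiber T}
    {a' : p.Fiber T'} (i : a ≅ P.add a a) (i' : a' ≅ P.add a' a') : Nonempty (FibHom p f a a') := by
  obtain ⟨z, c, hc⟩ := exists_lift hp f a'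
  have hl := hc.toIsHomLift
  let c' : FibHom p f z a' := ⟨c, hl⟩
  obtain ⟨χ, hχ, -⟩ := exists_factor (Category.id_comp f) (P.cart hp (P.map c' c').2)
    (isHomLift_comp_id hl i'.hom.2)
  have := P.groupoid (x := z) (y := P.add z z) ⟨χ, hχ⟩
  let j : z ≅ P.add z z := asIso (C := p.Fiber T) ⟨χ, hχ⟩
  obtain ⟨k⟩ := P.nonempty_add_iso i z
  obtain ⟨k'⟩ := P.nonempty_add_iso j a
  let e : a ≅ z := k'.symm ≪≫ P.comm z a ≪≫ k
  exact ⟨⟨e.hom.1 ≫ c, isHomLift_id_comp e.hom.2 hl⟩⟩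

end PicardStr

end Sums

/-! ### Additive families -/

section Fam

variable {B : Type u} [Category.{v} B] {X : Type w} [Category.{w'} X] {p : X ⥤ B}

/-- An additive family in the fibre over `T`, indexed by an abelian group `G`: an additive functor
from the discrete Picard category `G` to the fibre. The isomorphisms `pt (r + s) ≅ pt r + pt s` are
given together with a name `t` of `r + s`, so that no transport along equalities is needed. -/
structure FamAt (P : PicardStr p) (G : Type) [AddCommGroup G] (T : B) where
  pt : G → p.Fiber T
  σ {r s t : G} (h : t = r + s) : pt t ≅ P.add (pt r) (pt s)
  assoc {r s t u v w : G} (h₁ : u = r + s) (h₂ : w = u + t) (h₃ : v = s + t) (h₄ : w = r + v) :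
    (σ h₂).hom ≫ P.sum (σ h₁).hom (𝟙 _) ≫ (P.assoc _ _ _).hom =
      (σ h₄).hom ≫ P.sum (𝟙 _) (σ h₃).hom
  comm {r s t : G} (h : t = r + s) (h' : t = s + r) :
    (σ h).hom ≫ (P.comm _ _).hom = (σ h').hom

/-- An additive family in some fibre. -/
structure Fam (P : PicardStr p) (G : Type) [AddCommGroup G] where
  base : B
  fam : FamAt P G base

namespace Fam

variable {P : PicardStr p} {G : Type} [AddCommGroup G]

/-- An arrow of additive families: arrows over the same arrow of the base, compatible with sums. -/
@[ext]
structure Hom (x y : Fam P G) where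
  base : x.base ⟶ y.base
  arr (r : G) : (x.fam.pt r).1 ⟶ (y.fam.pt r).1
  lies (r : G) : p.IsHomLift base (arr r)
  compat {r s t : G} (h : t = r + s) : arr t ≫ (y.fam.σ h).hom.1 =
    (x.fam.σ h).hom.1 ≫ (P.map ⟨arr r, lies r⟩ ⟨arr s, lies s⟩).1

instance : Category (Fam P G) where
  Hom x y := Hom x y
  id x := ⟨𝟙 x.base, fun r => 𝟙 (x.fam.pt r).1, fun r => IsHomLift.id (x.fam.pt r).2, fun h => by
    rw [Category.id_comp]
    exact ((congrArg _ (congrArg Subtype.val (P.map_id _ _))).trans (Category.comp_id _)).symm⟩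
  comp {x y z} f g := ⟨f.base ≫ g.base, fun r => f.arr r ≫ g.arr r,
    fun r => isHomLift_comp_eq rfl (f.lies r) (g.lies r), fun {r s t} h => by
      rw [Category.assoc, g.compat h, reassoc_of% f.compat h,
        ← P.map_comp_of (f.lies r) (f.lies s) (g.lies r) (g.lies s)]⟩

theorem hom_ext {x y : Fam P G} {f g : x ⟶ y} (h : ∀ r, f.arr r = g.arr r) : f = g := by
  refine Hom.ext (AddStr.lift_unique (f.lies 0) ?_) (funext h)
  rw [h]
  exact g.lies 0

end Fam

end Fam

end PicardMatrix

namespace PicardMatrix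

section

/-- A nonempty commutative semigroup in which `a + c = b` has a solution `c` is a group. -/
theorem exists_addCommGroup {E : Type*} [Nonempty E] (add : E → E → E)
    (assoc : ∀ a b c, add (add a b) c = add a (add b c)) (comm : ∀ a b, add a b = add b a)
    (div : ∀ a b, ∃ c, add a c = b) : ∃ S : AddCommGroup E, ∀ a b, S.add a b = add a b := by
  obtain ⟨a₀⟩ := ‹Nonempty E›
  obtain ⟨z, hz⟩ := div a₀ a₀
  have hz' : ∀ b, add z b = b := fun b => by
    obtain ⟨c, rfl⟩ := div a₀ b
    rw [← assoc, comm z, hz]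
  choose n hn using fun b => div b z
  let _ : Add E := ⟨add⟩
  let _ : Zero E := ⟨z⟩
  let _ : Neg E := ⟨n⟩
  let _ : AddGroup E := AddGroup.ofLeftAxioms assoc hz' fun b => (comm _ _).trans (hn b)
  exact ⟨{ add_comm := comm }, fun _ _ => rfl⟩

theorem addMonoidHom_ext_basis {ι G E : Type*} [AddCommGroup G] [AddCommGroup E] [h : Module ℤ G]
    (b : Module.Basis ι ℤ G) {f g : G →+ E} (hfg : ∀ j, f (b j) = g (b j)) : f = g := by
  obtain rfl : h = AddCommGroup.toIntModule G := Subsingleton.elim _ _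
  exact AddMonoidHom.toIntLinearMap_injective (b.ext hfg)

end

section FamHom

/-- A prism whose other faces commute has a commutative last face. -/
theorem addArr_assoc_aux {V : Type*} [Category* V] {a b c d e a' b' c' d' e' : V}
    {f : a ⟶ b} {g : b ⟶ c} {h : c ⟶ d} {i : a ⟶ e} {j : e ⟶ d}
    {f' : a' ⟶ b'} {g' : b' ⟶ c'} {h' : c' ⟶ d'} {i' : a' ⟶ e'} {j' : e' ⟶ d'}
    {α : a ⟶ a'} {β : b ⟶ b'} {γ : c ⟶ c'} {δ : d ⟶ d'} {η : e ⟶ e'}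
    (h₁ : α ≫ f' = f ≫ β) (h₂ : β ≫ g' = g ≫ γ) (h₃ : γ ≫ h' = h ≫ δ) (h₄ : η ≫ j' = j ≫ δ)
    (k : f ≫ g ≫ h = i ≫ j) (k' : f' ≫ g' ≫ h' = i' ≫ j') (I : e' ≅ d') (hI : I.hom = j') :
    α ≫ i' = i ≫ η := by
  subst hI
  rw [← cancel_mono I.hom, Category.assoc, ← k', reassoc_of% h₁, reassoc_of% h₂, h₃,
    Category.assoc, h₄, reassoc_of% k]

variable {B : Type u} [Category.{v} B] {X : Type w} [Category.{w'} X] {p : X ⥤ B}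
  {P : PicardStr p} {G : Type} [AddCommGroup G]

namespace FamAt

section Arrows

variable {T T' : B} (x : FamAt P G T) (y : FamAt P G T') (f : T ⟶ T')

/-- The sum of two arrows between the values of two families, as an arrow between values. -/
def addArr {r s t : G} (h : t = r + s) (φ : FibHom p f (x.pt r) (y.pt r))
    (ψ : FibHom p f (x.pt s) (y.pt s)) : FibHom p f (x.pt t) (y.pt t) :=
  ⟨(x.σ h).hom.1 ≫ (P.map φ ψ).1 ≫ (y.σ h).inv.1,
    isHomLift_id_comp (x.σ h).hom.2 (isHomLift_comp_id (P.map φ ψ).2 (y.σ h).inv.2)⟩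

variable {x y f}

theorem addArr_eq_iff {r s t : G} (h : t = r + s) (φ : FibHom p f (x.pt r) (y.pt r))
    (ψ : FibHom p f (x.pt s) (y.pt s)) (θ : FibHom p f (x.pt t) (y.pt t)) :
    addArr x y f h φ ψ = θ ↔ θ.1 ≫ (y.σ h).hom.1 = (x.σ h).hom.1 ≫ (P.map φ ψ).1 := by
  constructor
  · rintro rfl
    simp [addArr]
  · intro k
    refine Subtype.ext ?_
    change (x.σ h).hom.1 ≫ (P.map φ ψ).1 ≫ (y.σ h).inv.1 = _
    rw [← Category.assoc, ← k]
    simp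

theorem addArr_spec {r s t : G} (h : t = r + s) (φ : FibHom p f (x.pt r) (y.pt r))
    (ψ : FibHom p f (x.pt s) (y.pt s)) :
    (addArr x y f h φ ψ).1 ≫ (y.σ h).hom.1 = (x.σ h).hom.1 ≫ (P.map φ ψ).1 :=
  (addArr_eq_iff h φ ψ _).1 rfl

theorem addArr_comm {r s t : G} (h : t = r + s) (h' : t = s + r)
    (φ : FibHom p f (x.pt r) (y.pt r)) (ψ : FibHom p f (x.pt s) (y.pt s)) :
    addArr x y f h φ ψ = addArr x y f h' ψ φ := by
  symm
  rw [addArr_eq_iff]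
  have h1 := congrArg Subtype.val (x.comm h h')
  have h2 := congrArg Subtype.val (y.comm h h')
  rw [← h2, ← h1]
  change _ ≫ (y.σ h).hom.1 ≫ (P.comm _ _).hom.1 = ((x.σ h).hom.1 ≫ (P.comm _ _).hom.1) ≫ _
  rw [← Category.assoc, addArr_spec, Category.assoc, Category.assoc, P.comm_nat]

theorem addArr_assoc {r s t u v w : G} (h₁ : u = r + s) (h₂ : w = u + t) (h₃ : v = s + t)
    (h₄ : w = r + v) (φ : FibHom p f (x.pt r) (y.pt r)) (ψ : FibHom p f (x.pt s) (y.pt s))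
    (χ : FibHom p f (x.pt t) (y.pt t)) :
    addArr x y f h₂ (addArr x y f h₁ φ ψ) χ = addArr x y f h₄ φ (addArr x y f h₃ ψ χ) := by
  symm
  rw [addArr_eq_iff]
  have k₁ := addArr_spec h₁ φ ψ
  have k₂ := addArr_spec h₂ (addArr x y f h₁ φ ψ) χ
  have k₃ := addArr_spec h₃ ψ χ
  have k₁' := P.sum_map_square (f := (x.σ h₁).hom) (f' := (y.σ h₁).hom) (g := 𝟙 (x.pt t))
    (g' := 𝟙 (y.pt t)) k₁.symm ((Category.id_comp χ.1).trans (Category.comp_id χ.1).symm)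
  have k₃' := P.sum_map_square (f := 𝟙 (x.pt r)) (f' := 𝟙 (y.pt r)) (g := (x.σ h₃).hom)
    (g' := (y.σ h₃).hom) ((Category.id_comp φ.1).trans (Category.comp_id φ.1).symm) k₃.symm
  exact addArr_assoc_aux k₂ k₁'.symm (P.assoc_nat φ ψ χ) k₃'.symm
    (congrArg Subtype.val (x.assoc h₁ h₂ h₃ h₄)) (congrArg Subtype.val (y.assoc h₁ h₂ h₃ h₄))
    (fiberIsoVal (P.sumIso (Iso.refl (y.pt r)) (y.σ h₃))) rfl

/-- An arrow at `t = r + s` is the sum of the given arrow at `r` and an arrow at `s`: translations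
are full, and arrows factor through cartesian lifts. -/
theorem exists_addArr (hp : p.IsFibered) {r s t : G} (h : t = r + s)
    (φ : FibHom p f (x.pt r) (y.pt r)) (θ : FibHom p f (x.pt t) (y.pt t)) :
    ∃ ψ, addArr x y f h φ ψ = θ := by
  obtain ⟨ψ, hψ⟩ := P.exists_map_eq hp φ (y := x.pt s) (y' := y.pt s)
    ⟨(x.σ h).inv.1 ≫ θ.1 ≫ (y.σ h).hom.1,
      isHomLift_id_comp (x.σ h).inv.2 (isHomLift_comp_id θ.2 (y.σ h).hom.2)⟩
  refine ⟨ψ, (addArr_eq_iff h φ ψ θ).2 ?_⟩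
  rw [hψ]
  exact (fiber_hom_inv_assoc _ _).symm

/-- Independence of the name `t` of the sum `r + s`. -/
theorem sigma_addArr {r s t t' : G} (h : t = r + s) (h' : t' = r + s)
    (φ : FibHom p f (x.pt r) (y.pt r)) (ψ : FibHom p f (x.pt s) (y.pt s)) :
    (⟨t, addArr x y f h φ ψ⟩ : Σ r, FibHom p f (x.pt r) (y.pt r)) =
      ⟨t', addArr x y f h' φ ψ⟩ := by
  subst h h'
  rfl

variable (x y f) in
/-- The arrows over `f` between corresponding values of two additive families form an abelian
group, which is an extension of the indexing group. -/
theorem exists_group_arrows (hp : p.IsFibered) :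
    ∃ S : AddCommGroup (Σ r, FibHom p f (x.pt r) (y.pt r)),
      ∀ {r s t : G} (h : t = r + s) (φ : FibHom p f (x.pt r) (y.pt r))
        (ψ : FibHom p f (x.pt s) (y.pt s)), S.add ⟨r, φ⟩ ⟨s, ψ⟩ = ⟨t, addArr x y f h φ ψ⟩ := by
  obtain ⟨φ₀⟩ := P.nonempty_fibHom_zero hp f (x.σ (add_zero (0 : G)).symm)
    (y.σ (add_zero (0 : G)).symm)
  have : Nonempty (Σ r, FibHom p f (x.pt r) (y.pt r)) := ⟨⟨0, φ₀⟩⟩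
  obtain ⟨S, hS⟩ := exists_addCommGroup (E := Σ r, FibHom p f (x.pt r) (y.pt r))
    (fun a b => ⟨a.1 + b.1, addArr x y f rfl a.2 b.2⟩)
    (fun a b c => by
      refine (sigma_addArr _ rfl _ _).trans ?_
      rw [addArr_assoc (h₁ := rfl) (h₃ := rfl) (h₄ := add_assoc _ _ _)]
      exact sigma_addArr _ _ _ _)
    (fun a b => by
      rw [addArr_comm rfl (add_comm _ _)]
      exact sigma_addArr _ _ _ _)
    (fun a b => by
      obtain ⟨ψ, hψ⟩ := exists_addArr hp (s := b.1 - a.1) (add_sub_cancel _ _).symm a.2 b.2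
      refine ⟨⟨b.1 - a.1, ψ⟩, ?_⟩
      rw [sigma_addArr rfl (add_sub_cancel a.1 b.1).symm, hψ])
  exact ⟨S, fun h φ ψ => (hS _ _).trans (sigma_addArr _ _ _ _)⟩

end Arrows

end FamAt

namespace Fam

variable {ι : Type*} [Module ℤ G] (b : Module.Basis ι ℤ G) {x y : Fam P G}

/-- An arrow of additive families over `f` is a section of the group of arrows over `f`. -/
theorem exists_hom (hp : p.IsFibered) (f : x.base ⟶ y.base)
    (φ : ∀ j, FibHom p f (x.fam.pt (b j)) (y.fam.pt (b j))) :
    ∃ h : x ⟶ y, h.base = f ∧ ∀ j, h.arr (b j) = (φ j).1 := by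
  obtain ⟨S, hS⟩ := FamAt.exists_group_arrows x.fam y.fam f hp
  let L := b.constr ℕ (M' := Σ r, FibHom p f (x.fam.pt r) (y.fam.pt r)) fun j => ⟨b j, φ j⟩
  let π : (Σ r, FibHom p f (x.fam.pt r) (y.fam.pt r)) →+ G := AddMonoidHom.mk' Sigma.fst
    fun a b => congrArg Sigma.fst (hS rfl a.2 b.2)
  have hL : ∀ r, (L r).1 = r := fun r => by
    have h1 : (π.comp L.toAddMonoidHom) = AddMonoidHom.id G := by
      refine addMonoidHom_ext_basis b fun j => ?_
      exact congrArg Sigma.fst (b.constr_basis ℕ _ j)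
    exact DFunLike.congr_fun h1 r
  have hL' : ∀ r, ∃ τ, L r = ⟨r, τ⟩ := fun r => by
    obtain ⟨s, τ, hs⟩ : ∃ s τ, L r = ⟨s, τ⟩ := ⟨_, _, rfl⟩
    obtain rfl : s = r := by rw [← hL r, hs]
    exact ⟨τ, hs⟩
  choose τ hτ using hL'
  refine ⟨⟨f, fun r => (τ r).1, fun r => (τ r).2, fun {r s t} h => ?_⟩, rfl, fun j => ?_⟩
  · have h1 : L t = L r + L s := by rw [h, map_add]
    rw [hτ, hτ, hτ] at h1
    have h2 := eq_of_heq (Sigma.mk.inj (h1.trans (hS h _ _))).2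
    exact (FamAt.addArr_eq_iff h _ _ _).1 h2.symm
  · have h1 : L (b j) = ⟨b j, φ j⟩ := b.constr_basis ℕ _ j
    rw [hτ] at h1
    exact congrArg Subtype.val (eq_of_heq (Sigma.mk.inj h1).2)

/-- A morphism of additive families is determined by its values at a basis. -/
theorem hom_ext_basis (hp : p.IsFibered) {h h' : x ⟶ y} (hb : h.base = h'.base)
    (hh : ∀ j, h.arr (b j) = h'.arr (b j)) : h = h' := by
  obtain ⟨f, a, l, c⟩ := h
  obtain ⟨f', a', l', c'⟩ := h'
  obtain rfl : f = f' := hb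
  obtain ⟨S, hS⟩ := FamAt.exists_group_arrows x.fam y.fam f hp
  let E := Σ r, FibHom p f (x.fam.pt r) (y.fam.pt r)
  let L : G →+ E := AddMonoidHom.mk' (fun r => (⟨r, a r, l r⟩ : E)) fun r s =>
    ((hS rfl _ _).trans (congrArg (Sigma.mk _) ((FamAt.addArr_eq_iff rfl _ _ _).2 (c rfl)))).symm
  let L' : G →+ E := AddMonoidHom.mk' (fun r => (⟨r, a' r, l' r⟩ : E)) fun r s =>
    ((hS rfl _ _).trans (congrArg (Sigma.mk _) ((FamAt.addArr_eq_iff rfl _ _ _).2 (c' rfl)))).symm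
  have key : L = L' := addMonoidHom_ext_basis b fun j =>
    congrArg (Sigma.mk (b j)) (Subtype.ext (hh j))
  refine hom_ext fun r => ?_
  exact congrArg Subtype.val (eq_of_heq (Sigma.mk.inj (DFunLike.congr_fun key r)).2)

end Fam

end FamHom

end PicardMatrix

namespace PicardMatrix

/-! ### Additive families in symmetric monoidal categories -/

section AddFam

open MonoidalCategory

/-- The interchange of the middle factors is compatible with the symmetry. -/
theorem tensorμ_braiding {V : Type*} [Category* V] [MonoidalCategory V] [SymmetricCategory V]
    (X₁ X₂ Y₁ Y₂ : V) : tensorμ X₁ X₂ Y₁ Y₂ ≫ (β_ (X₁ ⊗ Y₁) (X₂ ⊗ Y₂)).hom =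
      ((β_ X₁ X₂).hom ⊗ₘ (β_ Y₁ Y₂).hom) ≫ tensorμ X₂ X₁ Y₂ Y₁ := by
  dsimp only [tensorμ]
  simp only [BraidedCategory.braiding_tensor_left_hom, BraidedCategory.braiding_tensor_right_hom]
  calc
    _ = 𝟙 _ ⊗≫ X₁ ◁ ((β_ X₂ Y₁).hom ≫ (β_ Y₁ X₂).hom) ▷ Y₂ ⊗≫
        ((β_ X₁ X₂).hom ▷ (Y₁ ⊗ Y₂) ≫ (X₂ ⊗ X₁) ◁ (β_ Y₁ Y₂).hom) ⊗≫
        X₂ ◁ (β_ X₁ Y₂).hom ▷ Y₁ ⊗≫ 𝟙 _ := by monoidal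
    _ = _ := by
      rw [SymmetricCategory.symmetry, MonoidalCategory.tensorHom_def]
      monoidal

/-- Recursion over `ℤ` in both directions, for a relation which is total on both sides. -/
theorem exists_int_section {S : ℤ → Sort*} (R : ∀ n, S n → S (n + 1) → Prop)
    (h : ∀ n s, ∃ s', R n s s') (h' : ∀ n s', ∃ s, R n s s') (s₀ : S 0) :
    ∃ s : ∀ n, S n, s 0 = s₀ ∧ ∀ n, R n (s n) (s (n + 1)) := by
  choose f hf using h
  choose g hg using h'
  let a : ∀ n : ℕ, S (Int.ofNat n) := fun n => Nat.rec s₀ (fun n s => f n s) n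
  let b : ∀ n : ℕ, S (Int.negSucc n) := fun n => Nat.rec (g (Int.negSucc 0) s₀) (fun n s => g (Int.negSucc (n + 1)) s) n
  refine ⟨fun n => match n with
    | .ofNat n => a n
    | .negSucc n => b n, rfl, fun n => ?_⟩
  match n with
  | .ofNat n => exact hf _ _
  | .negSucc 0 => exact hg (Int.negSucc 0) _
  | .negSucc (n + 1) => exact hg (Int.negSucc (n + 1)) _

variable {V : Type*} [Category* V] [MonoidalCategory V]

/-- The iterates of an invertible object: a sequence indexed by `ℤ`, starting from the unit, in
which every term is the product of the preceding one and `X`. -/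
theorem exists_sequence (X : V) [(tensorRight X).IsEquivalence] : ∃ (x : ℤ → V)
    (_ : ∀ {m m' : ℤ}, m' = m + 1 → (x m' ≅ x m ⊗ X)), x 0 = 𝟙_ V := by
  obtain ⟨x, hx, h⟩ := exists_int_section (S := fun _ => V) (fun _ Y Z => Nonempty (Z ≅ Y ⊗ X))
    (fun _ Y => ⟨Y ⊗ X, ⟨Iso.refl _⟩⟩)
    (fun _ Z => ⟨(tensorRight X).objPreimage Z, ⟨((tensorRight X).objObjPreimageIso Z).symm⟩⟩) (𝟙_ V)
  exact ⟨x, fun {m m'} e => eqToIso (congrArg x e) ≪≫ (h m).some, hx⟩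

section Sequence

variable {X : V} [(tensorRight X).IsEquivalence] {x : ℤ → V}
  (t : ∀ {m m' : ℤ}, m' = m + 1 → (x m' ≅ x m ⊗ X))

/-- The isomorphisms `x (m + n) ≅ x m ⊗ x n` for the powers `x` of `X`, obtained by recursion on `n`
from the unit and the condition that they be compatible with adding `X` on the right. -/
theorem exists_sequence_iso (i : x 0 ≅ 𝟙_ V) (m : ℤ) :
    ∃ σ : ∀ n k : ℤ, k = m + n → (x k ≅ x m ⊗ x n),
      (∀ h : m = m + 0, (σ 0 m h).hom = (ρ_ (x m)).inv ≫ x m ◁ i.inv) ∧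
      ∀ {n n' k k' : ℤ} (h : k = m + n) (h' : k' = m + n') (hn : n' = n + 1) (hk : k' = k + 1),
        (t hk).hom ≫ (σ n k h).hom ▷ X ≫ (α_ (x m) (x n) X).hom =
          (σ n' k' h').hom ≫ x m ◁ (t hn).hom := by
  obtain ⟨σ, h₀, h⟩ := exists_int_section (S := fun n => ∀ k : ℤ, k = m + n → (x k ≅ x m ⊗ x n))
    (fun n σ σ' => ∀ {k k' : ℤ} (h : k = m + n) (h' : k' = m + (n + 1)) (hk : k' = k + 1),
        (t hk).hom ≫ (σ k h).hom ▷ X ≫ (α_ (x m) (x n) X).hom =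
          (σ' k' h').hom ≫ x m ◁ (t rfl).hom)
    (fun n σ => ⟨fun k' h' => t (sub_add_cancel k' 1).symm ≪≫
      whiskerRightIso (σ (k' - 1) (by omega)) X ≪≫ α_ (x m) (x n) X ≪≫
      whiskerLeftIso (x m) (t rfl).symm, fun {k k'} h h' hk => by
        obtain rfl : k = k' - 1 := by omega
        simp⟩)
    (fun n σ' => ⟨fun k h => (tensorRight X).preimageIso ((t rfl).symm ≪≫
      σ' (k + 1) (by omega) ≪≫ whiskerLeftIso (x m) (t rfl) ≪≫ (α_ (x m) (x n) X).symm),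
      fun {k k'} h h' hk => by
        subst hk
        have e : ∀ {Y Z : V} (E : Y ⊗ X ≅ Z ⊗ X), ((tensorRight X).preimageIso E).hom ▷ X = E.hom :=
          fun E => (tensorRight X).map_preimage E.hom
        rw [e]
        simp⟩)
    (fun k h => eqToIso (congrArg x (h.trans (add_zero m))) ≪≫ (ρ_ (x m)).symm ≪≫
      whiskerLeftIso (x m) i.symm)
  refine ⟨σ, fun h => ?_, fun {n n' k k'} e e' hn hk => ?_⟩
  · rw [h₀]
    simp
  · subst hn
    exact h n e e' hk

variable {t} {σ : ∀ m n k : ℤ, k = m + n → (x k ≅ x m ⊗ x n)}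
  (hσ : ∀ {m n n' k k' : ℤ} (h : k = m + n) (h' : k' = m + n') (hn : n' = n + 1) (hk : k' = k + 1),
    (t hk).hom ≫ (σ m n k h).hom ▷ X ≫ (α_ (x m) (x n) X).hom =
      (σ m n' k' h').hom ≫ x m ◁ (t hn).hom)
  (i : x 0 ≅ 𝟙_ V)
  (h₀ : ∀ (m : ℤ) (h : m = m + 0), (σ m 0 m h).hom = (ρ_ (x m)).inv ≫ x m ◁ i.inv)

include hσ

/-- The associativity condition at `n` and at `n + 1` are equivalent, which is what makes the
induction on `n` run in both directions. -/
theorem sequence_assoc_succ_iff {r s n n' u v v' w w' : ℤ} (h₁ : u = r + s) (h₂ : w = u + n)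
    (h₂' : w' = u + n') (h₃ : v = s + n) (h₃' : v' = s + n') (h₄ : w = r + v) (h₄' : w' = r + v')
    (hn : n' = n + 1) :
    ((σ u n' w' h₂').hom ≫ (σ r s u h₁).hom ▷ x n' ≫ (α_ (x r) (x s) (x n')).hom =
      (σ r v' w' h₄').hom ≫ x r ◁ (σ s n' v' h₃').hom) ↔
    ((σ u n w h₂).hom ≫ (σ r s u h₁).hom ▷ x n ≫ (α_ (x r) (x s) (x n)).hom =
      (σ r v w h₄).hom ≫ x r ◁ (σ s n v h₃).hom) := by
  have hw : w' = w + 1 := by omega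
  have hv : v' = v + 1 := by omega
  have l : ((σ u n' w' h₂').hom ≫ (σ r s u h₁).hom ▷ x n' ≫ (α_ (x r) (x s) (x n')).hom) ≫
      x r ◁ x s ◁ (t hn).hom = (t hw).hom ≫ ((σ u n w h₂).hom ≫ (σ r s u h₁).hom ▷ x n ≫
        (α_ (x r) (x s) (x n)).hom) ▷ X ≫ (α_ (x r) (x s ⊗ x n) X).hom ≫
          x r ◁ (α_ (x s) (x n) X).hom := by
    have e := hσ h₂ h₂' hn hw
    simp only [MonoidalCategory.comp_whiskerRight, Category.assoc, MonoidalCategory.pentagon]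
    rw [← MonoidalCategory.associator_naturality_right, ← MonoidalCategory.whisker_exchange_assoc, ← reassoc_of% e,
      MonoidalCategory.associator_naturality_left_assoc]
  have r' : ((σ r v' w' h₄').hom ≫ x r ◁ (σ s n' v' h₃').hom) ≫ x r ◁ x s ◁ (t hn).hom =
      (t hw).hom ≫ ((σ r v w h₄).hom ≫ x r ◁ (σ s n v h₃).hom) ▷ X ≫
        (α_ (x r) (x s ⊗ x n) X).hom ≫ x r ◁ (α_ (x s) (x n) X).hom := by
    have e := hσ h₄ h₄' hv hw
    rw [Category.assoc, ← MonoidalCategory.whiskerLeft_comp, ← hσ h₃ h₃' hn hv]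
    simp only [MonoidalCategory.comp_whiskerRight, MonoidalCategory.whiskerLeft_comp,
      Category.assoc]
    rw [← reassoc_of% e, MonoidalCategory.associator_naturality_middle_assoc]
  rw [← cancel_mono (x r ◁ x s ◁ (t hn).hom), l, r', cancel_epi, cancel_mono]
  exact (tensorRight X).map_injective_iff _ _

include h₀

theorem sequence_assoc {r s n u v w : ℤ} (h₁ : u = r + s) (h₂ : w = u + n) (h₃ : v = s + n)
    (h₄ : w = r + v) : (σ u n w h₂).hom ≫ (σ r s u h₁).hom ▷ x n ≫ (α_ (x r) (x s) (x n)).hom =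
      (σ r v w h₄).hom ≫ x r ◁ (σ s n v h₃).hom := by
  induction n using Int.induction_on generalizing v w with
  | zero =>
    obtain rfl : w = u := by omega
    obtain rfl : v = s := by omega
    rw [h₀, h₀]
    simp only [MonoidalCategory.whiskerLeft_comp, Category.assoc]
    rw [MonoidalCategory.whisker_exchange_assoc, MonoidalCategory.associator_naturality_right]
    simp
  | succ n ih => exact (sequence_assoc_succ_iff hσ h₁ (w := w - 1) (v := v - 1) (by omega) h₂
      (by omega) h₃ (by omega) h₄ rfl).2 (ih _ _ _)
  | pred n ih => exact (sequence_assoc_succ_iff hσ h₁ (w' := w + 1) (v' := v + 1) (n' := -n) h₂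
      (by omega) h₃ (by omega) h₄ (by omega) (by omega)).1 (ih _ _ _)

end Sequence

variable [SymmetricCategory V] {G : Type} [AddCommGroup G]

variable (V G) in
/-- An additive family of objects indexed by `G`. -/
structure AddFam where
  pt : G → V
  σ {r s t : G} (h : t = r + s) : pt t ≅ pt r ⊗ pt s
  assoc {r s t u v w : G} (h₁ : u = r + s) (h₂ : w = u + t) (h₃ : v = s + t) (h₄ : w = r + v) :
    (σ h₂).hom ≫ (σ h₁).hom ▷ pt t ≫ (α_ (pt r) (pt s) (pt t)).hom = (σ h₄).hom ≫ pt r ◁ (σ h₃).hom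
  comm {r s t : G} (h : t = r + s) (h' : t = s + r) :
    (σ h).hom ≫ (β_ _ _).hom = (σ h').hom

namespace AddFam

/-- The zero family. -/
def zero : AddFam V G where
  pt _ := 𝟙_ V
  σ _ := (λ_ (𝟙_ V)).symm
  assoc _ _ _ _ := by
    dsimp
    monoidal
  comm _ _ := by
    dsimp
    rw [braiding_tensorUnit_left]
    monoidal

/-- The family obtained from a change of the indexing group. -/
def comap {H : Type} [AddCommGroup H] (x : AddFam V H) (f : G →+ H) : AddFam V G where
  pt r := x.pt (f r)
  σ h := x.σ (h ▸ map_add f _ _)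
  assoc _ _ _ _ := x.assoc _ _ _ _
  comm _ _ := x.comm _ _

/-- The sum of two families. -/
def sum (x y : AddFam V G) : AddFam V G where
  pt r := x.pt r ⊗ y.pt r
  σ h := (x.σ h ⊗ᵢ y.σ h) ≪≫
    ⟨tensorμ _ _ _ _, tensorδ _ _ _ _, tensorμ_tensorδ _ _ _ _, tensorδ_tensorμ _ _ _ _⟩
  assoc {r s t u v w} h₁ h₂ h₃ h₄ := by
    have k := associator_monoidal (x.pt r) (x.pt s) (x.pt t) (y.pt r) (y.pt s) (y.pt t)
    have n₁ := tensorμ_natural (x.σ h₁).hom (𝟙 (x.pt t)) (y.σ h₁).hom (𝟙 (y.pt t))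
    have n₂ := tensorμ_natural (𝟙 (x.pt r)) (x.σ h₃).hom (𝟙 (y.pt r)) (y.σ h₃).hom
    simp only [tensorHom_id, id_tensorHom, MonoidalCategory.id_whiskerRight] at n₁ n₂
    simp only [Iso.trans_hom, tensorIso_hom, MonoidalCategory.comp_whiskerRight,
      MonoidalCategory.whiskerLeft_comp, Category.assoc]
    rw [← reassoc_of% n₁, k, ← reassoc_of% n₂, tensorHom_comp_tensorHom_assoc,
      tensorHom_comp_tensorHom_assoc, tensorHom_comp_tensorHom_assoc, Category.assoc,
      Category.assoc, x.assoc h₁ h₂ h₃ h₄, y.assoc h₁ h₂ h₃ h₄]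
  comm {r s t} h h' := by
    simp only [Iso.trans_hom, tensorIso_hom]
    rw [Category.assoc, tensorμ_braiding, tensorHom_comp_tensorHom_assoc, x.comm h h', y.comm h h']


section Comm

variable {pt : G → V} {σ : ∀ {r s t : G}, t = r + s → (pt t ≅ pt r ⊗ pt s)}
  (assoc : ∀ {r s t u v w : G} (h₁ : u = r + s) (h₂ : w = u + t) (h₃ : v = s + t) (h₄ : w = r + v),
    (σ h₂).hom ≫ (σ h₁).hom ▷ pt t ≫ (α_ (pt r) (pt s) (pt t)).hom =
      (σ h₄).hom ≫ pt r ◁ (σ h₃).hom)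

include assoc

/-- By the hexagon axiom, the commutativity condition for `r` and `s + s'` is equivalent to the one
for `r` and `s`, once it holds for `r` and `s'`. -/
theorem comm_add_iff {r s s' : G}
    [(tensorRight (pt s')).IsEquivalence]
    (h : ∀ {t} (h : t = r + s') (h' : t = s' + r), (σ h).hom ≫ (β_ _ _).hom = (σ h').hom) :
    (∀ {t} (h : t = r + (s + s')) (h' : t = (s + s') + r),
      (σ h).hom ≫ (β_ _ _).hom = (σ h').hom) ↔
    ∀ {t} (h : t = r + s) (h' : t = s + r), (σ h).hom ≫ (β_ _ _).hom = (σ h').hom := by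
  have key : ∀ {t t'} (h₁ : t = r + s) (h₁' : t = s + r) (h₂ : t' = r + (s + s'))
      (h₂' : t' = (s + s') + r),
      (σ h₂).hom ≫ (β_ _ _).hom = (σ h₂').hom ↔ (σ h₁).hom ≫ (β_ _ _).hom = (σ h₁').hom := by
    intro t t' h₁ h₁' h₂ h₂'
    have h₃ : t' = t + s' := by rw [h₁, h₂, add_assoc]
    have h₄ : t' = s + (s' + r) := by rw [h₂', add_assoc]
    have e₁ := assoc h₁ h₃ (rfl : s + s' = s + s') h₂
    have e₂ := assoc h₁' h₃ (add_comm s' r) h₄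
    have e₃ := assoc (rfl : s + s' = s + s') h₂' rfl h₄
    have e₄ := BraidedCategory.hexagon_forward (pt r) (pt s) (pt s')
    have e₅ := h (add_comm s' r) rfl
    have l : ((σ h₂).hom ≫ (β_ (pt r) (pt (s + s'))).hom) ≫ (σ rfl).hom ▷ pt r ≫
        (α_ (pt s) (pt s') (pt r)).hom =
        (σ h₃).hom ≫ ((σ h₁).hom ≫ (β_ (pt r) (pt s)).hom) ▷ pt s' ≫
          (α_ (pt s) (pt r) (pt s')).hom ≫ pt s ◁ (β_ (pt r) (pt s')).hom := by
      rw [MonoidalCategory.comp_whiskerRight, Category.assoc, Category.assoc, ← e₄,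
        reassoc_of% e₁, BraidedCategory.braiding_naturality_right_assoc]
    have r' : (σ h₂').hom ≫ (σ rfl).hom ▷ pt r ≫ (α_ (pt s) (pt s') (pt r)).hom =
        (σ h₃).hom ≫ (σ h₁').hom ▷ pt s' ≫
          (α_ (pt s) (pt r) (pt s')).hom ≫ pt s ◁ (β_ (pt r) (pt s')).hom := by
      rw [e₃, reassoc_of% e₂, ← MonoidalCategory.whiskerLeft_comp, e₅]
    rw [← cancel_mono ((σ rfl).hom ▷ pt r ≫ (α_ (pt s) (pt s') (pt r)).hom), l, r', cancel_epi,
      cancel_mono]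
    exact (tensorRight (pt s')).map_injective_iff _ _
  constructor
  · intro H t h₁ h₁'
    exact (key h₁ h₁' rfl (add_comm _ _)).1 (H _ _)
  · intro H t h₁ h₁'
    exact (key rfl (add_comm _ _) h₁ h₁').2 (H _ _)

end Comm

/-- Every object `X` of a strictly commutative Picard category is the value at `1` of a family
indexed by `ℤ`. -/
theorem exists_int_family (strict : ∀ X : V, (β_ X X).hom = 𝟙 (X ⊗ X))
    (tr : ∀ X : V, (tensorRight X).IsEquivalence) (X : V) :
    ∃ x : AddFam V ℤ, Nonempty (x.pt 0 ≅ 𝟙_ V) ∧ Nonempty (x.pt 1 ≅ X) := by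
  obtain ⟨x, t, hx⟩ := exists_sequence X
  let i : x 0 ≅ 𝟙_ V := eqToIso hx
  choose σ h₀ hσ using exists_sequence_iso t i
  let τ : ∀ {r s k : ℤ}, k = r + s → (x k ≅ x r ⊗ x s) := fun {r s k} h => σ r s k h
  have assoc : ∀ {r s n u v w : ℤ} (h₁ : u = r + s) (h₂ : w = u + n) (h₃ : v = s + n)
      (h₄ : w = r + v), (τ h₂).hom ≫ (τ h₁).hom ▷ x n ≫ (α_ (x r) (x s) (x n)).hom =
        (τ h₄).hom ≫ x r ◁ (τ h₃).hom :=
    fun h₁ h₂ h₃ h₄ => sequence_assoc (hσ _) i h₀ h₁ h₂ h₃ h₄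
  -- strictness at `x 1` gives commutativity on the subgroup generated by `1`, in each variable
  have step : ∀ r s' : ℤ, (∀ {t} (h : t = r + s') (h' : t = s' + r),
      (τ h).hom ≫ (β_ _ _).hom = (τ h').hom) → ∀ s : ℤ,
      (∀ {t} (h : t = r + (s + s')) (h' : t = (s + s') + r),
        (τ h).hom ≫ (β_ _ _).hom = (τ h').hom) ↔
      ∀ {t} (h : t = r + s) (h' : t = s + r), (τ h).hom ≫ (β_ _ _).hom = (τ h').hom :=
    fun r s' h s => comm_add_iff assoc h
  have all : ∀ r : ℤ, (∀ {t} (h : t = r + 1) (h' : t = 1 + r),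
      (τ h).hom ≫ (β_ _ _).hom = (τ h').hom) → ∀ s {t : ℤ} (h : t = r + s) (h' : t = s + r),
      (τ h).hom ≫ (β_ _ _).hom = (τ h').hom := by
    intro r hr s
    induction s using Int.induction_on with
    | zero =>
      refine (step r 1 hr 0).1 ?_
      rw [zero_add]
      exact hr
    | succ n ih => exact (step r 1 hr n).2 ih
    | pred n ih =>
      refine (step r 1 hr (-n - 1)).1 ?_
      rw [sub_add_cancel]
      exact ih
  have one := all 1 fun h h' => by rw [strict, Category.comp_id]
  have comm : ∀ r s {t : ℤ} (h : t = r + s) (h' : t = s + r),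
      (τ h).hom ≫ (β_ _ _).hom = (τ h').hom := fun r => all r fun h h' => by
    rw [← one r h' h, Category.assoc, SymmetricCategory.symmetry, Category.comp_id]
  exact ⟨⟨x, τ, assoc, fun {r s t} h h' => comm r s h h'⟩, ⟨i⟩,
    ⟨t (zero_add 1).symm ≪≫ whiskerRightIso i X ≪≫ λ_ X⟩⟩

/-- In a strictly commutative Picard category there are additive families with prescribed values
at the elements of a finite basis. -/
theorem exists_family (strict : ∀ X : V, (β_ X X).hom = 𝟙 (X ⊗ X))
    (tr : ∀ X : V, (tensorRight X).IsEquivalence) {ι : Type*} [Finite ι] [Module ℤ G]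
    (b : Module.Basis ι ℤ G) (X : ι → V) : ∃ x : AddFam V G, ∀ j, Nonempty (x.pt (b j) ≅ X j) := by
  classical
  have := Fintype.ofFinite ι
  choose z hz₀ hz₁ using exists_int_family strict tr
  suffices H : ∀ s : Finset ι, ∃ x : AddFam V G, ∀ j,
      Nonempty (x.pt (b j) ≅ if j ∈ s then X j else 𝟙_ V) by
    obtain ⟨x, hx⟩ := H Finset.univ
    refine ⟨x, fun j => ?_⟩
    simpa using hx j
  intro s
  induction s using Finset.induction_on with
  | empty => exact ⟨zero, fun j => ⟨Iso.refl _⟩⟩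
  | insert k s hk ih =>
    obtain ⟨x, hx⟩ := ih
    refine ⟨x.sum ((z (X k)).comap (b.coord k).toAddMonoidHom), fun j => ?_⟩
    obtain ⟨e⟩ := hx j
    change Nonempty (x.pt (b j) ⊗ (z (X k)).pt (b.coord k (b j)) ≅ _)
    rw [Module.Basis.coord_apply, Module.Basis.repr_self]
    by_cases hj : j = k
    · subst hj
      obtain ⟨f⟩ := hz₁ (X j)
      rw [if_neg hk] at e
      rw [if_pos (Finset.mem_insert_self j s), Finsupp.single_eq_same]
      exact ⟨(e ⊗ᵢ f) ≪≫ λ_ _⟩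
    · obtain ⟨f⟩ := hz₀ (X k)
      have : (j ∈ insert k s) = (j ∈ s) := by simp [hj]
      rw [Finsupp.single_eq_of_ne (by tauto)]
      simp only [this]
      exact ⟨(e ⊗ᵢ f) ≪≫ ρ_ _⟩

end AddFam

end AddFam

end PicardMatrix

namespace PicardMatrix

/-! ### The fibres of a Picard stack as symmetric monoidal categories -/

section FiberMonoidal

variable {B : Type u} [Category.{v} B] {X : Type w} [Category.{w'} X] {p : X ⥤ B}

namespace PicardStr

variable (P : PicardStr p) {T : B}

theorem assoc_nat_fib {x y z x' y' z' : p.Fiber T} (f : x ⟶ x') (g : y ⟶ y') (h : z ⟶ z') :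
    P.sum (P.sum f g) h ≫ (P.assoc x' y' z').hom =
      (P.assoc x y z).hom ≫ P.sum f (P.sum g h) :=
  Subtype.ext (P.assoc_nat f g h)

theorem comm_nat_fib {x y x' y' : p.Fiber T} (f : x ⟶ x') (g : y ⟶ y') :
    P.sum f g ≫ (P.comm x' y').hom = (P.comm x y).hom ≫ P.sum g f :=
  Subtype.ext (P.comm_nat f g)

theorem sum_id_comp (a : p.Fiber T) {x y z : p.Fiber T} (f : x ⟶ y) (g : y ⟶ z) :
    P.sum (𝟙 a) (f ≫ g) = P.sum (𝟙 a) f ≫ P.sum (𝟙 a) g := by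
  rw [← P.sum_comp, Category.comp_id]

theorem sum_comp_id' (a : p.Fiber T) {x y z : p.Fiber T} (f : x ⟶ y) (g : y ⟶ z) :
    P.sum (f ≫ g) (𝟙 a) = P.sum f (𝟙 a) ≫ P.sum g (𝟙 a) := by
  rw [← P.sum_comp, Category.comp_id]

theorem sum_left_injective (a : p.Fiber T) {x y : p.Fiber T} {f g : x ⟶ y}
    (h : P.sum (𝟙 a) f = P.sum (𝟙 a) g) : f = g := by
  have := P.translation_equiv a
  exact (P.translation a).map_injective h

/-- If `x + e ≅ x` then `x + (e + e) ≅ x + e`, so that `e + e ≅ e` because translations are fully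
faithful. -/
theorem exists_zero (T : B) : ∃ e : p.Fiber T, Nonempty (P.add e e ≅ e) := by
  obtain ⟨x⟩ := P.nonempty T
  have := P.translation_equiv x
  let i := (P.translation x).objObjPreimageIso x
  let e := (P.translation x).objPreimage x
  exact ⟨e, ⟨(P.translation x).preimageIso ((P.assoc x e e).symm ≪≫ P.sumIso i (Iso.refl e))⟩⟩

section Unit

variable {e : p.Fiber T} (j : P.add e e ≅ e)

/-- A neutral object acts trivially. -/
noncomputable def unitor (x : p.Fiber T) : P.add e x ≅ x :=
  have := P.translation_equiv e
  (P.translation e).preimageIso ((P.assoc e e x).symm ≪≫ P.sumIso j (Iso.refl x))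

theorem sum_unitor (x : p.Fiber T) : (P.assoc e e x).hom ≫ P.sum (𝟙 e) (P.unitor j x).hom =
    P.sum j.hom (𝟙 x) := by
  have := P.translation_equiv e
  have h : P.sum (𝟙 e) (P.unitor j x).hom = (P.assoc e e x).inv ≫ P.sum j.hom (𝟙 x) :=
    (P.translation e).map_preimage _
  rw [h, Iso.hom_inv_id_assoc]

theorem unitor_nat {x y : p.Fiber T} (f : x ⟶ y) :
    P.sum (𝟙 e) f ≫ (P.unitor j y).hom = (P.unitor j x).hom ≫ f := by
  apply P.sum_left_injective e
  rw [sum_id_comp, sum_id_comp, ← cancel_epi (P.assoc e e x).hom, ← Category.assoc,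
    ← assoc_nat_fib, Category.assoc, sum_unitor, ← Category.assoc, sum_unitor, P.sum_id,
    ← P.sum_comp, ← P.sum_comp]
  simp

theorem unitor_add (x y : p.Fiber T) : (P.assoc e x y).hom ≫ (P.unitor j (P.add x y)).hom =
    P.sum (P.unitor j x).hom (𝟙 y) := by
  apply P.sum_left_injective e
  have h : IsIso (P.sum (P.assoc e e x).hom (𝟙 y)) := P.groupoid _
  rw [← cancel_epi (P.sum (P.assoc e e x).hom (𝟙 y) ≫ (P.assoc e (P.add e x) y).hom)]
  have h₁ := P.pentagon e e x y
  have h₂ := P.assoc_nat_fib (𝟙 e) (P.unitor j x).hom (𝟙 y)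
  have h₃ := P.assoc_nat_fib j.hom (𝟙 x) (𝟙 y)
  rw [P.sum_id] at h₃
  rw [sum_id_comp, Category.assoc, Category.assoc, reassoc_of% h₁, sum_unitor, ← h₂, ← h₃,
    ← Category.assoc, ← sum_comp_id', sum_unitor]

/-- A fibre of a Picard stack is a monoidal category. -/
@[reducible] noncomputable def fiberMonoidal : MonoidalCategory (p.Fiber T) where
  tensorObj := P.add
  whiskerLeft x _ _ f := P.sum (𝟙 x) f
  whiskerRight f y := P.sum f (𝟙 y)
  tensorHom := P.sum
  tensorUnit := e
  associator := P.assoc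
  leftUnitor := P.unitor j
  rightUnitor x := P.comm x e ≪≫ P.unitor j x
  tensorHom_def f g := by rw [← P.sum_comp, Category.comp_id, Category.id_comp]
  id_tensorHom_id := P.sum_id
  tensorHom_comp_tensorHom f g f' g' := (P.sum_comp f g f' g').symm
  whiskerLeft_id := P.sum_id
  id_whiskerRight := P.sum_id
  associator_naturality := P.assoc_nat_fib
  leftUnitor_naturality f := P.unitor_nat j f
  rightUnitor_naturality {x y} f := by
    rw [Iso.trans_hom, ← Category.assoc, P.comm_nat_fib, Category.assoc, unitor_nat,
      Iso.trans_hom, Category.assoc]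
  pentagon := P.pentagon
  triangle x y := by
    have h₁ := P.hexagon x e y
    have h₂ := P.unitor_nat j (P.comm x y).hom
    have h₃ := P.unitor_add j x y
    have h₄ := P.unitor_add j y x
    have h₅ := P.comm_nat_fib (𝟙 x) (P.unitor j y).hom
    rw [← cancel_mono (P.comm x y).hom, Category.assoc, h₅, ← h₄, reassoc_of% h₁, h₂,
      reassoc_of% h₃, Iso.trans_hom, sum_comp_id', Category.assoc]

/-- A fibre of a Picard stack is a symmetric monoidal category. -/
@[reducible] noncomputable def fiberSymmetric :
    letI := P.fiberMonoidal j
    SymmetricCategory (p.Fiber T) :=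
  letI := P.fiberMonoidal j
  { braiding := P.comm
    braiding_naturality_right x _ _ f := P.comm_nat_fib (𝟙 x) f
    braiding_naturality_left f z := P.comm_nat_fib f (𝟙 z)
    hexagon_forward := P.hexagon
    hexagon_reverse x y z := by
      have h := P.hexagon z x y
      have h' : ∀ a b : p.Fiber T, (P.comm a b).inv = (P.comm b a).hom := fun a b =>
        (cancel_epi (P.comm a b).hom).1 ((P.comm a b).hom_inv_id.trans (P.comm_comm a b).symm)
      have h₁ : P.assoc z x y ≪≫ P.comm z (P.add x y) ≪≫ P.assoc x y z =
        P.sumIso (P.comm z x) (Iso.refl y) ≪≫ P.assoc x z y ≪≫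
          P.sumIso (Iso.refl x) (P.comm z y) := Iso.ext h
      have h₂ := congrArg Iso.inv h₁
      simp only [Iso.trans_inv, Law.sumIso_inv, Iso.refl_inv, h', Category.assoc] at h₂
      exact h₂
    symmetry := P.comm_comm }

end Unit

/-- There are additive families with prescribed values at the elements of a finite basis. -/
theorem exists_fam (P : PicardStr p) {G : Type} [AddCommGroup G] [Module ℤ G] {ι : Type*}
    [Finite ι] (b : Module.Basis ι ℤ G) (x : ι → p.Fiber T) :
    ∃ y : FamAt P G T, ∀ i, Nonempty (y.pt (b i) ≅ x i) := by
  obtain ⟨e, ⟨j⟩⟩ := P.exists_zero T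
  let _ := P.fiberMonoidal j
  let _ := P.fiberSymmetric j
  obtain ⟨y, hy⟩ := AddFam.exists_family (V := p.Fiber T) P.strict (fun x => by
    have := P.translation_equiv x
    exact Functor.isEquivalence_of_iso (NatIso.ofComponents (F := P.translation x)
      (fun y => P.comm x y) (fun f => P.comm_nat_fib (𝟙 x) f))) b x
  exact ⟨⟨y.pt, y.σ, y.assoc, y.comm⟩, hy⟩

end PicardStr

end FiberMonoidal

end PicardMatrix

namespace PicardMatrix

/-! ### Operations on additive families -/

section FamOps

variable {B : Type u} [Category.{v} B] {X : Type w} [Category.{w'} X] {p : X ⥤ B}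
  {P : PicardStr p} {G : Type} [AddCommGroup G]

theorem Law.map_eq_id (P : Law p) {T : B} {x y : p.Fiber T} {φ : x.1 ⟶ x.1} {ψ : y.1 ⟶ y.1}
    (hφ : φ = 𝟙 x.1) (hψ : ψ = 𝟙 y.1) (h : p.IsHomLift (𝟙 T) φ) (h' : p.IsHomLift (𝟙 T) ψ) :
    (P.map (x := x) (y := y) (x' := x) (y' := y) ⟨φ, h⟩ ⟨ψ, h'⟩).1 = 𝟙 (P.add x y).1 := by
  subst hφ hψ
  exact congrArg Subtype.val (P.map_id x y)

namespace FamAt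

variable {T : B}

/-- The isomorphism between the values of a family at equal elements. -/
def ptIso (x : FamAt P G T) {r r' : G} (h : r = r') : x.pt r ≅ x.pt r' := eqToIso (congrArg x.pt h)

@[simp] theorem ptIso_trans (x : FamAt P G T) {r r' r'' : G} (h : r = r') (h' : r' = r'') :
    (x.ptIso h).hom ≫ (x.ptIso h').hom = (x.ptIso (h.trans h')).hom := by
  subst h h'
  exact Category.comp_id _

theorem ptIso_trans_val (x : FamAt P G T) {r r' r'' : G} (h : r = r') (h' : r' = r'') :
    (x.ptIso h).hom.1 ≫ (x.ptIso h').hom.1 = (x.ptIso (h.trans h')).hom.1 :=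
  congrArg Subtype.val (x.ptIso_trans h h')

theorem ptIso_σ (x : FamAt P G T) {r s t r' s' t' : G} (h : t = r + s) (h' : t' = r' + s')
    (hr : r = r') (hs : s = s') (ht : t = t') :
    (x.ptIso ht).hom ≫ (x.σ h').hom = (x.σ h).hom ≫ P.sum (x.ptIso hr).hom (x.ptIso hs).hom := by
  subst hr hs ht
  exact (Category.id_comp _).trans ((congrArg (_ ≫ ·) (P.sum_id _ _)).trans (Category.comp_id _)).symm

/-- Change of the indexing group. -/
def comap {H : Type} [AddCommGroup H] (x : FamAt P H T) (f : G →+ H) : FamAt P G T where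
  pt r := x.pt (f r)
  σ h := x.σ (h ▸ map_add f _ _)
  assoc _ _ _ _ := x.assoc _ _ _ _
  comm _ _ := x.comm _ _

section Push

variable {B' : Type u'} [Category.{v'} B'] {X' : Type w₁} [Category.{w₂} X'] {q : X' ⥤ B'}
  {Q : PicardStr q} {K : B ⥤ B'} {F : CartFunctor K p q} (s : AddStr P Q F)

theorem push_assoc_aux {V W : Type*} [Category* V] [Category* W] (H : V ⥤ W)
    {a b c d e : V} {f : a ⟶ b} {g : b ⟶ c} {h : c ⟶ d} {i : a ⟶ e} {j : e ⟶ d}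
    (k : f ≫ g ≫ h = i ≫ j) {x₁ x₂ x₃ x₄ x₅ x₆ : W}
    {s₁ : H.obj c ⟶ x₁} {s₂ : H.obj d ⟶ x₂} {s₃ : H.obj b ⟶ x₃} {s₄ : H.obj e ⟶ x₄}
    {m : x₂ ⟶ x₆} {n : x₁ ⟶ x₅} {o : x₅ ⟶ x₆} {g' : x₃ ⟶ x₁} {j' : x₄ ⟶ x₂} {l : x₃ ⟶ x₅}
    {l' : x₄ ⟶ x₆} (k₁ : H.map h ≫ s₂ ≫ m = s₁ ≫ n ≫ o) (k₂ : H.map g ≫ s₁ = s₃ ≫ g')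
    (k₃ : H.map j ≫ s₂ = s₄ ≫ j') (hl : l = g' ≫ n) (hl' : l' = j' ≫ m) :
    (H.map f ≫ s₃) ≫ l ≫ o = (H.map i ≫ s₄) ≫ l' := by
  have k' := congrArg H.map k
  simp only [Functor.map_comp] at k'
  subst hl hl'
  simp only [Category.assoc]
  rw [← reassoc_of% k₂, ← reassoc_of% k₃, ← k₁, reassoc_of% k']

/-- The image of an additive family under an additive functor. -/
def push {T' : B'} (hT : K.obj T = T') (x : FamAt P G T) : FamAt Q G T' where
  pt r := (F.fib hT).obj (x.pt r)
  σ h := (F.fib hT).mapIso (x.σ h) ≪≫ s.σ hT _ _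
  assoc h₁ h₂ h₃ h₄ := push_assoc_aux (F.fib hT) (x.assoc h₁ h₂ h₃ h₄) (s.assoc hT _ _ _)
    (s.nat_fib hT (x.σ h₁).hom (𝟙 _)) (s.nat_fib hT (𝟙 _) (x.σ h₃).hom)
    (Q.sum_comp_id (F.fib hT) _ _ _) (Q.id_sum_comp (F.fib hT) _ _ _)
  comm {r s' t} h h' := by
    have h₁ := s.comm hT (x.pt r) (x.pt s')
    simp only [Iso.trans_hom, Functor.mapIso_hom, Category.assoc]
    rw [← h₁, ← Functor.map_comp_assoc, x.comm h h']

end Push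

end FamAt

namespace Fam

variable {x y : Fam P G}

theorem arr_ptIso (h : x ⟶ y) {r r' : G} (e : r = r') :
    h.arr r ≫ (y.fam.ptIso e).hom.1 = (x.fam.ptIso e).hom.1 ≫ h.arr r' := by
  subst e
  exact (Category.comp_id _).trans (Category.id_comp _).symm

theorem isIso_of_arr (h : x ⟶ y) [IsIso h.base] [∀ r, IsIso (h.arr r)] : IsIso h := by
  have hl : ∀ r, p.IsHomLift (inv h.base) (inv (h.arr r)) := fun r => by
    have := h.lies r
    infer_instance
  let k : y ⟶ x := ⟨inv h.base, fun r => inv (h.arr r), hl, fun {r s t} e => by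
    rw [IsIso.inv_comp_eq, ← Category.assoc, h.compat e, Category.assoc,
      ← P.map_comp_of (h.lies r) (h.lies s) (hl r) (hl s) (b'' := 𝟙 x.base)]
    · refine (Category.comp_id _).symm.trans (congrArg _ (Eq.symm ?_))
      exact P.map_eq_id (IsIso.hom_inv_id (h.arr r)) (IsIso.hom_inv_id (h.arr s)) _ _
    · rw [IsIso.hom_inv_id]
      exact IsHomLift.id (x.fam.pt r).2
    · rw [IsIso.hom_inv_id]
      exact IsHomLift.id (x.fam.pt s).2⟩
  exact ⟨k, hom_ext fun r => IsIso.hom_inv_id _, hom_ext fun r => IsIso.inv_hom_id _⟩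

/-- Change of the indexing group. -/
def comap {H : Type} [AddCommGroup H] (f : G →+ H) : Fam P H ⥤ Fam P G where
  obj x := ⟨x.base, x.fam.comap f⟩
  map h := ⟨h.base, fun r => h.arr (f r), fun r => h.lies (f r), fun e => h.compat _⟩

/-- The families obtained by restriction along equal homomorphisms are isomorphic. -/
def comapCongr {H : Type} [AddCommGroup H] {f f' : G →+ H} (e : f = f') (x : Fam P H) :
    (comap f).obj x ⟶ (comap f').obj x where
  base := 𝟙 _
  arr r := (x.fam.ptIso (DFunLike.congr_fun e r)).hom.1
  lies r := (x.fam.ptIso (DFunLike.congr_fun e r)).hom.2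
  compat {r s t} h := congrArg Subtype.val (x.fam.ptIso_σ (h ▸ map_add f _ _ : f t = f r + f s)
    (h ▸ map_add f' _ _) (DFunLike.congr_fun e r) (DFunLike.congr_fun e s) _)

section Push

variable {B' : Type u'} [Category.{v'} B'] {X' : Type w₁} [Category.{w₂} X'] {q : X' ⥤ B'}
  {Q : PicardStr q} {K : B ⥤ B'} {F : CartFunctor K p q} (s : AddStr P Q F)

/-- The image of an additive family under an additive functor. -/
def push : Fam P G ⥤ Fam Q G where
  obj x := ⟨K.obj x.base, x.fam.push s rfl⟩
  map h := ⟨K.map h.base, fun r => F.F.map (h.arr r), fun r => F.lift_map _ (h.lies r),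
    fun {r t u} e => by
      exact AddStr.comp_nat_aux F.F (h.compat e) (s.nat rfl rfl ⟨h.arr r, h.lies r⟩
        ⟨h.arr t, h.lies t⟩ (F.fibMap ⟨h.arr r, h.lies r⟩) (F.fibMap ⟨h.arr t, h.lies t⟩) rfl rfl)⟩
  map_id x := hom_ext fun r => F.F.map_id _
  map_comp f g := hom_ext fun r => F.F.map_comp _ _

end Push

end Fam

end FamOps

end PicardMatrix

namespace PicardMatrix

/-! ### The algebra of additive families of a Picard stack -/

/-- The action of a matrix with `k` rows and `n` columns on rows, from `ℤᵏ` to `ℤⁿ`. -/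
def rowHom {n k : ℕ} (M : Matrix (Fin k) (Fin n) ℤ) : (Fin k → ℤ) →+ (Fin n → ℤ) :=
  AddMonoidHom.mk' (fun r => Matrix.vecMul r M) (fun r s => Matrix.add_vecMul M r s)

theorem rowHom_apply {n k : ℕ} (M : Matrix (Fin k) (Fin n) ℤ) (r : Fin k → ℤ) :
    rowHom M r = Matrix.vecMul r M := rfl

theorem rowHom_one (n : ℕ) : rowHom (1 : Matrix (Fin n) (Fin n) ℤ) = AddMonoidHom.id _ := by
  refine DFunLike.ext _ _ fun r => ?_
  exact Matrix.vecMul_one r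

theorem rowHom_mul {n k l : ℕ} (M : Matrix (Fin k) (Fin n) ℤ) (N : Matrix (Fin l) (Fin k) ℤ) :
    rowHom (N * M) = (rowHom M).comp (rowHom N) := by
  refine DFunLike.ext _ _ fun r => ?_
  exact (Matrix.vecMul_vecMul r N M).symm

attribute [irreducible] rowHom

section SmallFam

variable {B : Type u} [Category.{v} B] {X : Type w} [Category.{w'} X] {p : X ⥤ B}

theorem PicardStr.isIso_of_isHomLift (P : PicardStr p) (hp : p.IsFibered) {S T : B} {f : S ⟶ T}
    (hf : IsIso f) {x y : X} {φ : x ⟶ y} (h : p.IsHomLift f φ) : IsIso φ := by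
  have := P.cart hp h
  exact Functor.IsStronglyCartesian.isIso_of_base_isIso p f φ

/-- Additive families with isomorphic values at a basis are isomorphic. -/
theorem Fam.exists_iso {P : PicardStr p} {G : Type} [AddCommGroup G] {ι : Type*} [Module ℤ G]
    (b : Module.Basis ι ℤ G) (hp : p.IsFibered) {T : B} (x y : FamAt P G T)
    (φ : ∀ j, x.pt (b j) ≅ y.pt (b j)) :
    ∃ i : (⟨T, x⟩ : Fam P G) ≅ ⟨T, y⟩, i.hom.base = 𝟙 T ∧ i.inv.base = 𝟙 T := by
  obtain ⟨h, hb, -⟩ := Fam.exists_hom b hp (x := ⟨T, x⟩) (y := ⟨T, y⟩) (𝟙 T) fun j => (φ j).hom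
  have h₁ : ∀ r, IsIso (h.arr r) := fun r => by
    have l := h.lies r
    rw [hb] at l
    exact P.isIso_of_isHomLift hp (IsIso.id T) l
  have h₂ : IsIso h.base := hb ▸ IsIso.id T
  have h₃ := Fam.isIso_of_arr h
  refine ⟨asIso h, hb, ?_⟩
  have h₅ : h.base ≫ (inv h).base = 𝟙 T := congrArg Fam.Hom.base (IsIso.hom_inv_id h)
  rw [hb] at h₅
  exact (Category.id_comp _).symm.trans h₅

namespace Pow

variable (P : PicardStr p) {m : ℕ} (z : Pow p m)

/-- A chosen additive family indexed by `ℤᵐ` with prescribed values at the standard basis. -/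
noncomputable def fam : FamAt P (Fin m → ℤ) z.base :=
  (P.exists_fam (Pi.basisFun ℤ (Fin m)) z.pt).choose

/-- The values of the chosen family at the standard basis. -/
noncomputable def famIso (i : Fin m) : (z.fam P).pt (Pi.basisFun ℤ (Fin m) i) ≅ z.pt i :=
  ((P.exists_fam (Pi.basisFun ℤ (Fin m)) z.pt).choose_spec i).some

end Pow

/-- A presentation of an additive family indexed by `ℤⁿ`: the restriction, along a homomorphism
`f : ℤⁿ → ℤᵐ`, of the family chosen for a point `z` of `pᵐ`. All additive families are isomorphic
to such families; unlike the additive families themselves, whose isomorphisms `σ` are arrows of `p`,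
presentations live in the universe of the objects of `p`. Composing `f` with
a homomorphism makes the restriction of presented families strictly functorial. -/
structure SmallFam (P : PicardStr p) (n : ℕ) where
  {m : ℕ}
  z : Pow p m
  f : (Fin n → ℤ) →+ (Fin m → ℤ)

namespace SmallFam

variable {P : PicardStr p} {n : ℕ}

/-- The family which is presented. -/
noncomputable def fam (c : SmallFam P n) : Fam P (Fin n → ℤ) :=
  ⟨c.z.base, (c.z.fam P).comap c.f⟩

noncomputable instance : Category (SmallFam P n) where
  Hom c c' := c.fam ⟶ c'.fam
  id c := 𝟙 c.fam
  comp {c c' c''} h k := CategoryStruct.comp (X := c.fam) (Y := c'.fam) (Z := c''.fam) h k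
  id_comp h := Category.id_comp (obj := Fam P (Fin n → ℤ)) h
  comp_id h := Category.comp_id (obj := Fam P (Fin n → ℤ)) h
  assoc h k l := Category.assoc (obj := Fam P (Fin n → ℤ)) h k l

/-- An arrow between the families which are presented, as an arrow of presentations. -/
abbrev homMk {c c' : SmallFam P n} (h : c.fam ⟶ c'.fam) : c ⟶ c' := h

theorem hom_ext {c c' : SmallFam P n} {h k : c ⟶ c'} (e : ∀ r, h.arr r = k.arr r) : h = k :=
  Fam.hom_ext e

variable (P n) in
/-- The projection to the base. -/
noncomputable def proj : SmallFam P n ⥤ B where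
  obj c := c.fam.base
  map h := h.base

theorem isHomLift_base {c c' : SmallFam P n} (h : c ⟶ c') : (proj P n).IsHomLift h.base h :=
  IsHomLift.map (proj P n) h

theorem lies_of {c c' : SmallFam P n} {h : c ⟶ c'} {S T : B} {b : S ⟶ T}
    (l : (proj P n).IsHomLift b h) (r : Fin n → ℤ) : p.IsHomLift b (h.arr r) :=
  isHomLift_transfer (isHomLift_base h) l (h.lies r)

theorem isHomLift_of {c c' : SmallFam P n} {h : c ⟶ c'} {S T : B} {b : S ⟶ T} {r : Fin n → ℤ}
    (l : p.IsHomLift b (h.arr r)) : (proj P n).IsHomLift b h :=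
  isHomLift_transfer (h.lies r) l (isHomLift_base h)

theorem isIso_of_arr {c c' : SmallFam P n} (h : c ⟶ c') [IsIso h.base] [∀ r, IsIso (h.arr r)] :
    IsIso h := by
  obtain ⟨k, h₁, h₂⟩ := Fam.isIso_of_arr h
  exact ⟨k, h₁, h₂⟩

/-- Evaluation at finitely many elements of the indexing group. -/
noncomputable def eval (P : PicardStr p) {j : ℕ} (g : Fin j → (Fin n → ℤ)) :
    OverFunctor (proj P n) (Pow.proj p j) where
  F :=
    { obj c := ⟨c.fam.base, fun i => c.fam.fam.pt (g i)⟩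
      map h := ⟨h.base, fun i => h.arr (g i), fun i => h.lies (g i)⟩ }
  w := rfl

/-- Evaluation at a basis is an equivalence. -/
theorem eval_isFibEquiv (hp : p.IsFibered) {j : ℕ} (b : Module.Basis (Fin j) ℤ (Fin n → ℤ)) :
    IsFibEquiv (eval P b) where
  full := ⟨fun {c c'} h => by
    obtain ⟨k, hk, hk'⟩ := Fam.exists_hom b hp (x := c.fam) (y := c'.fam) h.base
      fun i => ⟨h.arr i, h.lies i⟩
    exact ⟨k, Pow.Hom.ext hk (funext hk')⟩⟩
  faithful := ⟨fun {c c'} h k e => Fam.hom_ext_basis b hp (congrArg Pow.Hom.base e)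
    fun i => congrFun (congrArg Pow.Hom.arr e) i⟩
  surj {T} x := by
    obtain ⟨x, rfl⟩ := x
    let f : (Fin n → ℤ) →+ (Fin j → ℤ) := b.equivFun.toLinearMap.toAddMonoidHom
    have hf : ∀ i, f (b i) = Pi.basisFun ℤ (Fin j) i := fun i => by
      rw [Pi.basisFun_apply]
      refine funext fun k => (b.equivFun_self i k).trans ?_
      rw [Pi.single_apply]
      simp only [eq_comm]
    let e : ∀ i, ((x.fam P).comap f).pt (b i) ≅ x.pt i := fun i =>
      (x.fam P).ptIso (hf i) ≪≫ x.famIso P i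
    exact ⟨⟨⟨x, f⟩, rfl⟩, ⟨⟨𝟙 _, fun i => (e i).hom.1, fun i => (e i).hom.2⟩,
      ⟨𝟙 _, fun i => (e i).inv.1, fun i => (e i).inv.2⟩,
      Pow.Hom.ext (Category.comp_id _) (funext fun i => fiber_hom_inv _),
      Pow.Hom.ext (Category.comp_id _) (funext fun i => fiber_inv_hom _)⟩,
      IsHomLift.map (Pow.proj p j) (Pow.Hom.mk _ _ _)⟩

section Stack

variable {K : GrothendieckTopology B} (hp : IsStack K p)

include hp

theorem isStack (P : PicardStr p) (n : ℕ) : IsStack K (proj P n) :=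
  (eval_isFibEquiv hp.fibered (Pi.basisFun ℤ (Fin n))).isStack (Pow.isStack hp n)

theorem groupoid {T : B} {c c' : (proj P n).Fiber T} (h : c ⟶ c') : IsIso h := by
  have h₁ : ∀ r, IsIso (h.1.arr r) := fun r =>
    P.isIso_of_isHomLift hp.fibered (IsIso.id T) (lies_of h.2 r)
  have h₂ : IsIso h.1.base := by
    have l := h.2
    have e : IsIso ((proj P n).map h.1) := by
      rw [IsHomLift.fac' (proj P n) (𝟙 T) h.1]
      infer_instance
    exact e
  have h₃ : IsIso h.1 := isIso_of_arr h.1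
  exact (fiberIsoMk (asIso h.1) h.2).isIso_hom

theorem cart {S T : B} {b : S ⟶ T} {c c' : SmallFam P n} {h : c ⟶ c'}
    (l : (proj P n).IsHomLift b h) : (proj P n).IsStronglyCartesian b h :=
  isStronglyCartesian_of_groupoid (isStack hp P n).fibered (fun h => groupoid hp h) l

end Stack

/-- Restriction along a homomorphism. -/
noncomputable def comap {k : ℕ} (g : (Fin k → ℤ) →+ (Fin n → ℤ)) : SmallFam P n ⥤ SmallFam P k where
  obj c := ⟨c.z, c.f.comp g⟩
  map h := (Fam.comap g).map h

/-- The presented families obtained by restriction along equal homomorphisms are isomorphic. -/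
noncomputable def comapCongr {k : ℕ} {g g' : (Fin k → ℤ) →+ (Fin n → ℤ)} (e : g = g') :
    comap (P := P) g ≅ comap g' :=
  NatIso.ofComponents (fun c => ⟨Fam.comapCongr e c.fam, Fam.comapCongr e.symm c.fam,
      hom_ext fun _ => (FamAt.ptIso_trans_val _ _ _).trans rfl,
      hom_ext fun _ => (FamAt.ptIso_trans_val _ _ _).trans rfl⟩)
    (fun h => hom_ext fun r => Fam.arr_ptIso h (DFunLike.congr_fun e r))

section Push

variable {B' : Type u'} [Category.{v'} B'] {X' : Type w₁} [Category.{w₂} X'] {q : X' ⥤ B'}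
  {Q : PicardStr q} {K : B ⥤ B'} {F : CartFunctor K p q} (s : AddStr P Q F)

/-- The image of a point of `pᵐ` under a cartesian functor. -/
def _root_.PicardMatrix.Pow.push {m : ℕ} (F : CartFunctor K p q) (z : Pow p m) : Pow q m :=
  ⟨K.obj z.base, fun i => (F.fib rfl).obj (z.pt i)⟩

/-- The image under an additive functor of the family spanned by a tuple is the family spanned by
the image of the tuple. -/
theorem exists_pushIso (hq : q.IsFibered) {m : ℕ} (z : Pow p m) :
    ∃ i : (⟨_, (z.push F).fam Q⟩ : Fam Q (Fin m → ℤ)) ≅ (Fam.push s).obj ⟨z.base, z.fam P⟩,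
      i.hom.base = 𝟙 _ ∧ i.inv.base = 𝟙 _ :=
  Fam.exists_iso (Pi.basisFun ℤ (Fin m)) hq ((z.push F).fam Q)
    ((Fam.push s).obj ⟨z.base, z.fam P⟩).fam fun i =>
      (z.push F).famIso Q i ≪≫ (F.fib rfl).mapIso (z.famIso P i).symm

variable (hq : q.IsFibered)

/-- The comparison between the family chosen for the image of a point, and the image of the family
chosen for the point. -/
noncomputable def pushIso (c : SmallFam P n) :
    (⟨c.z.push F, c.f⟩ : SmallFam Q n).fam ≅ (Fam.push s).obj c.fam :=
  (Fam.comap c.f).mapIso (exists_pushIso s hq c.z).choose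

theorem pushIso_hom_base (c : SmallFam P n) : (pushIso s hq c).hom.base = 𝟙 _ :=
  (exists_pushIso s hq c.z).choose_spec.1

theorem pushIso_inv_base (c : SmallFam P n) : (pushIso s hq c).inv.base = 𝟙 _ :=
  (exists_pushIso s hq c.z).choose_spec.2

/-- The action of an additive functor on presented families. -/
noncomputable def push : SmallFam P n ⥤ SmallFam Q n where
  obj c := ⟨c.z.push F, c.f⟩
  map {c c'} h := homMk ((pushIso s hq c).hom ≫ (Fam.push s).map h ≫ (pushIso s hq c').inv)
  map_id c := by
    refine Eq.trans (congrArg (fun h => (pushIso s hq c).hom ≫ h ≫ (pushIso s hq c).inv)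
      ((Fam.push s).map_id c.fam)) ?_
    rw [Category.id_comp, Iso.hom_inv_id]
    rfl
  map_comp {c c' c''} h k := by
    refine Eq.trans (congrArg (fun h => (pushIso s hq c).hom ≫ h ≫ (pushIso s hq c'').inv)
      ((Fam.push s).map_comp (X := c.fam) (Y := c'.fam) (Z := c''.fam) h k)) ?_
    change _ = ((pushIso s hq c).hom ≫ (Fam.push s).map h ≫ (pushIso s hq c').inv) ≫
      ((pushIso s hq c').hom ≫ (Fam.push s).map k ≫ (pushIso s hq c'').inv)
    simp only [Category.assoc, Iso.inv_hom_id_assoc]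

/-- Presented families over an additive functor. -/
noncomputable def pushCart {J : GrothendieckTopology B'} (hQ : IsStack J q) :
    CartFunctor K (proj P n) (proj Q n) where
  F := push s hQ.fibered
  w := by
    refine CategoryTheory.Functor.ext (fun c => rfl) fun c c' h => ?_
    change (pushIso s hQ.fibered c).hom.base ≫ K.map h.base ≫ (pushIso s hQ.fibered c').inv.base = _
    rw [pushIso_hom_base, pushIso_inv_base]
    rfl
  cart h _ := cart hQ (IsHomLift.map _ _)

end Push

end SmallFam

end SmallFam

end PicardMatrix

namespace PicardMatrix

theorem FamAt.ptIso_trans_four {B : Type u} [Category.{v} B] {X : Type w} [Category.{w'} X]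
    {p : X ⥤ B} {P : PicardStr p} {G : Type} [AddCommGroup G] {T : B} (x : FamAt P G T)
    {r₁ r₂ r₃ r₄ r₅ : G} (h₁ : r₁ = r₂) (h₂ : r₂ = r₃) (h₃ : r₃ = r₄) (h₄ : r₄ = r₅)
    (h₅ : r₁ = r₅) :
    (x.ptIso h₁).hom.1 ≫ (x.ptIso h₂).hom.1 ≫ 𝟙 _ ≫ (x.ptIso h₃).hom.1 ≫ (x.ptIso h₄).hom.1 =
      (x.ptIso h₅).hom.1 := by
  subst h₁ h₂ h₃ h₄
  exact (Category.id_comp _).trans ((Category.id_comp _).trans ((Category.id_comp _).trans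
    (Category.id_comp _)))

theorem FamAt.ptIso_trans_two {B : Type u} [Category.{v} B] {X : Type w} [Category.{w'} X]
    {p : X ⥤ B} {P : PicardStr p} {G : Type} [AddCommGroup G] {T : B} (x : FamAt P G T)
    {r₁ r₂ r₃ : G} (h₁ : r₁ = r₂) (h₂ : r₂ = r₃) (h₃ : r₁ = r₃) :
    (x.ptIso h₁).hom.1 ≫ (x.ptIso h₂).hom.1 ≫ 𝟙 _ = (x.ptIso h₃).hom.1 := by
  subst h₁ h₂
  exact (Category.id_comp _).trans (Category.id_comp _)

namespace PicardStack

variable {C : Type u} [Category.{v} C] {J : GrothendieckTopology C} {U : C}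
  (P : PicardStack.{max u v w₁, max v w₂} (J.over U))

/-- The stack of families indexed by `ℤⁿ`, which is equivalent to the `n`-th power. -/
noncomputable def famStk (n : ℕ) : Stk.{max u v w₁, max v w₂} (J.over U) where
  X := SmallFam P.str n
  p := SmallFam.proj P.str n
  isStack := SmallFam.isStack P.isStack P.str n

/-- Restriction of families along a homomorphism. -/
noncomputable def famComap {n k : ℕ} (g : (Fin k → ℤ) →+ (Fin n → ℤ)) : P.famStk n ⟶ P.famStk k where
  F := SmallFam.comap g
  w := rfl
  cart _ _ := SmallFam.cart P.isStack (IsHomLift.map (P.famStk k).p _)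

theorem isVertical_comapCongr {n k : ℕ} {g g' : (Fin k → ℤ) →+ (Fin n → ℤ)} (e : g = g') :
    IsVertical (SmallFam.proj P.str k) (SmallFam.comapCongr e).hom := fun c =>
  IsHomLift.map (SmallFam.proj P.str k) ((SmallFam.comapCongr e).hom.app c)

/-- Restriction along the identity is isomorphic to the identity. -/
noncomputable def famComapId {n : ℕ} {g : (Fin n → ℤ) →+ (Fin n → ℤ)} (e : g = AddMonoidHom.id _) :
    P.famComap g ≅ 𝟙 (P.famStk n) :=
  Stk.isoMk (SmallFam.comapCongr e) (P.isVertical_comapCongr e) (P.isVertical_comapCongr e.symm)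

/-- Restriction along a composite is isomorphic to the composite of the restrictions. -/
noncomputable def famComapComp {n k l : ℕ} {g : (Fin k → ℤ) →+ (Fin n → ℤ)}
    {h : (Fin l → ℤ) →+ (Fin k → ℤ)} {gh : (Fin l → ℤ) →+ (Fin n → ℤ)} (e : gh = g.comp h) :
    P.famComap gh ≅ P.famComap g ≫ P.famComap h :=
  Stk.isoMk (SmallFam.comapCongr e) (P.isVertical_comapCongr e) (P.isVertical_comapCongr e.symm)

theorem famComap_eqToHom {n k : ℕ} {g g' : (Fin k → ℤ) →+ (Fin n → ℤ)} (e : g = g')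
    (h : P.famComap g = P.famComap g') (c : SmallFam P.str n) (r : Fin k → ℤ) :
    Fam.Hom.arr ((Stk.Hom₂.τ (eqToHom h)).app c) r =
      (c.fam.fam.ptIso (DFunLike.congr_fun e r)).hom.1 := by
  subst e
  rfl

theorem famComap_assoc {n k l m : ℕ} {g : (Fin k → ℤ) →+ (Fin n → ℤ)}
    {h : (Fin l → ℤ) →+ (Fin k → ℤ)} {i : (Fin m → ℤ) →+ (Fin l → ℤ)}
    {gh : (Fin l → ℤ) →+ (Fin n → ℤ)} {hi : (Fin m → ℤ) →+ (Fin k → ℤ)}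
    {a b : (Fin m → ℤ) →+ (Fin n → ℤ)} (e₁ : gh = g.comp h) (e₂ : hi = h.comp i)
    (e₃ : a = gh.comp i) (e₄ : b = g.comp hi) (e : a = b) (w : P.famComap a = P.famComap b) :
    (P.famComapComp e₃).hom ≫ (P.famComapComp e₁).hom ▷ P.famComap i ≫
      (α_ (P.famComap g) (P.famComap h) (P.famComap i)).hom ≫
        P.famComap g ◁ (P.famComapComp e₂).inv ≫ (P.famComapComp e₄).inv = eqToHom w :=
  Stk.hom₂_ext fun c => SmallFam.hom_ext fun r =>
    (FamAt.ptIso_trans_four (c.z.fam P.str) (congrArg c.f (DFunLike.congr_fun e₃ r))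
      (congrArg c.f (DFunLike.congr_fun e₁ (i r)))
      (congrArg c.f (congrArg g (DFunLike.congr_fun e₂ r).symm))
      (congrArg c.f (DFunLike.congr_fun e₄ r).symm) (congrArg c.f (DFunLike.congr_fun e r))).trans
      (P.famComap_eqToHom e w c r).symm

theorem famComap_id_comp {n k : ℕ} {g a : (Fin k → ℤ) →+ (Fin n → ℤ)}
    {j : (Fin n → ℤ) →+ (Fin n → ℤ)} (e₁ : j = AddMonoidHom.id _) (e₂ : a = j.comp g) (e : a = g)
    (w : P.famComap a = P.famComap g) :
    (P.famComapComp e₂).hom ≫ (P.famComapId e₁).hom ▷ P.famComap g ≫ (λ_ (P.famComap g)).hom =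
      eqToHom w :=
  Stk.hom₂_ext fun c => SmallFam.hom_ext fun r =>
    (FamAt.ptIso_trans_two (c.z.fam P.str) (congrArg c.f (DFunLike.congr_fun e₂ r))
      (congrArg c.f (DFunLike.congr_fun e₁ (g r))) (congrArg c.f (DFunLike.congr_fun e r))).trans
      (P.famComap_eqToHom e w c r).symm

theorem famComap_comp_id {n k : ℕ} {g a : (Fin k → ℤ) →+ (Fin n → ℤ)}
    {j : (Fin k → ℤ) →+ (Fin k → ℤ)} (e₁ : j = AddMonoidHom.id _) (e₂ : a = g.comp j) (e : a = g)
    (w : P.famComap a = P.famComap g) :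
    (P.famComapComp e₂).hom ≫ P.famComap g ◁ (P.famComapId e₁).hom ≫ (ρ_ (P.famComap g)).hom =
      eqToHom w :=
  Stk.hom₂_ext fun c => SmallFam.hom_ext fun r =>
    (FamAt.ptIso_trans_two (c.z.fam P.str) (congrArg c.f (DFunLike.congr_fun e₂ r))
      (congrArg c.f (congrArg g (DFunLike.congr_fun e₁ r)))
      (congrArg c.f (DFunLike.congr_fun e r))).trans
      (P.famComap_eqToHom e w c r).symm

/-- The pseudofunctor of families. A matrix `M` acts on families by restriction along the
homomorphism `r ↦ rM`. -/
noncomputable def famPseudofunctor : TOne ⥤ᵖ Stk.{max u v w₁, max v w₂} (J.over U) :=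
  LocallyDiscrete.mkPseudofunctor (fun t : PowOne => P.famStk t.exp)
    (fun {n k} (M : Matrix (Fin k.exp) (Fin n.exp) ℤ) => P.famComap (rowHom M))
    (fun n => P.famComapId (rowHom_one n.exp))
    (fun M N => P.famComapComp (rowHom_mul M N))
    (fun f g h => P.famComap_assoc _ _ _ _ (congrArg rowHom (Category.assoc f g h)) _)
    (fun f => P.famComap_id_comp _ _ (congrArg rowHom (Category.id_comp f)) _)
    (fun f => P.famComap_comp_id _ _ (congrArg rowHom (Category.comp_id f)) _)

end PicardStack

end PicardMatrix

namespace PicardMatrix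

/-! ### The algebra of families preserves products -/

section StkProduct

variable {B : Type u} [Category.{v} B] {K : GrothendieckTopology B}

/-- A criterion for a product of stacks all of whose arrows are cartesian: arrows and objects are
determined by their projections. -/
theorem Stk.isProduct_of {ι : Type} {x : Stk.{w, w'} K} {y : ι → Stk.{w, w'} K}
    (π : ∀ i, x ⟶ y i)
    (cart : ∀ {a b : x.X} (h : a ⟶ b), x.p.IsStronglyCartesian (x.p.map h) h)
    (full : ∀ {S T : B} (f : S ⟶ T) (a : x.p.Fiber S) (b : x.p.Fiber T)
      (φ : ∀ i, (π i).F.obj a.1 ⟶ (π i).F.obj b.1), (∀ i, (y i).p.IsHomLift f (φ i)) →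
      ∃ h : a.1 ⟶ b.1, x.p.IsHomLift f h ∧ ∀ i, (π i).F.map h = φ i)
    (faithful : ∀ {a b : x.X} (h h' : a ⟶ b), x.p.map h = x.p.map h' →
      (∀ i, (π i).F.map h = (π i).F.map h') → h = h')
    (surj : ∀ {T : B} (c : ∀ i, (y i).p.Fiber T), ∃ (a : x.p.Fiber T)
      (e : ∀ i, (π i).F.obj a.1 ≅ (c i).1), ∀ i, (y i).p.IsHomLift (𝟙 T) (e i).hom) :
    IsProduct π := by
  have faithful' : ∀ {S T : B} {f : S ⟶ T} {a b : x.X} {h h' : a ⟶ b}, x.p.IsHomLift f h →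
      x.p.IsHomLift f h' → (∀ i, (π i).F.map h = (π i).F.map h') → h = h' := by
    intro S T f a b h h' l l' k
    refine faithful h h' ?_ k
    rw [IsHomLift.fac' x.p f h, IsHomLift.fac' x.p f h']
  intro z
  refine ⟨⟨fun {F F'} α β k => ?_⟩, ⟨fun {F F'} γ => ?_⟩, ⟨fun G => ?_⟩⟩
  · have k' := fun i => congrFun k i
    refine Stk.hom₂_ext fun t => faithful' (f := 𝟙 (x.p.obj (F.F.obj t))) (α.vert t) (β.vert t)
      fun i => ?_
    exact NatTrans.congr_app (congrArg Hom₂.τ (k' i)) t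
  · have hl : ∀ t i, (y i).p.IsHomLift (𝟙 (x.p.obj (F.F.obj t))) ((Hom₂.τ (γ i)).app t) :=
      fun t i => isHomLift_congr _ ((γ i).vert t) ((π i).obj_eq _)
    have ho : ∀ t, x.p.obj (F'.F.obj t) = x.p.obj (F.F.obj t) := fun t =>
      (F'.obj_eq t).trans (F.obj_eq t).symm
    choose h hh hπ using fun t => full (𝟙 (x.p.obj (F.F.obj t))) ⟨F.F.obj t, rfl⟩
      ⟨F'.F.obj t, ho t⟩ (fun i => (Hom₂.τ (γ i)).app t) (hl t)
    refine ⟨⟨⟨h, fun s t φ => ?_⟩, hh⟩, ?_⟩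
    · have l₁ : x.p.IsHomLift (z.p.map φ) (F.F.map φ) := isHomLift_map_of_eq F.w φ
      have l₂ : x.p.IsHomLift (z.p.map φ) (F'.F.map φ) := isHomLift_map_of_eq F'.w φ
      refine faithful' (f := z.p.map φ)
        (isHomLift_comp_id l₁ (isHomLift_congr _ (hh t) (F.obj_eq t)))
        (isHomLift_id_comp (isHomLift_congr _ (hh s) (F.obj_eq s)) l₂) fun i => ?_
      rw [Functor.map_comp, Functor.map_comp, hπ, hπ]
      exact (Hom₂.τ (γ i)).naturality φ
    · exact funext fun i => Stk.hom₂_ext fun t => hπ t i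
  · have hs : ∀ t : z.X, ∃ (a : x.X) (_ : x.p.obj a = z.p.obj t)
        (e : ∀ i, (π i).F.obj a ≅ (G i).F.obj t), ∀ i, (y i).p.IsHomLift (𝟙 (z.p.obj t)) (e i).hom :=
      fun t => by
        obtain ⟨a, e, h⟩ := surj (T := z.p.obj t) fun i => ⟨(G i).F.obj t, (G i).obj_eq t⟩
        exact ⟨a.1, a.2, e, h⟩
    choose a ha e he using hs
    have hl : ∀ {s t : z.X} (φ : s ⟶ t) (i : ι), (y i).p.IsHomLift (z.p.map φ)
        ((e s i).hom ≫ (G i).F.map φ ≫ (e t i).inv) := fun {s t} φ i =>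
      isHomLift_id_comp (he s i) (isHomLift_comp_id (isHomLift_map_of_eq (G i).w φ)
        (isHomLift_inv _ (he t i)))
    choose h hh hπ using fun (s t : z.X) (φ : s ⟶ t) => full (z.p.map φ) ⟨a s, ha s⟩ ⟨a t, ha t⟩
      (fun i => (e s i).hom ≫ (G i).F.map φ ≫ (e t i).inv) (hl φ)
    let H : z.X ⥤ x.X :=
      { obj t := a t
        map {s t} φ := h s t φ
        map_id t := by
          refine faithful' (hh t t (𝟙 t)) ?_ fun i => ?_
          · rw [z.p.map_id]
            exact IsHomLift.id (ha t)
          · rw [hπ, CategoryTheory.Functor.map_id, CategoryTheory.Functor.map_id, Category.id_comp, Iso.hom_inv_id]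
        map_comp {r s t} φ ψ := by
          refine faithful' (hh r t (φ ≫ ψ))
            (isHomLift_comp_eq (z.p.map_comp φ ψ).symm (hh r s φ) (hh s t ψ)) fun i => ?_
          rw [Functor.map_comp, hπ, hπ, hπ, Functor.map_comp]
          simp }
    refine ⟨⟨H, CategoryTheory.Functor.ext ha fun s t φ => ?_, fun _ _ => cart _⟩,
      ⟨CategoryTheory.Pi.isoMk fun i => Stk.isoMk
        (NatIso.ofComponents (fun t => e t i) fun {s t} φ => ?_) (fun t => ?_) (fun t => ?_)⟩⟩
    · have := hh s t φ
      exact IsHomLift.fac' x.p (z.p.map φ) (h s t φ)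
    · change (π i).F.map (h s t φ) ≫ _ = _
      rw [hπ]
      simp
      rfl
    · exact isHomLift_congr _ (he t i) rfl
    · exact isHomLift_congr _ (isHomLift_inv _ (he t i)) rfl

end StkProduct

/-- The rows of the projections of a product in `T₁` form a basis. -/
theorem TOne.exists_basis {m : ℕ} {x : TOne} {y : Fin m → TOne} {π : ∀ i, x ⟶ y i}
    (h : IsProduct π) : ∃ b : Module.Basis (Σ i, Fin (y i).as.exp) ℤ (Fin x.as.exp → ℤ),
      ∀ i j, b ⟨i, j⟩ = rowHom (π i).as (Pi.basisFun ℤ _ j) := by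
  let M : ∀ i, Matrix (Fin (y i).as.exp) (Fin x.as.exp) ℤ := fun i => (π i).as
  let A : Matrix (Σ i, Fin (y i).as.exp) (Fin x.as.exp) ℤ := fun s => M s.1 s.2
  have hz := h (TOne.pow 1)
  let col : ∀ {k : PowOne}, (Fin k.exp → ℤ) → (TOne.pow 1 ⟶ (⟨k⟩ : TOne)) :=
    fun v => ⟨Matrix.replicateCol (Fin 1) v⟩
  have hcol : ∀ (v : Fin x.as.exp → ℤ) i, col (k := x.as) v ≫ π i =
      col (k := (y i).as) (Matrix.mulVec (M i) v) := fun v i =>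
    congrArg Discrete.mk (Matrix.replicateCol_mulVec (M i) v).symm
  have hinj : ∀ {k : PowOne} {v v' : Fin k.exp → ℤ}, col (k := k) v = col v' → v = v' :=
    fun e => Matrix.replicateCol_injective (congrArg Discrete.as e)
  have bij : Function.Bijective (Matrix.mulVecLin A) := by
    constructor
    · intro v v' e
      have e' : ∀ i, col (k := x.as) v ≫ π i = col (k := x.as) v' ≫ π i := fun i => by
        rw [hcol, hcol]
        exact congrArg _ (funext fun j => congrFun e ⟨i, j⟩)
      have f : (Functor.pi' fun i => postcomp (TOne.pow 1) (π i)).obj (col (k := x.as) v) ⟶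
          (Functor.pi' fun i => postcomp (TOne.pow 1) (π i)).obj (col (k := x.as) v') :=
        fun i => eqToHom (e' i)
      exact hinj (LocallyDiscrete.eq_of_hom ((Functor.pi' fun i =>
        postcomp (TOne.pow 1) (π i)).preimage f))
    · intro c
      obtain ⟨v, ⟨e⟩⟩ := hz.essSurj.mem_essImage fun i => col (k := (y i).as) fun j => c ⟨i, j⟩
      obtain ⟨v, rfl⟩ : ∃ v', v = col (k := x.as) v' :=
        ⟨fun a => (v.as : Matrix (Fin x.as.exp) (Fin 1) ℤ) a (0 : Fin 1), congrArg Discrete.mk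
          (Matrix.ext fun a a' => congrArg (fun a' : Fin 1 =>
            (v.as : Matrix (Fin x.as.exp) (Fin 1) ℤ) a a') (Subsingleton.elim (α := Fin 1) a' 0))⟩
      refine ⟨v, funext fun s => ?_⟩
      have e₁ := LocallyDiscrete.eq_of_hom (e.hom s.1)
      have e₂ := hinj ((hcol v s.1).symm.trans e₁)
      exact congrFun e₂ s.2
  let e := LinearEquiv.ofBijective _ bij
  have h₁ : A * LinearMap.toMatrix' e.symm.toLinearMap = 1 := by
    have : A = LinearMap.toMatrix' e.toLinearMap := (LinearMap.toMatrix'_toLin' A).symm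
    rw [this, ← LinearMap.toMatrix'_comp]
    simp
  have h₂ : LinearMap.toMatrix' e.symm.toLinearMap * A = 1 := by
    have : A = LinearMap.toMatrix' e.toLinearMap := (LinearMap.toMatrix'_toLin' A).symm
    rw [this, ← LinearMap.toMatrix'_comp]
    simp
  let L := Matrix.toLin'OfInv (M := (LinearMap.toMatrix' e.symm.toLinearMap).transpose)
    (M' := A.transpose) (by rw [← Matrix.transpose_mul, h₁, Matrix.transpose_one])
    (by rw [← Matrix.transpose_mul, h₂, Matrix.transpose_one])
  refine ⟨Module.Basis.ofEquivFun L.symm, fun i j => ?_⟩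
  rw [Module.Basis.coe_ofEquivFun, rowHom_apply, Pi.basisFun_apply, Matrix.single_one_vecMul]
  change Matrix.mulVec A.transpose _ = _
  rw [Matrix.mulVec_single_one]
  rfl

section

variable {B : Type u} [Category.{v} B] {X : Type w} [Category.{w'} X] {p : X ⥤ B}
  {P : PicardStr p} {n : ℕ}

namespace SmallFam

/-- The value of a presented family over `T`, in the fibre over `T`. -/
noncomputable def fibPt {T : B} (c : (proj P n).Fiber T) (r : Fin n → ℤ) : p.Fiber T :=
  ⟨(c.1.fam.fam.pt r).1, (c.1.fam.fam.pt r).2.trans c.2⟩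

variable (hp : p.IsFibered) {ι : Type*} (b : Module.Basis ι ℤ (Fin n → ℤ)) {g : ι → (Fin n → ℤ)}
  (hg : ∀ i, b i = g i)

include hp hg

theorem exists_hom {S T : B} (f : S ⟶ T) (c : (proj P n).Fiber S) (c' : (proj P n).Fiber T)
    (φ : ∀ i, FibHom p f (fibPt c (g i)) (fibPt c' (g i))) :
    ∃ h : c.1 ⟶ c'.1, (proj P n).IsHomLift f h ∧ ∀ i, h.arr (g i) = (φ i).1 := by
  obtain rfl : b = g := funext hg
  obtain ⟨c, rfl⟩ := c
  obtain ⟨c', rfl⟩ := c'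
  obtain ⟨h, rfl, h₂⟩ := Fam.exists_hom b hp (x := c.fam) (y := c'.fam) f φ
  exact ⟨h, isHomLift_base _, h₂⟩

theorem hom_ext_basis {S T : B} {f : S ⟶ T} {c c' : SmallFam P n} {h h' : c ⟶ c'}
    (l : (proj P n).IsHomLift f h) (l' : (proj P n).IsHomLift f h')
    (e : ∀ i, h.arr (g i) = h'.arr (g i)) : h = h' := by
  obtain rfl : b = g := funext hg
  refine Fam.hom_ext_basis b hp ?_ e
  exact (IsHomLift.fac' (proj P n) f h).trans (IsHomLift.fac' (proj P n) f h').symm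

/-- Every tuple of objects is, up to isomorphism, the tuple of values at a basis of an additive
family. -/
theorem exists_obj [Finite ι] {T : B} (x : ι → p.Fiber T) :
    ∃ c : (proj P n).Fiber T, ∀ i, Nonempty (fibPt c (g i) ≅ x i) := by
  obtain rfl : b = g := funext hg
  obtain ⟨j, ⟨e⟩⟩ := Finite.exists_equiv_fin ι
  obtain ⟨c, i, hi⟩ := (eval_isFibEquiv (P := P) hp (b.reindex e)).surj
    (⟨⟨T, fun k => x (e.symm k)⟩, rfl⟩ : (Pow.proj p j).Fiber T)
  obtain ⟨c, rfl⟩ := c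
  have hb : Pow.Hom.base i.hom = 𝟙 ((proj P n).obj c) :=
    (IsHomLift.fac' (Pow.proj p j) (𝟙 ((proj P n).obj c)) i.hom).trans
      ((congrArg (_ ≫ ·) (Category.id_comp _)).trans (Category.id_comp _))
  have h : ∀ k, Nonempty (fibPt (P := P) ⟨c, rfl⟩ (b (e.symm k)) ≅ x (e.symm k)) := fun k => by
    have l := Pow.Hom.lies i.hom k
    rw [hb] at l
    have hk : b (e.symm k) = b.reindex e k := (b.reindex_apply e k).symm
    refine ⟨c.fam.fam.ptIso hk ≪≫ fiberIsoMk (x := c.fam.fam.pt (b.reindex e k))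
      ⟨Pow.Hom.arr i.hom k, Pow.Hom.arr i.inv k, ?_, ?_⟩ l⟩
    · exact congrFun (congrArg Pow.Hom.arr i.hom_inv_id) k
    · exact congrFun (congrArg Pow.Hom.arr i.inv_hom_id) k
  refine ⟨⟨c, rfl⟩, fun i => ?_⟩
  have := h (e i)
  rwa [e.symm_apply_apply] at this

end SmallFam

end

namespace PicardStack

variable {C : Type u} [Category.{v} C] {J : GrothendieckTopology C} {U : C}
  (P : PicardStack.{max u v w₁, max v w₂} (J.over U))

/-- If the `g i` carry the standard bases to the parts of a basis of `ℤⁿ`, restriction along them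
exhibits the families indexed by `ℤⁿ` as a product: both sides are determined by the values at the
basis. -/
theorem isProduct_famComap {m n : ℕ} {k : Fin m → ℕ} (g : ∀ i, (Fin (k i) → ℤ) →+ (Fin n → ℤ))
    (b : Module.Basis (Σ i, Fin (k i)) ℤ (Fin n → ℤ))
    (hb : ∀ i j, b ⟨i, j⟩ = g i (Pi.basisFun ℤ _ j)) : IsProduct fun i => P.famComap (g i) := by
  have hp := P.isStack.fibered
  have hv : ∀ s : Σ i, Fin (k i), b s = g s.1 (Pi.basisFun ℤ _ s.2) := fun s => hb s.1 s.2
  refine Stk.isProduct_of _ (fun h => SmallFam.cart P.isStack (IsHomLift.map (P.famStk n).p h))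
    (fun {S T} f a c φ hφ => ?_) (fun {a c} h h' e e' => ?_) (fun {T} c => ?_)
  · obtain ⟨h, h₁, h₂⟩ := SmallFam.exists_hom hp b hv f a c
      fun s => ⟨(φ s.1).arr (Pi.basisFun ℤ _ s.2), SmallFam.lies_of (hφ s.1) _⟩
    refine ⟨h, h₁, fun i => ?_⟩
    exact SmallFam.hom_ext_basis hp (Pi.basisFun ℤ (Fin (k i))) (fun _ => rfl)
      ((P.famComap (g i)).lift_map h h₁) (hφ i) fun j => h₂ ⟨i, j⟩
  · exact SmallFam.hom_ext_basis hp b hv (IsHomLift.map (SmallFam.proj P.str n) h)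
      (by
        have := IsHomLift.map (SmallFam.proj P.str n) h'
        exact e ▸ this)
      fun s => congrArg (fun h => Fam.Hom.arr h (Pi.basisFun ℤ _ s.2)) (e' s.1)
  · obtain ⟨a, e⟩ := SmallFam.exists_obj hp b hv
      fun s => SmallFam.fibPt (P := P.str) (c s.1) (Pi.basisFun ℤ _ s.2)
    choose h h₁ h₂ using fun i => SmallFam.exists_hom hp (Pi.basisFun ℤ (Fin (k i)))
      (fun _ => rfl) (𝟙 T) (((P.famComap (g i)).fib rfl).obj a) (c i) fun j => (e ⟨i, j⟩).some.hom
    let H : ∀ i, ((P.famComap (g i)).fib rfl).obj a ⟶ c i := fun i => ⟨h i, h₁ i⟩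
    have h₃ : ∀ i, IsIso (H i) := fun i => SmallFam.groupoid P.isStack _
    exact ⟨a, fun i => fiberIsoVal (asIso (H i)), h₁⟩

theorem preserves_famPseudofunctor : PreservesFiniteProducts P.famPseudofunctor := by
  intro m x y π h
  obtain ⟨b, hb⟩ := TOne.exists_basis h
  exact P.isProduct_famComap (fun i => rowHom (π i).as) b hb

end PicardStack

end PicardMatrix

namespace PicardMatrix

/-! ### Strong transformations of algebras, objectwise -/

theorem IsVertical.inv {B : Type u} [Category.{v} B] {X : Type w} [Category.{w'} X]
    {E : Type*} [Category* E] {q : X ⥤ B} {F F' : E ⥤ X} {τ : F ⟶ F'} [IsIso τ]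
    (h : IsVertical q τ) : IsVertical q (CategoryTheory.inv τ) := fun x => by
  have h₁ := isHomLift_inv ((asIso τ).app x) (h x)
  exact isHomLift_congr _ h₁ rfl

namespace Alg

variable {C : Type u} [Category.{v} C] {J : GrothendieckTopology C}

section Raw

variable {A A' : Alg.{w₁, w₂} J}

/-- The component at `t` of an arrow of 2-algebras, as a functor. -/
abbrev comp (α : A ⟶ A') (t : TOne) : (A.alg.A.obj t).X ⥤ (A'.alg.A.obj t).X :=
  (α.hom.app t).fn.F

/-- The compatibility of an arrow of 2-algebras with a matrix. -/
abbrev nat (α : A ⟶ A') {a b : TOne} (M : a ⟶ b) :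
    (A.alg.A.map M).F ⋙ comp α b ⟶ comp α a ⋙ (A'.alg.A.map M).F :=
  StackTot.Hom₂.τ (α.hom.naturality M).hom

theorem nat_id (α : A ⟶ A') (a : TOne) (z : (A.alg.A.obj a).X) :
    (nat α (𝟙 a)).app z ≫ (Stk.Hom₂.τ (A'.alg.A.mapId a).hom).app ((comp α a).obj z) =
      (comp α a).map ((Stk.Hom₂.τ (A.alg.A.mapId a).hom).app z) := by
  have h := NatTrans.congr_app (congrArg StackTot.Hom₂.τ (α.hom.naturality_id a)) z
  have h' : (nat α (𝟙 a)).app z ≫ ((Stk.Hom₂.τ (A'.alg.A.mapId a).hom).app ((comp α a).obj z) ≫ 𝟙 _) =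
    (comp α a).map ((Stk.Hom₂.τ (A.alg.A.mapId a).hom).app z ≫ 𝟙 _) ≫ 𝟙 _ ≫ 𝟙 _ := h
  simpa using h'

theorem nat_comp (α : A ⟶ A') {a b c : TOne} (M : a ⟶ b) (N : b ⟶ c) (z : (A.alg.A.obj a).X) :
    (nat α (M ≫ N)).app z ≫ (Stk.Hom₂.τ (A'.alg.A.mapComp M N).hom).app ((comp α a).obj z) =
      (comp α c).map ((Stk.Hom₂.τ (A.alg.A.mapComp M N).hom).app z) ≫
        (nat α N).app ((A.alg.A.map M).F.obj z) ≫ (A'.alg.A.map N).F.map ((nat α M).app z) := by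
  have h := NatTrans.congr_app (congrArg StackTot.Hom₂.τ (α.hom.naturality_comp M N)) z
  have h' : (nat α (M ≫ N)).app z ≫
      ((Stk.Hom₂.τ (A'.alg.A.mapComp M N).hom).app ((comp α a).obj z) ≫ 𝟙 _) =
      (comp α c).map ((Stk.Hom₂.τ (A.alg.A.mapComp M N).hom).app z ≫ 𝟙 _) ≫ 𝟙 _ ≫
        (nat α N).app ((A.alg.A.map M).F.obj z) ≫ 𝟙 _ ≫
          (A'.alg.A.map N).F.map ((nat α M).app z) ≫ 𝟙 _ := h
  simpa using h'

instance (α : A ⟶ A') {a b : TOne} (M : a ⟶ b) (z : (A.alg.A.obj a).X) :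
    IsIso ((nat α M).app z) :=
  ⟨(StackTot.Hom₂.τ (α.hom.naturality M).inv).app z,
    NatTrans.congr_app (congrArg StackTot.Hom₂.τ (α.hom.naturality M).hom_inv_id) z,
    NatTrans.congr_app (congrArg StackTot.Hom₂.τ (α.hom.naturality M).inv_hom_id) z⟩

theorem nat_vert (α : A ⟶ A') {a b : TOne} (M : a ⟶ b) : IsVertical (A'.alg.A.obj b).p (nat α M) :=
  StackTot.Hom₂.vert (α.hom.naturality M).hom

/-- The constructor of arrows of 2-algebras. -/
noncomputable def homMk (f : A.base ⟶ A'.base)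
    (F : ∀ t, CartFunctor (Over.map f) (A.alg.A.obj t).p (A'.alg.A.obj t).p)
    (ν : ∀ {a b : TOne} (M : a ⟶ b), (A.alg.A.map M).F ⋙ (F b).F ⟶ (F a).F ⋙ (A'.alg.A.map M).F)
    (hν : ∀ {a b : TOne} (M : a ⟶ b), IsVertical (A'.alg.A.obj b).p (ν M))
    (iso : ∀ {a b : TOne} (M : a ⟶ b) (z : (A.alg.A.obj a).X), IsIso ((ν M).app z))
    (h_id : ∀ (a : TOne) (z : (A.alg.A.obj a).X),
      (ν (𝟙 a)).app z ≫ (Stk.Hom₂.τ (A'.alg.A.mapId a).hom).app ((F a).F.obj z) =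
        (F a).F.map ((Stk.Hom₂.τ (A.alg.A.mapId a).hom).app z))
    (h_comp : ∀ {a b c : TOne} (M : a ⟶ b) (N : b ⟶ c) (z : (A.alg.A.obj a).X),
      (ν (M ≫ N)).app z ≫ (Stk.Hom₂.τ (A'.alg.A.mapComp M N).hom).app ((F a).F.obj z) =
        (F c).F.map ((Stk.Hom₂.τ (A.alg.A.mapComp M N).hom).app z) ≫
          (ν N).app ((A.alg.A.map M).F.obj z) ≫ (A'.alg.A.map N).F.map ((ν M).app z)) :
    A ⟶ A' where
  base := f
  lies _ := rfl
  hom :=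
    { app t := ⟨f, F t⟩
      naturality {a b} M := StackTot.isoMk ((Category.id_comp f).trans (Category.comp_id f).symm)
        (@asIso _ _ _ _ (ν M) (NatIso.isIso_of_isIso_app (ν M))) (hν M)
        (@IsVertical.inv _ _ _ _ _ _ _ _ _ _ (NatIso.isIso_of_isIso_app (ν M)) (hν M))
      naturality_naturality {a b M N} η := by
        obtain rfl := LocallyDiscrete.eq_of_hom η
        obtain rfl : η = 𝟙 _ := Subsingleton.elim _ _
        simp only [PrelaxFunctor.map₂_id, id_whiskerRight, whiskerLeft_id, Category.id_comp,
          Category.comp_id]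
      naturality_id a := by
        refine StackTot.hom₂_ext fun z => ?_
        change (ν (𝟙 a)).app z ≫
          ((Stk.Hom₂.τ (A'.alg.A.mapId a).hom).app ((F a).F.obj z) ≫ 𝟙 _) =
          (F a).F.map ((Stk.Hom₂.τ (A.alg.A.mapId a).hom).app z ≫ 𝟙 _) ≫ 𝟙 _ ≫ 𝟙 _
        have := h_id a z
        simpa using this
      naturality_comp {a b c} M N := by
        refine StackTot.hom₂_ext fun z => ?_
        change (ν (M ≫ N)).app z ≫
          ((Stk.Hom₂.τ (A'.alg.A.mapComp M N).hom).app ((F a).F.obj z) ≫ 𝟙 _) =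
          (F c).F.map ((Stk.Hom₂.τ (A.alg.A.mapComp M N).hom).app z ≫ 𝟙 _) ≫ 𝟙 _ ≫
            (ν N).app ((A.alg.A.map M).F.obj z) ≫ 𝟙 _ ≫
              (A'.alg.A.map N).F.map ((ν M).app z) ≫ 𝟙 _
        have := h_comp M N z
        simpa using this }

/-- The component of a 2-arrow. -/
abbrev mod {α β : A ⟶ A'} (m : α ⟶ β) (t : TOne) : comp α t ⟶ comp β t :=
  StackTot.Hom₂.τ (m.hom.as.app t)

theorem mod_nat {α β : A ⟶ A'} (m : α ⟶ β) {a b : TOne} (M : a ⟶ b) (z : (A.alg.A.obj a).X) :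
    (mod m b).app ((A.alg.A.map M).F.obj z) ≫ (nat β M).app z =
      (nat α M).app z ≫ (A'.alg.A.map M).F.map ((mod m a).app z) :=
  NatTrans.congr_app (congrArg StackTot.Hom₂.τ (m.hom.as.naturality M)) z

theorem mod_ext {α β : A ⟶ A'} {m m' : α ⟶ β}
    (h : ∀ t z, (mod m t).app z = (mod m' t).app z) : m = m' := by
  apply hom₂_ext
  apply Pseudofunctor.StrongTrans.Hom.ext
  apply Pseudofunctor.StrongTrans.Modification.ext
  exact funext fun t => StackTot.hom₂_ext fun z => h t z

/-- The constructor of 2-arrows. -/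
def modMk {α β : A ⟶ A'} (hb : α.base = β.base) (m : ∀ t, comp α t ⟶ comp β t)
    (hm : ∀ t, IsVertical (A'.alg.A.obj t).p (m t))
    (h : ∀ {a b : TOne} (M : a ⟶ b) (z : (A.alg.A.obj a).X),
      (m b).app ((A.alg.A.map M).F.obj z) ≫ (nat β M).app z =
        (nat α M).app z ≫ (A'.alg.A.map M).F.map ((m a).app z)) : α ⟶ β :=
  ⟨⟨⟨fun t => ⟨((α.lies t).trans hb).trans (β.lies t).symm, m t, hm t⟩,
    fun M => StackTot.hom₂_ext fun z => h M z⟩⟩⟩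

end Raw

end Alg

end PicardMatrix

namespace PicardMatrix

/-! ### The algebra of families, on arrows -/

namespace SmallFam

section

variable {B : Type u} [Category.{v} B] {X : Type w} [Category.{w'} X] {p : X ⥤ B} {n : ℕ}
  {B' : Type u'} [Category.{v'} B'] {X' : Type w₁} [Category.{w₂} X'] {q : X' ⥤ B'}
  {P : PicardStr p} {Q : PicardStr q} {K : B ⥤ B'} {F : CartFunctor K p q} (s : AddStr P Q F)

theorem push_ptIso_aux {G : Type} [AddCommGroup G] {x : Fam P G} {y : Fam Q G}
    (i : y ≅ (Fam.push s).obj x) {a b : G} (e : a = b) :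
    i.hom.arr a ≫ F.F.map (x.fam.ptIso e).hom.1 ≫ i.inv.arr b = (y.fam.ptIso e).hom.1 := by
  subst e
  refine (congrArg (fun t => i.hom.arr a ≫ t ≫ i.inv.arr a) (F.F.map_id _)).trans ?_
  refine (congrArg (i.hom.arr a ≫ ·) (Category.id_comp _)).trans ?_
  exact congrArg (fun h => Fam.Hom.arr h a) i.hom_inv_id

theorem push_comapCongr (hq : q.IsFibered) {k : ℕ} {g g' : (Fin k → ℤ) →+ (Fin n → ℤ)}
    (e : g = g') (c : SmallFam P n) : (push s hq).map ((comapCongr e).hom.app c) =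
      (comapCongr e).hom.app ((push s hq).obj c) :=
  hom_ext fun r => push_ptIso_aux s (exists_pushIso s hq c.z).choose
    (congrArg c.f (DFunLike.congr_fun e r))

/-- The action of an additive functor commutes with restriction along a homomorphism. -/
noncomputable def comapPush (hq : q.IsFibered) {k : ℕ} (g : (Fin k → ℤ) →+ (Fin n → ℤ)) :
    comap g ⋙ push s hq ⟶ push s hq ⋙ comap g where
  app c := 𝟙 ((push s hq).obj ((comap g).obj c))
  naturality {c c'} h := by
    refine (Category.comp_id _).trans (Eq.trans ?_ (Category.id_comp _).symm)
    rfl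

end

end SmallFam

namespace Picard

variable {C : Type u} [Category.{v} C] {J : GrothendieckTopology C}

/-- The 2-algebra of families of a Picard stack. -/
noncomputable def toAlg (P : Picard.{w₁, w₂} J) : Alg.{w₁, w₂} J :=
  ⟨P.base, ⟨P.pic.famPseudofunctor, P.pic.preserves_famPseudofunctor⟩⟩

/-- The arrow of 2-algebras defined by an additive functor. -/
noncomputable def toAlgMap {P Q : Picard.{w₁, w₂} J} (F : P ⟶ Q) : P.toAlg ⟶ Q.toAlg :=
  Alg.homMk (A := P.toAlg) (A' := Q.toAlg) F.hom.base
    (fun t => SmallFam.pushCart (n := t.as.exp) F.add Q.pic.isStack)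
    (fun M => SmallFam.comapPush F.add Q.pic.isStack.fibered (rowHom M.as))
    (fun M c => IsHomLift.id (p := SmallFam.proj Q.pic.str _) rfl)
    (fun {a b} M c => inferInstanceAs (IsIso (𝟙 ((SmallFam.push F.add Q.pic.isStack.fibered).obj
      ((SmallFam.comap (rowHom M.as)).obj c)))))
    (fun a c => (Category.id_comp _).trans
      (SmallFam.push_comapCongr F.add Q.pic.isStack.fibered (rowHom_one a.as.exp) c).symm)
    (fun {a b d} M N c => by
      refine (Category.id_comp _).trans ((SmallFam.push_comapCongr F.add Q.pic.isStack.fibered (rowHom_mul M.as N.as) c).symm.trans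
        (Eq.symm ?_))
      refine (congrArg (((SmallFam.push F.add Q.pic.isStack.fibered).map
        ((SmallFam.comapCongr (rowHom_mul M.as N.as)).hom.app c)) ≫ ·)
        (Category.id_comp (obj := SmallFam Q.pic.str _) _)).trans ?_
      exact Category.comp_id (obj := SmallFam Q.pic.str _) _)

end Picard

end PicardMatrix

namespace PicardMatrix

/-! ### Comparison of images of families -/

namespace Fam

section

variable {B : Type u} [Category.{v} B] {X : Type w} [Category.{w'} X] {p : X ⥤ B}
  {G : Type} [AddCommGroup G]
  {B' : Type u'} [Category.{v'} B'] {X' : Type w₁} [Category.{w₂} X'] {q : X' ⥤ B'}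
  {P : PicardStr p} {Q : PicardStr q} {K K' : B ⥤ B'} {F : CartFunctor K p q}
  {F' : CartFunctor K' p q} {s : AddStr P Q F} {s' : AddStr P Q F'}

/-- The arrow of families defined by a morphism of additive functors. -/
def pushTrans (hK : K = K') {τ : F.F ⟶ F'.F} {hτ : IsVertical q τ} (a : IsAdditive s s' hτ)
    (x : Fam P G) : (push s).obj x ⟶ (push s').obj x where
  base := eqToHom (Functor.congr_obj hK x.base)
  arr r := τ.app (x.fam.pt r).1
  lies r := by
    subst hK
    exact (hτ.fibApp rfl rfl (x.fam.pt r)).2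
  compat {r t u} h := by
    subst hK
    have k := congrArg Subtype.val (a.eq rfl rfl (x.fam.pt r) (x.fam.pt t))
    exact (comp_aux (τ.naturality (x.fam.σ h).hom.1) k).symm

/-- The image of a family under the identity. -/
def pushId {K : B ⥤ B} (hK : K = 𝟭 B) (P : PicardStr p) (x : Fam P G) :
    (push (AddStr.id hK P)).obj x ≅ x where
  hom := ⟨eqToHom (Functor.congr_obj hK x.base), fun r => 𝟙 (x.fam.pt r).1, fun r => by
      subst hK
      exact IsHomLift.id (x.fam.pt r).2, fun {r t u} h => by
      subst hK
      exact (Category.id_comp _).trans ((congrArg (((x.fam.push (AddStr.id rfl P) rfl).σ h).hom.1 ≫ ·)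
        (P.map_eq_id rfl rfl _ _)).trans ((Category.comp_id _).trans (Category.comp_id _))).symm⟩
  inv := ⟨eqToHom (Functor.congr_obj hK x.base).symm, fun r => 𝟙 (x.fam.pt r).1, fun r => by
      subst hK
      exact IsHomLift.id (x.fam.pt r).2, fun {r t u} h => by
      subst hK
      exact (Category.id_comp _).trans ((Category.comp_id _).trans
        ((congrArg ((x.fam.σ h).hom.1 ≫ ·) (P.map_eq_id rfl rfl _ _)).trans
          (Category.comp_id _)).symm)⟩
  hom_inv_id := Fam.hom_ext fun r => Category.comp_id _
  inv_hom_id := Fam.hom_ext fun r => Category.comp_id _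

variable {B'' : Type*} [Category* B''] {X'' : Type*} [Category* X''] {H : B' ⥤ B''}
  {r : X'' ⥤ B''} {R : PicardStr r} {E : CartFunctor H q r} {L : B ⥤ B''}

/-- The image of a family under a composite. -/
def pushComp (hL : K ⋙ H = L) (s : AddStr P Q F) (t : AddStr Q R E) (x : Fam P G) :
    (push (s.comp hL t)).obj x ≅ (push t).obj ((push s).obj x) where
  hom := ⟨eqToHom (Functor.congr_obj hL x.base).symm, fun r => 𝟙 (E.F.obj (F.F.obj (x.fam.pt r).1)),
    fun r => by
      subst hL
      exact IsHomLift.id (((push t).obj ((push s).obj x)).fam.pt r).2, fun {_ _ _} h => by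
      subst hL
      refine (Category.id_comp _).trans (Eq.trans ?_ (Eq.trans (congrArg
        (((x.fam.push (s.comp rfl t) rfl).σ h).hom.1 ≫ ·) (R.map_eq_id rfl rfl _ _))
        (Category.comp_id _)).symm)
      exact (congrArg (· ≫ _) (E.F.map_comp _ _)).trans (Category.assoc _ _ _)⟩
  inv := ⟨eqToHom (Functor.congr_obj hL x.base), fun r => 𝟙 (E.F.obj (F.F.obj (x.fam.pt r).1)),
    fun r => by
      subst hL
      exact IsHomLift.id (((push t).obj ((push s).obj x)).fam.pt r).2, fun {_ _ _} h => by
      subst hL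
      refine (Category.id_comp _).trans (Eq.trans ?_ (Eq.trans (congrArg
        (((((push s).obj x).fam.push t rfl).σ h).hom.1 ≫ ·) (R.map_eq_id rfl rfl _ _))
        (Category.comp_id _)).symm)
      exact ((congrArg (· ≫ _) (E.F.map_comp _ _)).trans (Category.assoc _ _ _)).symm⟩
  hom_inv_id := Fam.hom_ext fun r => Category.comp_id _
  inv_hom_id := Fam.hom_ext fun r => Category.comp_id _

end

end Fam

namespace Alg

variable {C : Type u} [Category.{v} C] {J : GrothendieckTopology C}

theorem nat_id_app (A : Alg.{w₁, w₂} J) {a b : TOne} (M : a ⟶ b) (z : (A.alg.A.obj a).X) :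
    (nat (𝟙 A) M).app z = 𝟙 ((A.alg.A.map M).F.obj z) :=
  Category.comp_id (𝟙 ((A.alg.A.map M).F.obj z))

theorem nat_comp_app {A A' A'' : Alg.{w₁, w₂} J} (α : A ⟶ A') (β : A' ⟶ A'') {a b : TOne}
    (M : a ⟶ b) (z : (A.alg.A.obj a).X) : (nat (α ≫ β) M).app z =
      (comp β b).map ((nat α M).app z) ≫ (nat β M).app ((comp α a).obj z) := by
  have h : (nat (α ≫ β) M).app z = 𝟙 _ ≫ (comp β b).map ((nat α M).app z) ≫ 𝟙 _ ≫
    (nat β M).app ((comp α a).obj z) ≫ 𝟙 _ := rfl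
  simpa using h

/-- The constructor of invertible 2-arrows. -/
def modIso {A A' : Alg.{w₁, w₂} J} {α β : A ⟶ A'} (hb : α.base = β.base)
    (m : ∀ t, comp α t ≅ comp β t)
    (hm : ∀ t, IsVertical (A'.alg.A.obj t).p (m t).hom)
    (h : ∀ {a b : TOne} (M : a ⟶ b) (z : (A.alg.A.obj a).X),
      (m b).hom.app ((A.alg.A.map M).F.obj z) ≫ (nat β M).app z =
        (nat α M).app z ≫ (A'.alg.A.map M).F.map ((m a).hom.app z)) : α ≅ β where
  hom := modMk hb (fun t => (m t).hom) hm h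
  inv := modMk hb.symm (fun t => (m t).inv)
    (fun t z => isHomLift_congr _ (isHomLift_inv ((m t).app z) (hm t z)) rfl) fun {a b} M z => by
      rw [← cancel_epi ((m b).hom.app ((A.alg.A.map M).F.obj z)), Iso.hom_inv_id_app_assoc,
        reassoc_of% h M z, ← Functor.map_comp, Iso.hom_inv_id_app]
      exact ((congrArg (_ ≫ ·) ((A'.alg.A.map M).F.map_id _)).trans (Category.comp_id _)).symm
  hom_inv_id := mod_ext fun t z => (m t).hom_inv_id_app z
  inv_hom_id := mod_ext fun t z => (m t).inv_hom_id_app z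

end Alg

namespace SmallFam

variable {B : Type u} [Category.{v} B] {X : Type w} [Category.{w'} X] {p : X ⥤ B} {n : ℕ}
  {P : PicardStr p}

/-- An isomorphism between presented families. -/
def isoMk {c c' : SmallFam P n} (i : c.fam ≅ c'.fam) : c ≅ c' where
  hom := i.hom
  inv := i.inv
  hom_inv_id := i.hom_inv_id
  inv_hom_id := i.inv_hom_id

end SmallFam

namespace Picard

variable {C : Type u} [Category.{v} C] {J : GrothendieckTopology C} {P Q R S : Picard.{w₁, w₂} J}

/-- The comparison of a presented family with its image. -/
noncomputable abbrev cmp (F : P ⟶ Q) {n : ℕ} (c : SmallFam P.pic.str n) :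
    ((SmallFam.push F.add Q.pic.isStack.fibered).obj c).fam ≅ (Fam.push F.add).obj c.fam :=
  SmallFam.pushIso F.add Q.pic.isStack.fibered c

theorem conj_naturality {V : Type*} [Category* V] {a a' b b' x x' y y' : V} (u : a ≅ x)
    (u' : a' ≅ x') (v : b ≅ y) (v' : b' ≅ y') {f : x ⟶ x'} {g : y ⟶ y'} {t : x ⟶ y}
    {t' : x' ⟶ y'} (h : f ≫ t' = t ≫ g) :
    (u.hom ≫ f ≫ u'.inv) ≫ u'.hom ≫ t' ≫ v'.inv =
      (u.hom ≫ t ≫ v.inv) ≫ v.hom ≫ g ≫ v'.inv := by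
  simp [reassoc_of% h]

theorem conj_naturality_hom {V : Type*} [Category* V] {a a' x x' y y' : V} (u : a ≅ x)
    (u' : a' ≅ x') (i : x ≅ y) (i' : x' ≅ y') {f : x ⟶ x'} {g : y ⟶ y'}
    (h : f ≫ i'.hom = i.hom ≫ g) :
    (u.hom ≫ f ≫ u'.inv) ≫ (u' ≪≫ i').hom = (u ≪≫ i).hom ≫ g := by
  simp [h]

theorem conj_naturality_comp {V W : Type*} [Category* V] [Category* W] (H : V ⥤ W)
    {a a' x x' z z' : W} {y y' t t' : V} (u : a ≅ x) (u' : a' ≅ x') (k : x ≅ H.obj y)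
    (k' : x' ≅ H.obj y') (l : t ≅ y) (l' : t' ≅ y') (m : z ≅ H.obj t) (m' : z' ≅ H.obj t')
    {f : x ⟶ x'} {g : y ⟶ y'} (h : f ≫ k'.hom = k.hom ≫ H.map g) :
    (u.hom ≫ f ≫ u'.inv) ≫ (u' ≪≫ k' ≪≫ H.mapIso l'.symm ≪≫ m'.symm).hom =
      (u ≪≫ k ≪≫ H.mapIso l.symm ≪≫ m.symm).hom ≫ m.hom ≫ H.map (l.hom ≫ g ≫ l'.inv) ≫ m'.inv := by
  simp [reassoc_of% h]

theorem isHomLift_of_base {n : ℕ} {c c' : SmallFam P.pic.str n} (h : c ⟶ c')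
    (e : c.fam.base = c'.fam.base) (hb : Fam.Hom.base h = eqToHom e) :
    (SmallFam.proj P.pic.str n).IsHomLift (𝟙 c.fam.base) h := by
  refine IsHomLift.of_fac' _ _ _ rfl e.symm (hb.trans ?_)
  exact (eqToHom_trans rfl e).symm.trans (congrArg (_ ≫ ·) (Category.id_comp _).symm)

theorem eqToHom_conj {V : Type*} [Category* V] {a b c d : V} {f : a ⟶ b} {g : c ⟶ d} (e : b = c)
    (ha : a = b) (hd : c = d) (hf : f = eqToHom ha) (hg : g = eqToHom hd) :
    f ≫ eqToHom e ≫ g = eqToHom ((ha.trans e).trans hd) := by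
  subst ha e hd hf hg
  simp

theorem cmp_hom_base (F : P ⟶ Q) {n : ℕ} (c : SmallFam P.pic.str n) :
    Fam.Hom.base (cmp F c).hom = 𝟙 _ := SmallFam.pushIso_hom_base _ _ _

theorem cmp_inv_base (F : P ⟶ Q) {n : ℕ} (c : SmallFam P.pic.str n) :
    Fam.Hom.base (cmp F c).inv = 𝟙 _ := SmallFam.pushIso_inv_base _ _ _

/-- The 2-arrow of 2-algebras defined by a morphism of additive functors. -/
noncomputable def toAlgMap₂ {F F' : P ⟶ Q} (τ : F ⟶ F') : toAlgMap F ⟶ toAlgMap F' :=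
  Alg.modMk (A := P.toAlg) (A' := Q.toAlg) (α := toAlgMap F) (β := toAlgMap F') τ.hom.base_eq
    (fun _ =>
      { app c := SmallFam.homMk ((cmp F c).hom ≫
          Fam.pushTrans (congrArg Over.map τ.hom.base_eq) τ.add (SmallFam.fam c) ≫
            (cmp F' c).inv)
        naturality {c c'} h := conj_naturality (cmp F c) (cmp F c') (cmp F' c) (cmp F' c')
          (Fam.hom_ext fun r => τ.hom.τ.naturality (Fam.Hom.arr h r)) })
    (fun _ c => isHomLift_of_base _ (Functor.congr_obj (congrArg Over.map τ.hom.base_eq) (SmallFam.fam c).base) 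
      (eqToHom_conj (Functor.congr_obj (congrArg Over.map τ.hom.base_eq) (SmallFam.fam c).base)
        rfl rfl (cmp_hom_base F c) (cmp_inv_base F' c)))
    (fun _ _ => (Category.comp_id (obj := SmallFam Q.pic.str _) _).trans
      (Category.id_comp (obj := SmallFam Q.pic.str _) _).symm)

/-- The comparison 2-arrow for an identity. -/
noncomputable def toAlgMapId (P : Picard.{w₁, w₂} J) : toAlgMap (𝟙 P) ≅ 𝟙 P.toAlg :=
  Alg.modIso (A := P.toAlg) (A' := P.toAlg) (α := toAlgMap (𝟙 P)) (β := 𝟙 P.toAlg) rfl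
    (fun _ => NatIso.ofComponents (fun c => SmallFam.isoMk (cmp (𝟙 P) c ≪≫
        Fam.pushId (Over.mapId_eq P.base) P.pic.str (SmallFam.fam c))) fun {c c'} _ =>
      conj_naturality_hom (cmp (𝟙 P) c) (cmp (𝟙 P) c') (Fam.pushId (Over.mapId_eq P.base) _ _)
        (Fam.pushId (Over.mapId_eq P.base) _ _)
        (Fam.hom_ext fun _ => (Category.comp_id _).trans (Category.id_comp _).symm))
    (fun _ c => isHomLift_of_base _ (Functor.congr_obj (Over.mapId_eq P.base) (SmallFam.fam c).base) 
      ((congrArg (· ≫ _) (cmp_hom_base (𝟙 P) c)).trans (Category.id_comp _)))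
    (fun M c => (congrArg (_ ≫ ·) (Alg.nat_id_app P.toAlg M c)).trans
      ((Category.comp_id (obj := SmallFam P.pic.str _) _).trans
        (Category.id_comp (obj := SmallFam P.pic.str _) _).symm))

/-- The comparison 2-arrow for a composite. -/
noncomputable def toAlgMapComp (F : P ⟶ Q) (G : Q ⟶ R) :
    toAlgMap (F ≫ G) ≅ toAlgMap F ≫ toAlgMap G :=
  Alg.modIso (A := P.toAlg) (A' := R.toAlg) (α := toAlgMap (F ≫ G)) (β := toAlgMap F ≫ toAlgMap G)
    rfl
    (fun _ => NatIso.ofComponents (fun c => SmallFam.isoMk (cmp (F ≫ G) c ≪≫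
        Fam.pushComp (Over.mapComp_eq F.hom.base G.hom.base).symm F.add G.add (SmallFam.fam c) ≪≫
          (Fam.push G.add).mapIso (cmp F c).symm ≪≫
            (cmp G ((SmallFam.push F.add Q.pic.isStack.fibered).obj c)).symm)) fun {c c'} _ =>
      conj_naturality_comp (Fam.push G.add) (cmp (F ≫ G) c) (cmp (F ≫ G) c')
        (Fam.pushComp _ F.add G.add _) (Fam.pushComp _ F.add G.add _) (cmp F c) (cmp F c')
        (cmp G _) (cmp G _)
        (Fam.hom_ext fun _ => (Category.comp_id _).trans (Category.id_comp _).symm))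
    (fun _ c => isHomLift_of_base _
      (Functor.congr_obj (Over.mapComp_eq F.hom.base G.hom.base) (SmallFam.fam c).base) 
      (eqToHom_conj
        (Functor.congr_obj (Over.mapComp_eq F.hom.base G.hom.base) (SmallFam.fam c).base)
        rfl rfl (cmp_hom_base (F ≫ G) c) ((congrArg₂ (· ≫ ·)
        ((congrArg (Over.map G.hom.base).map (cmp_inv_base F c)).trans
          ((Over.map G.hom.base).map_id _)) (cmp_inv_base G _)).trans (Category.id_comp _))))
    (fun M c => (congrArg (_ ≫ ·) ((Alg.nat_comp_app (toAlgMap F) (toAlgMap G) M c).trans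
        ((Category.comp_id (obj := SmallFam R.pic.str _) _).trans
          ((SmallFam.push G.add R.pic.isStack.fibered).map_id _)))).trans
      ((Category.comp_id (obj := SmallFam R.pic.str _) _).trans
        (Category.id_comp (obj := SmallFam R.pic.str _) _).symm))

end Picard

end PicardMatrix

namespace PicardMatrix

namespace Picard

section Aux

variable {V W Z : Type*} [Category* V] [Category* W] [Category* Z]

theorem whiskerLeft_aux (G G' : V ⥤ W) {x x' : V} (l : x' ≅ x) {a b a' b' m m' : W} (u : a' ≅ a)
    (v : b' ≅ b) (k : a ≅ G.obj x) (k' : b ≅ G'.obj x) (w : m ≅ G.obj x') (w' : m' ≅ G'.obj x')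
    {t : a ⟶ b} {s : G.obj x ⟶ G'.obj x} {s' : G.obj x' ⟶ G'.obj x'}
    (h : t ≫ k'.hom = k.hom ≫ s) (h' : G.map l.hom ≫ s = s' ≫ G'.map l.hom) :
    u.hom ≫ t ≫ v.inv = (u ≪≫ k ≪≫ G.mapIso l.symm ≪≫ w.symm).hom ≫ (w.hom ≫ s' ≫ w'.inv) ≫
      (v ≪≫ k' ≪≫ G'.mapIso l.symm ≪≫ w'.symm).inv := by
  simp only [Iso.trans_hom, Iso.trans_inv, Functor.mapIso_hom, Functor.mapIso_inv, Iso.symm_hom,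
    Iso.symm_inv, Category.assoc, Iso.inv_hom_id_assoc]
  rw [← reassoc_of% h', ← Functor.map_comp_assoc, Iso.inv_hom_id, CategoryTheory.Functor.map_id,
    Category.id_comp, ← reassoc_of% h, Iso.hom_inv_id_assoc]

theorem whiskerRight_aux (G : V ⥤ W) {x x' y y' : V} (l : x' ≅ x) (l' : y' ≅ y)
    {a b a' b' m m' : W} (u : a' ≅ a) (v : b' ≅ b) (k : a ≅ G.obj x) (k' : b ≅ G.obj y)
    (w : m ≅ G.obj x') (w' : m' ≅ G.obj y') {t : a ⟶ b} {s : x ⟶ y}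
    (h : t ≫ k'.hom = k.hom ≫ G.map s) :
    u.hom ≫ t ≫ v.inv = (u ≪≫ k ≪≫ G.mapIso l.symm ≪≫ w.symm).hom ≫
      (w.hom ≫ G.map (l.hom ≫ s ≫ l'.inv) ≫ w'.inv) ≫
        (v ≪≫ k' ≪≫ G.mapIso l'.symm ≪≫ w'.symm).inv := by
  simp [← reassoc_of% h]

theorem associator_aux (G : V ⥤ W) (H : W ⥤ Z) (L : V ⥤ Z) {x x' : V} (l : x' ≅ x)
    {y y' y'' : W} (m : y' ≅ y) (k : y ≅ G.obj x) (n : y'' ≅ G.obj x')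
    {z₀ z₀' z₁ z₂ z₃ z₄ z₄' : Z} (u : z₀' ≅ z₀) (k₁ : z₀ ≅ H.obj y) (h₁ : z₁ ≅ H.obj y')
    (h₂ : z₂ ≅ H.obj y'') (j : L.obj x ≅ H.obj (G.obj x)) (j' : L.obj x' ≅ H.obj (G.obj x'))
    (h₃ : z₃ ≅ L.obj x') (v : z₄' ≅ z₄) (k₄ : z₄ ≅ L.obj x) {t : z₀ ⟶ z₄}
    (ht : t ≫ k₄.hom ≫ j.hom = k₁.hom ≫ H.map k.hom)
    (hj : L.map l.hom ≫ j.hom = j'.hom ≫ H.map (G.map l.hom)) :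
    u.hom ≫ t ≫ v.inv = (u ≪≫ k₁ ≪≫ H.mapIso m.symm ≪≫ h₁.symm).hom ≫
      (h₁.hom ≫ H.map (m ≪≫ k ≪≫ G.mapIso l.symm ≪≫ n.symm).hom ≫ h₂.inv) ≫ 𝟙 _ ≫
        (h₃ ≪≫ j' ≪≫ H.mapIso n.symm ≪≫ h₂.symm).inv ≫
          (v ≪≫ k₄ ≪≫ L.mapIso l.symm ≪≫ h₃.symm).inv := by
  have ht' : t = k₁.hom ≫ H.map k.hom ≫ j.inv ≫ k₄.inv := by
    rw [← reassoc_of% ht]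
    simp
  have hj' : H.map (G.map l.inv) ≫ j'.inv ≫ L.map l.hom = j.inv := by
    rw [← cancel_mono j.hom]
    simp only [Category.assoc]
    rw [hj]
    simp [← Functor.map_comp]
  simp only [Iso.trans_hom, Iso.trans_inv, Functor.mapIso_hom, Functor.mapIso_inv, Iso.symm_hom,
    Iso.symm_inv, Category.assoc, Iso.inv_hom_id_assoc, Category.id_comp, Functor.map_comp]
  have e : H.map m.inv ≫ H.map m.hom = 𝟙 _ := by rw [← Functor.map_comp]; simp
  have e' : H.map n.inv ≫ H.map n.hom = 𝟙 _ := by rw [← Functor.map_comp]; simp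
  rw [reassoc_of% e, reassoc_of% e', reassoc_of% hj', ht']
  simp

theorem leftUnitor_aux (G : V ⥤ W) {x x' y : V} (l : x' ≅ x) (i : x ≅ y) {a a' b' m : W}
    (u : a' ≅ a) (k : a ≅ G.obj x) (w : m ≅ G.obj x') (v : b' ≅ G.obj y) {t : a ⟶ G.obj y}
    (h : t = k.hom ≫ G.map i.hom) :
    u.hom ≫ t ≫ v.inv = (u ≪≫ k ≪≫ G.mapIso l.symm ≪≫ w.symm).hom ≫
      (w.hom ≫ G.map (l ≪≫ i).hom ≫ v.inv) ≫ 𝟙 _ := by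
  simp [h]

theorem rightUnitor_aux (G : V ⥤ V) {x x' : V} (l : x' ≅ x) (i : G.obj x ≅ x) (i' : G.obj x' ≅ x')
    {a a' m : V} (u : a' ≅ a) (k : a ≅ G.obj x) (w : m ≅ G.obj x') {t : a ⟶ x}
    (h : t = k.hom ≫ i.hom) (h' : G.map l.hom ≫ i.hom = i'.hom ≫ l.hom) :
    u.hom ≫ t ≫ l.inv = (u ≪≫ k ≪≫ G.mapIso l.symm ≪≫ w.symm).hom ≫ (w ≪≫ i').hom ≫ 𝟙 _ := by
  have h'' : G.map l.inv ≫ i'.hom = i.hom ≫ l.inv := by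
    rw [Iso.eq_comp_inv, Category.assoc, ← h', ← Functor.map_comp_assoc]
    simp
  simp [h, h'']

end Aux

variable {C : Type u} [Category.{v} C] {J : GrothendieckTopology C} {P Q R S : Picard.{w₁, w₂} J}

theorem toAlgMap₂_id (F : P ⟶ Q) : toAlgMap₂ (𝟙 F) = 𝟙 (toAlgMap F) :=
  Alg.mod_ext fun _ c => (congrArg ((cmp F c).hom ≫ ·) (Category.id_comp _)).trans
    (cmp F c).hom_inv_id

theorem toAlgMap₂_comp {F F' F'' : P ⟶ Q} (τ : F ⟶ F') (τ' : F' ⟶ F'') :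
    toAlgMap₂ (τ ≫ τ') = toAlgMap₂ τ ≫ toAlgMap₂ τ' :=
  Alg.mod_ext fun _ c => by
    have h : Fam.pushTrans (congrArg Over.map (τ ≫ τ').hom.base_eq) (τ ≫ τ').add (SmallFam.fam c) =
      Fam.pushTrans (congrArg Over.map τ.hom.base_eq) τ.add (SmallFam.fam c) ≫
        Fam.pushTrans (congrArg Over.map τ'.hom.base_eq) τ'.add (SmallFam.fam c) :=
      Fam.hom_ext fun r => rfl
    have h' : (cmp F c).hom ≫ (Fam.pushTrans (congrArg Over.map τ.hom.base_eq) τ.add (SmallFam.fam c) ≫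
        Fam.pushTrans (congrArg Over.map τ'.hom.base_eq) τ'.add (SmallFam.fam c)) ≫
        (cmp F'' c).inv = ((cmp F c).hom ≫ Fam.pushTrans (congrArg Over.map τ.hom.base_eq) τ.add
          (SmallFam.fam c) ≫ (cmp F' c).inv) ≫ ((cmp F' c).hom ≫ Fam.pushTrans
            (congrArg Over.map τ'.hom.base_eq) τ'.add (SmallFam.fam c) ≫ (cmp F'' c).inv) := by
      simp only [Category.assoc, Iso.inv_hom_id_assoc]
    exact (congrArg (fun t => (cmp F c).hom ≫ t ≫ (cmp F'' c).inv) h).trans h'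

theorem toAlgMap₂_whiskerLeft (F : P ⟶ Q) {G G' : Q ⟶ R} (τ : G ⟶ G') :
    toAlgMap₂ (F ◁ τ) =
      (toAlgMapComp F G).hom ≫ toAlgMap F ◁ toAlgMap₂ τ ≫ (toAlgMapComp F G').inv :=
  Alg.mod_ext fun _ c => whiskerLeft_aux (Fam.push G.add) (Fam.push G'.add) (cmp F c)
    (cmp (F ≫ G) c) (cmp (F ≫ G') c) (Fam.pushComp _ F.add G.add _) (Fam.pushComp _ F.add G'.add _)
    (cmp G _) (cmp G' _)
    (s := Fam.pushTrans (congrArg Over.map τ.hom.base_eq) τ.add _)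
    (s' := Fam.pushTrans (congrArg Over.map τ.hom.base_eq) τ.add _)
    (Fam.hom_ext fun _ => (Category.comp_id _).trans (Category.id_comp _).symm)
    (Fam.hom_ext fun r => τ.hom.τ.naturality ((cmp F c).hom.arr r))

theorem toAlgMap₂_whiskerRight {F F' : P ⟶ Q} (τ : F ⟶ F') (G : Q ⟶ R) :
    toAlgMap₂ (τ ▷ G) =
      (toAlgMapComp F G).hom ≫ toAlgMap₂ τ ▷ toAlgMap G ≫ (toAlgMapComp F' G).inv :=
  Alg.mod_ext fun _ c => whiskerRight_aux (Fam.push G.add) (cmp F c) (cmp F' c)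
    (cmp (F ≫ G) c) (cmp (F' ≫ G) c) (Fam.pushComp _ F.add G.add _) (Fam.pushComp _ F'.add G.add _)
    (cmp G _) (cmp G _) (s := Fam.pushTrans (congrArg Over.map τ.hom.base_eq) τ.add _)
    (Fam.hom_ext fun _ => (Category.comp_id _).trans (Category.id_comp _).symm)

theorem toAlgMap₂_associator (F : P ⟶ Q) (G : Q ⟶ R) (H : R ⟶ S) :
    toAlgMap₂ (α_ F G H).hom = (toAlgMapComp (F ≫ G) H).hom ≫ (toAlgMapComp F G).hom ▷ toAlgMap H ≫
      (α_ (toAlgMap F) (toAlgMap G) (toAlgMap H)).hom ≫ toAlgMap F ◁ (toAlgMapComp G H).inv ≫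
        (toAlgMapComp F (G ≫ H)).inv :=
  Alg.mod_ext fun _ c => associator_aux (Fam.push G.add) (Fam.push H.add) (Fam.push (G ≫ H).add)
    (cmp F c) (cmp (F ≫ G) c) (Fam.pushComp _ F.add G.add _) (cmp G _) (cmp ((F ≫ G) ≫ H) c)
    (Fam.pushComp _ (F ≫ G).add H.add _) (cmp H _) (cmp H _) (Fam.pushComp _ G.add H.add _)
    (Fam.pushComp _ G.add H.add _) (cmp (G ≫ H) _) (cmp (F ≫ G ≫ H) c)
    (Fam.pushComp _ F.add (G ≫ H).add _)
    (Fam.hom_ext fun _ => (congrArg (_ ≫ ·) (Category.comp_id _)).trans ((congrArg (_ ≫ ·)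
      (H.hom.fn.F.map_id _).symm)))
    (Fam.hom_ext fun _ => (Category.comp_id _).trans (Category.id_comp _).symm)

theorem toAlgMap₂_leftUnitor (F : P ⟶ Q) : toAlgMap₂ (λ_ F).hom =
    (toAlgMapComp (𝟙 P) F).hom ≫ (toAlgMapId P).hom ▷ toAlgMap F ≫ (λ_ (toAlgMap F)).hom :=
  Alg.mod_ext fun _ c => leftUnitor_aux (Fam.push F.add) (cmp (𝟙 P) c) (Fam.pushId _ P.pic.str _)
    (cmp (𝟙 P ≫ F) c) (Fam.pushComp _ (𝟙 P : P ⟶ P).add F.add _) (cmp F _) (cmp F _)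
    (Fam.hom_ext fun _ => ((Category.id_comp _).trans (F.hom.fn.F.map_id _)).symm)

theorem toAlgMap₂_rightUnitor (F : P ⟶ Q) : toAlgMap₂ (ρ_ F).hom =
    (toAlgMapComp F (𝟙 Q)).hom ≫ toAlgMap F ◁ (toAlgMapId Q).hom ≫ (ρ_ (toAlgMap F)).hom :=
  Alg.mod_ext fun _ c => rightUnitor_aux (Fam.push (𝟙 Q : Q ⟶ Q).add) (cmp F c)
    (Fam.pushId _ Q.pic.str _) (Fam.pushId _ Q.pic.str _) (cmp (F ≫ 𝟙 Q) c)
    (Fam.pushComp _ F.add (𝟙 Q : Q ⟶ Q).add _) (cmp (𝟙 Q) _)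
    (Fam.hom_ext fun _ => (Category.id_comp _).symm)
    (Fam.hom_ext fun _ => (Category.comp_id _).trans (Category.id_comp _).symm)

/-- The pseudofunctor which sends a Picard stack to the 2-algebra of its families. -/
noncomputable def toAlgPseudofunctor : Picard.{w₁, w₂} J ⥤ᵖ Alg.{w₁, w₂} J where
  obj := toAlg
  map := toAlgMap
  map₂ := toAlgMap₂
  map₂_id := toAlgMap₂_id
  map₂_comp := toAlgMap₂_comp
  mapId := toAlgMapId
  mapComp := toAlgMapComp
  map₂_whisker_left F _ _ τ := toAlgMap₂_whiskerLeft F τ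
  map₂_whisker_right τ G := toAlgMap₂_whiskerRight τ G
  map₂_associator := toAlgMap₂_associator
  map₂_left_unitor := toAlgMap₂_leftUnitor
  map₂_right_unitor := toAlgMap₂_rightUnitor

end Picard

end PicardMatrix

namespace PicardMatrix

/-! ### Values of a transformation of families -/

/-- An element of `ℤⁿ`, as a matrix with one row. -/
def rowMat {n : ℕ} (r : Fin n → ℤ) : Matrix (Fin 1) (Fin n) ℤ := Matrix.of fun _ => r

theorem rowHom_rowMat {n : ℕ} (r : Fin n → ℤ) : rowHom (rowMat r) 1 = r := by
  rw [rowHom_apply]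
  ext j
  simp [Matrix.vecMul, dotProduct, rowMat]

theorem rowMat_mul {n k : ℕ} (M : Matrix (Fin k) (Fin n) ℤ) (s : Fin k → ℤ) :
    rowMat s * M = rowMat (rowHom M s) := by
  rw [rowHom_apply]
  rfl

section

variable {B : Type u} [Category.{v} B] {X : Type w} [Category.{w'} X] {p : X ⥤ B}
  {P : PicardStr p}

namespace SmallFam

theorem basisFun_one (i : Fin 1) : Pi.basisFun ℤ (Fin 1) i = 1 := by
  rw [Pi.basisFun_apply]
  ext j
  simp [Subsingleton.elim j i]

variable (P) in
/-- The value at the generator of a family indexed by `ℤ`. -/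
noncomputable def evOne : OverFunctor (proj P 1) p where
  F :=
    { obj c := (c.fam.fam.pt 1).1
      map h := h.arr 1 }
  w := CategoryTheory.Functor.ext (fun c => (c.fam.fam.pt 1).2) fun c c' h =>
    have := h.lies 1
    IsHomLift.fac' p h.base (h.arr 1)

/-- Evaluation at `1` is an equivalence from the families indexed by `ℤ` to the Picard stack. -/
theorem evOne_isFibEquiv (hp : p.IsFibered) (P : PicardStr p) : IsFibEquiv (evOne P) where
  full := ⟨fun {c c'} φ => by
    obtain ⟨b, l⟩ := exists_base φ (c.fam.fam.pt 1).2 (c'.fam.fam.pt 1).2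
    obtain ⟨h, -, h₂⟩ := exists_hom hp (Pi.basisFun ℤ (Fin 1)) basisFun_one b
      (⟨c, rfl⟩ : (proj P 1).Fiber _) (⟨c', rfl⟩ : (proj P 1).Fiber _) fun _ => ⟨φ, l⟩
    exact ⟨h, h₂ 0⟩⟩
  faithful := ⟨fun {c c'} h h' e => by
    have l : (proj P 1).IsHomLift h.base h' :=
      isHomLift_of (r := 1) (by
        have := h.lies 1
        exact (show h.arr 1 = h'.arr 1 from e) ▸ this)
    exact hom_ext_basis hp (Pi.basisFun ℤ (Fin 1)) basisFun_one (isHomLift_base h) l fun _ => e⟩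
  surj {T} x := by
    obtain ⟨c, hc⟩ := exists_obj (P := P) hp (Pi.basisFun ℤ (Fin 1)) basisFun_one fun _ => x
    exact ⟨c, fiberIsoVal (hc 0).some, (hc 0).some.hom.2⟩

end SmallFam

end

section

variable {B : Type u} [Category.{v} B] {X : Type w} [Category.{w'} X] {p : X ⥤ B}
  {B' : Type u'} [Category.{v'} B'] {X' : Type w₁} [Category.{w₂} X'] {q : X' ⥤ B'}

open SmallFam

/-- A transformation from the families of `P` to the families of `Q`. -/
structure FamTrans (P : PicardStr p) (Q : PicardStr q) (K : B ⥤ B') where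
  T (n : ℕ) : CartFunctor K (proj P n) (proj Q n)
  ν {n k : ℕ} (M : Matrix (Fin k) (Fin n) ℤ) (c : SmallFam P n) :
    (T k).F.obj ((comap (rowHom M)).obj c) ≅ (comap (rowHom M)).obj ((T n).F.obj c)
  ν_nat {n k : ℕ} (M : Matrix (Fin k) (Fin n) ℤ) {c c' : SmallFam P n} (h : c ⟶ c') :
    (T k).F.map ((comap (rowHom M)).map h) ≫ (ν M c').hom =
      (ν M c).hom ≫ (comap (rowHom M)).map ((T n).F.map h)
  ν_lies {n k : ℕ} (M : Matrix (Fin k) (Fin n) ℤ) (c : SmallFam P n) :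
    (proj Q k).IsHomLift (𝟙 (K.obj c.fam.base)) (ν M c).hom
  ν_comp {n k l : ℕ} (M : Matrix (Fin k) (Fin n) ℤ) (N : Matrix (Fin l) (Fin k) ℤ)
    (c : SmallFam P n) :
    (ν (N * M) c).hom ≫ (comapCongr (rowHom_mul M N)).hom.app ((T n).F.obj c) =
      (T l).F.map ((comapCongr (rowHom_mul M N)).hom.app c) ≫ (ν N ((comap (rowHom M)).obj c)).hom ≫
        (comap (rowHom N)).map (ν M c).hom

variable {P : PicardStr p} {Q : PicardStr q} {K : B ⥤ B'}

/-- A quasi-inverse of the evaluation at the generator of `ℤ`. -/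
structure EvOneInv (P : PicardStr p) where
  M : OverFunctor p (proj P 1)
  η : M.F ⋙ (evOne P).F ≅ 𝟭 X
  lies (x : X) : p.IsHomLift (𝟙 (p.obj x)) (η.hom.app x)

theorem nonempty_evOneInv (hp : p.IsFibered) (P : PicardStr p) : Nonempty (EvOneInv P) := by
  obtain ⟨M, η, -, h⟩ := (evOne_isFibEquiv hp P).exists_inverse
  exact ⟨⟨M, η, h⟩⟩

namespace EvOneInv

variable (I : EvOneInv P) (hp : p.IsFibered) {n : ℕ} (c : SmallFam P n)
  (N : Matrix (Fin 1) (Fin n) ℤ) {r : Fin n → ℤ} (e : rowHom N 1 = r)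

/-- The value of a family at `r` determines its restriction along the row `r`. -/
noncomputable def κ : I.M.F.obj (c.fam.fam.pt r).1 ≅ (comap (rowHom N)).obj c :=
  have := (evOne_isFibEquiv hp P).full
  have := (evOne_isFibEquiv hp P).faithful
  (evOne P).F.preimageIso (I.η.app (c.fam.fam.pt r).1 ≪≫ fiberIsoVal (c.fam.fam.ptIso e.symm))

theorem κ_arr : (evOne P).F.map (I.κ hp c N e).hom =
    I.η.hom.app (c.fam.fam.pt r).1 ≫ (c.fam.fam.ptIso e.symm).hom.1 := by
  have := (evOne_isFibEquiv hp P).full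
  have := (evOne_isFibEquiv hp P).faithful
  exact (evOne P).F.map_preimage _

theorem κ_nat {c c' : SmallFam P n} (h : c ⟶ c') : I.M.F.map (h.arr r) ≫ (I.κ hp c' N e).hom =
    (I.κ hp c N e).hom ≫ (comap (rowHom N)).map h := by
  apply (evOne_isFibEquiv hp P).map_inj
  rw [Functor.map_comp, Functor.map_comp, κ_arr, κ_arr]
  exact (comp_aux (I.η.hom.naturality (h.arr r)).symm (Fam.arr_ptIso h e.symm).symm).symm

theorem κ_comp {k : ℕ} (M : Matrix (Fin k) (Fin n) ℤ) (N : Matrix (Fin 1) (Fin k) ℤ)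
    {s : Fin k → ℤ} (e : rowHom N 1 = s) (e' : rowHom (N * M) 1 = rowHom M s) :
    (I.κ hp c (N * M) e').hom ≫ (comapCongr (rowHom_mul M N)).hom.app c =
      (I.κ hp ((comap (rowHom M)).obj c) N e).hom := by
  apply (evOne_isFibEquiv hp P).map_inj
  rw [Functor.map_comp, κ_arr]
  exact ((Category.assoc _ _ _).trans (congrArg (I.η.hom.app (c.fam.fam.pt (rowHom M s)).1 ≫ ·)
    (c.fam.fam.ptIso_trans_val _ _))).trans (I.κ_arr hp ((comap (rowHom M)).obj c) N e).symm

theorem κ_lies {T : B} (hT : c.fam.base = T) :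
    (proj P 1).IsHomLift (𝟙 T) (I.κ hp c N e).hom := by
  refine (evOne P).isHomLift_iff.1 ?_
  rw [κ_arr]
  subst hT
  have h : ∀ {x : X} {T : B}, p.obj x = T → p.IsHomLift (𝟙 T) (I.η.hom.app x) := by
    rintro x _ rfl
    exact I.lies x
  exact isHomLift_id_comp (h (c.fam.fam.pt r).2) (c.fam.fam.ptIso e.symm).hom.2

end EvOneInv

theorem comp_aux_three {V : Type*} [Category* V] {a b c d e f : V} {x : a ⟶ b} {y' : b ⟶ c}
    {x' : a ⟶ d} {m : d ⟶ c} {t : b ⟶ e} {y : e ⟶ f} {t'' : c ⟶ f} {t' : d ⟶ f}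
    (h₁ : x ≫ y' = x' ≫ m) (h₂ : t ≫ y = y' ≫ t'') (h₃ : m ≫ t'' = t') :
    (x ≫ t) ≫ y = x' ≫ t' := by
  rw [Category.assoc, h₂, reassoc_of% h₁, h₃]

theorem comp_aux_map {V W : Type*} [Category* V] [Category* W] (H : V ⥤ W) {a b c : V} {d e f : W}
    {k : a ⟶ b} {k' : a ⟶ c} {l : c ⟶ b} (h : k' ≫ l = k) {m : H.obj b ⟶ d} {n : H.obj c ⟶ e}
    {x : d ⟶ f} {y : e ⟶ f} (h' : n ≫ y = H.map l ≫ m ≫ x) :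
    (H.map k ≫ m) ≫ x = (H.map k' ≫ n) ≫ y := by
  rw [Category.assoc, Category.assoc, h', ← h, Functor.map_comp, Category.assoc]

namespace FamTrans

variable (α : FamTrans P Q K) (I : EvOneInv P)

/-- The underlying functor of a transformation of families. -/
noncomputable def toCart (hq : q.IsFibered) : CartFunctor K p q where
  F := I.M.F ⋙ (α.T 1).F ⋙ (evOne Q).F
  w := by
    rw [Functor.assoc, Functor.assoc, (evOne Q).w, (α.T 1).w, ← Functor.assoc, I.M.w]
  cart φ _ := Q.cart hq (IsHomLift.map q _)

variable (hp : p.IsFibered) (hq : q.IsFibered) {n : ℕ} (c : SmallFam P n)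

/-- The value at `r` of the image of a family is the image of its value at `r`. -/
noncomputable def θ (N : Matrix (Fin 1) (Fin n) ℤ) {r : Fin n → ℤ} (e : rowHom N 1 = r) :
    (α.toCart I hq).F.obj (c.fam.fam.pt r).1 ≅ (((α.T n).F.obj c).fam.fam.pt r).1 :=
  (evOne Q).F.mapIso ((α.T 1).F.mapIso (I.κ hp c N e) ≪≫ α.ν N c) ≪≫
    fiberIsoVal (((α.T n).F.obj c).fam.fam.ptIso e)

theorem θ_nat {c c' : SmallFam P n} (h : c ⟶ c') (N : Matrix (Fin 1) (Fin n) ℤ) {r : Fin n → ℤ}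
    (e : rowHom N 1 = r) : (α.toCart I hq).F.map (h.arr r) ≫ (α.θ I hp hq c' N e).hom =
      (α.θ I hp hq c N e).hom ≫ ((α.T n).F.map h).arr r := by
  exact AddStr.comp_nat_aux (evOne Q).F
    (AddStr.comp_nat_aux (α.T 1).F (I.κ_nat hp N e h) (α.ν_nat N h))
    (Fam.arr_ptIso ((α.T n).F.map h) e)

theorem θ_comp {k : ℕ} (M : Matrix (Fin k) (Fin n) ℤ) (N : Matrix (Fin 1) (Fin k) ℤ)
    {s : Fin k → ℤ} (e : rowHom N 1 = s) (e' : rowHom (N * M) 1 = rowHom M s) :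
    (α.θ I hp hq ((comap (rowHom M)).obj c) N e).hom ≫ (α.ν M c).hom.arr s =
      (α.θ I hp hq c (N * M) e').hom := by
  have h₁ : ((α.T 1).F.map (I.κ hp ((comap (rowHom M)).obj c) N e).hom ≫
      (α.ν N ((comap (rowHom M)).obj c)).hom) ≫ (comap (rowHom N)).map (α.ν M c).hom =
      ((α.T 1).F.map (I.κ hp c (N * M) e').hom ≫ (α.ν (N * M) c).hom) ≫
        (comapCongr (rowHom_mul M N)).hom.app ((α.T n).F.obj c) :=
    comp_aux_map (α.T 1).F (I.κ_comp hp c M N e e') (α.ν_comp M N c)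
  have h₂ := ((evOne Q).F.map_comp _ _).symm.trans
    ((congrArg (evOne Q).F.map h₁).trans ((evOne Q).F.map_comp _ _))
  exact comp_aux_three h₂ (Fam.arr_ptIso (α.ν M c).hom e).symm
    (((α.T n).F.obj c).fam.fam.ptIso_trans_val _ (congrArg (rowHom M) e))

theorem θ_lies (N : Matrix (Fin 1) (Fin n) ℤ) {r : Fin n → ℤ} (e : rowHom N 1 = r) {T : B}
    (hT : c.fam.base = T) : q.IsHomLift (𝟙 (K.obj T)) (α.θ I hp hq c N e).hom := by
  subst hT
  have h₁ := (α.T 1).lift_id rfl _ (I.κ_lies hp c N e rfl)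
  have h₂ := isHomLift_comp_id h₁ (α.ν_lies N c)
  have h₃ := (evOne Q).isHomLift_iff.2 h₂
  have h₄ := (((α.T n).F.obj c).fam.fam.ptIso e).hom.2
  have h₅ : ((α.T n).F.obj c).fam.base = K.obj c.fam.base := (α.T n).obj_eq c
  exact isHomLift_comp_id h₃
    (isHomLift_congr _ h₄ ((((α.T n).F.obj c).fam.fam.pt (rowHom N 1)).2.trans h₅))

end FamTrans

end

end PicardMatrix

namespace PicardMatrix

/-! ### Inverse images of additive families -/

section

variable {B : Type u} [Category.{v} B] {X : Type w} [Category.{w'} X] {p : X ⥤ B}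
  {P : PicardStr p} {G : Type} [AddCommGroup G]

theorem pull_assoc_aux {V : Type*} [Category* V] {a b c d a' b' c' d' e e' : V} {f : a ⟶ b}
    {g : b ⟶ c} {h : c ⟶ d} {f' : a' ⟶ b'} {g' : b' ⟶ c'} {h' : c' ⟶ d'} {i : a ⟶ a'} {j : b ⟶ b'}
    {k : c ⟶ c'} {l : d ⟶ d'} {m : a ⟶ e} {n : e ⟶ d} {m' : a' ⟶ e'} {n' : e' ⟶ d'} {o : e ⟶ e'}
    (h₁ : f ≫ j = i ≫ f') (h₂ : g ≫ k = j ≫ g') (h₃ : h ≫ l = k ≫ h') (h₄ : m ≫ o = i ≫ m')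
    (h₅ : n ≫ l = o ≫ n') (e : f' ≫ g' ≫ h' = m' ≫ n') :
    (f ≫ g ≫ h) ≫ l = (m ≫ n) ≫ l := by
  simp only [Category.assoc]
  rw [h₃, reassoc_of% h₂, reassoc_of% h₁, e, h₅, reassoc_of% h₄]

namespace FamAt

variable {T T' : B} {b : T ⟶ T'} (y : FamAt P G T') {x : G → p.Fiber T}
  (i : ∀ r, FibHom p b (x r) (y.pt r)) (hp : p.IsFibered)

include hp in
/-- The comparison isomorphism of an inverse image: it is the factorization of that of `y` through
the cartesian arrow given by the sum of the arrows `i r` and `i s`. -/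
theorem exists_pull {r s t : G} (h : t = r + s) : ∃ u : x t ≅ P.add (x r) (x s),
    u.hom.1 ≫ (P.map (i r) (i s)).1 = (i t).1 ≫ (y.σ h).hom.1 := by
  obtain ⟨χ, hχ, e⟩ := exists_factor (Category.id_comp b) (P.cart hp (P.map (i r) (i s)).2)
    (isHomLift_comp_id (i t).2 (y.σ h).hom.2)
  have := P.groupoid (x := x t) (y := P.add (x r) (x s)) ⟨χ, hχ⟩
  exact ⟨asIso (C := p.Fiber T) ⟨χ, hχ⟩, e⟩

/-- The additive family obtained from `y` by replacing its values by their inverse images along an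
arrow of the base. -/
noncomputable def pull : FamAt P G T where
  pt := x
  σ h := (y.exists_pull i hp h).choose
  assoc {r s t u v w} h₁ h₂ h₃ h₄ := by
    have k : ∀ {r s t : G} (h : t = r + s), _ := fun h => (y.exists_pull i hp h).choose_spec
    have e₁ : ∀ r, (𝟙 (x r) : x r ⟶ x r).1 ≫ (i r).1 = (i r).1 ≫ (𝟙 (y.pt r) : y.pt r ⟶ y.pt r).1 :=
      fun r => (Category.id_comp _).trans (Category.comp_id _).symm
    refine Subtype.ext (cart_ext (P.cart hp (P.map (i r) (P.map (i s) (i t))).2)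
      (Subtype.prop _) (Subtype.prop _) ?_)
    exact pull_assoc_aux (k h₂) (P.sum_map_square (φ := i u) (ψ := i t) (k h₁) (e₁ t))
      (P.assoc_nat (i r) (i s) (i t)).symm (k h₄) (P.sum_map_square (e₁ r) (k h₃))
      (congrArg Subtype.val (y.assoc h₁ h₂ h₃ h₄))
  comm {r s t} h h' := by
    have k : ∀ {r s t : G} (h : t = r + s), _ := fun h => (y.exists_pull i hp h).choose_spec
    refine Subtype.ext (cart_ext (P.cart hp (P.map (i s) (i r)).2)
      (Subtype.prop _) (Subtype.prop _) ?_)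
    refine Eq.trans (b := (i t).1 ≫ (y.σ h).hom.1 ≫ (P.comm (y.pt r) (y.pt s)).hom.1) ?_ ?_
    · exact comp_aux (k h) (P.comm_nat (i r) (i s)).symm
    · exact (congrArg (fun f => (i t).1 ≫ f.1) (y.comm h h')).trans (k h').symm

theorem pull_σ {r s t : G} (h : t = r + s) :
    ((y.pull i hp).σ h).hom.1 ≫ (P.map (i r) (i s)).1 = (i t).1 ≫ (y.σ h).hom.1 :=
  (y.exists_pull i hp h).choose_spec

theorem pull_σ_unique {r s t : G} (h : t = r + s) {f : (x t).1 ⟶ (P.add (x r) (x s)).1}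
    (l : p.IsHomLift (𝟙 T) f) (e : f ≫ (P.map (i r) (i s)).1 = (i t).1 ≫ (y.σ h).hom.1) :
    f = ((y.pull i hp).σ h).hom.1 :=
  cart_ext (P.cart hp (P.map (i r) (i s)).2) l ((y.pull i hp).σ h).hom.2
    (e.trans (y.pull_σ i hp h).symm)

end FamAt

end

/-! ### Additivity from the values on additive families -/

section

variable {B : Type u} [Category.{v} B] {X : Type w} [Category.{w'} X] {p : X ⥤ B}
  {B' : Type u'} [Category.{v'} B'] {X' : Type w₁} [Category.{w₂} X'] {q : X' ⥤ B'}

open SmallFam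

/-- A structure of additive family on the image under `F` of every presented additive family,
compatible with arrows of families and with matrices. -/
structure FamAdd (P : PicardStr p) (Q : PicardStr q) {K : B ⥤ B'} (F : CartFunctor K p q) where
  σ {n : ℕ} (c : SmallFam P n) {r s t : Fin n → ℤ} (h : t = r + s) :
    (F.fib rfl).obj (c.fam.fam.pt t) ≅
      Q.add ((F.fib rfl).obj (c.fam.fam.pt r)) ((F.fib rfl).obj (c.fam.fam.pt s))
  assoc {n : ℕ} (c : SmallFam P n) {r s t u v w : Fin n → ℤ} (h₁ : u = r + s) (h₂ : w = u + t)
      (h₃ : v = s + t) (h₄ : w = r + v) :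
    (σ c h₂).hom ≫ Q.sum (σ c h₁).hom (𝟙 _) ≫ (Q.assoc _ _ _).hom =
      (σ c h₄).hom ≫ Q.sum (𝟙 _) (σ c h₃).hom
  comm {n : ℕ} (c : SmallFam P n) {r s t : Fin n → ℤ} (h : t = r + s) (h' : t = s + r) :
    (σ c h).hom ≫ (Q.comm _ _).hom = (σ c h').hom
  nat {n : ℕ} {c d : SmallFam P n} (k : c ⟶ d) {r s t : Fin n → ℤ} (h : t = r + s) :
    F.F.map (k.arr t) ≫ (σ d h).hom.1 =
      (σ c h).hom.1 ≫ (Q.map (F.fibMap ⟨k.arr r, k.lies r⟩) (F.fibMap ⟨k.arr s, k.lies s⟩)).1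
  comap_σ {n m : ℕ} (M : Matrix (Fin m) (Fin n) ℤ) (c : SmallFam P n) {r s t : Fin m → ℤ}
      (h : t = r + s) :
    (σ ((comap (rowHom M)).obj c) h).hom.1 = (σ c (h ▸ map_add (rowHom M) r s :
      rowHom M t = rowHom M r + rowHom M s)).hom.1

theorem isHomLift_eqToHom {S T T' : B} {x y : X} {φ : x ⟶ y} (h : p.IsHomLift (𝟙 S) φ) (e : T = S)
    (e' : T = T') : p.IsHomLift (eqToHom e') φ := by
  subst e e'
  exact h

namespace FamTrans

variable {P : PicardStr p} {Q : PicardStr q} {K : B ⥤ B'} (α : FamTrans P Q K) (I : EvOneInv P)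
  (hp : p.IsFibered) (hq : q.IsFibered)

/-- The isomorphism `θ`, as an arrow over the equality of bases. -/
noncomputable def ψ {n : ℕ} (c : SmallFam P n) (r : Fin n → ℤ) :
    FibHom q (eqToHom ((α.T n).obj_eq c).symm) (((α.toCart I hq).fib rfl).obj (c.fam.fam.pt r))
      (((α.T n).F.obj c).fam.fam.pt r) :=
  ⟨(α.θ I hp hq c (rowMat r) (rowHom_rowMat r)).hom,
    isHomLift_eqToHom (α.θ_lies I hp hq c (rowMat r) (rowHom_rowMat r) rfl) rfl _⟩

theorem ψ_eq {n : ℕ} (c : SmallFam P n) {r : Fin n → ℤ} (N : Matrix (Fin 1) (Fin n) ℤ)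
    (hN : N = rowMat r) (e : rowHom N 1 = r) :
    (α.ψ I hp hq c r).1 = (α.θ I hp hq c N e).hom := by
  subst hN
  rfl

theorem ψ_nat {n : ℕ} {c d : SmallFam P n} (k : c ⟶ d) (r : Fin n → ℤ) :
    (α.toCart I hq).F.map (k.arr r) ≫ (α.ψ I hp hq d r).1 =
      (α.ψ I hp hq c r).1 ≫ ((α.T n).F.map k).arr r :=
  α.θ_nat I hp hq k (rowMat r) (rowHom_rowMat r)

theorem ψ_comp {n k : ℕ} (c : SmallFam P n) (M : Matrix (Fin k) (Fin n) ℤ) (s : Fin k → ℤ) :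
    (α.ψ I hp hq ((comap (rowHom M)).obj c) s).1 ≫ (α.ν M c).hom.arr s =
      (α.ψ I hp hq c (rowHom M s)).1 := by
  have h := rowMat_mul M s
  have e : rowHom (rowMat s * M) 1 = rowHom M s := by
    rw [h, rowHom_rowMat]
  rw [α.ψ_eq I hp hq c _ h e]
  exact α.θ_comp I hp hq c M (rowMat s) (rowHom_rowMat s) e

end FamTrans

end

end PicardMatrix

namespace PicardMatrix

section

variable {B : Type u} [Category.{v} B] {X : Type w} [Category.{w'} X] {p : X ⥤ B}
  {B' : Type u'} [Category.{v'} B'] {X' : Type w₁} [Category.{w₂} X'] {q : X' ⥤ B'}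

open SmallFam

/-- The sum of two commutative squares of arrows over the base. -/
theorem Law.map_map_square (P : Law p) {S T U V : B} {b : S ⟶ T} {b' : T ⟶ V} {d : S ⟶ U}
    {d' : U ⟶ V} {x y : p.Fiber S} {x₁ y₁ : p.Fiber T} {x₂ y₂ : p.Fiber U} {x₃ y₃ : p.Fiber V}
    {φ : FibHom p b x x₁} {ψ : FibHom p b y y₁} {φ' : FibHom p b' x₁ x₃} {ψ' : FibHom p b' y₁ y₃}
    {χ : FibHom p d x x₂} {ω : FibHom p d y y₂} {χ' : FibHom p d' x₂ x₃} {ω' : FibHom p d' y₂ y₃}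
    (h : φ.1 ≫ φ'.1 = χ.1 ≫ χ'.1) (h' : ψ.1 ≫ ψ'.1 = ω.1 ≫ ω'.1) :
    (P.map φ ψ).1 ≫ (P.map φ' ψ').1 = (P.map χ ω).1 ≫ (P.map χ' ω').1 := by
  have k := (χ.comp χ').2
  have e : b ≫ b' = d ≫ d' := AddStr.lift_unique (φ.comp φ').2
    (show p.IsHomLift (d ≫ d') (φ.1 ≫ φ'.1) from h.symm ▸ k)
  exact (congrArg Subtype.val (P.map_comp φ ψ φ' ψ')).symm.trans ((P.map_congr e h h').trans
    (congrArg Subtype.val (P.map_comp χ ω χ' ω')))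

/-- The sum of two commutative triangles of arrows over the base. -/
theorem Law.map_map_triangle (P : Law p) {S T V : B} {b : S ⟶ T} {b' : T ⟶ V} {d : S ⟶ V}
    {x y : p.Fiber S} {x₁ y₁ : p.Fiber T} {x₃ y₃ : p.Fiber V}
    {φ : FibHom p b x x₁} {ψ : FibHom p b y y₁} {φ' : FibHom p b' x₁ x₃} {ψ' : FibHom p b' y₁ y₃}
    {χ : FibHom p d x x₃} {ω : FibHom p d y y₃} (h : φ.1 ≫ φ'.1 = χ.1) (h' : ψ.1 ≫ ψ'.1 = ω.1) :
    (P.map φ ψ).1 ≫ (P.map φ' ψ').1 = (P.map χ ω).1 := by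
  have k := χ.2
  have e : b ≫ b' = d := AddStr.lift_unique (φ.comp φ').2
    (show p.IsHomLift d (φ.1 ≫ φ'.1) from h.symm ▸ k)
  exact (congrArg Subtype.val (P.map_comp φ ψ φ' ψ')).symm.trans (P.map_congr e h h')

theorem cube_aux {V : Type*} [Category* V] {a b c d a' b' c' d' : V} {f : a ⟶ b} {g : b ⟶ d}
    {h : a ⟶ c} {k : c ⟶ d} {f' : a' ⟶ b'} {g' : b' ⟶ d'}
    {h' : a' ⟶ c'} {k' : c' ⟶ d'} {i : a ⟶ a'} {j : b ⟶ b'} {l : c ⟶ c'} {m : d ⟶ d'}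
    (e₁ : g ≫ m = j ≫ g') (e₂ : f ≫ j = i ≫ f') (e₃ : f' ≫ g' = h' ≫ k')
    (e₄ : h ≫ l = i ≫ h') (e₅ : k ≫ m = l ≫ k') : (f ≫ g) ≫ m = (h ≫ k) ≫ m := by
  rw [Category.assoc, e₁, reassoc_of% e₂, e₃, Category.assoc, e₅, reassoc_of% e₄]

theorem comap_aux {V : Type*} [Category* V] {a b a' b' c d : V} {f : a ⟶ b} {i : a ⟶ a'}
    {j : b ⟶ b'} {f' : a' ⟶ b'} {k : a' ⟶ c} {l : b' ⟶ d} {g : c ⟶ d} {i' : a ⟶ c} {j' : b ⟶ d}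
    (e₁ : f ≫ j = i ≫ f') (e₂ : k ≫ g = f' ≫ l) (e₃ : j ≫ l = j') (e₄ : i ≫ k = i') :
    f ≫ j' = i' ≫ g := by
  rw [← e₃, reassoc_of% e₁, ← e₂, reassoc_of% e₄]

namespace FamTrans

variable {P : PicardStr p} {Q : PicardStr q} {K : B ⥤ B'} (α : FamTrans P Q K) (I : EvOneInv P)
  (hp : p.IsFibered) (hq : q.IsFibered)

/-- The images of additive families under the functor defined by a transformation of families
are additive families. -/
noncomputable def famAdd : FamAdd P Q (α.toCart I hq) where
  σ c _ _ _ h := (((α.T _).F.obj c).fam.fam.pull (α.ψ I hp hq c) hq).σ h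
  assoc c _ _ _ _ _ _ h₁ h₂ h₃ h₄ :=
    (((α.T _).F.obj c).fam.fam.pull (α.ψ I hp hq c) hq).assoc h₁ h₂ h₃ h₄
  comm c _ _ _ h h' := (((α.T _).F.obj c).fam.fam.pull (α.ψ I hp hq c) hq).comm h h'
  nat {n c d} k r s t h := by
    have e₁ := ((α.T _).F.obj c).fam.fam.pull_σ (α.ψ I hp hq c) hq h
    have e₂ := ((α.T _).F.obj d).fam.fam.pull_σ (α.ψ I hp hq d) hq h
    have e₃ := ((α.T _).F.map k).compat h
    have l₁ := (α.toCart I hq).lift_map (k.arr t) (k.lies t)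
    refine cart_ext (Q.cart hq (Q.map (α.ψ I hp hq d r) (α.ψ I hp hq d s)).2)
      (isHomLift_comp_id l₁ (((α.T _).F.obj d).fam.fam.pull (α.ψ I hp hq d) hq |>.σ h).hom.2)
      (isHomLift_id_comp (((α.T _).F.obj c).fam.fam.pull (α.ψ I hp hq c) hq |>.σ h).hom.2
        (Q.map _ _).2) ?_
    exact cube_aux e₂ (α.ψ_nat I hp hq k t) e₃ e₁
      (Q.map_map_square (α.ψ_nat I hp hq k r) (α.ψ_nat I hp hq k s))
  comap_σ {n m} M c {r s t} h := by
    have e₁ := ((α.T _).F.obj ((comap (rowHom M)).obj c)).fam.fam.pull_σ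
      (α.ψ I hp hq ((comap (rowHom M)).obj c)) hq h
    have e₂ := (α.ν M c).hom.compat h
    refine FamAt.pull_σ_unique _ (α.ψ I hp hq c) hq _ (Subtype.prop _) ?_
    exact comap_aux e₁ e₂ (Q.map_map_triangle (α.ψ_comp I hp hq c M r) (α.ψ_comp I hp hq c M s))
      (α.ψ_comp I hp hq c M t)

end FamTrans

end

end PicardMatrix

namespace PicardMatrix

/-! ### The additive structure determined by its values on additive families -/

section Aux

variable {V W : Type*} [Category* V] [Category* W] (H : V ⥤ W)

theorem assoc_of_push_aux {a b c d e : V} {f : a ⟶ b} {g : b ⟶ c} {h : c ⟶ d} {i : a ⟶ e}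
    {j : e ⟶ d} (hf : IsIso f) (hg : IsIso g) (k : f ≫ g ≫ h = i ≫ j) {x₁ x₂ x₃ x₄ x₅ x₆ : W}
    {s₁ : H.obj b ⟶ x₃} {s₂ : H.obj c ⟶ x₁} {s₃ : H.obj e ⟶ x₄} {s₄ : H.obj d ⟶ x₂}
    {g' : x₃ ⟶ x₁} {j' : x₄ ⟶ x₂} {n : x₁ ⟶ x₅} {o : x₅ ⟶ x₆} {m : x₂ ⟶ x₆} {l : x₃ ⟶ x₅}
    {l' : x₄ ⟶ x₆} (e₁ : H.map g ≫ s₂ = s₁ ≫ g') (e₂ : H.map j ≫ s₄ = s₃ ≫ j')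
    (hl : l = g' ≫ n) (hl' : l' = j' ≫ m) {u : H.obj a ⟶ x₃} {u' : H.obj a ⟶ x₄}
    (hu : u = H.map f ≫ s₁) (hu' : u' = H.map i ≫ s₃) (e₃ : u ≫ l ≫ o = u' ≫ l') :
    H.map h ≫ s₄ ≫ m = s₂ ≫ n ≫ o := by
  subst hl hl' hu hu'
  have k' := congrArg H.map k
  simp only [Functor.map_comp, Category.assoc] at k' e₃
  rw [← reassoc_of% e₁, ← reassoc_of% e₂, ← reassoc_of% k'] at e₃
  rw [cancel_epi, cancel_epi] at e₃
  exact e₃.symm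

theorem assoc_transport_aux {a a' b b' : V} {f : a ⟶ a'} {g : b ⟶ b'} {h : a ⟶ b} {h' : a' ⟶ b'}
    (hf : IsIso f) (k : f ≫ h' = h ≫ g) {x x' y y' z z' w w' : W} {s : H.obj b ⟶ x}
    {s' : H.obj b' ⟶ x'} {g₁ : x ⟶ x'} {m : x ⟶ y} {m' : x' ⟶ y'} {g₂ : y ⟶ y'}
    {t : H.obj a ⟶ z} {t' : H.obj a' ⟶ z'} {f₁ : z ⟶ z'} {n : z ⟶ w} {n' : z' ⟶ w'} {f₂ : w ⟶ w'}
    {o : w ⟶ y} {o' : w' ⟶ y'} (e₁ : H.map g ≫ s' = s ≫ g₁) (e₂ : g₁ ≫ m' = m ≫ g₂)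
    (e₃ : H.map f ≫ t' = t ≫ f₁) (e₄ : f₁ ≫ n' = n ≫ f₂) (e₅ : f₂ ≫ o' = o ≫ g₂)
    (e : H.map h ≫ s ≫ m = t ≫ n ≫ o) : H.map h' ≫ s' ≫ m' = t' ≫ n' ≫ o' := by
  rw [← cancel_epi (H.map f), ← H.map_comp_assoc, k, H.map_comp_assoc, reassoc_of% e₁, e₂,
    reassoc_of% e₃, reassoc_of% e₄, e₅, reassoc_of% e]

theorem comm_of_push_aux {a b c : V} {f : a ⟶ b} {h : b ⟶ c} {i : a ⟶ c}
    (hf : IsIso f) (k : f ≫ h = i) {x y : W} {s : H.obj b ⟶ x} {t : H.obj c ⟶ y} {o : x ⟶ y}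
    {u : H.obj a ⟶ x} {u' : H.obj a ⟶ y} (hu : u = H.map f ≫ s) (hu' : u' = H.map i ≫ t)
    (e : u ≫ o = u') : H.map h ≫ t = s ≫ o := by
  subst hu hu' k
  rw [← cancel_epi (H.map f), ← H.map_comp_assoc, ← e, Category.assoc]

theorem comm_transport_aux {a a' b b' : V} {f : a ⟶ a'} {g : b ⟶ b'} {h : a ⟶ b} {h' : a' ⟶ b'}
    (hf : IsIso f) (k : f ≫ h' = h ≫ g) {x x' z z' : W} {s : H.obj b ⟶ x}
    {s' : H.obj b' ⟶ x'} {g₁ : x ⟶ x'} {t : H.obj a ⟶ z} {t' : H.obj a' ⟶ z'} {f₁ : z ⟶ z'}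
    {o : z ⟶ x} {o' : z' ⟶ x'} (e₁ : H.map g ≫ s' = s ≫ g₁) (e₃ : H.map f ≫ t' = t ≫ f₁)
    (e₅ : f₁ ≫ o' = o ≫ g₁) (e : H.map h ≫ s = t ≫ o) : H.map h' ≫ s' = t' ≫ o' := by
  rw [← cancel_epi (H.map f), ← H.map_comp_assoc, k, H.map_comp_assoc, e₁, reassoc_of% e₃, e₅,
    reassoc_of% e]

theorem nat_transport_aux {a b c : V} {f : a ⟶ b} {g : b ⟶ c} {h : a ⟶ c} (hf : IsIso f)
    (k : f ≫ g = h) {x y z : W} {s : H.obj b ⟶ y} {g' : y ⟶ z} {s' : H.obj c ⟶ z}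
    {t : H.obj a ⟶ x} {f' : x ⟶ y} {h' : x ⟶ z} (k' : f' ≫ g' = h') (e₁ : H.map f ≫ s = t ≫ f')
    (e₂ : H.map h ≫ s' = t ≫ h') : H.map g ≫ s' = s ≫ g' := by
  rw [← cancel_epi (H.map f), ← H.map_comp_assoc, k, e₂, reassoc_of% e₁, k']

theorem nat_of_push_aux {a b c d : V} {k : a ⟶ b} {f : a ⟶ c} {f' : b ⟶ d} {m : c ⟶ d}
    (hf : IsIso f) (e : k ≫ f' = f ≫ m) {x y : W} {s : H.obj c ⟶ x} {s' : H.obj d ⟶ y} {v : x ⟶ y}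
    {u : H.obj a ⟶ x} {u' : H.obj b ⟶ y} (hu : u = H.map f ≫ s) (hu' : u' = H.map f' ≫ s')
    (h : H.map k ≫ u' = u ≫ v) : H.map m ≫ s' = s ≫ v := by
  subst hu hu'
  rw [← cancel_epi (H.map f), ← H.map_comp_assoc, ← e, H.map_comp_assoc, h, Category.assoc]

theorem cancel_map_aux {a b : V} {f : a ⟶ b} (hf : IsIso f) {x : W} {s t : H.obj b ⟶ x}
    {u : H.obj a ⟶ x} (hs : u = H.map f ≫ s) (ht : u = H.map f ≫ t) : s = t :=
  (cancel_epi (H.map f)).1 (hs.symm.trans ht)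

theorem comp_cancel_aux {a b c : V} {f : a ⟶ b} {g : b ⟶ c} {h : c ⟶ b} (e : g ≫ h = 𝟙 b) :
    (f ≫ g) ≫ h = f := by
  rw [Category.assoc, e, Category.comp_id]

theorem sig_aux {a b c : V} {f : a ⟶ b} {g : b ⟶ c} {h : a ⟶ c} {g' : c ⟶ b} (k : f ≫ g = h)
    (k₂ : g ≫ g' = 𝟙 b) {x y z : W} {s : H.obj b ⟶ y} {t : H.obj a ⟶ x} {i : x ⟶ y} {j : y ⟶ z}
    {l : x ⟶ z} (e : H.map f ≫ s = t ≫ i) (hl : i ≫ j = l) :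
    H.map h ≫ H.map g' ≫ s ≫ j = t ≫ l := by
  subst hl k
  rw [← H.map_comp_assoc, Category.assoc, k₂, Category.comp_id, reassoc_of% e]

end Aux

section

variable {B : Type u} [Category.{v} B] {X : Type w} [Category.{w'} X] {p : X ⥤ B}
  {B' : Type u'} [Category.{v'} B'] {X' : Type w₁} [Category.{w₂} X'] {q : X' ⥤ B'}

open SmallFam

/-- The sum of two commutative squares of a fibre. -/
theorem Law.sum_square (P : Law p) {T : B} {x y z t x' y' z' t' : p.Fiber T} {f : x ⟶ y}
    {g : y ⟶ t} {h : x ⟶ z} {k : z ⟶ t} {f' : x' ⟶ y'} {g' : y' ⟶ t'} {h' : x' ⟶ z'}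
    {k' : z' ⟶ t'} (e : f ≫ g = h ≫ k) (e' : f' ≫ g' = h' ≫ k') :
    P.sum f f' ≫ P.sum g g' = P.sum h h' ≫ P.sum k k' := by
  rw [← P.sum_comp, ← P.sum_comp, e, e']

theorem rowHom_of_two {n : ℕ} (r s : Fin n → ℤ) :
    ∃ M : Matrix (Fin 2) (Fin n) ℤ, rowHom M (Pi.basisFun ℤ (Fin 2) 0) = r ∧
      rowHom M (Pi.basisFun ℤ (Fin 2) 1) = s := by
  refine ⟨Matrix.of ![r, s], ?_, ?_⟩ <;> rw [rowHom_apply, Pi.basisFun_apply] <;>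
    exact (Matrix.single_one_vecMul _ _)

namespace FamAdd

variable {P : PicardStr p} {Q : PicardStr q} {K : B ⥤ B'} {F : CartFunctor K p q}
  (A : FamAdd P Q F)

/-- The isomorphism `F (x + y) ≅ F x + F y`, for two values of an additive family. -/
noncomputable def τ {n : ℕ} (c : SmallFam P n) (r s : Fin n → ℤ) :
    (F.fib rfl).obj (P.add (c.fam.fam.pt r) (c.fam.fam.pt s)) ≅
      Q.add ((F.fib rfl).obj (c.fam.fam.pt r)) ((F.fib rfl).obj (c.fam.fam.pt s)) :=
  (F.fib rfl).mapIso (c.fam.fam.σ rfl).symm ≪≫ A.σ c rfl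

/-- Each comparison isomorphism of `A` is the one for the sum of the two values, preceded by the
image of the comparison isomorphism of the family. -/
theorem σ_eq {n : ℕ} (c : SmallFam P n) {r s t : Fin n → ℤ} (h : t = r + s) :
    (A.σ c h).hom = (F.fib rfl).map (c.fam.fam.σ h).hom ≫ (A.τ c r s).hom := by
  subst h
  exact (((F.fib rfl).mapIso (c.fam.fam.σ rfl)).hom_inv_id_assoc (A.σ c rfl).hom).symm

theorem τ_nat_aux {n : ℕ} {c d : SmallFam P n} (k : c ⟶ d) (r s : Fin n → ℤ) :
    F.F.map (P.map ⟨k.arr r, k.lies r⟩ ⟨k.arr s, k.lies s⟩).1 ≫ (A.τ d r s).hom.1 =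
      (A.τ c r s).hom.1 ≫
        (Q.map (F.fibMap ⟨k.arr r, k.lies r⟩) (F.fibMap ⟨k.arr s, k.lies s⟩)).1 := by
  have e := congrArg Subtype.val (A.σ_eq c (rfl : r + s = _))
  have e' := congrArg Subtype.val (A.σ_eq d (rfl : r + s = _))
  have h := A.nat k (rfl : r + s = _)
  have hσ : IsIso (c.fam.fam.σ (rfl : r + s = _)).hom.1 :=
    (fiberIsoVal (c.fam.fam.σ (rfl : r + s = _))).isIso_hom
  exact nat_of_push_aux F.F hσ (k.compat rfl) e e' h

theorem τ_comap {n m : ℕ} (M : Matrix (Fin m) (Fin n) ℤ) (c : SmallFam P n) (r s : Fin m → ℤ) :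
    (A.τ ((comap (rowHom M)).obj c) r s).hom.1 = (A.τ c (rowHom M r) (rowHom M s)).hom.1 := by
  have e := congrArg Subtype.val (A.σ_eq c (map_add (rowHom M) r s))
  have e' := congrArg Subtype.val (A.σ_eq ((comap (rowHom M)).obj c) (rfl : r + s = _))
  have h := A.comap_σ M c (rfl : r + s = _)
  have hσ : IsIso (c.fam.fam.σ (map_add (rowHom M) r s)).hom.1 :=
    (fiberIsoVal (c.fam.fam.σ (map_add (rowHom M) r s))).isIso_hom
  exact cancel_map_aux F.F hσ (h.symm.trans e') e

theorem τ_nat (hp : p.IsFibered) {n m : ℕ} {c : SmallFam P n} {d : SmallFam P m}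
    {b : c.fam.base ⟶ d.fam.base} {r s : Fin n → ℤ} {r' s' : Fin m → ℤ}
    (φ : FibHom p b (c.fam.fam.pt r) (d.fam.fam.pt r'))
    (ψ : FibHom p b (c.fam.fam.pt s) (d.fam.fam.pt s')) :
    F.F.map (P.map φ ψ).1 ≫ (A.τ d r' s').hom.1 =
      (A.τ c r s).hom.1 ≫ (Q.map (F.fibMap φ) (F.fibMap ψ)).1 := by
  obtain ⟨M, rfl, rfl⟩ := rowHom_of_two r s
  obtain ⟨N, rfl, rfl⟩ := rowHom_of_two r' s'
  obtain ⟨k, l, hk⟩ := exists_hom (n := 2) hp (Pi.basisFun ℤ (Fin 2)) (fun _ => rfl) b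
    (⟨(comap (rowHom M)).obj c, rfl⟩ : (proj P 2).Fiber _)
    (⟨(comap (rowHom N)).obj d, rfl⟩ : (proj P 2).Fiber _)
    (Fin.cases φ fun i => Fin.cases ψ (fun i => i.elim0) i)
  have h := A.τ_nat_aux k (Pi.basisFun ℤ (Fin 2) 0) (Pi.basisFun ℤ (Fin 2) 1)
  have hb : k.base = b := AddStr.lift_unique (isHomLift_base k) l
  subst hb
  have h₀ : (⟨k.arr (Pi.basisFun ℤ (Fin 2) 0), k.lies _⟩ : FibHom p k.base _ _) = φ :=
    Subtype.ext (hk 0)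
  have h₁ : (⟨k.arr (Pi.basisFun ℤ (Fin 2) 1), k.lies _⟩ : FibHom p k.base _ _) = ψ :=
    Subtype.ext (hk 1)
  subst h₀ h₁
  rw [τ_comap, τ_comap] at h
  exact h

/-- The isomorphism `F (x + y) ≅ F x + F y`. It is transported from the family indexed by `ℤ²` with
values `x` and `y` at the basis, and the stated compatibility with every other family follows from
the naturality of `τ`. -/
theorem exists_sig (hp : p.IsFibered) {T : B} (x y : p.Fiber T) :
    ∃ u : (F.fib rfl).obj (P.add x y) ≅ Q.add ((F.fib rfl).obj x) ((F.fib rfl).obj y),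
      ∀ {n : ℕ} (c : SmallFam P n) {b : c.fam.base ⟶ T} {r s : Fin n → ℤ}
        (φ : FibHom p b (c.fam.fam.pt r) x) (ψ : FibHom p b (c.fam.fam.pt s) y),
        F.F.map (P.map φ ψ).1 ≫ u.hom.1 =
          (A.τ c r s).hom.1 ≫ (Q.map (F.fibMap φ) (F.fibMap ψ)).1 := by
  obtain ⟨⟨d, rfl⟩, hd⟩ := exists_obj (P := P) hp (Pi.basisFun ℤ (Fin 2)) (fun _ => rfl)
    (Fin.cases x fun _ => y)
  obtain ⟨i⟩ := hd 0
  obtain ⟨j⟩ := hd 1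
  refine ⟨(F.fib rfl).mapIso (P.sumIso i j).symm ≪≫
    A.τ d (Pi.basisFun ℤ (Fin 2) 0) (Pi.basisFun ℤ (Fin 2) 1) ≪≫
    Q.sumIso ((F.fib rfl).mapIso i) ((F.fib rfl).mapIso j), fun c b r s φ ψ => ?_⟩
  have l₁ := isHomLift_comp_id φ.2 i.inv.2
  have l₂ := isHomLift_comp_id ψ.2 j.inv.2
  have h := A.τ_nat hp (d := d) (r' := Pi.basisFun ℤ (Fin 2) 0) (s' := Pi.basisFun ℤ (Fin 2) 1)
    ⟨φ.1 ≫ i.inv.1, l₁⟩ ⟨ψ.1 ≫ j.inv.1, l₂⟩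
  have e₁ : (φ.1 ≫ i.inv.1) ≫ i.hom.1 = φ.1 :=
    comp_cancel_aux (fiber_inv_hom i)
  have e₂ : (ψ.1 ≫ j.inv.1) ≫ j.hom.1 = ψ.1 :=
    comp_cancel_aux (fiber_inv_hom j)
  have e₃ : F.F.map (φ.1 ≫ i.inv.1) ≫ F.F.map i.hom.1 = F.F.map φ.1 :=
    (F.F.map_comp _ _).symm.trans (congrArg F.F.map e₁)
  have e₄ : F.F.map (ψ.1 ≫ j.inv.1) ≫ F.F.map j.hom.1 = F.F.map ψ.1 :=
    (F.F.map_comp _ _).symm.trans (congrArg F.F.map e₂)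
  exact sig_aux F.F (P.map_map_triangle (φ' := i.hom) (ψ' := j.hom) e₁ e₂)
    (congrArg Subtype.val (P.sumIso i j).hom_inv_id) h
    (Q.map_map_triangle (φ' := (F.fib rfl).map i.hom) (ψ' := (F.fib rfl).map j.hom) e₃ e₄)

section

variable (hp : p.IsFibered)

/-- The isomorphism `F (x + y) ≅ F x + F y`. -/
noncomputable def sig {T : B} (x y : p.Fiber T) :
    (F.fib rfl).obj (P.add x y) ≅ Q.add ((F.fib rfl).obj x) ((F.fib rfl).obj y) :=
  (A.exists_sig hp x y).choose

theorem sig_spec {T : B} {x y : p.Fiber T} {n : ℕ} (c : SmallFam P n) {b : c.fam.base ⟶ T}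
    {r s : Fin n → ℤ} (φ : FibHom p b (c.fam.fam.pt r) x) (ψ : FibHom p b (c.fam.fam.pt s) y) :
    F.F.map (P.map φ ψ).1 ≫ (A.sig hp x y).hom.1 =
      (A.τ c r s).hom.1 ≫ (Q.map (F.fibMap φ) (F.fibMap ψ)).1 :=
  (A.exists_sig hp x y).choose_spec c φ ψ

/-- On the values of a family, the additive structure is the given comparison. -/
theorem sig_pt {n : ℕ} (c : SmallFam P n) (r s : Fin n → ℤ) :
    A.sig hp (c.fam.fam.pt r) (c.fam.fam.pt s) = A.τ c r s := by
  have h := A.sig_spec hp c (FibHom.id (c.fam.fam.pt r)) (FibHom.id (c.fam.fam.pt s))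
  refine Iso.ext (Subtype.ext ?_)
  have e₁ := congrArg (fun f => F.F.map f.1) (P.map_id (c.fam.fam.pt r) (c.fam.fam.pt s))
  have e₂ : (Q.map (F.fibMap (FibHom.id (c.fam.fam.pt r)))
      (F.fibMap (FibHom.id (c.fam.fam.pt s)))).1 = 𝟙 _ :=
    (Q.map_congr (K.map_id _) (F.F.map_id _) (F.F.map_id _)).trans
      (congrArg Subtype.val (Q.map_id ((F.fib rfl).obj (c.fam.fam.pt r))
        ((F.fib rfl).obj (c.fam.fam.pt s))))
  exact (Category.id_comp _).symm.trans ((congrArg (· ≫ (A.sig hp _ _).hom.1)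
    (e₁.trans (F.F.map_id _)).symm).trans (h.trans ((congrArg ((A.τ c r s).hom.1 ≫ ·) e₂).trans
      (Category.comp_id _))))

theorem σ_eq_sig {n : ℕ} (c : SmallFam P n) {r s t : Fin n → ℤ} (h : t = r + s) :
    (A.σ c h).hom = (F.fib rfl).map (c.fam.fam.σ h).hom ≫
      (A.sig hp (c.fam.fam.pt r) (c.fam.fam.pt s)).hom := by
  rw [sig_pt]
  exact A.σ_eq c h

theorem sig_nat {T T' : B} {b : T ⟶ T'} {x y : p.Fiber T} {x' y' : p.Fiber T'}
    (φ : FibHom p b x x') (ψ : FibHom p b y y') :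
    F.F.map (P.map φ ψ).1 ≫ (A.sig hp x' y').hom.1 =
      (A.sig hp x y).hom.1 ≫ (Q.map (F.fibMap φ) (F.fibMap ψ)).1 := by
  obtain ⟨⟨d, rfl⟩, hd⟩ := exists_obj (P := P) hp (Pi.basisFun ℤ (Fin 2)) (fun _ => rfl)
    (Fin.cases x fun _ => y)
  obtain ⟨i⟩ := hd 0
  obtain ⟨j⟩ := hd 1
  have h₁ := A.sig_spec hp d (x := x) (y := y) (r := Pi.basisFun ℤ (Fin 2) 0)
    (s := Pi.basisFun ℤ (Fin 2) 1) i.hom j.hom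
  have h₂ := A.sig_spec hp d (x := x') (y := y') (r := Pi.basisFun ℤ (Fin 2) 0)
    (s := Pi.basisFun ℤ (Fin 2) 1) ⟨i.hom.1 ≫ φ.1, isHomLift_id_comp i.hom.2 φ.2⟩
    ⟨j.hom.1 ≫ ψ.1, isHomLift_id_comp j.hom.2 ψ.2⟩
  exact nat_transport_aux F.F (fiberIsoVal (P.sumIso i j)).isIso_hom
    (P.map_map_triangle rfl rfl) (Q.map_map_triangle (F.F.map_comp _ _).symm
      (F.F.map_comp _ _).symm) h₁ h₂

theorem sig_nat_fib {T : B} {x y x' y' : p.Fiber T} (f : x ⟶ x') (g : y ⟶ y') :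
    (F.fib rfl).map (P.sum f g) ≫ (A.sig hp x' y').hom =
      (A.sig hp x y).hom ≫ Q.sum ((F.fib rfl).map f) ((F.fib rfl).map g) := by
  refine Subtype.ext ((A.sig_nat hp (b := 𝟙 T) f g).trans (congrArg (_ ≫ ·) ?_))
  exact Q.map_congr (K.map_id T) rfl rfl

theorem sig_assoc_pt {n : ℕ} (c : SmallFam P n) (r s t : Fin n → ℤ) :
    (F.fib rfl).map (P.assoc (c.fam.fam.pt r) (c.fam.fam.pt s) (c.fam.fam.pt t)).hom ≫
        (A.sig hp _ _).hom ≫ Q.sum (𝟙 _) (A.sig hp _ _).hom =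
      (A.sig hp _ _).hom ≫ Q.sum (A.sig hp _ _).hom (𝟙 _) ≫ (Q.assoc _ _ _).hom := by
  have h₁ : r + s = r + s := rfl
  have h₂ : r + s + t = r + s + t := rfl
  have h₃ : s + t = s + t := rfl
  have h₄ : r + s + t = r + (s + t) := add_assoc r s t
  exact assoc_of_push_aux (F.fib rfl) (c.fam.fam.σ h₂).isIso_hom
    (P.sumIso (c.fam.fam.σ h₁) (Iso.refl _)).isIso_hom (c.fam.fam.assoc h₁ h₂ h₃ h₄)
    (A.sig_nat_fib hp (c.fam.fam.σ h₁).hom (𝟙 (c.fam.fam.pt t)))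
    (A.sig_nat_fib hp (𝟙 (c.fam.fam.pt r)) (c.fam.fam.σ h₃).hom)
    ((congrArg (Q.sum · (𝟙 _)) (A.σ_eq_sig hp c h₁)).trans
      (Q.sum_comp_id (F.fib rfl) (c.fam.fam.pt t) _ _))
    ((congrArg (Q.sum (𝟙 _) ·) (A.σ_eq_sig hp c h₃)).trans
      (Q.id_sum_comp (F.fib rfl) (c.fam.fam.pt r) _ _))
    (A.σ_eq_sig hp c h₂) (A.σ_eq_sig hp c h₄) (A.assoc c h₁ h₂ h₃ h₄)

theorem sig_comm_pt {n : ℕ} (c : SmallFam P n) (r s : Fin n → ℤ) :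
    (F.fib rfl).map (P.comm (c.fam.fam.pt r) (c.fam.fam.pt s)).hom ≫ (A.sig hp _ _).hom =
      (A.sig hp _ _).hom ≫ (Q.comm _ _).hom :=
  comm_of_push_aux (F.fib rfl) (c.fam.fam.σ (rfl : r + s = r + s)).isIso_hom
    (c.fam.fam.comm rfl (add_comm r s)) (A.σ_eq_sig hp c rfl) (A.σ_eq_sig hp c (add_comm r s))
    (A.comm c rfl (add_comm r s))

/-- Compatibility with associativity: three objects are, up to isomorphism, values of one family
indexed by `ℤ³`, and for the values of a family the condition is part of `A`. -/
theorem sig_assoc {T : B} (x y z : p.Fiber T) :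
    (F.fib rfl).map (P.assoc x y z).hom ≫
        (A.sig hp _ _).hom ≫ Q.sum (𝟙 _) (A.sig hp _ _).hom =
      (A.sig hp _ _).hom ≫ Q.sum (A.sig hp _ _).hom (𝟙 _) ≫ (Q.assoc _ _ _).hom := by
  obtain ⟨⟨d, rfl⟩, hd⟩ := exists_obj (P := P) hp (Pi.basisFun ℤ (Fin 3)) (fun _ => rfl)
    (Fin.cases x (Fin.cases y fun _ => z))
  obtain ⟨i⟩ := hd 0
  obtain ⟨j⟩ := hd 1
  obtain ⟨k⟩ := hd 2
  have n₁ := P.assoc_nat_fib i.hom j.hom k.hom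
  have n₂ := Q.assoc_nat_fib ((F.fib rfl).map i.hom) ((F.fib rfl).map j.hom) ((F.fib rfl).map k.hom)
  have e : ∀ {a b : p.Fiber ((proj P 3).obj d)} (f : a ⟶ b), (F.fib rfl).map f ≫ 𝟙 _ =
      𝟙 _ ≫ (F.fib rfl).map f := fun f => (Category.comp_id _).trans (Category.id_comp _).symm
  exact assoc_transport_aux (F.fib rfl) (P.sumIso (P.sumIso i j) k).isIso_hom n₁
    (A.sig_nat_fib hp i.hom (P.sum j.hom k.hom))
    (Q.sum_square (e i.hom) (A.sig_nat_fib hp j.hom k.hom))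
    (A.sig_nat_fib hp (P.sum i.hom j.hom) k.hom)
    (Q.sum_square (A.sig_nat_fib hp i.hom j.hom) (e k.hom)) n₂ (A.sig_assoc_pt hp d _ _ _)

/-- Compatibility with commutativity: as for associativity, with a family indexed by `ℤ²`. -/
theorem sig_comm {T : B} (x y : p.Fiber T) :
    (F.fib rfl).map (P.comm x y).hom ≫ (A.sig hp _ _).hom =
      (A.sig hp _ _).hom ≫ (Q.comm _ _).hom := by
  obtain ⟨⟨d, rfl⟩, hd⟩ := exists_obj (P := P) hp (Pi.basisFun ℤ (Fin 2)) (fun _ => rfl)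
    (Fin.cases x fun _ => y)
  obtain ⟨i⟩ := hd 0
  obtain ⟨j⟩ := hd 1
  exact comm_transport_aux (F.fib rfl) (P.sumIso i j).isIso_hom (P.comm_nat_fib i.hom j.hom)
    (A.sig_nat_fib hp j.hom i.hom) (A.sig_nat_fib hp i.hom j.hom)
    (Q.comm_nat_fib ((F.fib rfl).map i.hom) ((F.fib rfl).map j.hom)) (A.sig_comm_pt hp d _ _)

/-- A cartesian functor with compatible structures of additive families on the images of
additive families is additive. -/
noncomputable def addStr : AddStr P Q F where
  σ {T T'} h x y := by
    subst h
    exact A.sig hp x y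
  nat h₁ h₂ b b' x₁ y₁ x₂ y₂ φ ψ φ' ψ' hφ hψ := by
    subst h₁ h₂
    have k := φ'.2
    rw [hφ] at k
    refine (A.sig_nat hp φ ψ).trans (congrArg (_ ≫ ·) ?_)
    exact Q.map_congr (AddStr.lift_unique (F.fibMap φ).2 k) hφ.symm hψ.symm
  assoc h x y z := by
    subst h
    exact A.sig_assoc hp x y z
  comm h x y := by
    subst h
    exact A.sig_comm hp x y

end

end FamAdd

end

end PicardMatrix

namespace PicardMatrix

/-! ### Morphisms of additive functors from their values on additive families -/

section

variable {V W : Type*} [Category* V] [Category* W] (H H' : V ⥤ W)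

theorem conj_nat_aux {a b a' b' : V} (i : a ≅ a') (j : b ≅ b') (φ : a' ⟶ b')
    {s : H.obj a ⟶ H'.obj a} {t : H.obj b ⟶ H'.obj b}
    (h : H.map (i.hom ≫ φ ≫ j.inv) ≫ t = s ≫ H'.map (i.hom ≫ φ ≫ j.inv)) :
    H.map φ ≫ H.map j.inv ≫ t ≫ H'.map j.hom =
      (H.map i.inv ≫ s ≫ H'.map i.hom) ≫ H'.map φ := by
  rw [← cancel_epi (H.map i.hom), ← cancel_mono (H'.map j.inv)]
  simpa using h

theorem conj_eq_aux {a b : V} (i : a ≅ b) {s : H.obj a ⟶ H'.obj a} {t : H.obj b ⟶ H'.obj b}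
    (h : H.map i.hom ≫ t = s ≫ H'.map i.hom) : H.map i.inv ≫ s ≫ H'.map i.hom = t := by
  rw [← h, ← H.map_comp_assoc, i.inv_hom_id, H.map_id, Category.id_comp]

theorem additive_aux {a b c : V} {f : a ⟶ b} {g : b ⟶ c} (hf : IsIso f) (hg : IsIso g)
    {x x' y y' : W} {s : H.obj b ⟶ x} {s' : H.obj c ⟶ y} {t : H'.obj b ⟶ x'} {t' : H'.obj c ⟶ y'}
    {g₁ : x ⟶ y} {g₂ : x' ⟶ y'} {u : H.obj a ⟶ H'.obj a} {v : x ⟶ x'} {v' : y ⟶ y'}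
    {w : H.obj c ⟶ H'.obj c} (e₁ : H.map g ≫ s' = s ≫ g₁) (e₂ : H'.map g ≫ t' = t ≫ g₂)
    (e₃ : u ≫ H'.map f ≫ t = (H.map f ≫ s) ≫ v) (e₄ : v ≫ g₂ = g₁ ≫ v')
    (e₅ : H.map (f ≫ g) ≫ w = u ≫ H'.map (f ≫ g)) : s' ≫ v' = w ≫ t' := by
  rw [← cancel_epi (H.map (f ≫ g)), reassoc_of% e₅, H.map_comp, H'.map_comp]
  simp only [Category.assoc] at e₃ ⊢
  rw [e₂, reassoc_of% e₃, e₄, reassoc_of% e₁]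

end

section

variable {B : Type u} [Category.{v} B] {X : Type w} [Category.{w'} X] {p : X ⥤ B}
  {B' : Type u'} [Category.{v'} B'] {X' : Type w₁} [Category.{w₂} X'] {q : X' ⥤ B'}

open SmallFam

variable {P : PicardStr p} {Q : PicardStr q} {K : B ⥤ B'}

/-- Naturality of the components `(t c).arr r` with respect to all arrows between values of
families, not only those induced by morphisms of families: restricting along the maps `ℤ ⟶ ℤⁿ`
defined by `r` and `r'` reduces to families indexed by `ℤ`, where every arrow of values extends. -/
theorem exists_nat_of_fam_aux {F F' : CartFunctor K p q} {s : AddStr P Q F} {s' : AddStr P Q F'}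
    (hp : p.IsFibered)
    (t : ∀ {n : ℕ} (c : SmallFam P n), (Fam.push s).obj c.fam ⟶ (Fam.push s').obj c.fam)
    (t_nat : ∀ {n : ℕ} {c d : SmallFam P n} (k : c ⟶ d) (r : Fin n → ℤ),
      F.F.map (k.arr r) ≫ (t d).arr r = (t c).arr r ≫ F'.F.map (k.arr r))
    (t_comap : ∀ {n m : ℕ} (M : Matrix (Fin m) (Fin n) ℤ) (c : SmallFam P n) (r : Fin m → ℤ),
      (t ((comap (rowHom M)).obj c)).arr r = (t c).arr (rowHom M r))
    {n m : ℕ} {c : SmallFam P n} {d : SmallFam P m} {r : Fin n → ℤ} {r' : Fin m → ℤ}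
    (φ : (c.fam.fam.pt r).1 ⟶ (d.fam.fam.pt r').1) :
    F.F.map φ ≫ (t d).arr r' = (t c).arr r ≫ F'.F.map φ := by
  obtain ⟨M, rfl⟩ : ∃ M : Matrix (Fin 1) (Fin n) ℤ, rowHom M 1 = r := ⟨_, rowHom_rowMat r⟩
  obtain ⟨N, rfl⟩ : ∃ N : Matrix (Fin 1) (Fin m) ℤ, rowHom N 1 = r' := ⟨_, rowHom_rowMat r'⟩
  obtain ⟨b, hb⟩ := exists_base φ (c.fam.fam.pt _).2 (d.fam.fam.pt _).2
  obtain ⟨k, -, hk⟩ := exists_hom hp (Pi.basisFun ℤ (Fin 1)) basisFun_one b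
    (⟨(comap (rowHom M)).obj c, rfl⟩ : (proj P 1).Fiber _)
    (⟨(comap (rowHom N)).obj d, rfl⟩ : (proj P 1).Fiber _) fun _ => ⟨φ, hb⟩
  have h := t_nat k 1
  obtain rfl : k.arr 1 = φ := hk 0
  rw [t_comap, t_comap] at h
  exact h

/-- A compatible system of arrows between the images of additive families comes from a morphism of
additive functors. -/
theorem exists_isAdditive {K' : B ⥤ B'} (hK : K = K') {F : CartFunctor K p q}
    {F' : CartFunctor K' p q} {s : AddStr P Q F} {s' : AddStr P Q F'} (I : EvOneInv P)
    (hp : p.IsFibered)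
    (t : ∀ {n : ℕ} (c : SmallFam P n), (Fam.push s).obj c.fam ⟶ (Fam.push s').obj c.fam)
    (ht : ∀ {n : ℕ} (c : SmallFam P n), (t c).base = eqToHom (Functor.congr_obj hK _))
    (t_nat : ∀ {n : ℕ} {c d : SmallFam P n} (k : c ⟶ d) (r : Fin n → ℤ),
      F.F.map (k.arr r) ≫ (t d).arr r = (t c).arr r ≫ F'.F.map (k.arr r))
    (t_comap : ∀ {n m : ℕ} (M : Matrix (Fin m) (Fin n) ℤ) (c : SmallFam P n) (r : Fin m → ℤ),
      (t ((comap (rowHom M)).obj c)).arr r = (t c).arr (rowHom M r)) :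
    ∃ (τ : F.F ⟶ F'.F) (hτ : IsVertical q τ), IsAdditive s s' hτ ∧
      ∀ {n : ℕ} (c : SmallFam P n) (r : Fin n → ℤ), τ.app (c.fam.fam.pt r).1 = (t c).arr r := by
  subst hK
  have key := fun {n m : ℕ} {c : SmallFam P n} {d : SmallFam P m} {r : Fin n → ℤ}
    {r' : Fin m → ℤ} (φ : (c.fam.fam.pt r).1 ⟶ (d.fam.fam.pt r').1) =>
    exists_nat_of_fam_aux hp t t_nat t_comap φ
  let τ : F.F ⟶ F'.F :=
    { app x := F.F.map (I.η.inv.app x) ≫ (t (I.M.F.obj x)).arr 1 ≫ F'.F.map (I.η.hom.app x)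
      naturality x y φ := conj_nat_aux F.F F'.F (I.η.app x) (I.η.app y) φ (key _) }
  have hτ' : ∀ {n : ℕ} (c : SmallFam P n) (r : Fin n → ℤ),
      τ.app (c.fam.fam.pt r).1 = (t c).arr r := fun c r =>
    conj_eq_aux F.F F'.F (I.η.app (c.fam.fam.pt r).1) (key _)
  have l : ∀ {n : ℕ} (c : SmallFam P n) (r : Fin n → ℤ),
      q.IsHomLift (𝟙 (K.obj c.fam.base)) ((t c).arr r) := fun c r => by
    have h := (t c).lies r
    rw [ht c] at h
    exact h
  have hτ : IsVertical q τ := fun x => by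
    obtain ⟨⟨d, hd'⟩, hd⟩ := exists_obj (P := P) hp (Pi.basisFun ℤ (Fin 1)) basisFun_one
      fun _ => (⟨x, rfl⟩ : p.Fiber _)
    obtain ⟨i⟩ := hd 0
    have e : τ.app x = F.F.map i.inv.1 ≫ (t d).arr 1 ≫ F'.F.map i.hom.1 := by
      have h := conj_eq_aux F.F F'.F (fiberIsoVal i) (τ.naturality i.hom.1)
      rw [← h]
      exact congrArg (F.F.map i.inv.1 ≫ · ≫ F'.F.map i.hom.1) (hτ' d 1)
    rw [e]
    refine isHomLift_congr (T := K.obj (p.obj x)) _ ?_ rfl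
    refine isHomLift_id_comp (F.lift_id rfl _ i.inv.2) (isHomLift_id_comp ?_
      (F'.lift_id rfl _ i.hom.2))
    exact isHomLift_congr _ (l d 1) ((F.obj_eq _).trans
      (congrArg K.obj ((d.fam.fam.pt 1).2.trans hd')))
  refine ⟨τ, hτ, ⟨fun {T T'} h h' x y => ?_⟩, hτ'⟩
  subst h
  obtain ⟨⟨d, rfl⟩, hd⟩ := exists_obj (P := P) hp (Pi.basisFun ℤ (Fin 2)) (fun _ => rfl)
    (Fin.cases x fun _ => y)
  obtain ⟨i⟩ := hd 0
  obtain ⟨j⟩ := hd 1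
  let σ := d.fam.fam.σ (rfl : Pi.basisFun ℤ (Fin 2) 0 + Pi.basisFun ℤ (Fin 2) 1 = _)
  have n₁ := congrArg Subtype.val (s.nat_fib rfl i.hom j.hom)
  have n₂ := congrArg Subtype.val (s'.nat_fib rfl i.hom j.hom)
  have c₁ := (t d).compat (rfl : Pi.basisFun ℤ (Fin 2) 0 + Pi.basisFun ℤ (Fin 2) 1 = _)
  have hs : ∀ r, τ.app (d.fam.fam.pt r).1 = (t d).arr r := fun r => hτ' d r
  have e : (Q.map ⟨(t d).arr _, (t d).lies _⟩ ⟨(t d).arr _, (t d).lies _⟩).1 =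
      (Q.sum (hτ.fibApp rfl rfl (d.fam.fam.pt (Pi.basisFun ℤ (Fin 2) 0)))
        (hτ.fibApp rfl rfl (d.fam.fam.pt (Pi.basisFun ℤ (Fin 2) 1)))).1 :=
    Q.map_congr (ht d) (hs _).symm (hs _).symm
  refine Subtype.ext (additive_aux F.F F'.F (fiberIsoVal σ).isIso_hom
    (fiberIsoVal (P.sumIso i j)).isIso_hom n₁ n₂ (c₁.trans (congrArg (_ ≫ ·) e)) ?_ ?_)
  · refine congrArg Subtype.val (Q.sum_square (f := hτ.fibApp rfl rfl _)
      (g := (F'.fib rfl).map i.hom) (h := (F.fib rfl).map i.hom) (k := hτ.fibApp rfl rfl _)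
      (f' := hτ.fibApp rfl rfl _)
      (g' := (F'.fib rfl).map j.hom) (h' := (F.fib rfl).map j.hom) (k' := hτ.fibApp rfl rfl _)
      ?_ ?_)
    · exact Subtype.ext (τ.naturality i.hom.1).symm
    · exact Subtype.ext (τ.naturality j.hom.1).symm
  · exact (τ.naturality _).trans (congrArg (· ≫ F'.F.map _) (hs _))

/-- A morphism of functors is determined by its values on additive families. -/
theorem nat_ext_of_fam {F F' : X ⥤ X'} {τ τ' : F ⟶ F'} (I : EvOneInv P)
    (h : ∀ (c : SmallFam P 1), τ.app (c.fam.fam.pt 1).1 = τ'.app (c.fam.fam.pt 1).1) : τ = τ' := by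
  refine NatTrans.ext (funext fun x => ?_)
  have k : ∀ {a b : X} (i : a ≅ b), τ.app a = τ'.app a → τ.app b = τ'.app b := fun i e => by
    rw [← cancel_epi (F.map i.hom), τ.naturality, τ'.naturality, e]
  exact k (I.η.app x) (h (I.M.F.obj x))

end

end PicardMatrix

namespace PicardMatrix

/-! ### Additive functors and arrows of 2-algebras -/

/-- A cartesian functor over an equal functor of the bases. -/
def CartFunctor.ofEq {B : Type u} [Category.{v} B] {X : Type w} [Category.{w'} X]
    {B' : Type u'} [Category.{v'} B'] {X' : Type w₁} [Category.{w₂} X'] {p : X ⥤ B} {q : X' ⥤ B'}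
    {K K' : B ⥤ B'} (h : K = K') (F : CartFunctor K p q) : CartFunctor K' p q where
  F := F.F
  w := F.w.trans (congrArg (p ⋙ ·) h)
  cart := F.cart

theorem Alg.isIso_nat {C : Type u} [Category.{v} C] {J : GrothendieckTopology C}
    {A A' : Alg.{w₁, w₂} J} (α : A ⟶ A') {a b : TOne} (M : a ⟶ b) (z : (A.alg.A.obj a).X) :
    IsIso ((nat α M).app z) := inferInstance

namespace Picard

open SmallFam

variable {C : Type u} [Category.{v} C] {J : GrothendieckTopology C} {P Q : Picard.{w₁, w₂} J}

/-- An arrow between the 2-algebras of families of two Picard stacks, as a transformation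
of families. -/
noncomputable def famTrans (α : P.toAlg ⟶ Q.toAlg) :
    FamTrans P.pic.str Q.pic.str (Over.map α.base) where
  T n := ((α.hom.app (TOne.pow n)).fn : CartFunctor _ (proj P.pic.str n) (proj Q.pic.str n)).ofEq
    (congrArg Over.map (α.lies (TOne.pow n)))
  ν M c := @asIso (SmallFam Q.pic.str _) _ _ _ ((Alg.nat α (TOne.arrow M)).app c)
    (Alg.isIso_nat α (TOne.arrow M) c)
  ν_nat M _ _ h := (Alg.nat α (TOne.arrow M)).naturality h
  ν_lies {n k} M c := by
    refine isHomLift_congr (p := proj Q.pic.str k) _ (Alg.nat_vert α (TOne.arrow M) c) ?_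
    exact (((α.hom.app (TOne.pow k)).fn : CartFunctor _ (proj P.pic.str k) (proj Q.pic.str k)).ofEq
      (congrArg Over.map (α.lies (TOne.pow k)))).obj_eq ((comap (rowHom M)).obj c)
  ν_comp M N c := Alg.nat_comp α (TOne.arrow M) (TOne.arrow N) c

variable (α : P.toAlg ⟶ Q.toAlg)

/-- A quasi-inverse of the evaluation at the generator of `ℤ`, for the families of `P`. -/
noncomputable def inv (P : Picard.{w₁, w₂} J) : EvOneInv P.pic.str :=
  (nonempty_evOneInv P.pic.isStack.fibered P.pic.str).some

/-- The additive functor defined by an arrow of 2-algebras. -/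
noncomputable def ofAlg : P ⟶ Q :=
  Hom.mk (P := P) (Q := Q)
    ⟨α.base, (famTrans α).toCart P.inv Q.pic.isStack.fibered⟩
    (((famTrans α).famAdd P.inv P.pic.isStack.fibered Q.pic.isStack.fibered).addStr
      P.pic.isStack.fibered)

/-- The comparison of the image of a family under `ofAlg α` and its image under `α`. -/
noncomputable def ofAlgHom {n : ℕ} (c : SmallFam P.pic.str n) :
    (Fam.push (ofAlg α).add).obj c.fam ⟶ SmallFam.fam (((famTrans α).T n).F.obj c) where
  base := eqToHom (((famTrans α).T n).obj_eq c).symm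
  arr r := ((famTrans α).ψ P.inv P.pic.isStack.fibered Q.pic.isStack.fibered c r).1
  lies r := ((famTrans α).ψ P.inv P.pic.isStack.fibered Q.pic.isStack.fibered c r).2
  compat {r s t} h := by
    have e := FamAt.pull_σ (((famTrans α).T n).F.obj c).fam.fam
      ((famTrans α).ψ P.inv P.pic.isStack.fibered Q.pic.isStack.fibered c)
      Q.pic.isStack.fibered h
    have e' := congrArg Subtype.val (((famTrans α).famAdd P.inv P.pic.isStack.fibered
      Q.pic.isStack.fibered).σ_eq_sig P.pic.isStack.fibered c h)
    exact e.symm.trans (congrArg (· ≫ _) e')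

theorem isIso_ofAlgHom {n : ℕ} (c : SmallFam P.pic.str n) : IsIso (ofAlgHom α c) := by
  have : IsIso (ofAlgHom α c).base :=
    inferInstanceAs (IsIso (eqToHom (((famTrans α).T n).obj_eq c).symm))
  have : ∀ r, IsIso ((ofAlgHom α c).arr r) := fun r =>
    Q.pic.str.isIso_of_isHomLift Q.pic.isStack.fibered this ((ofAlgHom α c).lies r)
  exact Fam.isIso_of_arr _

/-- The comparison `ofAlgHom`, as an isomorphism. -/
noncomputable abbrev ofAlgIso {n : ℕ} (c : SmallFam P.pic.str n) :
    (Fam.push (ofAlg α).add).obj c.fam ≅ SmallFam.fam (((famTrans α).T n).F.obj c) :=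
  @asIso _ _ _ _ (ofAlgHom α c) (isIso_ofAlgHom α c)

/-- The arrow of 2-algebras defined by `ofAlg α` is isomorphic to `α`. -/
noncomputable def toAlgMapOfAlg : toAlgMap (ofAlg α) ≅ α :=
  Alg.modIso (A := P.toAlg) (A' := Q.toAlg) (α := toAlgMap (ofAlg α)) (β := α) rfl
    (fun t => NatIso.ofComponents (fun c => SmallFam.isoMk (cmp (ofAlg α) c ≪≫
        ofAlgIso α (n := t.as.exp) c)) fun {c c'} h =>
      conj_naturality_hom (cmp (ofAlg α) c) (cmp (ofAlg α) c')
        (ofAlgIso α (n := t.as.exp) c) (ofAlgIso α (n := t.as.exp) c')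
        (Fam.hom_ext fun r => (famTrans α).ψ_nat P.inv P.pic.isStack.fibered
          Q.pic.isStack.fibered h r))
    (fun t c => isHomLift_of_base _ (((famTrans α).T t.as.exp).obj_eq c).symm
      ((congrArg (· ≫ _) (cmp_hom_base (ofAlg α) c)).trans (Category.id_comp _)))
    (fun M c => by
      refine Eq.trans ?_ (Category.id_comp (obj := SmallFam Q.pic.str _) _).symm
      refine SmallFam.hom_ext fun s => ?_
      have h := (famTrans α).ψ_comp P.inv P.pic.isStack.fibered Q.pic.isStack.fibered c M.as s
      exact (Category.assoc _ _ _).trans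
        (congrArg ((cmp (ofAlg α) c).hom.arr (rowHom M.as s) ≫ ·) h))

end Picard

end PicardMatrix

namespace PicardMatrix

theorem SmallFam.base_eq_eqToHom {B : Type u} [Category.{v} B] {X : Type w} [Category.{w'} X]
    {p : X ⥤ B} {P : PicardStr p} {n : ℕ} {c c' : SmallFam P n} {h : c ⟶ c'} {T : B}
    (l : (proj P n).IsHomLift (𝟙 T) h) (e : c.fam.base = c'.fam.base) :
    Fam.Hom.base h = eqToHom e := by
  refine (IsHomLift.fac' (proj P n) (𝟙 T) h).trans ?_
  exact (congrArg (_ ≫ ·) (Category.id_comp _)).trans (eqToHom_trans _ _)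

namespace Picard

open SmallFam

variable {C : Type u} [Category.{v} C] {J : GrothendieckTopology C} {P Q : Picard.{w₁, w₂} J}

theorem cmp_inv_hom_arr (F : P ⟶ Q) {n : ℕ} (c : SmallFam P.pic.str n) (r : Fin n → ℤ) :
    (cmp F c).inv.arr r ≫ (cmp F c).hom.arr r = 𝟙 (F.hom.fn.F.obj (c.fam.fam.pt r).1) :=
  congrArg (fun h => Fam.Hom.arr h r) (cmp F c).inv_hom_id

theorem cmp_hom_inv_arr (F : P ⟶ Q) {n : ℕ} (c : SmallFam P.pic.str n) (r : Fin n → ℤ) :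
    (cmp F c).hom.arr r ≫ (cmp F c).inv.arr r =
      𝟙 ((SmallFam.fam ((SmallFam.push F.add Q.pic.isStack.fibered).obj c)).fam.pt r).1 :=
  congrArg (fun h => Fam.Hom.arr h r) (cmp F c).hom_inv_id

theorem conj_cancel_aux {V : Type*} [Category* V] {a b c d : V} {f : a ⟶ b} {f' : b ⟶ a}
    {h : c ⟶ d} {h' : d ⟶ c} (e : f' ≫ f = 𝟙 b) (e' : h ≫ h' = 𝟙 c) {g g' : b ⟶ c}
    (k : f ≫ g ≫ h = f ≫ g' ≫ h) : g = g' := by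
  have := congrArg (fun t => f' ≫ t ≫ h') k
  simpa [reassoc_of% e, e'] using this

theorem conj_conj_aux {V : Type*} [Category* V] {a b c d : V} {f : a ⟶ b} {f' : b ⟶ a}
    {h : d ⟶ c} {h' : c ⟶ d} (e : f ≫ f' = 𝟙 a) (e' : h ≫ h' = 𝟙 d) {g : a ⟶ d} :
    f ≫ (f' ≫ g ≫ h) ≫ h' = g := by
  simp [reassoc_of% e, e']

theorem conj_nat_of_aux {V W : Type*} [Category* V] [Category* W] (H H' : V ⥤ W) {x y : V}
    {f : x ⟶ y} {a b a' b' : W} {i : a ⟶ H.obj x} {i' : H.obj x ⟶ a} 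
    {j' : H.obj y ⟶ b} {k : a' ⟶ H'.obj x} {l : b' ⟶ H'.obj y}
    {l' : H'.obj y ⟶ b'} {m : a ⟶ a'} {n : b ⟶ b'} (hi : i' ≫ i = 𝟙 _)
    (hl : l' ≫ l = 𝟙 _)
    (h : (i ≫ H.map f ≫ j') ≫ n = m ≫ k ≫ H'.map f ≫ l') :
    H.map f ≫ j' ≫ n ≫ l = (i' ≫ m ≫ k) ≫ H'.map f := by
  have := congrArg (fun t => i' ≫ t ≫ l) h
  simpa [reassoc_of% hi, hl] using this

/-- A morphism of additive functors is recovered from the modification, because every object is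
isomorphic to a value of a family. -/
theorem toAlgMap₂_injective {F F' : P ⟶ Q} {τ τ' : F ⟶ F'} (h : toAlgMap₂ τ = toAlgMap₂ τ') :
    τ = τ' := by
  refine hom₂_ext (StackTot.Hom₂.ext (nat_ext_of_fam P.inv fun c => ?_))
  have e := congrArg (fun m => Fam.Hom.arr ((Alg.mod m (TOne.pow 1)).app c) 1) h
  exact conj_cancel_aux (cmp_inv_hom_arr F c 1) (cmp_inv_hom_arr F' c 1) e

/-- The arrow of families defined by a 2-arrow between images of additive functors. -/
noncomputable def modFam {F F' : P ⟶ Q} (m : toAlgMap F ⟶ toAlgMap F') {n : ℕ}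
    (c : SmallFam P.pic.str n) : (Fam.push F.add).obj c.fam ⟶ (Fam.push F'.add).obj c.fam :=
  (cmp F c).inv ≫ (show ((SmallFam.push F.add Q.pic.isStack.fibered).obj c).fam ⟶
    ((SmallFam.push F'.add Q.pic.isStack.fibered).obj c).fam from
      (Alg.mod m (TOne.pow n)).app c) ≫ (cmp F' c).hom

/-- Every modification comes from a morphism of additive functors, whose value at an object is the
component at `1` of the modification on the family spanned by that object. -/
theorem exists_toAlgMap₂ {F F' : P ⟶ Q} (m : toAlgMap F ⟶ toAlgMap F') :
    ∃ τ : F ⟶ F', toAlgMap₂ τ = m := by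
  have hb : F.hom.base = F'.hom.base := Over2.proj_eq m
  obtain ⟨τ, hτ, ha, e⟩ := exists_isAdditive (congrArg Over.map hb) P.inv P.pic.isStack.fibered
    (modFam m)
    (fun {n} c => by
      have l := (StackTot.Hom₂.vert (m.hom.as.app (TOne.pow n))) c
      have h₁ := cmp_inv_base F c
      have h₂ := cmp_hom_base F' c
      refine (congrArg₂ (fun f g => f ≫ _ ≫ g) h₁ h₂).trans ?_
      refine (Category.id_comp _).trans ((Category.comp_id _).trans ?_)
      exact SmallFam.base_eq_eqToHom (n := n) l _)
    (fun {n c d} k r => by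
      have h := congrArg (fun h => Fam.Hom.arr h r) ((Alg.mod m (TOne.pow n)).naturality k)
      exact conj_nat_of_aux F.hom.fn.F F'.hom.fn.F (cmp_inv_hom_arr F c r)
        (cmp_inv_hom_arr F' d r) h)
    (fun {n k} M c r => by
      have h := congrArg (fun h => Fam.Hom.arr h r) (Alg.mod_nat m (TOne.arrow M) c)
      have h' := (Category.comp_id _).symm.trans (h.trans (Category.id_comp _))
      exact congrArg (fun t => (cmp F c).inv.arr (rowHom M r) ≫ t ≫
        (cmp F' c).hom.arr (rowHom M r)) h')
  refine ⟨⟨⟨hb, τ, hτ⟩, ha⟩, Alg.mod_ext fun t c => SmallFam.hom_ext fun r => ?_⟩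
  refine (congrArg (fun f => (cmp F c).hom.arr r ≫ f ≫ (cmp F' c).inv.arr r)
    (e (n := t.as.exp) c r)).trans ?_
  exact conj_conj_aux (cmp_hom_inv_arr F c r) (cmp_hom_inv_arr F' c r)

end Picard

end PicardMatrix

namespace PicardMatrix

/-! ### Cartesian arrows and local equivalences of 2-categories over a category -/

section

open Over2

variable {C : Type u} [Category.{v} C] {D : Type u'} [Bicategory.{w', v'} D] [Over2 C D]
  {D' : Type u''} [Bicategory.{w₁, w₂} D'] [Over2 C D']

namespace Over2

/-- The universal property of a cartesian arrow `φ : x ⟶ y` with respect to the arrows from `z`. -/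
structure IsCartesianAt {x y : D} (φ : x ⟶ y) (z : D) : Prop where
  inj {χ χ' : z ⟶ x} {a b : χ ⟶ χ'} (h : a ▷ φ = b ▷ φ) : a = b
  full {χ χ' : z ⟶ x} (h : proj χ = proj χ') (m : χ ≫ φ ⟶ χ' ≫ φ) : ∃ a : χ ⟶ χ', a ▷ φ = m
  surj (ω : z ⟶ y) (g : base z ⟶ base x) (h : proj ω = g ≫ proj φ) :
    ∃ χ : z ⟶ x, proj χ = g ∧ Nonempty (χ ≫ φ ≅ ω)

theorem isCartesianArrow_iff {x y : D} (φ : x ⟶ y) :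
    IsCartesianArrow φ ↔ ∀ z, IsCartesianAt φ z := by
  constructor
  · intro h z
    refine ⟨fun {χ χ' a b} k => ?_, fun {χ χ'} e m => ?_, fun ω g e => ?_⟩
    · have := h z (proj χ)
      let χ₁ : HomOver z x (proj χ) := ⟨χ, rfl⟩
      let χ₂ : HomOver z x (proj χ) := ⟨χ', (proj_eq a).symm⟩
      have := (postcompOver φ z (proj χ)).map_injective (X := χ₁) (Y := χ₂)
        (a₁ := ObjectProperty.homMk a) (a₂ := ObjectProperty.homMk b)
        (ObjectProperty.hom_ext _ k)
      exact congrArg InducedCategory.Hom.hom this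
    · have := h z (proj χ)
      let χ₁ : HomOver z x (proj χ) := ⟨χ, rfl⟩
      let χ₂ : HomOver z x (proj χ) := ⟨χ', e.symm⟩
      obtain ⟨a, ha⟩ := (postcompOver φ z (proj χ)).map_surjective (X := χ₁) (Y := χ₂)
        (ObjectProperty.homMk m)
      exact ⟨a.hom, congrArg InducedCategory.Hom.hom ha⟩
    · have := h z g
      obtain ⟨χ, ⟨i⟩⟩ := (h z g).essSurj.mem_essImage ⟨ω, e⟩
      exact ⟨χ.obj, χ.property, ⟨(ObjectProperty.ι _).mapIso i⟩⟩
  · intro h z g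
    have := h z
    refine ⟨⟨fun {χ χ' a b} k => ?_⟩, ⟨fun {χ χ'} m => ?_⟩, ⟨fun ω => ?_⟩⟩
    · exact ObjectProperty.hom_ext _ (this.inj (congrArg InducedCategory.Hom.hom k))
    · obtain ⟨a, ha⟩ := this.full (χ.property.trans χ'.property.symm) m.hom
      exact ⟨ObjectProperty.homMk a, ObjectProperty.hom_ext _ ha⟩
    · obtain ⟨χ, h₁, ⟨i⟩⟩ := this.surj ω.obj g ω.property
      exact ⟨⟨χ, h₁⟩, ⟨ObjectProperty.isoMk _ i⟩⟩

theorem IsCartesianAt.comp {x y z : D} {φ : x ⟶ y} {ψ : y ⟶ z} {t : D} (h : IsCartesianAt φ t)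
    (h' : IsCartesianAt ψ t) : IsCartesianAt (φ ≫ ψ) t := by
  have e : ∀ {χ χ' : t ⟶ x} (a : χ ⟶ χ'),
      a ▷ (φ ≫ ψ) = (α_ χ φ ψ).inv ≫ a ▷ φ ▷ ψ ≫ (α_ χ' φ ψ).hom := fun a => by simp
  refine ⟨fun {χ χ' a b} k => ?_, fun {χ χ'} k m => ?_, fun ω g k => ?_⟩
  · rw [e, e, cancel_epi, cancel_mono] at k
    exact h.inj (h'.inj k)
  · obtain ⟨b, hb⟩ := h'.full (by rw [proj_comp, proj_comp, k])
      ((α_ χ φ ψ).hom ≫ m ≫ (α_ χ' φ ψ).inv)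
    obtain ⟨a, rfl⟩ := h.full k b
    exact ⟨a, by rw [e, hb]; simp⟩
  · obtain ⟨χ, h₁, ⟨i⟩⟩ := h'.surj ω (g ≫ proj φ) (by rw [k, proj_comp, Category.assoc])
    obtain ⟨χ', h₂, ⟨i'⟩⟩ := h.surj χ g h₁
    exact ⟨χ', h₂, ⟨(α_ χ' φ ψ).symm ≪≫ whiskerRightIso i' ψ ≪≫ i⟩⟩

theorem proj_hom_inv {x y : D} (e : x ≌ y) : proj e.hom ≫ proj e.inv = 𝟙 (base x) := by
  rw [← proj_comp, ← proj_eq e.unit.hom, proj_id]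

theorem proj_inv_hom {x y : D} (e : x ≌ y) : proj e.inv ≫ proj e.hom = 𝟙 (base y) := by
  rw [← proj_comp, proj_eq e.counit.hom, proj_id]

/-- Composition with an equivalence is an equivalence of categories of arrows. -/
theorem isEquivalence_postcomp {x y : D} (e : x ≌ y) (z : D) :
    (postcomp z e.hom).IsEquivalence :=
  (CategoryTheory.Equivalence.mk (postcomp z e.hom) (postcomp z e.inv)
    (NatIso.ofComponents (fun χ => (ρ_ χ).symm ≪≫ whiskerLeftIso χ e.unit ≪≫ (α_ _ _ _).symm)
      fun {χ χ'} f => by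
        have h := whisker_exchange f e.unit.hom
        rw [Bicategory.whiskerRight_comp, Bicategory.whiskerRight_id] at h
        dsimp [postcomp]
        rw [← cancel_epi (ρ_ χ).hom]
        simp only [Category.assoc] at h
        simp [← reassoc_of% h])
    (NatIso.ofComponents (fun χ => α_ _ _ _ ≪≫ whiskerLeftIso χ e.counit ≪≫ ρ_ χ)
      fun {χ χ'} f => by
        have h := whisker_exchange f e.counit.hom
        rw [Bicategory.whiskerRight_comp, Bicategory.whiskerRight_id] at h
        dsimp [postcomp]
        rw [← cancel_mono (ρ_ χ').inv]
        simp only [Category.assoc] at h ⊢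
        simp [h])).isEquivalence_functor

theorem isEquivalence_precomp {x y : D} (e : x ≌ y) (z : D) :
    (precomp z e.hom).IsEquivalence :=
  (CategoryTheory.Equivalence.mk (precomp z e.hom) (precomp z e.inv)
    (NatIso.ofComponents (fun χ => (λ_ χ).symm ≪≫ whiskerRightIso e.counit.symm χ ≪≫ (α_ _ _ _))
      fun {χ χ'} f => by
        have h := whisker_exchange e.counit.inv f
        rw [Bicategory.comp_whiskerLeft, Bicategory.id_whiskerLeft] at h
        dsimp [precomp]
        rw [← cancel_epi (λ_ χ).hom]
        simp only [Category.assoc] at h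
        simp [reassoc_of% h])
    (NatIso.ofComponents (fun χ => (α_ _ _ _).symm ≪≫ whiskerRightIso e.unit.symm χ ≪≫ λ_ χ)
      fun {χ χ'} f => by
        have h := whisker_exchange e.unit.inv f
        rw [Bicategory.comp_whiskerLeft, Bicategory.id_whiskerLeft] at h
        dsimp [precomp]
        rw [← cancel_mono (λ_ χ').inv]
        simp only [Category.assoc] at h ⊢
        simp [← h])).isEquivalence_functor

theorem isCartesianAt_equivalence {x y : D} (e : x ≌ y) (z : D) : IsCartesianAt e.hom z := by
  have := isEquivalence_postcomp e z
  refine ⟨fun k => (postcomp z e.hom).map_injective k,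
    fun _ m => (postcomp z e.hom).map_surjective m, fun ω g k => ⟨ω ≫ e.inv, ?_,
      ⟨α_ _ _ _ ≪≫ whiskerLeftIso ω e.counit ≪≫ ρ_ ω⟩⟩⟩
  rw [proj_comp, k, Category.assoc, proj_hom_inv, Category.comp_id]

/-- The lifting property of a cartesian arrow may be tested on objects up to equivalence. -/
theorem IsCartesianAt.of_equivalence {x y : D} {φ : x ⟶ y} {z z' : D} (e : z ≌ z')
    (h : IsCartesianAt φ z) : IsCartesianAt φ z' := by
  have e₁ := isEquivalence_precomp e x
  have e₂ := isEquivalence_precomp e y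
  have k : ∀ {χ χ' : z' ⟶ x} (a : χ ⟶ χ'), (e.hom ◁ a) ▷ φ =
      (α_ e.hom χ φ).hom ≫ e.hom ◁ (a ▷ φ) ≫ (α_ e.hom χ' φ).inv := fun a => by simp
  refine ⟨fun {χ χ' a b} l => ?_, fun {χ χ'} l m => ?_, fun ω g l => ?_⟩
  · have : e.hom ◁ a = e.hom ◁ b := h.inj (by rw [k, k, l])
    exact (precomp x e.hom).map_injective this
  · obtain ⟨a₀, ha⟩ := h.full (χ := e.hom ≫ χ) (χ' := e.hom ≫ χ')
      (by rw [proj_comp, proj_comp, l]) ((α_ e.hom χ φ).hom ≫ e.hom ◁ m ≫ (α_ e.hom χ' φ).inv)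
    obtain ⟨a, rfl⟩ := (precomp x e.hom).map_surjective (X := χ) (Y := χ') a₀
    refine ⟨a, (precomp y e.hom).map_injective ?_⟩
    change (e.hom ◁ a) ▷ φ = _ at ha
    rw [k, cancel_epi, cancel_mono] at ha
    exact ha
  · obtain ⟨χ, h₁, ⟨i⟩⟩ := h.surj (e.hom ≫ ω) (proj e.hom ≫ g)
      (by rw [proj_comp, l, Category.assoc])
    refine ⟨e.inv ≫ χ, ?_, ⟨α_ _ _ _ ≪≫ whiskerLeftIso e.inv i ≪≫ (α_ _ _ _).symm ≪≫
      whiskerRightIso e.counit ω ≪≫ λ_ ω⟩⟩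
    rw [proj_comp, h₁, ← Category.assoc, proj_inv_hom, Category.id_comp]

end Over2

/-- A pseudofunctor which induces equivalences on the categories of arrows. -/
structure IsLocalEquiv (Φ : D ⥤ᵖ D') : Prop where
  full {x y : D} {φ ψ : x ⟶ y} (m : Φ.map φ ⟶ Φ.map ψ) : ∃ τ : φ ⟶ ψ, Φ.map₂ τ = m
  inj {x y : D} {φ ψ : x ⟶ y} {τ τ' : φ ⟶ ψ} (h : Φ.map₂ τ = Φ.map₂ τ') : τ = τ'
  surj {x y : D} (α : Φ.obj x ⟶ Φ.obj y) : ∃ φ : x ⟶ y, Nonempty (Φ.map φ ≅ α)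

theorem CartPseudofunctor.isEquivalence_mapOver (Φ : CartPseudofunctor D D')
    (h : IsLocalEquiv Φ.toPseudofunctor) (x y : D) (f : base x ⟶ base y) :
    (Φ.mapOver x y f).IsEquivalence := by
  refine ⟨⟨fun {φ φ' a b} k => ?_⟩, ⟨fun {φ φ'} m => ?_⟩, ⟨fun α => ?_⟩⟩
  · have k' : ((Φ.mapOver x y f).map a).hom = ((Φ.mapOver x y f).map b).hom := by rw [k]
    exact ObjectProperty.hom_ext _ (h.inj k')
  · obtain ⟨a, ha⟩ := h.full m.hom
    exact ⟨ObjectProperty.homMk a, ObjectProperty.hom_ext _ ha⟩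
  · obtain ⟨φ, ⟨i⟩⟩ := h.surj α.obj
    refine ⟨⟨φ, ?_⟩, ⟨ObjectProperty.isoMk _ i⟩⟩
    have e := (Φ.proj_map φ).symm.trans ((Over2.proj_eq i.hom).trans α.property)
    rwa [cancel_epi, cancel_mono] at e

namespace IsLocalEquiv

open Over2

variable {Φ : D ⥤ᵖ D'} (h : IsLocalEquiv Φ) (base_obj : ∀ x : D, base (Φ.obj x) = base x)
  (proj_map : ∀ {x y : D} (φ : x ⟶ y),
    proj (Φ.map φ) = eqToHom (base_obj x) ≫ proj φ ≫ eqToHom (base_obj y).symm)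

include proj_map in
theorem proj_eq_of_map {x y : D} {φ : x ⟶ y} {α : Φ.obj x ⟶ Φ.obj y} (i : Φ.map φ ≅ α) :
    proj φ = eqToHom (base_obj x).symm ≫ proj α ≫ eqToHom (base_obj y) := by
  rw [← proj_eq i.hom, proj_map]
  simp

include h proj_map in
/-- A local equivalence preserves the lifting property against objects in its image. -/
theorem isCartesianAt {x y : D} {φ : x ⟶ y} {z : D} (hφ : IsCartesianAt φ z) :
    IsCartesianAt (Φ.map φ) (Φ.obj z) := by
  have k : ∀ {χ χ' : z ⟶ x} (a : χ ⟶ χ'), Φ.map₂ a ▷ Φ.map φ =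
      (Φ.mapComp χ φ).inv ≫ Φ.map₂ (a ▷ φ) ≫ (Φ.mapComp χ' φ).hom := fun a => by
    rw [Φ.map₂_whisker_right]
    simp
  refine ⟨fun {χ χ' a b} l => ?_, fun {χ χ'} l m => ?_, fun ω g l => ?_⟩
  · obtain ⟨χ₀, ⟨i⟩⟩ := h.surj χ
    obtain ⟨χ₀', ⟨i'⟩⟩ := h.surj χ'
    obtain ⟨a₀, ha⟩ := h.full (i.hom ≫ a ≫ i'.inv)
    obtain ⟨b₀, hb⟩ := h.full (i.hom ≫ b ≫ i'.inv)
    have e : Φ.map₂ a₀ ▷ Φ.map φ = Φ.map₂ b₀ ▷ Φ.map φ := by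
      rw [ha, hb]
      simp [l]
    rw [k, k, cancel_epi, cancel_mono] at e
    obtain rfl := hφ.inj (h.inj e)
    rw [ha, cancel_epi, cancel_mono] at hb
    exact hb
  · obtain ⟨χ₀, ⟨i⟩⟩ := h.surj χ
    obtain ⟨χ₀', ⟨i'⟩⟩ := h.surj χ'
    obtain ⟨n, hn⟩ := h.full ((Φ.mapComp χ₀ φ).hom ≫ i.hom ▷ Φ.map φ ≫ m ≫ i'.inv ▷ Φ.map φ ≫
      (Φ.mapComp χ₀' φ).inv)
    obtain ⟨a, rfl⟩ := hφ.full (by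
      rw [proj_eq_of_map base_obj proj_map i, proj_eq_of_map base_obj proj_map i', l]) n
    refine ⟨i.inv ≫ Φ.map₂ a ≫ i'.hom, ?_⟩
    rw [Bicategory.comp_whiskerRight, Bicategory.comp_whiskerRight, k, hn]
    simp
  · obtain ⟨ω₀, ⟨i⟩⟩ := h.surj ω
    obtain ⟨χ, h₁, ⟨j⟩⟩ := hφ.surj ω₀ (eqToHom (base_obj z).symm ≫ g ≫ eqToHom (base_obj x)) (by
      rw [proj_eq_of_map base_obj proj_map i, l, proj_map]
      simp)
    refine ⟨Φ.map χ, ?_, ⟨(Φ.mapComp χ φ).symm ≪≫ Φ.map₂Iso j ≪≫ i⟩⟩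
    rw [proj_map, h₁]
    simp

variable (surj : ∀ y : D', ∃ (x : D) (h : base (Φ.obj x) = base y) (e : Φ.obj x ≌ y),
  proj e.hom = eqToHom h)

include h proj_map surj

/-- A local equivalence which is essentially surjective preserves cartesian arrows. -/
theorem isCartesianArrow {x y : D} {φ : x ⟶ y} (hφ : IsCartesianArrow φ) :
    IsCartesianArrow (Φ.map φ) := by
  rw [isCartesianArrow_iff] at hφ ⊢
  intro z'
  obtain ⟨z, -, e, -⟩ := surj z'
  exact (h.isCartesianAt base_obj proj_map (hφ z)).of_equivalence e

/-- Being fibred transfers along a local equivalence which is essentially surjective. -/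
theorem isFibred2 (hD : IsFibred2 D) : IsFibred2 D' := by
  intro y' U f
  obtain ⟨y, hy, e, he⟩ := surj y'
  obtain ⟨x, hx, φ, h₁, h₂⟩ := hD y U (f ≫ eqToHom (hy.symm.trans (base_obj y)))
  refine ⟨Φ.obj x, (base_obj x).trans hx, Φ.map φ ≫ e.hom, ?_, ?_⟩
  · rw [proj_comp, proj_map, h₁, he]
    simp
  · have h₃ := h.isCartesianArrow base_obj proj_map surj h₂
    rw [isCartesianArrow_iff] at h₃ ⊢
    exact fun z => (h₃ z).comp (isCartesianAt_equivalence e z)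

/-- The cartesian 2-functor defined by a local equivalence. -/
def toCartPseudofunctor : CartPseudofunctor D D' where
  toPseudofunctor := Φ
  base_obj := base_obj
  proj_map := proj_map
  cart _ := h.isCartesianArrow base_obj proj_map surj

theorem isTwoEquivalence :
    (h.toCartPseudofunctor base_obj proj_map surj).IsTwoEquivalence where
  ess_surj := surj
  hom_equiv := (h.toCartPseudofunctor base_obj proj_map surj).isEquivalence_mapOver h

end IsLocalEquiv

end

end PicardMatrix

namespace PicardMatrix

/-! ### Inverse images of Picard stacks -/

theorem isHomLift_map_eqToHom {B : Type*} [Category* B] {B' : Type*} [Category* B'] {X : Type*}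
    [Category* X] {p : X ⥤ B'} (G : B ⥤ B') {S S' : B} (h : S = S') {x y : X} {φ : x ⟶ y}
    (k : p.IsHomLift (𝟙 (G.obj S)) φ) : p.IsHomLift (G.map (eqToHom h)) φ := by
  subst h
  rw [eqToHom_refl, G.map_id]
  exact k

namespace Pull

section

variable {B : Type u} [Category.{v} B] {B' : Type u'} [Category.{v'} B']
  {X : Type w} [Category.{w'} X] {G : B ⥤ B'} {p : X ⥤ B'}

/-- The object of a fibre of `p` underlying an object of a fibre of its inverse image. -/
def val {T : B} (z : (proj G p Unit).Fiber T) : p.Fiber (G.obj T) :=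
  ⟨(z.1.pt ()).1, (z.1.pt ()).2.trans (congrArg G.obj z.2)⟩

/-- The object of a fibre of the inverse image of `p` defined by an object of a fibre of `p`. -/
def ob {T : B} (x : p.Fiber (G.obj T)) : (proj G p Unit).Fiber T := ⟨⟨T, fun _ => x⟩, rfl⟩

/-- The arrow of `p` underlying an arrow of the inverse image. -/
def valHom {T T' : B} {b : T ⟶ T'} {z : (proj G p Unit).Fiber T} {z' : (proj G p Unit).Fiber T'}
    (f : FibHom (proj G p Unit) b z z') : FibHom p (G.map b) (val z) (val z') :=
  ⟨f.1.arr (), lies_of f.2 ()⟩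

/-- The arrow of the inverse image defined by an arrow of `p`; inverse to `valHom`. -/
def homOf {T T' : B} {b : T ⟶ T'} {z : (proj G p Unit).Fiber T} {z' : (proj G p Unit).Fiber T'}
    (φ : FibHom p (G.map b) (val z) (val z')) : FibHom (proj G p Unit) b z z' :=
  ⟨⟨eqToHom z.2 ≫ b ≫ eqToHom z'.2.symm, fun _ => φ.1, fun _ => by
    obtain ⟨⟨T, z⟩, rfl⟩ := z
    obtain ⟨⟨T', z'⟩, rfl⟩ := z'
    exact (congrArg (fun t => p.IsHomLift (G.map t) φ.1)
      ((Category.id_comp _).trans (Category.comp_id b))).mpr φ.2⟩, by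
    obtain ⟨⟨T, z⟩, rfl⟩ := z
    obtain ⟨⟨T', z'⟩, rfl⟩ := z'
    refine IsHomLift.of_fac' _ _ _ rfl rfl ?_
    simp [proj]⟩

theorem ext_of_lift {T T' : B} {b : T ⟶ T'} {z z' : Pull G p Unit} {f g : z ⟶ z'}
    (hf : (proj G p Unit).IsHomLift b f) (hg : (proj G p Unit).IsHomLift b g)
    (h : f.arr () = g.arr ()) : f = g := by
  refine hom_ext ?_ fun _ => h
  have h1 := IsHomLift.fac' (proj G p Unit) b f
  have h2 := IsHomLift.fac' (proj G p Unit) b g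
  exact h1.trans h2.symm

theorem fiber_ext {T : B} {z z' : (proj G p Unit).Fiber T} {f g : z ⟶ z'}
    (h : f.1.arr () = g.1.arr ()) : f = g := Subtype.ext (ext_of_lift f.2 g.2 h)

/-- An arrow of a fibre of the inverse image. -/
def fibOf {T : B} {z z' : (proj G p Unit).Fiber T} (φ : val z ⟶ val z') : z ⟶ z' :=
  homOf (b := 𝟙 T) ⟨φ.1, by rw [G.map_id]; exact φ.2⟩

/-- The isomorphism in a fibre of the inverse image defined by one in a fibre of `p`. -/
def isoOf {T : B} {z z' : (proj G p Unit).Fiber T} (i : val z ≅ val z') : z ≅ z' where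
  hom := fibOf i.hom
  inv := fibOf i.inv
  hom_inv_id := fiber_ext (congrArg Subtype.val i.hom_inv_id)
  inv_hom_id := fiber_ext (congrArg Subtype.val i.inv_hom_id)

variable (G p) in
/-- The fibre of the inverse image at `T` is equivalent to the fibre of `p` at `G.obj T`. -/
def valFunctor (T : B) : (proj G p Unit).Fiber T ⥤ p.Fiber (G.obj T) where
  obj := val
  map {z z'} f := ⟨f.1.arr (), by
    have := lies_of f.2 ()
    rwa [G.map_id] at this⟩

instance (T : B) : (valFunctor G p T).IsEquivalence where
  faithful := ⟨fun h => fiber_ext (congrArg Subtype.val h)⟩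
  full := ⟨fun φ => ⟨fibOf φ, rfl⟩⟩
  essSurj := ⟨fun x => ⟨ob x, ⟨Iso.refl x⟩⟩⟩

/-- The inverse image of a law of composition. -/
def law (P : Law p) : Law (proj G p Unit) where
  add z z' := ob (P.add (val z) (val z'))
  map φ ψ := homOf (P.map (valHom φ) (valHom ψ))
  map_id x y := Subtype.ext (ext_of_lift (homOf _).2 (FibHom.id _).2
    ((P.map_congr (φ' := FibHom.id (val x)) (ψ' := FibHom.id (val y)) (G.map_id _) rfl rfl).trans
      (congrArg Subtype.val (P.map_id _ _))))
  map_comp φ ψ φ' ψ' := Subtype.ext (ext_of_lift (homOf _).2 (FibHom.comp _ _).2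
    ((P.map_congr (φ' := (valHom φ).comp (valHom φ')) (ψ' := (valHom ψ).comp (valHom ψ'))
      (G.map_comp _ _) rfl rfl).trans (congrArg Subtype.val (P.map_comp _ _ _ _))))

theorem law_sum_arr (P : Law p) {T : B} {x y x' y' : (proj G p Unit).Fiber T} {f : x ⟶ x'}
    {g : y ⟶ y'} {φ : val x ⟶ val x'} {ψ : val y ⟶ val y'} (hf : f.1.arr () = φ.1)
    (hg : g.1.arr () = ψ.1) : ((law P).sum f g).1.arr () = (P.sum φ ψ).1 :=
  P.map_congr (G.map_id T) hf hg

theorem comp_congr₃ {V : Type*} [Category* V] {a b c d : V} {f f' : a ⟶ b} {g g' : b ⟶ c}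
    {h h' : c ⟶ d} {k : a ⟶ d} (e : f = f') (e₁ : g = g') (e₂ : h = h') (e₃ : f' ≫ g' ≫ h' = k) :
    f ≫ g ≫ h = k := by
  subst e e₁ e₂
  exact e₃

/-- The inverse image of a Picard stack. -/
def picardStr (P : PicardStr p) : PicardStr (proj G p Unit) where
  toLaw := law P.toLaw
  groupoid {T x y} f := by
    have := P.groupoid ((valFunctor G p T).map f)
    exact isIso_of_reflects_iso f (valFunctor G p T)
  assoc x y z := isoOf (P.assoc (val x) (val y) (val z))
  comm x y := isoOf (P.comm (val x) (val y))
  assoc_nat φ ψ χ := ext_of_lift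
    (isHomLift_comp_id (Subtype.property _) (isoOf _).hom.2) (isHomLift_id_comp (isoOf _).hom.2 (Subtype.property _))
    (P.assoc_nat (valHom φ) (valHom ψ) (valHom χ))
  comm_nat φ ψ := ext_of_lift
    (isHomLift_comp_id (Subtype.property _) (isoOf _).hom.2) (isHomLift_id_comp (isoOf _).hom.2 (Subtype.property _))
    (P.comm_nat (valHom φ) (valHom ψ))
  pentagon {T} x y z t := fiber_ext (comp_congr₃ (law_sum_arr P.toLaw rfl rfl)
    (rfl : (P.assoc (val x) (P.add (val y) (val z)) (val t)).hom.1 = _) (law_sum_arr P.toLaw rfl rfl)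
    (congrArg Subtype.val (P.pentagon (val x) (val y) (val z) (val t))))
  hexagon x y z := fiber_ext (comp_congr₃ (law_sum_arr P.toLaw rfl rfl)
    (rfl : (P.assoc (val y) (val x) (val z)).hom.1 = _) (law_sum_arr P.toLaw rfl rfl)
    (congrArg Subtype.val (P.hexagon (val x) (val y) (val z)).symm)).symm
  comm_comm x y := fiber_ext (congrArg Subtype.val (P.comm_comm (val x) (val y)))
  strict x := fiber_ext (congrArg Subtype.val (P.strict (val x)))
  nonempty T := (P.nonempty (G.obj T)).map ob
  translation_equiv {T} x := by
    have := P.translation_equiv (val x)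
    have : ((law P.toLaw).translation x ⋙ valFunctor G p T).IsEquivalence :=
      Functor.isEquivalence_of_iso (F := valFunctor G p T ⋙ P.translation (val x))
        (NatIso.ofComponents (fun y => Iso.refl _) fun {y y'} f => Subtype.ext
          ((Category.comp_id _).trans ((law_sum_arr P.toLaw rfl rfl).symm.trans
            (Category.id_comp _).symm)))
    exact Functor.isEquivalence_of_comp_right _ (valFunctor G p T)

variable (G p) in
/-- The canonical functor from the inverse image of `p` to `p`. -/
def fst (hp : p.IsFibered) : CartFunctor G (proj G p Unit) p where
  F :=
    { obj z := (z.pt ()).1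
      map f := f.arr () }
  w := by
    refine CategoryTheory.Functor.ext (fun z => (z.pt ()).2) fun z z' f => ?_
    have := f.lies ()
    exact IsHomLift.fac' p (G.map f.base) (f.arr ())
  cart φ h := isStronglyCartesian_of_isHomLift (arr_cart hp h ()) (IsHomLift.map p (φ.arr ()))

/-- The canonical functor from the inverse image is additive. -/
def fstAdd (hp : p.IsFibered) (P : PicardStr p) : AddStr (picardStr P) P (fst G p hp) where
  σ {T T'} h x y := eqToIso (by cases h; rfl)
  nat h₁ h₂ b b' x₁ y₁ x₂ y₂ φ ψ φ' ψ' hφ hψ := by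
    cases h₁
    cases h₂
    refine (Category.comp_id _).trans (Eq.trans ?_ (Category.id_comp _).symm)
    have h' : p.IsHomLift b' (valHom φ).1 := by
      have h := φ'.2
      rw [hφ] at h
      exact h
    exact P.map_congr (AddStr.lift_unique (valHom φ).2 h') hφ.symm hψ.symm
  assoc h x y z := by
    cases h
    apply Subtype.ext
    change (P.assoc (val x) (val y) (val z)).hom.1 ≫ 𝟙 _ ≫
        (P.sum (𝟙 (val x)) (𝟙 (P.add (val y) (val z)))).1 =
      𝟙 _ ≫ (P.sum (𝟙 (P.add (val x) (val y))) (𝟙 (val z))).1 ≫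
        (P.assoc (val x) (val y) (val z)).hom.1
    rw [P.sum_id, P.sum_id]
    exact (congrArg _ (Category.id_comp _)).trans ((Category.comp_id _).trans
      ((Category.id_comp _).trans (Category.id_comp _)).symm)
  comm h x y := by
    cases h
    exact (Category.comp_id _).trans (Category.id_comp _).symm

section Lift

variable {A : Type u''} [Category.{v''} A] {Z : Type w₁} [Category.{w₂} Z] {r : Z ⥤ A}
  {L : A ⥤ B'} {K : A ⥤ B} (hL : K ⋙ G = L)

/-- The functor to the inverse image of `p` along `G` defined by a functor to `p` over
`K ⋙ G`, on the underlying categories. -/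
def liftFunctor (F : CartFunctor L r p) : Z ⥤ Pull G p Unit where
  obj a := ⟨K.obj (r.obj a), fun _ => ⟨F.F.obj a, (F.obj_eq a).trans (Functor.congr_obj hL.symm _)⟩⟩
  map f := ⟨K.map (r.map f), fun _ => F.F.map f, fun _ => by
    subst hL
    exact isHomLift_map_of_eq F.w f⟩
  map_id a := hom_ext ((r ⋙ K).map_id a) fun _ => F.F.map_id a
  map_comp f g := hom_ext ((r ⋙ K).map_comp f g) fun _ => F.F.map_comp f g

/-- The cartesian functor to the inverse image of `p` defined by a cartesian functor to `p`. -/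
def lift (F : CartFunctor L r p) : CartFunctor K r (proj G p Unit) where
  F := liftFunctor hL F
  w := rfl
  cart f h := cart_of_arr ((liftFunctor hL F).map f) fun _ =>
    isStronglyCartesian_of_isHomLift (F.cart f h) (((liftFunctor hL F).map f).lies ())

/-- The isomorphism `F (x + y) ≅ F x + F y` of the lift of an additive functor. -/
def liftσ {R : PicardStr r} {P : PicardStr p} {F : CartFunctor L r p} (s : AddStr R P F)
    {T : A} {T' : B} (h : K.obj T = T') (x y : r.Fiber T) :
    ((lift hL F).fib h).obj (R.add x y) ≅
      (picardStr P).add (((lift hL F).fib h).obj x) (((lift hL F).fib h).obj y) :=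
  isoOf (s.σ ((Functor.congr_obj hL.symm T).trans (congrArg G.obj h)) x y)

/-- The lift of an additive functor is additive. -/
def liftAdd {R : PicardStr r} {P : PicardStr p} {F : CartFunctor L r p} (s : AddStr R P F) :
    AddStr R (picardStr P) (lift hL F) where
  σ := liftσ hL s
  nat {T₁ T₂ T₁' T₂'} h₁ h₂ b b' x₁ y₁ x₂ y₂ φ ψ φ' ψ' hφ hψ := by
    cases h₁
    cases h₂
    obtain rfl : b' = K.map b := AddStr.lift_unique
      (p := proj G p Unit) φ'.2 (hφ ▸ (lift hL F).lift_map φ.1 φ.2)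
    refine ext_of_lift (b := K.map b)
      (isHomLift_comp_id ((lift hL F).lift_map _ (R.map φ ψ).2) (isoOf _).hom.2)
      (isHomLift_id_comp (isoOf _).hom.2 (Subtype.property _)) ?_
    exact s.nat (Functor.congr_obj hL.symm T₁) (Functor.congr_obj hL.symm T₂) φ ψ (valHom φ')
      (valHom ψ') (congrArg (fun f => Hom.arr f ()) hφ) (congrArg (fun f => Hom.arr f ()) hψ)
  assoc {T T'} h x y z := by
    have h' : L.obj T = G.obj T' := (Functor.congr_obj hL.symm T).trans (congrArg G.obj h)
    exact fiber_ext ((congrArg (fun t => F.F.map (R.assoc x y z).hom.1 ≫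
        (s.σ h' x (R.add y z)).hom.1 ≫ t)
        (law_sum_arr P.toLaw (f := 𝟙 (((lift hL F).fib h).obj x))
          (g := (liftσ hL s h y z).hom) (φ := 𝟙 _) (ψ := (s.σ h' y z).hom) rfl rfl)).trans
      ((congrArg Subtype.val (s.assoc h' x y z)).trans
        (congrArg (fun t => (s.σ h' (R.add x y) z).hom.1 ≫ t ≫ (P.assoc _ _ _).hom.1)
        (law_sum_arr P.toLaw (f := (liftσ hL s h x y).hom)
          (g := 𝟙 (((lift hL F).fib h).obj z)) (φ := (s.σ h' x y).hom) (ψ := 𝟙 _) rfl rfl)).symm))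
  comm {T T'} h x y := by
    have h' : L.obj T = G.obj T' := (Functor.congr_obj hL.symm T).trans (congrArg G.obj h)
    exact fiber_ext (congrArg Subtype.val (s.comm h' x y))

end Lift

end

end Pull

namespace Picard

variable {C : Type u} [Category.{v} C] {J : GrothendieckTopology C}

/-- The inverse image of a Picard stack over `C/V` along `f : U ⟶ V`. -/
def pull (Q : Picard.{w₁, w₂} J) {U : C} (f : U ⟶ Q.base) : Picard.{w₁, w₂} J where
  base := U
  pic :=
    { X := Pull (Over.map f) Q.pic.p Unit
      p := Pull.proj (Over.map f) Q.pic.p Unit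
      isStack := Pull.isStack (IsLocalizing.overMap J f) Q.pic.isStack
      str := Pull.picardStr Q.pic.str }

/-- The canonical arrow from an inverse image. -/
def pullFst (Q : Picard.{w₁, w₂} J) {U : C} (f : U ⟶ Q.base) : Q.pull f ⟶ Q where
  hom := ⟨f, Pull.fst (Over.map f) Q.pic.p Q.pic.isStack.fibered⟩
  add := Pull.fstAdd Q.pic.isStack.fibered Q.pic.str

variable {Q Z : Picard.{w₁, w₂} J} {U : C} {f : U ⟶ Q.base}

theorem comp_pullFst_σ (χ : Z ⟶ Q.pull f) {T : Over Z.base} {T' : Over (Q.pull f).base}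
    (e : (Over.map χ.hom.base).obj T = T')
    (e' : (Over.map (χ.hom.base ≫ f)).obj T = (Over.map f).obj T') (x y : Z.pic.p.Fiber T) :
    ((χ ≫ Q.pullFst f).add.σ e' x y).hom.1 = (χ.add.σ e x y).hom.1.arr () := by
  subst e
  exact Category.comp_id _

/-- Morphisms of additive functors into the inverse image are the morphisms between their composites
with the projection. -/
theorem pullFst_full {χ χ' : Z ⟶ Q.pull f} (h : χ.hom.base = χ'.hom.base)
    (m : χ ≫ Q.pullFst f ⟶ χ' ≫ Q.pullFst f) : ∃ a : χ ⟶ χ', a ▷ Q.pullFst f = m := by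
  have hw : χ.hom.fn.F ⋙ (Q.pull f).pic.p = χ'.hom.fn.F ⋙ (Q.pull f).pic.p :=
    χ.hom.fn.w.trans ((congrArg (fun g => Z.pic.p ⋙ Over.map g) h).trans χ'.hom.fn.w.symm)
  have hb : ∀ z, (χ.hom.fn.F.obj z).base = (χ'.hom.fn.F.obj z).base := Functor.congr_obj hw
  let τ : ∀ z, χ.hom.fn.F.obj z ⟶ χ'.hom.fn.F.obj z := fun z =>
    ⟨eqToHom (hb z), fun _ => m.hom.τ.app z, fun _ => by
      have k := isHomLift_congr (m.hom.τ.app z) (m.hom.vert z) ((χ.hom.fn.F.obj z).pt ()).2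
      exact isHomLift_map_eqToHom (Over.map f) (hb z) k⟩
  have hτ : ∀ z, (Pull.proj (Over.map f) Q.pic.p Unit).IsHomLift (𝟙 (χ.hom.fn.F.obj z).base)
      (τ z) := fun z => IsHomLift.of_fac' _ _ _ rfl (hb z).symm
        ((Category.id_comp _).trans (Category.id_comp _)).symm
  let t : χ.hom.fn.F ⟶ χ'.hom.fn.F :=
    { app := τ
      naturality z z' g := Pull.hom_ext (by
        have k : (χ.hom.fn.F.map g).base = eqToHom (hb z) ≫ (χ'.hom.fn.F.map g).base ≫
          eqToHom (hb z').symm := Functor.congr_hom hw g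
        change (χ.hom.fn.F.map g).base ≫ eqToHom (hb z') =
          eqToHom (hb z) ≫ (χ'.hom.fn.F.map g).base
        rw [k]
        simp) fun _ => m.hom.τ.naturality g }
  refine ⟨⟨⟨h, t, hτ⟩, ⟨fun {T T'} e e' x y => ?_⟩⟩, hom₂_ext (StackTot.hom₂_ext fun _ => rfl)⟩
  have e₁ : (Over.map (χ.hom.base ≫ f)).obj T = (Over.map f).obj T' :=
    (Functor.congr_obj (Over.mapComp_eq _ _) T).trans (congrArg (Over.map f).obj e)
  have e₁' : (Over.map (χ'.hom.base ≫ f)).obj T = (Over.map f).obj T' :=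
    (Functor.congr_obj (Over.mapComp_eq _ _) T).trans (congrArg (Over.map f).obj e')
  have k := congrArg Subtype.val (m.add.eq e₁ e₁' x y)
  refine Pull.fiber_ext ?_
  refine Eq.trans ?_ (k.trans (congrArg (m.hom.τ.app _ ≫ ·) (comp_pullFst_σ χ' e' e₁' x y)))
  exact congrArg₂ (· ≫ ·) (comp_pullFst_σ χ e e₁ x y).symm
    (Pull.law_sum_arr Q.pic.str.toLaw rfl rfl)

/-- The projection from the inverse image of a Picard stack is cartesian: an additive functor over a
composite `g ≫ f` factors through the inverse image along `f` by keeping its values and recording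
the base, and morphisms of additive functors do as well. -/
theorem isCartesianAt_pullFst : Over2.IsCartesianAt (Q.pullFst f) Z where
  inj {χ χ' a b} h := by
    refine hom₂_ext (StackTot.hom₂_ext fun z => ?_)
    exact Pull.ext_of_lift (a.hom.vert z) (b.hom.vert z)
      (congrArg (fun m => (Hom₂.hom m).τ.app z) h)
  full h m := pullFst_full h m
  surj ω g h := by
    have hL : Over.map g ⋙ Over.map f = Over.map ω.hom.base := by
      change ω.hom.base = g ≫ f at h
      rw [h]
      exact (Over.mapComp_eq g f).symm
    refine ⟨⟨⟨g, Pull.lift hL ω.hom.fn⟩, Pull.liftAdd hL ω.add⟩, rfl, ⟨?_⟩⟩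
    refine isoMk (StackTot.isoMk h.symm (Iso.refl ω.hom.fn.F) (IsVertical.id _) (IsVertical.id _))
      ?_ ?_
    · refine IsAdditive.of_eq rfl (fun _ => rfl) fun {T T'} e e' x y => heq_of_eq ?_
      obtain rfl : (Over.map f).obj ((Over.map g).obj T) = T' := (Functor.congr_obj hL T).trans e'
      exact Category.comp_id (ω.add.σ e' x y).hom.1
    · refine IsAdditive.of_eq rfl (fun _ => rfl) fun {T T'} e' e x y => heq_of_eq ?_
      obtain rfl : (Over.map f).obj ((Over.map g).obj T) = T' := (Functor.congr_obj hL T).trans e'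
      exact (Category.comp_id (ω.add.σ e' x y).hom.1).symm

variable (J) in
theorem isFibred2 : IsFibred2 (Picard.{w₁, w₂} J) := fun Q _ f =>
  ⟨Q.pull f, rfl, Q.pullFst f, (Category.id_comp f).symm,
    (Over2.isCartesianArrow_iff _).2 fun _ => isCartesianAt_pullFst⟩

end Picard

end PicardMatrix

namespace PicardMatrix

/-! ### Actions of integral matrices on fibred categories -/

section

variable {B : Type u} [Category.{v} B]

/-- The standard basis of `ℤᵏ`. -/
noncomputable abbrev stdBasis (k : ℕ) : Module.Basis (Fin k) ℤ (Fin k → ℤ) := Pi.basisFun ℤ (Fin k)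

theorem map_comp_square {V W : Type*} [Category* V] [Category* W] (H : V ⥤ W) {a b c : V}
    {f : a ⟶ b} {g : b ⟶ c} {x y z : W} {i : H.obj a ⟶ x} {j : H.obj b ⟶ y} {k : H.obj c ⟶ z}
    {φ : x ⟶ y} {ψ : y ⟶ z} (h : H.map f ≫ j = i ≫ φ) (h' : H.map g ≫ k = j ≫ ψ) :
    H.map (f ≫ g) ≫ k = i ≫ φ ≫ ψ := by
  rw [H.map_comp, Category.assoc, h', reassoc_of% h]

theorem map_id_square {V W : Type*} [Category* V] [Category* W] (H : V ⥤ W) {a : V}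
    {x : W} {i : H.obj a ⟶ x} : H.map (𝟙 a) ≫ i = i ≫ 𝟙 x := by
  rw [H.map_id, Category.comp_id, Category.id_comp]

theorem rowHom_stdBasis {n k : ℕ} (M : Matrix (Fin k) (Fin n) ℤ) (i : Fin k) :
    rowHom M (stdBasis k i) = M i := by
  rw [rowHom_apply, Pi.basisFun_apply]
  exact Matrix.single_one_vecMul _ _

/-- An action up to coherent isomorphisms of the integral matrices on a sequence of categories over
`B`, such that the values of an object of `Y n` at the vectors of a basis of `ℤⁿ` can be
prescribed. -/
structure MatrixAction {Y : ℕ → Type w} [∀ n, Category.{w'} (Y n)] (q : ∀ n, Y n ⥤ B) where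
  act {n k : ℕ} (M : Matrix (Fin k) (Fin n) ℤ) : OverFunctor (q n) (q k)
  c {n k l : ℕ} {M : Matrix (Fin k) (Fin n) ℤ} {N : Matrix (Fin l) (Fin k) ℤ}
    {L : Matrix (Fin l) (Fin n) ℤ} (h : L = N * M) (z : Y n) :
    (act L).F.obj z ≅ (act N).F.obj ((act M).F.obj z)
  c_lies {n k l : ℕ} {M : Matrix (Fin k) (Fin n) ℤ} {N : Matrix (Fin l) (Fin k) ℤ}
    {L : Matrix (Fin l) (Fin n) ℤ} (h : L = N * M) (z : Y n) :
    (q l).IsHomLift (𝟙 ((q n).obj z)) (c h z).hom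
  c_nat {n k l : ℕ} {M : Matrix (Fin k) (Fin n) ℤ} {N : Matrix (Fin l) (Fin k) ℤ}
    {L : Matrix (Fin l) (Fin n) ℤ} (h : L = N * M) {z z' : Y n} (f : z ⟶ z') :
    (act L).F.map f ≫ (c h z').hom = (c h z).hom ≫ (act N).F.map ((act M).F.map f)
  c_assoc {n k l m : ℕ} {M : Matrix (Fin k) (Fin n) ℤ} {N : Matrix (Fin l) (Fin k) ℤ}
    {K : Matrix (Fin m) (Fin l) ℤ} {NM : Matrix (Fin l) (Fin n) ℤ} {KN : Matrix (Fin m) (Fin k) ℤ}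
    {L : Matrix (Fin m) (Fin n) ℤ} (h₁ : NM = N * M) (h₂ : L = K * NM) (h₃ : KN = K * N)
    (h₄ : L = KN * M) (z : Y n) :
    (c h₂ z).hom ≫ (act K).F.map (c h₁ z).hom = (c h₄ z).hom ≫ (c h₃ ((act M).F.obj z)).hom
  unit {n : ℕ} (z : Y n) : (act (1 : Matrix (Fin n) (Fin n) ℤ)).F.obj z ≅ z
  c_unit {n k : ℕ} {M : Matrix (Fin k) (Fin n) ℤ} (h : M = M * 1) (z : Y n) :
    (c h z).hom ≫ (act M).F.map (unit z).hom = 𝟙 ((act M).F.obj z)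
  exists_hom {n k : ℕ} (b : Module.Basis (Fin k) ℤ (Fin n → ℤ)) {S T : B} (f : S ⟶ T)
    (z : (q n).Fiber S) (z' : (q n).Fiber T)
    (φ : ∀ i, FibHom (q 1) f (((act (rowMat (b i))).fiberFunctor S).obj z)
      (((act (rowMat (b i))).fiberFunctor T).obj z')) :
    ∃ h : FibHom (q n) f z z', ∀ i, (act (rowMat (b i))).F.map h.1 = (φ i).1
  hom_ext {n k : ℕ} (b : Module.Basis (Fin k) ℤ (Fin n → ℤ)) {S T : B} {f : S ⟶ T}
    {z z' : Y n} {h h' : z ⟶ z'} (l : (q n).IsHomLift f h) (l' : (q n).IsHomLift f h')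
    (e : ∀ i, (act (rowMat (b i))).F.map h = (act (rowMat (b i))).F.map h') : h = h'
  exists_obj {n k : ℕ} (b : Module.Basis (Fin k) ℤ (Fin n → ℤ)) {T : B} (x : Fin k → (q 1).Fiber T) :
    ∃ z : (q n).Fiber T, ∀ i, Nonempty (((act (rowMat (b i))).fiberFunctor T).obj z ≅ x i)

namespace MatrixAction

variable {Y : ℕ → Type w} [∀ n, Category.{w'} (Y n)] {q : ∀ n, Y n ⥤ B} (A : MatrixAction q)
  {n k m : ℕ} {T T' : B}

/-- The value of `z` at a vector `r`: the action on `z` of the row matrix `r`. -/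
abbrev pt (z : (q n).Fiber T) (r : Fin n → ℤ) : (q 1).Fiber T :=
  ((A.act (rowMat r)).fiberFunctor T).obj z

/-- The action of a matrix on an object of a fibre. -/
abbrev on (M : Matrix (Fin k) (Fin n) ℤ) (z : (q n).Fiber T) : (q k).Fiber T :=
  ((A.act M).fiberFunctor T).obj z

/-- The action of an arrow on the values at `r`. -/
abbrev ptMap {b : T ⟶ T'} {z : (q n).Fiber T} {z' : (q n).Fiber T'} (f : FibHom (q n) b z z')
    (r : Fin n → ℤ) : FibHom (q 1) b (A.pt z r) (A.pt z' r) :=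
  ⟨(A.act (rowMat r)).F.map f.1, (OverFunctor.isHomLift_iff _).2 f.2⟩

/-- The value at `r` of `M z` is the value of `z` at the row `r M`. -/
def μ {M : Matrix (Fin k) (Fin n) ℤ} {r : Fin k → ℤ} {s : Fin n → ℤ} (h : s = rowHom M r)
    (z : (q n).Fiber T) : A.pt z s ≅ A.pt (A.on M z) r :=
  fiberIsoMk (A.c (h ▸ (rowMat_mul M r).symm) z.1)
    (isHomLift_congr _ (A.c_lies _ z.1) ((OverFunctor.obj_eq _ z.1).trans z.2))

theorem μ_nat {M : Matrix (Fin k) (Fin n) ℤ} {r : Fin k → ℤ} {s : Fin n → ℤ} (h : s = rowHom M r)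
    {b : T ⟶ T'} {z : (q n).Fiber T} {z' : (q n).Fiber T'} (f : FibHom (q n) b z z') :
    (A.ptMap f s).1 ≫ (A.μ h z').hom.1 =
      (A.μ h z).hom.1 ≫ (A.act (rowMat r)).F.map ((A.act M).F.map f.1) := A.c_nat _ f.1

theorem μ_comp {M : Matrix (Fin k) (Fin n) ℤ} {N : Matrix (Fin m) (Fin k) ℤ}
    {L : Matrix (Fin m) (Fin n) ℤ} (hL : L = N * M) {r : Fin m → ℤ} {s : Fin k → ℤ}
    {t : Fin n → ℤ} (h : s = rowHom N r) (h' : t = rowHom M s) (h'' : t = rowHom L r)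
    (z : (q n).Fiber T) :
    (A.μ h'' z).hom.1 ≫ (A.act (rowMat r)).F.map (A.c hL z.1).hom =
      (A.μ h' z).hom.1 ≫ (A.μ h (A.on M z)).hom.1 := A.c_assoc _ _ _ _ z.1

/-- Objects with isomorphic values at a basis are isomorphic. -/
theorem exists_iso (b : Module.Basis (Fin k) ℤ (Fin n → ℤ)) (z z' : (q n).Fiber T)
    (φ : ∀ i, A.pt z (b i) ≅ A.pt z' (b i)) :
    ∃ h : z ≅ z', ∀ i, (A.act (rowMat (b i))).F.map h.hom.1 = (φ i).hom.1 := by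
  obtain ⟨f, hf⟩ := A.exists_hom b (𝟙 T) z z' fun i => (φ i).hom
  obtain ⟨g, hg⟩ := A.exists_hom b (𝟙 T) z' z fun i => (φ i).inv
  refine ⟨⟨f, g, Subtype.ext ?_, Subtype.ext ?_⟩, hf⟩
  · refine A.hom_ext b (isHomLift_id_comp f.2 g.2) (IsHomLift.id z.2) fun i => ?_
    refine ((A.act _).F.map_comp f.1 g.1).trans (Eq.trans ?_ ((A.act _).F.map_id z.1).symm)
    rw [hf, hg]
    exact fiber_hom_inv (φ i)
  · refine A.hom_ext b (isHomLift_id_comp g.2 f.2) (IsHomLift.id z'.2) fun i => ?_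
    refine ((A.act _).F.map_comp g.1 f.1).trans (Eq.trans ?_ ((A.act _).F.map_id z'.1).symm)
    rw [hf, hg]
    exact fiber_inv_hom (φ i)

/-- An object with given values at the standard basis. -/
noncomputable def fill (x : Fin k → (q 1).Fiber T) : (q k).Fiber T :=
  (A.exists_obj (stdBasis k) x).choose

/-- The values of `fill x`. -/
noncomputable def fillIso (x : Fin k → (q 1).Fiber T) (i : Fin k) :
    A.pt (A.fill x) (stdBasis k i) ≅ x i :=
  ((A.exists_obj (stdBasis k) x).choose_spec i).some

/-- Arrows from the values of `z` at the standard basis to the objects `x i` come from an arrow from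
`z` to the object with these values. -/
theorem exists_fillHom {b : T ⟶ T'} {z : (q k).Fiber T} {x : Fin k → (q 1).Fiber T'}
    (φ : ∀ i, FibHom (q 1) b (A.pt z (stdBasis k i)) (x i)) :
    ∃ f : FibHom (q k) b z (A.fill x), ∀ i,
      (A.ptMap f (stdBasis k i)).1 ≫ (A.fillIso x i).hom.1 = (φ i).1 := by
  obtain ⟨f, hf⟩ := A.exists_hom (stdBasis k) b z (A.fill x) fun i =>
    ⟨(φ i).1 ≫ (A.fillIso x i).inv.1, isHomLift_comp_id (φ i).2 (A.fillIso x i).inv.2⟩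
  refine ⟨f, fun i => ?_⟩
  refine (congrArg (· ≫ (A.fillIso x i).hom.1) (hf i)).trans ?_
  exact (Category.assoc _ _ _).trans ((congrArg _ (fiber_inv_hom _)).trans (Category.comp_id _))

theorem fillHom_ext {b : T ⟶ T'} {z : (q k).Fiber T} {x : Fin k → (q 1).Fiber T'}
    {f g : z.1 ⟶ (A.fill x).1} (hf : (q k).IsHomLift b f) (hg : (q k).IsHomLift b g)
    (h : ∀ i, (A.act (rowMat (stdBasis k i))).F.map f ≫ (A.fillIso x i).hom.1 =
      (A.act (rowMat (stdBasis k i))).F.map g ≫ (A.fillIso x i).hom.1) : f = g := by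
  refine A.hom_ext (stdBasis k) hf hg fun i => ?_
  exact (cancel_mono (fiberIsoVal (A.fillIso x i)).hom).1 (h i)

theorem exists_fillIso {z : (q k).Fiber T} {x : Fin k → (q 1).Fiber T}
    (φ : ∀ i, A.pt z (stdBasis k i) ≅ x i) :
    ∃ f : z ≅ A.fill x, ∀ i,
      (A.ptMap f.hom (stdBasis k i)).1 ≫ (A.fillIso x i).hom.1 = (φ i).hom.1 := by
  obtain ⟨f, hf⟩ := A.exists_iso (stdBasis k) z (A.fill x) fun i => φ i ≪≫ (A.fillIso x i).symm
  refine ⟨f, fun i => ?_⟩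
  change (A.act _).F.map f.hom.1 ≫ _ = _
  rw [hf i]
  exact (Category.assoc _ _ _).trans ((congrArg _ (fiber_inv_hom _)).trans (Category.comp_id _))

/-! ### The sum defined by an action of matrices -/

/-- The arrow of `Y 2` defined by two arrows. -/
theorem exists_pairHom {b : T ⟶ T'} {x y : (q 1).Fiber T} {x' y' : (q 1).Fiber T'}
    (φ : FibHom (q 1) b x x') (ψ : FibHom (q 1) b y y') :
    ∃ f : FibHom (q 2) b (A.fill ![x, y]) (A.fill ![x', y']),
      (A.ptMap f (stdBasis 2 0)).1 ≫ (A.fillIso ![x', y'] 0).hom.1 = (A.fillIso ![x, y] 0).hom.1 ≫ φ.1 ∧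
      (A.ptMap f (stdBasis 2 1)).1 ≫ (A.fillIso ![x', y'] 1).hom.1 = (A.fillIso ![x, y] 1).hom.1 ≫ ψ.1 := by
  obtain ⟨f, hf⟩ := A.exists_fillHom (b := b) (z := A.fill ![x, y]) (x := ![x', y'])
    (Fin.cases ⟨(A.fillIso ![x, y] 0).hom.1 ≫ φ.1, isHomLift_id_comp (A.fillIso ![x, y] 0).hom.2 φ.2⟩ fun i =>
      Fin.cases ⟨(A.fillIso ![x, y] 1).hom.1 ≫ ψ.1, isHomLift_id_comp (A.fillIso ![x, y] 1).hom.2 ψ.2⟩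
        (fun j => j.elim0) i)
  exact ⟨f, hf 0, hf 1⟩

/-- The arrow of `Y 2` defined by two arrows. -/
noncomputable def pairHom {b : T ⟶ T'} {x y : (q 1).Fiber T} {x' y' : (q 1).Fiber T'}
    (φ : FibHom (q 1) b x x') (ψ : FibHom (q 1) b y y') :
    FibHom (q 2) b (A.fill ![x, y]) (A.fill ![x', y']) := (A.exists_pairHom φ ψ).choose

theorem pairHom_ext {b : T ⟶ T'} {z : (q 2).Fiber T} {x y : (q 1).Fiber T'}
    {f g : z.1 ⟶ (A.fill ![x, y]).1} (hf : (q 2).IsHomLift b f) (hg : (q 2).IsHomLift b g)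
    (h₀ : (A.act (rowMat (stdBasis 2 0))).F.map f ≫ (A.fillIso ![x, y] 0).hom.1 =
      (A.act (rowMat (stdBasis 2 0))).F.map g ≫ (A.fillIso ![x, y] 0).hom.1)
    (h₁ : (A.act (rowMat (stdBasis 2 1))).F.map f ≫ (A.fillIso ![x, y] 1).hom.1 =
      (A.act (rowMat (stdBasis 2 1))).F.map g ≫ (A.fillIso ![x, y] 1).hom.1) : f = g :=
  A.fillHom_ext hf hg (Fin.cases h₀ fun i => Fin.cases h₁ (fun j => j.elim0) i)

section

variable {b : T ⟶ T'} {x y : (q 1).Fiber T} {x' y' : (q 1).Fiber T'}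
    (φ : FibHom (q 1) b x x') (ψ : FibHom (q 1) b y y')

theorem pairHom_zero : (A.act (rowMat (stdBasis 2 0))).F.map (A.pairHom φ ψ).1 ≫
    (A.fillIso ![x', y'] 0).hom.1 = (A.fillIso ![x, y] 0).hom.1 ≫ φ.1 := (A.exists_pairHom φ ψ).choose_spec.1

theorem pairHom_one : (A.act (rowMat (stdBasis 2 1))).F.map (A.pairHom φ ψ).1 ≫
    (A.fillIso ![x', y'] 1).hom.1 = (A.fillIso ![x, y] 1).hom.1 ≫ ψ.1 := (A.exists_pairHom φ ψ).choose_spec.2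

end

/-- The law of composition defined by the matrix `(1 1)`. -/
noncomputable def law : Law (q 1) where
  add x y := A.pt (A.fill ![x, y]) (stdBasis 2 0 + stdBasis 2 1)
  map φ ψ := A.ptMap (A.pairHom φ ψ) _
  map_id {T} x y := by
    refine Subtype.ext ((congrArg (A.act _).F.map ?_).trans ((A.act _).F.map_id _))
    refine A.pairHom_ext (A.pairHom _ _).2 (IsHomLift.id (A.fill ![x, y]).2) ?_ ?_
    · exact (A.pairHom_zero _ _).trans (map_id_square _).symm
    · exact (A.pairHom_one _ _).trans (map_id_square _).symm
  map_comp {T T' T'' b b' x y x' y' x'' y''} φ ψ φ' ψ' := by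
    refine Subtype.ext ((congrArg (A.act _).F.map ?_).trans ((A.act _).F.map_comp _ _))
    refine A.pairHom_ext (A.pairHom _ _).2 (isHomLift_comp_eq rfl (A.pairHom φ ψ).2
      (A.pairHom φ' ψ').2) ?_ ?_
    · exact (A.pairHom_zero _ _).trans
        (map_comp_square _ (A.pairHom_zero φ ψ) (A.pairHom_zero φ' ψ')).symm
    · exact (A.pairHom_one _ _).trans
        (map_comp_square _ (A.pairHom_one φ ψ) (A.pairHom_one φ' ψ')).symm

/-- The matrix with rows `r` and `s`. -/
abbrev rows (r s : Fin n → ℤ) : Matrix (Fin 2) (Fin n) ℤ := Matrix.of ![r, s]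

theorem rowHom_rows (r s : Fin n → ℤ) :
    r = rowHom (rows r s) (stdBasis 2 0) ∧ s = rowHom (rows r s) (stdBasis 2 1) := by
  rw [rowHom_stdBasis, rowHom_stdBasis]
  exact ⟨rfl, rfl⟩

theorem exists_pairIso (z : (q n).Fiber T) (r s : Fin n → ℤ) :
    ∃ f : A.on (rows r s) z ≅ A.fill ![A.pt z r, A.pt z s],
      (A.act (rowMat (stdBasis 2 0))).F.map f.hom.1 ≫ (A.fillIso _ 0).hom.1 =
        (A.μ (rowHom_rows r s).1 z).inv.1 ∧
      (A.act (rowMat (stdBasis 2 1))).F.map f.hom.1 ≫ (A.fillIso _ 1).hom.1 =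
        (A.μ (rowHom_rows r s).2 z).inv.1 := by
  obtain ⟨f, hf⟩ := A.exists_fillIso (z := A.on (rows r s) z) (x := ![A.pt z r, A.pt z s])
    (Fin.cases (A.μ (rowHom_rows r s).1 z).symm fun i =>
      Fin.cases (A.μ (rowHom_rows r s).2 z).symm (fun j => j.elim0) i)
  exact ⟨f, hf 0, hf 1⟩

/-- The restriction of `z` along the two vectors `r` and `s` is the object with values `z r` and `z
s`. -/
noncomputable def pairIso (z : (q n).Fiber T) (r s : Fin n → ℤ) :
    A.on (rows r s) z ≅ A.fill ![A.pt z r, A.pt z s] := (A.exists_pairIso z r s).choose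

theorem rowHom_rows_add {r s t : Fin n → ℤ} (h : t = r + s) :
    t = rowHom (rows r s) (stdBasis 2 0 + stdBasis 2 1) := by
  rw [map_add, ← (rowHom_rows r s).1, ← (rowHom_rows r s).2, h]

/-- The value of `z` at a sum of vectors is the sum of the values. -/
noncomputable def σ (z : (q n).Fiber T) {r s t : Fin n → ℤ} (h : t = r + s) :
    A.pt z t ≅ A.law.add (A.pt z r) (A.pt z s) :=
  A.μ (rowHom_rows_add h) z ≪≫ ((A.act (rowMat _)).fiberFunctor T).mapIso (A.pairIso z r s)

section

variable (z : (q n).Fiber T) (r s : Fin n → ℤ)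

theorem pairIso_zero : (A.act (rowMat (stdBasis 2 0))).F.map (A.pairIso z r s).hom.1 ≫
    (A.fillIso _ 0).hom.1 = (A.μ (rowHom_rows r s).1 z).inv.1 := (A.exists_pairIso z r s).choose_spec.1

theorem pairIso_one : (A.act (rowMat (stdBasis 2 1))).F.map (A.pairIso z r s).hom.1 ≫
    (A.fillIso _ 1).hom.1 = (A.μ (rowHom_rows r s).2 z).inv.1 := (A.exists_pairIso z r s).choose_spec.2

end

end MatrixAction

end

end PicardMatrix

namespace PicardMatrix

section

variable {V W : Type*} [Category* V] [Category* W]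

theorem map_comp_square_left (H : V ⥤ W) {a b c : V} {f : a ⟶ b} {g : b ⟶ c} {x z : W}
    {j : H.obj b ⟶ z} {i : H.obj a ⟶ x} {k : H.obj c ⟶ z} {φ : x ⟶ z} (h : H.map f ≫ j = i ≫ φ)
    (h' : H.map g ≫ k = j) : H.map (f ≫ g) ≫ k = i ≫ φ := by
  rw [H.map_comp, Category.assoc, h', h]

theorem map_comp_square_right (H : V ⥤ W) {a b c : V} {f : a ⟶ b} {g : b ⟶ c} {x z : W}
    {j : H.obj b ⟶ x} {i : H.obj a ⟶ x} {k : H.obj c ⟶ z} {φ : x ⟶ z} (h : H.map f ≫ j = i)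
    (h' : H.map g ≫ k = j ≫ φ) : H.map (f ≫ g) ≫ k = i ≫ φ := by
  rw [H.map_comp, Category.assoc, h', reassoc_of% h]

theorem square_inv {a b c d : V} {f : a ⟶ c} {g : b ⟶ d} (i : a ≅ b) (j : c ≅ d)
    (h : f ≫ j.hom = i.hom ≫ g) : g ≫ j.inv = i.inv ≫ f := by
  rw [Iso.comp_inv_eq, Category.assoc, h, Iso.inv_hom_id_assoc]

theorem square_map_square (H : V ⥤ W) {a b c d : V} {f : a ⟶ b} {g : b ⟶ d} {h : a ⟶ c}
    {i : c ⟶ d} {x y : W} {l : x ⟶ y} {m : x ⟶ H.obj a} {n : y ⟶ H.obj b}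
    (k : l ≫ n = m ≫ H.map f) (e : f ≫ g = h ≫ i) :
    l ≫ n ≫ H.map g = (m ≫ H.map h) ≫ H.map i := by
  rw [reassoc_of% k, Category.assoc, ← H.map_comp, ← H.map_comp, e]

theorem assoc_univ_aux {a a' b b' c c' d d' : V} {θ : a ⟶ a'} {L : a ⟶ b} {L' : a' ≅ b'}
    {R : a ⟶ c} {R' : a' ⟶ c'} {m₀ : b ⟶ b'} {m₁ : c ⟶ c'} {e : b' ≅ d} {e' : c' ⟶ d'}
    {m : b ⟶ d} {m' : c ⟶ d'} (h : θ ≫ L'.hom = L ≫ m₀) (h' : θ ≫ R' = R ≫ m₁)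
    (k : m = m₀ ≫ e.hom) (k' : m' = m₁ ≫ e') :
    L ≫ m ≫ (e.inv ≫ L'.inv) ≫ R' ≫ e' = R ≫ m' := by
  subst k k'
  simp [← reassoc_of% h, ← reassoc_of% h']

theorem nat_of_univ_aux {a b c c' d b' d' : V} {L : a ≅ b} {e : b ≅ c} {m : c ⟶ c'} {α : c ⟶ d}
    {α' : c' ⟶ d'} {R : a ⟶ b'} {e' : b' ⟶ d} {m' : d ⟶ d'}
    (h : L.hom ≫ e.hom ≫ α = R ≫ e') (h' : L.hom ≫ (e.hom ≫ m) ≫ α' = R ≫ e' ≫ m') :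
    m ≫ α' = α ≫ m' := by
  rw [← reassoc_of% h, Category.assoc] at h'
  simpa using h'

end

theorem Law.map_eq_map_comp_sum {B : Type*} [Category* B] {X : Type*} [Category* X] {p : X ⥤ B}
    (P : Law p) {T T' : B} {b : T ⟶ T'} {x y : p.Fiber T} {x' y' x'' y'' : p.Fiber T'}
    {φ : FibHom p b x x''} {ψ : FibHom p b y y''} {φ' : FibHom p b x x'} {ψ' : FibHom p b y y'}
    {f : x' ⟶ x''} {g : y' ⟶ y''} (h : φ.1 = φ'.1 ≫ f.1) (h' : ψ.1 = ψ'.1 ≫ g.1) :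
    (P.map φ ψ).1 = (P.map φ' ψ').1 ≫ (P.sum f g).1 := by
  rw [P.map_comp_sum φ' ψ' f g (h ▸ φ.2) (h' ▸ ψ.2)]
  exact P.map_congr rfl h h'

namespace MatrixAction

variable {B : Type u} [Category.{v} B] {Y : ℕ → Type w} [∀ n, Category.{w'} (Y n)]
  {q : ∀ n, Y n ⥤ B} (A : MatrixAction q) {n k m : ℕ} {T T' : B}

/-- The isomorphisms `σ` are natural. -/
theorem σ_nat {b : T ⟶ T'} {z : (q n).Fiber T} {z' : (q n).Fiber T'} (f : FibHom (q n) b z z')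
    {r s t : Fin n → ℤ} (h : t = r + s) :
    (A.ptMap f t).1 ≫ (A.σ z' h).hom.1 =
      (A.σ z h).hom.1 ≫ (A.law.map (A.ptMap f r) (A.ptMap f s)).1 := by
  have l : (q 2).IsHomLift b ((A.act (rows r s)).F.map f.1) := (OverFunctor.isHomLift_iff _).2 f.2
  refine square_map_square _ (A.μ_nat (rowHom_rows_add h) f) ?_
  refine A.pairHom_ext (isHomLift_comp_id l (A.pairIso z' r s).hom.2)
    (isHomLift_id_comp (A.pairIso z r s).hom.2 (A.pairHom _ _).2) ?_ ?_
  · exact (map_comp_square_left _ (square_inv (fiberIsoVal (A.μ (rowHom_rows r s).1 z))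
      (fiberIsoVal (A.μ (rowHom_rows r s).1 z')) (A.μ_nat (rowHom_rows r s).1 f)) (A.pairIso_zero z' r s)).trans
        (map_comp_square_right _ (A.pairIso_zero z r s) (A.pairHom_zero _ _)).symm
  · exact (map_comp_square_left _ (square_inv (fiberIsoVal (A.μ (rowHom_rows r s).2 z))
      (fiberIsoVal (A.μ (rowHom_rows r s).2 z')) (A.μ_nat (rowHom_rows r s).2 f)) (A.pairIso_one z' r s)).trans
        (map_comp_square_right _ (A.pairIso_one z r s) (A.pairHom_one _ _)).symm

/-- The isomorphisms `σ` are compatible with the action of matrices. -/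
theorem σ_act {M : Matrix (Fin k) (Fin n) ℤ} (z : (q n).Fiber T) {r s t : Fin n → ℤ}
    {r' s' t' : Fin k → ℤ} (hr : r = rowHom M r') (hs : s = rowHom M s') (ht : t = rowHom M t')
    (h : t = r + s) (h' : t' = r' + s') :
    (A.μ ht z).hom.1 ≫ (A.σ (A.on M z) h').hom.1 =
      (A.σ z h).hom.1 ≫ (A.law.sum (A.μ hr z).hom (A.μ hs z).hom).1 := by
  have hL : rows r s = rows r' s' * M := by
    subst hr hs
    refine funext fun i => ?_
    rw [← rowHom_stdBasis (rows r' s' * M) i, rowHom_mul]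
    refine Fin.cases ?_ (fun j => Fin.cases ?_ (fun j => j.elim0) j) i
    · exact congrArg (rowHom M) (rowHom_rows r' s').1
    · exact congrArg (rowHom M) (rowHom_rows r' s').2
  have l : (q 2).IsHomLift (𝟙 T) (A.c hL z.1).hom :=
    isHomLift_congr _ (A.c_lies hL z.1) ((OverFunctor.obj_eq _ z.1).trans z.2)
  refine square_map_square _ (A.μ_comp hL (rowHom_rows_add h') ht (rowHom_rows_add h) z).symm ?_
  refine A.pairHom_ext (b := 𝟙 T) (isHomLift_comp_id l (A.pairIso _ _ _).hom.2)
    (isHomLift_id_comp (A.pairIso z r s).hom.2 (A.pairHom _ _).2) ?_ ?_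
  · exact (map_comp_square_left _ (square_inv (fiberIsoVal (A.μ (rowHom_rows r s).1 z))
      (fiberIsoVal (A.μ (rowHom_rows r' s').1 (A.on M z)))
      (A.μ_comp hL (rowHom_rows r' s').1 hr (rowHom_rows r s).1 z).symm)
      (A.pairIso_zero _ r' s')).trans
        (map_comp_square_right _ (A.pairIso_zero z r s) (A.pairHom_zero _ _)).symm
  · exact (map_comp_square_left _ (square_inv (fiberIsoVal (A.μ (rowHom_rows r s).2 z))
      (fiberIsoVal (A.μ (rowHom_rows r' s').2 (A.on M z)))
      (A.μ_comp hL (rowHom_rows r' s').2 hs (rowHom_rows r s).2 z).symm)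
      (A.pairIso_one _ r' s')).trans
        (map_comp_square_right _ (A.pairIso_one z r s) (A.pairHom_one _ _)).symm

/-- The arrow induced by `f : M z ⟶ z'` from the value of `z` at a row `r M` to the value of `z'`
at `r`. -/
abbrev θ {M : Matrix (Fin k) (Fin n) ℤ} {b : T ⟶ T'} {z : (q n).Fiber T} {z' : (q k).Fiber T'}
    (f : FibHom (q k) b (A.on M z) z') {r : Fin n → ℤ} {r' : Fin k → ℤ} (h : r = rowHom M r') :
    FibHom (q 1) b (A.pt z r) (A.pt z' r') :=
  ⟨(A.μ h z).hom.1 ≫ (A.ptMap f r').1, isHomLift_id_comp (A.μ h z).hom.2 (A.ptMap f r').2⟩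

theorem θ_σ_aux {V : Type*} [Category* V] {a b c d e f : V} {i : a ⟶ b} {j : b ⟶ c} {k : c ⟶ d}
    {l : b ⟶ e} {m : e ⟶ d} {n : a ⟶ f} {o : f ⟶ e} {o' : f ⟶ d} (h' : j ≫ k = l ≫ m)
    (h : i ≫ l = n ≫ o) (h'' : o ≫ m = o') : (i ≫ j) ≫ k = n ≫ o' := by
  subst h''
  rw [Category.assoc, h', reassoc_of% h]

/-- The isomorphisms `σ` are compatible with the action of matrices. -/
theorem θ_σ {M : Matrix (Fin k) (Fin n) ℤ} {b : T ⟶ T'} {z : (q n).Fiber T} {z' : (q k).Fiber T'}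
    (f : FibHom (q k) b (A.on M z) z') {r s t : Fin n → ℤ}
    {r' s' t' : Fin k → ℤ} (hr : r = rowHom M r') (hs : s = rowHom M s') (ht : t = rowHom M t')
    (h : t = r + s) (h' : t' = r' + s') :
    (A.θ f ht).1 ≫ (A.σ z' h').hom.1 = (A.σ z h).hom.1 ≫ (A.law.map (A.θ f hr) (A.θ f hs)).1 :=
  θ_σ_aux (A.σ_nat f h') (A.σ_act z hr hs ht h h') (A.law.sum_comp_map _ _ _ _ _ _)

section Threefold

variable (z : (q n).Fiber T) {r s t u v w : Fin n → ℤ} (h₁ : u = r + s) (h₂ : w = u + t)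
  (h₃ : v = s + t) (h₄ : w = r + v)

/-- The value at `(r + s) + t`. -/
noncomputable def σL : A.pt z w ≅ A.law.add (A.law.add (A.pt z r) (A.pt z s)) (A.pt z t) :=
  A.σ z h₂ ≪≫ A.law.sumIso (A.σ z h₁) (Iso.refl _)

/-- The value at `r + (s + t)`. -/
noncomputable def σR : A.pt z w ≅ A.law.add (A.pt z r) (A.law.add (A.pt z s) (A.pt z t)) :=
  A.σ z h₄ ≪≫ A.law.sumIso (Iso.refl _) (A.σ z h₃)

theorem σL_aux {V : Type*} [Category* V] {a b c d e f : V} {i : a ⟶ b} {j : b ⟶ c} {k : c ⟶ d}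
    {l : a ⟶ e} {m : e ⟶ c} {n : e ⟶ f} {o : f ⟶ d} (h : i ≫ j = l ≫ m)
    (h' : n ≫ o = m ≫ k) : i ≫ j ≫ k = (l ≫ n) ≫ o := by
  rw [reassoc_of% h, Category.assoc, h']

variable {M : Matrix (Fin k) (Fin n) ℤ} {b : T ⟶ T'} {z} {z' : (q k).Fiber T'}
  (f : FibHom (q k) b (A.on M z) z') {r' s' t' u' v' w' : Fin k → ℤ}
  (hr : r = rowHom M r') (hs : s = rowHom M s') (ht : t = rowHom M t') (hu : u = rowHom M u')
  (hv : v = rowHom M v') (hw : w = rowHom M w')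

include hu in
theorem θ_σL (h₁' : u' = r' + s') (h₂' : w' = u' + t') :
    (A.θ f hw).1 ≫ (A.σL z' h₁' h₂').hom.1 = (A.σL z h₁ h₂).hom.1 ≫
      (A.law.map (A.law.map (A.θ f hr) (A.θ f hs)) (A.θ f ht)).1 :=
  σL_aux (A.θ_σ f hu ht hw h₂ h₂') (A.law.sum_map_square (A.θ_σ f hr hs hu h₁ h₁').symm
    ((Category.id_comp _).trans (Category.comp_id _).symm))

include hv in
theorem θ_σR (h₃' : v' = s' + t') (h₄' : w' = r' + v') :
    (A.θ f hw).1 ≫ (A.σR z' h₃' h₄').hom.1 = (A.σR z h₃ h₄).hom.1 ≫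
      (A.law.map (A.θ f hr) (A.law.map (A.θ f hs) (A.θ f ht))).1 :=
  σL_aux (A.θ_σ f hr hv hw h₄ h₄') (A.law.sum_map_square
    ((Category.id_comp _).trans (Category.comp_id _).symm) (A.θ_σ f hs ht hv h₃ h₃').symm)

end Threefold

section Constraints

/-- The associativity constraint, computed on an object of `Y 3`. -/
noncomputable def assoc (x y z : (q 1).Fiber T) :
    A.law.add (A.law.add x y) z ≅ A.law.add x (A.law.add y z) :=
  (A.σL (A.fill ![x, y, z]) (r := stdBasis 3 0) (s := stdBasis 3 1) (t := stdBasis 3 2) rfl rfl ≪≫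
    A.law.sumIso (A.law.sumIso (A.fillIso ![x, y, z] 0) (A.fillIso ![x, y, z] 1))
      (A.fillIso ![x, y, z] 2)).symm ≪≫
  A.σR (A.fill ![x, y, z]) (r := stdBasis 3 0) (s := stdBasis 3 1) (t := stdBasis 3 2) rfl
    (add_assoc _ _ _) ≪≫
    A.law.sumIso (A.fillIso ![x, y, z] 0) (A.law.sumIso (A.fillIso ![x, y, z] 1)
      (A.fillIso ![x, y, z] 2))

/-- The commutativity constraint, computed on an object of `Y 2`. -/
noncomputable def comm (x y : (q 1).Fiber T) : A.law.add x y ≅ A.law.add y x :=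
  (A.σ (A.fill ![x, y]) (r := stdBasis 2 0) (s := stdBasis 2 1) rfl ≪≫
    A.law.sumIso (A.fillIso ![x, y] 0) (A.fillIso ![x, y] 1)).symm ≪≫
  A.σ (A.fill ![x, y]) (r := stdBasis 2 1) (s := stdBasis 2 0) (add_comm _ _) ≪≫
    A.law.sumIso (A.fillIso ![x, y] 1) (A.fillIso ![x, y] 0)

theorem inv_comp_of_aux {V : Type*} [Category* V] {a b c d : V} (m : a ≅ b) {f : b ⟶ c} {g : c ⟶ d}
    {i : a ⟶ d} (h : f ≫ g = m.inv ≫ i) : (m.hom ≫ f) ≫ g = i := by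
  rw [Category.assoc, h, Iso.hom_inv_id_assoc]

variable (z : (q n).Fiber T) {b : T ⟶ T'} {x₁ x₂ x₃ : (q 1).Fiber T'} {r s t u v w : Fin n → ℤ}
  (i : FibHom (q 1) b (A.pt z r) x₁) (j : FibHom (q 1) b (A.pt z s) x₂)
  (l : FibHom (q 1) b (A.pt z t) x₃)

/-- The associativity constraint of arbitrary objects is computed by any object of some `Y n` with
arrows from its values to these objects. -/
theorem assoc_univ (h₁ : u = r + s) (h₂ : w = u + t) (h₃ : v = s + t) (h₄ : w = r + v) :
    (A.σL z h₁ h₂).hom.1 ≫ (A.law.map (A.law.map i j) l).1 ≫ (A.assoc x₁ x₂ x₃).hom.1 =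
      (A.σR z h₃ h₄).hom.1 ≫ (A.law.map i (A.law.map j l)).1 := by
  let M : Matrix (Fin 3) (Fin n) ℤ := Matrix.of ![r, s, t]
  have hr : r = rowHom M (stdBasis 3 0) := (rowHom_stdBasis M 0).symm
  have hs : s = rowHom M (stdBasis 3 1) := (rowHom_stdBasis M 1).symm
  have ht : t = rowHom M (stdBasis 3 2) := (rowHom_stdBasis M 2).symm
  have hu : u = rowHom M (stdBasis 3 0 + stdBasis 3 1) := by rw [map_add, ← hr, ← hs, h₁]
  have hv : v = rowHom M (stdBasis 3 1 + stdBasis 3 2) := by rw [map_add, ← hs, ← ht, h₃]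
  have hw : w = rowHom M (stdBasis 3 0 + stdBasis 3 1 + stdBasis 3 2) := by
    rw [map_add, ← hu, ← ht, h₂]
  obtain ⟨f, hf⟩ := A.exists_fillHom (b := b) (z := A.on M z) (x := ![x₁, x₂, x₃])
    (Fin.cases ⟨(A.μ hr z).inv.1 ≫ i.1, isHomLift_id_comp (A.μ hr z).inv.2 i.2⟩ fun a =>
      Fin.cases ⟨(A.μ hs z).inv.1 ≫ j.1, isHomLift_id_comp (A.μ hs z).inv.2 j.2⟩ (fun a =>
        Fin.cases ⟨(A.μ ht z).inv.1 ≫ l.1, isHomLift_id_comp (A.μ ht z).inv.2 l.2⟩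
          (fun a => a.elim0) a) a)
  have ei : i.1 = (A.θ f hr).1 ≫ (A.fillIso ![x₁, x₂, x₃] 0).hom.1 :=
    (inv_comp_of_aux (fiberIsoVal (A.μ hr z)) (hf 0)).symm
  have ej : j.1 = (A.θ f hs).1 ≫ (A.fillIso ![x₁, x₂, x₃] 1).hom.1 :=
    (inv_comp_of_aux (fiberIsoVal (A.μ hs z)) (hf 1)).symm
  have el : l.1 = (A.θ f ht).1 ≫ (A.fillIso ![x₁, x₂, x₃] 2).hom.1 :=
    (inv_comp_of_aux (fiberIsoVal (A.μ ht z)) (hf 2)).symm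
  refine assoc_univ_aux (L' := fiberIsoVal (A.σL (A.fill ![x₁, x₂, x₃]) rfl rfl))
    (e := fiberIsoVal (A.law.sumIso (A.law.sumIso (A.fillIso ![x₁, x₂, x₃] 0)
      (A.fillIso ![x₁, x₂, x₃] 1)) (A.fillIso ![x₁, x₂, x₃] 2)))
    (A.θ_σL h₁ h₂ f hr hs ht hu hw rfl rfl) (A.θ_σR h₃ h₄ f hr hs ht hv hw rfl (add_assoc _ _ _)) ?_ ?_
  · exact A.law.map_eq_map_comp_sum (A.law.map_eq_map_comp_sum ei ej) el
  · exact A.law.map_eq_map_comp_sum ei (A.law.map_eq_map_comp_sum ej el)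

/-- The commutativity constraint is computed by any object of some `Y n`. -/
theorem comm_univ (h : t = r + s) (h' : t = s + r) :
    (A.σ z h).hom.1 ≫ (A.law.map i j).1 ≫ (A.comm x₁ x₂).hom.1 =
      (A.σ z h').hom.1 ≫ (A.law.map j i).1 := by
  have hr := (rowHom_rows r s).1
  have hs := (rowHom_rows r s).2
  obtain ⟨f, hf⟩ := A.exists_fillHom (b := b) (z := A.on (rows r s) z) (x := ![x₁, x₂])
    (Fin.cases ⟨(A.μ hr z).inv.1 ≫ i.1, isHomLift_id_comp (A.μ hr z).inv.2 i.2⟩ fun a =>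
      Fin.cases ⟨(A.μ hs z).inv.1 ≫ j.1, isHomLift_id_comp (A.μ hs z).inv.2 j.2⟩
        (fun a => a.elim0) a)
  have ei : i.1 = (A.θ f hr).1 ≫ (A.fillIso ![x₁, x₂] 0).hom.1 :=
    (inv_comp_of_aux (fiberIsoVal (A.μ hr z)) (hf 0)).symm
  have ej : j.1 = (A.θ f hs).1 ≫ (A.fillIso ![x₁, x₂] 1).hom.1 :=
    (inv_comp_of_aux (fiberIsoVal (A.μ hs z)) (hf 1)).symm
  have ht := rowHom_rows_add h
  refine assoc_univ_aux (L' := fiberIsoVal (A.σ (A.fill ![x₁, x₂]) rfl))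
    (e := fiberIsoVal (A.law.sumIso (A.fillIso ![x₁, x₂] 0) (A.fillIso ![x₁, x₂] 1)))
    (A.θ_σ f hr hs ht h rfl) (A.θ_σ f hs hr ht h' (add_comm _ _)) ?_ ?_
  · exact A.law.map_eq_map_comp_sum ei ej
  · exact A.law.map_eq_map_comp_sum ej ei

end Constraints

end MatrixAction

end PicardMatrix

namespace PicardMatrix

/-- The basis `e₀`, `e₀ + e₁` of `ℤ²`. Evaluating at it gives `(x, y) ↦ (x, x + y)`, which is
therefore an equivalence along with evaluation at the standard basis; this is why translations are
equivalences. -/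
theorem exists_basis_unipotent : ∃ b : Module.Basis (Fin 2) ℤ (Fin 2 → ℤ),
    b 0 = stdBasis 2 0 ∧ b 1 = stdBasis 2 0 + stdBasis 2 1 := by
  let e : (Fin 2 → ℤ) ≃ₗ[ℤ] (Fin 2 → ℤ) :=
    { toFun := fun v => ![v 0 + v 1, v 1]
      invFun := fun v => ![v 0 - v 1, v 1]
      map_add' := fun v w => by ext i; fin_cases i <;> simp [add_add_add_comm]
      map_smul' := fun c v => by ext i; fin_cases i <;> simp [mul_add]
      left_inv := fun v => by ext i; fin_cases i <;> simp
      right_inv := fun v => by ext i; fin_cases i <;> simp }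
  refine ⟨(stdBasis 2).map e, ?_, ?_⟩
  · ext i; fin_cases i <;> simp [e]
  · ext i; fin_cases i <;> simp [e]

theorem Law.map_eq_sum_comp_map {B : Type*} [Category* B] {X : Type*} [Category* X] {p : X ⥤ B}
    (P : Law p) {T T' : B} {b : T ⟶ T'} {x y x' y' : p.Fiber T} {x'' y'' : p.Fiber T'}
    {φ : FibHom p b x x''} {ψ : FibHom p b y y''} {f : x ⟶ x'} {g : y ⟶ y'}
    {φ' : FibHom p b x' x''} {ψ' : FibHom p b y' y''} (h : φ.1 = f.1 ≫ φ'.1)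
    (h' : ψ.1 = g.1 ≫ ψ'.1) : (P.map φ ψ).1 = (P.sum f g).1 ≫ (P.map φ' ψ').1 := by
  rw [P.sum_comp_map f g φ' ψ' (h ▸ φ.2) (h' ▸ ψ.2)]
  exact P.map_congr rfl h h'

namespace MatrixAction

variable {B : Type u} [Category.{v} B] {Y : ℕ → Type w} [∀ n, Category.{w'} (Y n)]
  {q : ∀ n, Y n ⥤ B} (A : MatrixAction q) {n k m : ℕ} {T T' : B}

/-- By `assoc_univ` the associativity isomorphism is characterized on the values of an object of
exponent `3`; both sides are compared on the one with values `x`, `y`, `z`. -/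
theorem assoc_nat {b : T ⟶ T'} {x y z : (q 1).Fiber T} {x' y' z' : (q 1).Fiber T'}
    (φ : FibHom (q 1) b x x') (ψ : FibHom (q 1) b y y') (χ : FibHom (q 1) b z z') :
    (A.law.map (A.law.map φ ψ) χ).1 ≫ (A.assoc x' y' z').hom.1 =
      (A.assoc x y z).hom.1 ≫ (A.law.map φ (A.law.map ψ χ)).1 := by
  let w := A.fill ![x, y, z]
  let ε₀ : A.pt w (stdBasis 3 0) ≅ x := A.fillIso ![x, y, z] 0
  let ε₁ : A.pt w (stdBasis 3 1) ≅ y := A.fillIso ![x, y, z] 1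
  let ε₂ : A.pt w (stdBasis 3 2) ≅ z := A.fillIso ![x, y, z] 2
  let i : FibHom (q 1) b (A.pt w (stdBasis 3 0)) x' :=
    ⟨ε₀.hom.1 ≫ φ.1, isHomLift_id_comp ε₀.hom.2 φ.2⟩
  let j : FibHom (q 1) b (A.pt w (stdBasis 3 1)) y' :=
    ⟨ε₁.hom.1 ≫ ψ.1, isHomLift_id_comp ε₁.hom.2 ψ.2⟩
  let l : FibHom (q 1) b (A.pt w (stdBasis 3 2)) z' :=
    ⟨ε₂.hom.1 ≫ χ.1, isHomLift_id_comp ε₂.hom.2 χ.2⟩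
  have e₁ : (A.law.map (A.law.map i j) l).1 =
      (A.law.sum (A.law.sum ε₀.hom ε₁.hom) ε₂.hom).1 ≫ (A.law.map (A.law.map φ ψ) χ).1 :=
    A.law.map_eq_sum_comp_map (A.law.map_eq_sum_comp_map rfl rfl) rfl
  have e₂ : (A.law.map i (A.law.map j l)).1 =
      (A.law.sum ε₀.hom (A.law.sum ε₁.hom ε₂.hom)).1 ≫ (A.law.map φ (A.law.map ψ χ)).1 :=
    A.law.map_eq_sum_comp_map rfl (A.law.map_eq_sum_comp_map rfl rfl)
  have k := A.assoc_univ w i j l rfl rfl rfl (add_assoc _ _ _)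
  rw [e₁, e₂] at k
  exact nat_of_univ_aux (L := fiberIsoVal (A.σL w rfl rfl))
    (e := fiberIsoVal (A.law.sumIso (A.law.sumIso ε₀ ε₁) ε₂))
    (A.assoc_univ w ε₀.hom ε₁.hom ε₂.hom rfl rfl rfl (add_assoc _ _ _)) k

theorem comm_nat {b : T ⟶ T'} {x y : (q 1).Fiber T} {x' y' : (q 1).Fiber T'}
    (φ : FibHom (q 1) b x x') (ψ : FibHom (q 1) b y y') :
    (A.law.map φ ψ).1 ≫ (A.comm x' y').hom.1 = (A.comm x y).hom.1 ≫ (A.law.map ψ φ).1 := by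
  let w := A.fill ![x, y]
  let ε₀ : A.pt w (stdBasis 2 0) ≅ x := A.fillIso ![x, y] 0
  let ε₁ : A.pt w (stdBasis 2 1) ≅ y := A.fillIso ![x, y] 1
  let i : FibHom (q 1) b (A.pt w (stdBasis 2 0)) x' :=
    ⟨ε₀.hom.1 ≫ φ.1, isHomLift_id_comp ε₀.hom.2 φ.2⟩
  let j : FibHom (q 1) b (A.pt w (stdBasis 2 1)) y' :=
    ⟨ε₁.hom.1 ≫ ψ.1, isHomLift_id_comp ε₁.hom.2 ψ.2⟩
  have e₁ : (A.law.map i j).1 = (A.law.sum ε₀.hom ε₁.hom).1 ≫ (A.law.map φ ψ).1 :=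
    A.law.map_eq_sum_comp_map rfl rfl
  have e₂ : (A.law.map j i).1 = (A.law.sum ε₁.hom ε₀.hom).1 ≫ (A.law.map ψ φ).1 :=
    A.law.map_eq_sum_comp_map rfl rfl
  have k := A.comm_univ w i j rfl (add_comm _ _)
  rw [e₁, e₂] at k
  exact nat_of_univ_aux (L := fiberIsoVal (A.σ w rfl)) (e := fiberIsoVal (A.law.sumIso ε₀ ε₁))
    (A.comm_univ w ε₀.hom ε₁.hom rfl (add_comm _ _)) k

section Plus

variable {z : (q n).Fiber T} {x y x' y' x₁ x₂ x₃ : (q 1).Fiber T} {r s t u v w : Fin n → ℤ}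

/-- The sum of arrows from values of `z`, as an arrow from the value at the sum of the vectors. -/
noncomputable def plus (h : t = r + s) (i : A.pt z r ⟶ x) (j : A.pt z s ⟶ y) :
    A.pt z t ⟶ A.law.add x y := (A.σ z h).hom ≫ A.law.sum i j

theorem plus_sum (h : t = r + s) (i : A.pt z r ⟶ x) (j : A.pt z s ⟶ y) (f : x ⟶ x') (g : y ⟶ y') :
    A.plus h i j ≫ A.law.sum f g = A.plus h (i ≫ f) (j ≫ g) := by
  rw [plus, plus, Category.assoc, A.law.sum_comp]

/-- Associativity, tested on the values of an object at `r`, `s` and `t`. -/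
theorem plus_assoc (h₁ : u = r + s) (h₂ : w = u + t) (h₃ : v = s + t) (h₄ : w = r + v)
    (i : A.pt z r ⟶ x₁) (j : A.pt z s ⟶ x₂) (l : A.pt z t ⟶ x₃) :
    A.plus h₂ (A.plus h₁ i j) l ≫ (A.assoc x₁ x₂ x₃).hom = A.plus h₄ i (A.plus h₃ j l) := by
  have k : (A.σL z h₁ h₂).hom ≫ A.law.sum (A.law.sum i j) l ≫ (A.assoc x₁ x₂ x₃).hom =
      (A.σR z h₃ h₄).hom ≫ A.law.sum i (A.law.sum j l) :=
    Subtype.ext (A.assoc_univ z i j l h₁ h₂ h₃ h₄)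
  simp only [σL, σR, Iso.trans_hom, Law.sumIso_hom, Iso.refl_hom, Category.assoc] at k
  simp only [plus]
  rw [Category.assoc]
  conv_lhs => rw [← Category.id_comp l, A.law.sum_comp, Category.assoc]
  conv_rhs => rw [← Category.id_comp i, A.law.sum_comp]
  exact k

theorem plus_comm (h : t = r + s) (h' : t = s + r) (i : A.pt z r ⟶ x) (j : A.pt z s ⟶ y) :
    A.plus h i j ≫ (A.comm x y).hom = A.plus h' j i :=
  (Category.assoc _ _ _).trans (Subtype.ext (A.comm_univ z i j h h'))

theorem plus_isIso (h : t = r + s) (i : A.pt z r ⟶ x) (j : A.pt z s ⟶ y) (hi : IsIso i)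
    (hj : IsIso j) : IsIso (A.plus h i j) :=
  inferInstanceAs (IsIso (A.σ z h ≪≫ A.law.sumIso (asIso i) (asIso j)).hom)

end Plus

theorem pentagon_aux {z : (q n).Fiber T} {x₁ x₂ x₃ x₄ : (q 1).Fiber T}
    {r s t u a b c d e f : Fin n → ℤ} (i : A.pt z r ≅ x₁) (j : A.pt z s ≅ x₂) (k : A.pt z t ≅ x₃)
    (l : A.pt z u ≅ x₄) (h₁ : a = r + s) (h₂ : b = s + t) (h₃ : c = t + u) (h₄ : d = a + t)
    (h₅ : d = r + b) (h₆ : e = b + u) (h₇ : e = s + c) (h₈ : f = d + u) (h₉ : f = r + e)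
    (h₀ : f = a + c) :
    A.law.sum (A.assoc x₁ x₂ x₃).hom (𝟙 x₄) ≫ (A.assoc x₁ (A.law.add x₂ x₃) x₄).hom ≫
      A.law.sum (𝟙 x₁) (A.assoc x₂ x₃ x₄).hom =
    (A.assoc (A.law.add x₁ x₂) x₃ x₄).hom ≫ (A.assoc x₁ x₂ (A.law.add x₃ x₄)).hom := by
  have h : IsIso (A.plus h₈ (A.plus h₄ (A.plus h₁ i.hom j.hom) k.hom) l.hom) :=
    A.plus_isIso _ _ _ (A.plus_isIso _ _ _ (A.plus_isIso _ _ _ inferInstance inferInstance)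
      inferInstance) inferInstance
  rw [← cancel_epi (A.plus h₈ (A.plus h₄ (A.plus h₁ i.hom j.hom) k.hom) l.hom),
    ← Category.assoc, A.plus_sum, A.plus_assoc h₁ h₄ h₂ h₅, Category.comp_id, ← Category.assoc,
    A.plus_assoc h₅ h₈ h₆ h₉, A.plus_sum, Category.comp_id, A.plus_assoc h₂ h₆ h₃ h₇,
    ← Category.assoc, A.plus_assoc h₄ h₈ h₃ h₀, A.plus_assoc h₁ h₀ h₇ h₉]

/-- Four objects are the values at the basis of one object of exponent `4`, and the sums of values
`A.plus` make the two paths agree. -/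
theorem pentagon (x y z t : (q 1).Fiber T) :
    A.law.sum (A.assoc x y z).hom (𝟙 t) ≫ (A.assoc x (A.law.add y z) t).hom ≫
      A.law.sum (𝟙 x) (A.assoc y z t).hom =
    (A.assoc (A.law.add x y) z t).hom ≫ (A.assoc x y (A.law.add z t)).hom := by
  refine A.pentagon_aux (z := A.fill ![x, y, z, t]) (A.fillIso ![x, y, z, t] 0)
    (A.fillIso ![x, y, z, t] 1) (A.fillIso ![x, y, z, t] 2) (A.fillIso ![x, y, z, t] 3)
    rfl rfl rfl rfl ?_ rfl ?_ rfl ?_ ?_ <;> simp only [add_assoc]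

theorem hexagon_aux {z : (q n).Fiber T} {x₁ x₂ x₃ : (q 1).Fiber T}
    {r s t a b c d : Fin n → ℤ} (i : A.pt z r ≅ x₁) (j : A.pt z s ≅ x₂) (k : A.pt z t ≅ x₃)
    (h₁ : a = r + s) (h₁' : a = s + r) (h₂ : b = s + t) (h₃ : c = r + t) (h₃' : c = t + r)
    (h₄ : d = a + t) (h₅ : d = r + b) (h₅' : d = b + r) (h₆ : d = s + c) :
    (A.assoc x₁ x₂ x₃).hom ≫ (A.comm x₁ (A.law.add x₂ x₃)).hom ≫ (A.assoc x₂ x₃ x₁).hom =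
    A.law.sum (A.comm x₁ x₂).hom (𝟙 x₃) ≫ (A.assoc x₂ x₁ x₃).hom ≫
      A.law.sum (𝟙 x₂) (A.comm x₁ x₃).hom := by
  have h : IsIso (A.plus h₄ (A.plus h₁ i.hom j.hom) k.hom) :=
    A.plus_isIso _ _ _ (A.plus_isIso _ _ _ inferInstance inferInstance) inferInstance
  rw [← cancel_epi (A.plus h₄ (A.plus h₁ i.hom j.hom) k.hom), ← Category.assoc,
    A.plus_assoc h₁ h₄ h₂ h₅, ← Category.assoc, A.plus_comm h₅ h₅', A.plus_assoc h₂ h₅' h₃' h₆,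
    ← Category.assoc, A.plus_sum, A.plus_comm h₁ h₁', Category.comp_id, ← Category.assoc,
    A.plus_assoc h₁' h₄ h₃ h₆, A.plus_sum, A.plus_comm h₃ h₃', Category.comp_id]

/-- As for the pentagon, with exponent `3`. -/
theorem hexagon (x y z : (q 1).Fiber T) :
    (A.assoc x y z).hom ≫ (A.comm x (A.law.add y z)).hom ≫ (A.assoc y z x).hom =
    A.law.sum (A.comm x y).hom (𝟙 z) ≫ (A.assoc y x z).hom ≫
      A.law.sum (𝟙 y) (A.comm x z).hom := by
  refine A.hexagon_aux (z := A.fill ![x, y, z]) (A.fillIso ![x, y, z] 0) (A.fillIso ![x, y, z] 1)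
    (A.fillIso ![x, y, z] 2) rfl (add_comm _ _) rfl rfl (add_comm _ _) rfl (add_assoc _ _ _) ?_ ?_
  · abel
  · abel

theorem comm_comm (x y : (q 1).Fiber T) :
    (A.comm x y).hom ≫ (A.comm y x).hom = 𝟙 (A.law.add x y) := by
  let i : A.pt (A.fill ![x, y]) (stdBasis 2 0) ≅ x := A.fillIso ![x, y] 0
  let j : A.pt (A.fill ![x, y]) (stdBasis 2 1) ≅ y := A.fillIso ![x, y] 1
  have h : IsIso (A.plus rfl i.hom j.hom) := A.plus_isIso _ _ _ inferInstance inferInstance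
  rw [← cancel_epi (A.plus rfl i.hom j.hom), ← Category.assoc, A.plus_comm _ (add_comm _ _),
    A.plus_comm _ rfl, Category.comp_id]

/-- The strictness condition. By `plus_comm` the commutativity isomorphism exchanges the terms of a
sum of two values of one object; for two equal values it fixes such a sum. -/
theorem comm_self (x : (q 1).Fiber T) : (A.comm x x).hom = 𝟙 (A.law.add x x) := by
  let i : A.pt (A.fill ![x]) (stdBasis 1 0) ≅ x := A.fillIso ![x] 0
  have h : IsIso (A.plus rfl i.hom i.hom) := A.plus_isIso _ _ _ inferInstance inferInstance
  rw [← cancel_epi (A.plus rfl i.hom i.hom), A.plus_comm _ rfl, Category.comp_id]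

theorem nonempty_fiber (A : MatrixAction q) (T : B) : Nonempty ((q 1).Fiber T) :=
  ⟨A.pt (A.fill (T := T) (k := 0) (fun i => i.elim0)) 0⟩

/-! ### Translations and inverses -/

section Basis

variable {f : T ⟶ T'}

theorem exists_hom_two (b : Module.Basis (Fin 2) ℤ (Fin n → ℤ)) {r s : Fin n → ℤ} (hr : b 0 = r)
    (hs : b 1 = s) (z : (q n).Fiber T) (z' : (q n).Fiber T')
    (φ : FibHom (q 1) f (A.pt z r) (A.pt z' r)) (ψ : FibHom (q 1) f (A.pt z s) (A.pt z' s)) :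
    ∃ h : FibHom (q n) f z z', (A.act (rowMat r)).F.map h.1 = φ.1 ∧
      (A.act (rowMat s)).F.map h.1 = ψ.1 := by
  subst hr hs
  obtain ⟨h, e⟩ := A.exists_hom b f z z' (Fin.cases φ fun i => Fin.cases ψ (fun j => j.elim0) i)
  exact ⟨h, e 0, e 1⟩

theorem hom_ext_two (b : Module.Basis (Fin 2) ℤ (Fin n → ℤ)) {r s : Fin n → ℤ} (hr : b 0 = r)
    (hs : b 1 = s) {z z' : Y n} {h h' : z ⟶ z'} (l : (q n).IsHomLift f h)
    (l' : (q n).IsHomLift f h')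
    (e : (A.act (rowMat r)).F.map h = (A.act (rowMat r)).F.map h')
    (e' : (A.act (rowMat s)).F.map h = (A.act (rowMat s)).F.map h') : h = h' := by
  subst hr hs
  exact A.hom_ext b l l' (Fin.cases e fun i => Fin.cases e' (fun j => j.elim0) i)

theorem exists_obj_two (b : Module.Basis (Fin 2) ℤ (Fin n → ℤ)) {r s : Fin n → ℤ} (hr : b 0 = r)
    (hs : b 1 = s) (x y : (q 1).Fiber T) :
    ∃ z : (q n).Fiber T, Nonempty (A.pt z r ≅ x) ∧ Nonempty (A.pt z s ≅ y) := by
  subst hr hs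
  obtain ⟨z, h⟩ := A.exists_obj b ![x, y]
  exact ⟨z, h 0, h 1⟩

end Basis

theorem eq_comp_inv_comp_of_aux {V : Type*} [Category* V] {a b c d : V} (i : a ≅ b) (j : c ≅ d)
    {f : a ⟶ c} : f ≫ j.hom = i.hom ≫ i.inv ≫ f ≫ j.hom := by
  rw [Iso.hom_inv_id_assoc]

/-- An arrow between the translates of `y` and `y'` by `x` gives, with the identity of `x`, an arrow
of values at the basis `e₀`, `e₀ + e₁`, hence an arrow of exponent `2` and an arrow between the
values at `e₁`. -/
theorem translation_full (x : (q 1).Fiber T) : (A.law.translation x).Full := by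
  refine ⟨fun {y y'} g => ?_⟩
  obtain ⟨b, hb, hb'⟩ := exists_basis_unipotent
  let i : A.pt (A.fill ![x, y]) (stdBasis 2 0) ≅ x := A.fillIso ![x, y] 0
  let i' : A.pt (A.fill ![x, y']) (stdBasis 2 0) ≅ x := A.fillIso ![x, y'] 0
  let j : A.pt (A.fill ![x, y]) (stdBasis 2 1) ≅ y := A.fillIso ![x, y] 1
  let j' : A.pt (A.fill ![x, y']) (stdBasis 2 1) ≅ y' := A.fillIso ![x, y'] 1
  obtain ⟨h, e, e'⟩ := A.exists_hom_two b hb hb' (A.fill ![x, y]) (A.fill ![x, y'])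
    (i.hom ≫ i'.inv) g
  let φ : y ⟶ y' := j.inv ≫ A.ptMap h (stdBasis 2 1) ≫ j'.hom
  refine ⟨φ, ?_⟩
  have k : (A.pairHom (b := 𝟙 T) (FibHom.id x) φ).1 = h.1 := by
    refine A.pairHom_ext (A.pairHom _ _).2 h.2 ?_ ?_
    · refine (A.pairHom_zero _ _).trans (Eq.trans ?_ (congrArg (· ≫ i'.hom.1) e).symm)
      exact (Category.comp_id _).trans ((congrArg _ (fiber_inv_hom i')).trans
        (Category.comp_id _)).symm |>.trans (Category.assoc _ _ _).symm
    · exact (A.pairHom_one _ _).trans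
        (eq_comp_inv_comp_of_aux (fiberIsoVal j) (fiberIsoVal j')).symm
  exact Subtype.ext ((congrArg (A.act _).F.map k).trans e')

theorem translation_faithful (x : (q 1).Fiber T) : (A.law.translation x).Faithful := by
  refine ⟨fun {y y' φ φ'} g => ?_⟩
  obtain ⟨b, hb, hb'⟩ := exists_basis_unipotent
  let j : A.pt (A.fill ![x, y]) (stdBasis 2 1) ≅ y := A.fillIso ![x, y] 1
  have k : (A.pairHom (b := 𝟙 T) (FibHom.id x) φ).1 = (A.pairHom (b := 𝟙 T) (FibHom.id x) φ').1 := by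
    refine A.hom_ext_two b hb hb' (A.pairHom _ _).2 (A.pairHom _ _).2 ?_ (congrArg Subtype.val g)
    refine (cancel_mono (fiberIsoVal (A.fillIso ![x, y'] 0)).hom).1 ?_
    exact (A.pairHom_zero _ _).trans (A.pairHom_zero _ _).symm
  refine Subtype.ext ((cancel_epi (fiberIsoVal j).hom).1 ?_)
  exact (A.pairHom_one (b := 𝟙 T) (FibHom.id x) φ).symm.trans
    ((congrArg (fun h => (A.act _).F.map h ≫ _) k).trans (A.pairHom_one _ _))

theorem translation_isEquivalence (x : (q 1).Fiber T) : (A.law.translation x).IsEquivalence where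
  full := A.translation_full x
  faithful := A.translation_faithful x
  essSurj := ⟨fun y => by
    obtain ⟨b, hb, hb'⟩ := exists_basis_unipotent
    obtain ⟨z, ⟨i⟩, ⟨j⟩⟩ := A.exists_obj_two b hb hb' x y
    exact ⟨A.pt z (stdBasis 2 1), ⟨A.law.sumIso i.symm (Iso.refl _) ≪≫
      (A.σ z rfl).symm ≪≫ j⟩⟩⟩

/-- Any arrow over an identity has an invertible value at the vector `0`. -/
theorem isIso_ptMap_zero {z z' : (q n).Fiber T} (f : z ⟶ z') :
    IsIso (((A.act (rowMat (0 : Fin n → ℤ))).fiberFunctor T).map f) := by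
  let M : Matrix (Fin 0) (Fin n) ℤ := 0
  have h0 : (0 : Fin n → ℤ) = rowHom M 0 := (map_zero _).symm
  obtain ⟨g, -⟩ := A.exists_iso (stdBasis 0) (A.on M z) (A.on M z') fun i => i.elim0
  have hg : g.hom = ((A.act M).fiberFunctor T).map f :=
    Subtype.ext (A.hom_ext (stdBasis 0) g.hom.2 (((A.act M).fiberFunctor T).map f).2
      fun i => i.elim0)
  have e : ((A.act (rowMat (0 : Fin n → ℤ))).fiberFunctor T).map f ≫ (A.μ h0 z').hom =
      (A.μ h0 z).hom ≫ ((A.act (rowMat 0)).fiberFunctor T).map g.hom := by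
    rw [hg]
    exact Subtype.ext (A.μ_nat h0 f)
  have e' : ((A.act (rowMat (0 : Fin n → ℤ))).fiberFunctor T).map f =
      (A.μ h0 z ≪≫ ((A.act (rowMat 0)).fiberFunctor T).mapIso g ≪≫ (A.μ h0 z').symm).hom := by
    rw [Iso.trans_hom, Iso.trans_hom, Iso.symm_hom, ← Category.assoc, Iso.eq_comp_inv, e]
    rfl
  rw [e']
  infer_instance

theorem isSplitMono_of_isIso_comp {V : Type*} [Category* V] {a b c : V} {f : a ⟶ b} {g : b ⟶ c}
    {h : a ⟶ c} (hh : IsIso h) (e : h = f ≫ g) : IsSplitMono f :=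
  ⟨⟨⟨g ≫ inv h, by rw [← Category.assoc, ← e, IsIso.hom_inv_id]⟩⟩⟩

theorem isSplitEpi_of_isIso_comp {V : Type*} [Category* V] {a b c : V} {f : a ⟶ b} {g : b ⟶ c}
    {h : a ⟶ c} (hh : IsIso h) (e : h = f ≫ g) : IsSplitEpi g :=
  ⟨⟨⟨inv h ≫ f, by rw [Category.assoc, ← e, IsIso.inv_hom_id]⟩⟩⟩

/-- If `f + g` is invertible then so is `f`: after translation `f` has a retraction and a section,
and translations are fully faithful. -/
theorem isIso_of_sum {x y x' y' : (q 1).Fiber T} (f : x ⟶ x') (g : y ⟶ y')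
    (h : IsIso (A.law.sum f g)) : IsIso f := by
  have h' : IsIso (A.law.sum g f) := by
    have e : A.law.sum g f = (A.comm y x).hom ≫ A.law.sum f g ≫ (A.comm x' y').hom := by
      rw [← Category.assoc, ← show A.law.sum g f ≫ (A.comm y' x').hom =
        (A.comm y x).hom ≫ A.law.sum f g from Subtype.ext (A.comm_nat (b := 𝟙 T) g f),
        Category.assoc, A.comm_comm, Category.comp_id]
    rw [e]
    infer_instance
  have h₁ := A.translation_full y
  have h₂ := A.translation_faithful y
  have h₃ := A.translation_full y'
  have h₄ := A.translation_faithful y'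
  have e₁ : A.law.sum g f = (A.law.translation y).map f ≫ A.law.sum g (𝟙 x') := by
    refine Eq.trans ?_ (A.law.sum_comp _ _ _ _)
    rw [Category.id_comp, Category.comp_id]
  have e₂ : A.law.sum g f = A.law.sum g (𝟙 x) ≫ (A.law.translation y').map f := by
    refine Eq.trans ?_ (A.law.sum_comp _ _ _ _)
    rw [Category.id_comp, Category.comp_id]
  have m := isSplitMono_of_isIso_comp h' e₁
  have m' := isSplitEpi_of_isIso_comp h' e₂
  have n : IsSplitMono f := ((A.law.translation y).isSplitMono_iff f).1 m
  have n' : IsSplitEpi f := ((A.law.translation y').isSplitEpi_iff f).1 m'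
  exact isIso_of_epi_of_isSplitMono f

/-- The fibres are groupoids. An arrow `f` extends to an arrow of exponent `1`, whose value at `-1`
is an arrow `f'` such that `f + f'` is, up to isomorphism, its value at `0`; this one is invertible
since it factors through exponent `0`. -/
theorem isIso_hom (A : MatrixAction q) {x y : (q 1).Fiber T} (f : x ⟶ y) : IsIso f := by
  let i : A.pt (A.fill ![x]) (stdBasis 1 0) ≅ x := A.fillIso ![x] 0
  let j : A.pt (A.fill ![y]) (stdBasis 1 0) ≅ y := A.fillIso ![y] 0
  obtain ⟨h, e⟩ := A.exists_hom (stdBasis 1) (𝟙 T) (A.fill ![x]) (A.fill ![y])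
    (Fin.cases (i.hom ≫ f ≫ j.inv) fun a => a.elim0)
  have e' : A.ptMap h (stdBasis 1 0) = i.hom ≫ f ≫ j.inv := Subtype.ext (e 0)
  have k := A.isIso_ptMap_zero h
  let P := (A.σ (A.fill ![x]) (add_neg_cancel (stdBasis 1 0)).symm)
  let P' := (A.σ (A.fill ![y]) (add_neg_cancel (stdBasis 1 0)).symm)
  have l : ((A.act (rowMat 0)).fiberFunctor T).map h ≫ P'.hom = P.hom ≫
      A.law.sum (A.ptMap h (stdBasis 1 0)) (A.ptMap h (-stdBasis 1 0)) :=
    Subtype.ext (A.σ_nat h _)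
  have m : IsIso (A.law.sum (A.ptMap h (stdBasis 1 0)) (A.ptMap h (-stdBasis 1 0))) := by
    rw [(Iso.inv_comp_eq P).2 l |>.symm]
    infer_instance
  have m' := A.isIso_of_sum _ _ m
  have e'' : f = i.inv ≫ (i.hom ≫ f ≫ j.inv) ≫ j.hom := by simp
  rw [e'', ← e']
  infer_instance

/-- The Picard structure on `q 1` defined by an action of matrices. -/
noncomputable def picardStr : PicardStr (q 1) where
  toLaw := A.law
  groupoid := A.isIso_hom
  assoc := A.assoc
  comm := A.comm
  assoc_nat := A.assoc_nat
  comm_nat := A.comm_nat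
  pentagon := A.pentagon
  hexagon := A.hexagon
  comm_comm := A.comm_comm
  strict := A.comm_self
  nonempty := A.nonempty_fiber
  translation_equiv := A.translation_isEquivalence

/-- The values of an object of `Y n` form an additive family. -/
noncomputable def famAt (z : (q n).Fiber T) : FamAt A.picardStr (Fin n → ℤ) T where
  pt r := A.pt z r
  σ h := A.σ z h
  assoc h₁ h₂ h₃ h₄ := by
    have k := A.plus_assoc (z := z) h₁ h₂ h₃ h₄ (𝟙 _) (𝟙 _) (𝟙 _)
    simp only [plus, A.law.sum_id, Category.comp_id, Category.assoc] at k
    exact k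
  comm h h' := by
    have k := A.plus_comm (z := z) h h' (𝟙 _) (𝟙 _)
    simp only [plus, A.law.sum_id, Category.comp_id] at k
    exact k

end MatrixAction

end PicardMatrix

namespace PicardMatrix

/-! ### Arrows and objects of a product of stacks -/

theorem inv_map_comp_aux {V W : Type*} [Category* V] [Category* W] (H : V ⥤ W) {a b a' b' : V}
    (i : a ≅ b) (i' : a' ≅ b') {f : a ⟶ a'} {φ : H.obj b ⟶ H.obj b'}
    (e : H.map f ≫ H.map i'.hom = H.map i.hom ≫ φ) : H.map (i.inv ≫ f ≫ i'.hom) = φ := by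
  rw [Functor.map_comp, Functor.map_comp, e, ← H.map_comp_assoc, i.inv_hom_id, H.map_id,
    Category.id_comp]

namespace Stk

variable {C : Type u} [Category.{v} C] {J : GrothendieckTopology C} {U : C}
  {S S' : Stk.{max u v w₁, max v w₂} (J.over U)} {k : ℕ}

/-- The components of an invertible 2-arrow. -/
def isoApp {F F' : S ⟶ S'} (e : F ≅ F') (z : S.X) : F.F.obj z ≅ F'.F.obj z where
  hom := (Hom₂.τ e.hom).app z
  inv := (Hom₂.τ e.inv).app z
  hom_inv_id := NatTrans.congr_app (congrArg Hom₂.τ e.hom_inv_id) z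
  inv_hom_id := NatTrans.congr_app (congrArg Hom₂.τ e.inv_hom_id) z

theorem isoApp_lies {F F' : S ⟶ S'} (e : F ≅ F') {z : S.X} {T : Over U} (hz : S.p.obj z = T) :
    S'.p.IsHomLift (𝟙 T) (isoApp e z).hom :=
  isHomLift_congr _ (e.hom.vert z) ((F.obj_eq z).trans hz)

/-- The powers of a stack. -/
def pow (S : Stk.{max u v w₁, max v w₂} (J.over U)) (k : ℕ) :
    Stk.{max u v w₁, max v w₂} (J.over U) where
  X := Pow S.p k
  p := Pow.proj S.p k
  isStack := Pow.isStack S.isStack k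

/-- The projections of a power of a stack. -/
def powPr (S : Stk.{max u v w₁, max v w₂} (J.over U)) (i : Fin k) : S.pow k ⟶ S where
  F := (Pow.pr S.p k i).F
  w := (Pow.pr S.p k i).w
  cart _ h := isStronglyCartesian_of_isHomLift (Pow.arr_cart S.isStack.fibered h i)
    (IsHomLift.map S.p _)

/-- The functor to a power of a stack with given projections. -/
def powLiftFunctor (π : Fin k → (S ⟶ S')) : S.X ⥤ Pow S'.p k where
  obj z := ⟨S.p.obj z, fun i => ⟨(π i).F.obj z, (π i).obj_eq z⟩⟩
  map φ := ⟨S.p.map φ, fun i => (π i).F.map φ, fun i => isHomLift_map_of_eq (π i).w φ⟩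
  map_id z := Pow.Hom.ext (S.p.map_id z) (funext fun i => (π i).F.map_id z)
  map_comp φ ψ := Pow.Hom.ext (S.p.map_comp φ ψ) (funext fun i => (π i).F.map_comp φ ψ)

/-- The morphism to a power of a stack with given projections. -/
def powLift (π : Fin k → (S ⟶ S')) : S ⟶ S'.pow k where
  F := powLiftFunctor π
  w := rfl
  cart φ h := Pow.cart_of_arr ((powLiftFunctor π).map φ) fun i =>
    isStronglyCartesian_of_isHomLift ((π i).cart φ h) (isHomLift_map_of_eq (π i).w φ)

/-- A morphism from the power of a stack to a product, quasi-inverse to the one defined by the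
projections. -/
theorem exists_powInv {π : Fin k → (S ⟶ S')} (h : IsProduct π) :
    ∃ (E : S'.pow k ⟶ S) (e : ∀ i, E ≫ π i ≅ S'.powPr i) (κ : powLift π ≫ E ≅ 𝟙 S),
      ∀ i z, (π i).F.map (isoApp κ z).hom = (isoApp (e i) ((powLift π).F.obj z)).hom := by
  obtain ⟨E, ⟨e⟩⟩ := (h (S'.pow k)).essSurj.mem_essImage fun i => S'.powPr i
  have e' : ∀ i, E ≫ π i ≅ S'.powPr i := fun i =>
    ⟨e.hom i, e.inv i, congrFun e.hom_inv_id i, congrFun e.inv_hom_id i⟩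
  have := (h S).full
  have := (h S).faithful
  let γ : ∀ i, (powLift π ≫ E) ≫ π i ≅ 𝟙 S ≫ π i := fun i => whiskerLeftIso (powLift π) (e' i)
  let γ' := CategoryTheory.Pi.isoMk γ
  let κ : powLift π ≫ E ≅ 𝟙 S := (Functor.pi' fun i => postcomp S (π i)).preimageIso γ'
  refine ⟨E, e', κ, fun i z => ?_⟩
  have k : (Functor.pi' fun i => postcomp S (π i)).map κ.hom = γ'.hom := Functor.map_preimage _ _
  exact NatTrans.congr_app (congrArg Hom₂.τ (congrFun k i)) z

section Product

variable {π : Fin k → (S ⟶ S')} (h : IsProduct π) {R T : Over U} {f : R ⟶ T}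
include h

theorem exists_hom_of_isProduct (z : S.p.Fiber R) (z' : S.p.Fiber T)
    (φ : ∀ i, FibHom S'.p f (((π i).fib rfl).obj z) (((π i).fib rfl).obj z')) :
    ∃ g : FibHom S.p f z z', ∀ i, (π i).F.map g.1 = (φ i).1 := by
  obtain ⟨E, e, κ, hκ⟩ := exists_powInv h
  obtain ⟨z, rfl⟩ := z
  obtain ⟨z', rfl⟩ := z'
  let Φ : (powLift π).F.obj z ⟶ (powLift π).F.obj z' := ⟨f, fun i => (φ i).1, fun i => (φ i).2⟩
  have l : S.p.IsHomLift f (E.F.map Φ) := E.lift_map (b := f) Φ (Pow.isHomLift_base Φ)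
  refine ⟨⟨(isoApp κ z).inv ≫ E.F.map Φ ≫ (isoApp κ z').hom, isHomLift_id_comp
    (isHomLift_inv _ (isoApp_lies κ rfl)) (isHomLift_comp_id l (isoApp_lies κ rfl))⟩, fun i => ?_⟩
  refine inv_map_comp_aux (π i).F (isoApp κ z) (isoApp κ z') ?_
  rw [hκ, hκ]
  exact (Hom₂.τ (e i).hom).naturality Φ

theorem hom_ext_of_isProduct {z z' : S.X} {g g' : z ⟶ z'} (l : S.p.IsHomLift f g)
    (l' : S.p.IsHomLift f g') (e : ∀ i, (π i).F.map g = (π i).F.map g') : g = g' := by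
  obtain ⟨E, -, κ, -⟩ := exists_powInv h
  have k : (powLift π).F.map g = (powLift π).F.map g' :=
    Pow.Hom.ext ((IsHomLift.fac' S.p f g).trans (IsHomLift.fac' S.p f g').symm) (funext e)
  have n := (Hom₂.τ κ.hom).naturality g
  have n' := (Hom₂.τ κ.hom).naturality g'
  exact (cancel_epi (isoApp κ z).hom).1 (n.symm.trans
    ((congrArg (fun t => E.F.map t ≫ (isoApp κ z').hom) k).trans n'))

theorem exists_obj_of_isProduct (x : Fin k → S'.p.Fiber T) :
    ∃ z : S.p.Fiber T, ∀ i, Nonempty (((π i).fib rfl).obj z ≅ x i) := by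
  obtain ⟨E, e, -, -⟩ := exists_powInv h
  exact ⟨(E.fib rfl).obj ⟨⟨T, x⟩, rfl⟩, fun i => ⟨fiberIsoMk (isoApp (e i) ⟨T, x⟩)
    (isoApp_lies (e i) rfl)⟩⟩

end Product

end Stk

/-! ### The action of matrices on a 2-algebra -/

theorem rowMat_injective {n : ℕ} {r s : Fin n → ℤ} (h : rowMat r = rowMat s) : r = s :=
  congrFun h 0

/-- The rows of a basis exhibit `1ⁿ` as a product of copies of `1`. -/
theorem TOne.isProduct_rowMat {n k : ℕ} (b : Module.Basis (Fin k) ℤ (Fin n → ℤ)) :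
    IsProduct fun i => TOne.arrow (rowMat (b i)) := by
  rintro ⟨⟨m⟩⟩
  refine ⟨⟨fun {F F'} α β _ => Subsingleton.elim _ _⟩, ⟨fun {F F'} γ => ?_⟩, ⟨fun G => ?_⟩⟩
  · obtain ⟨F : Matrix (Fin n) (Fin m) ℤ⟩ := F
    obtain ⟨F' : Matrix (Fin n) (Fin m) ℤ⟩ := F'
    have e : ∀ i, rowMat (b i) * F = rowMat (b i) * F' := fun i =>
      congrArg Discrete.as (LocallyDiscrete.eq_of_hom (γ i))
    have e' : rowHom F = rowHom F' := addMonoidHom_ext_basis b fun i =>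
      rowMat_injective (by rw [← rowMat_mul, ← rowMat_mul, e])
    have e'' : F = F' := funext fun i => by
      rw [← rowHom_stdBasis F i, e', rowHom_stdBasis]
    subst e''
    exact ⟨𝟙 _, funext fun i => Subsingleton.elim _ _⟩
  · let c : Fin k → Fin m → ℤ := fun i => ((G i).as : Matrix (Fin 1) (Fin m) ℤ) (0 : Fin 1)
    let L := b.constr ℤ c
    let F : Matrix (Fin n) (Fin m) ℤ := Matrix.of fun a => L (stdBasis n a)
    have hF : rowHom F = L.toAddMonoidHom := addMonoidHom_ext_basis (stdBasis n) fun a => by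
      rw [rowHom_stdBasis]
      rfl
    refine ⟨⟨F⟩, ⟨CategoryTheory.Pi.isoMk fun i => eqToIso ?_⟩⟩
    refine congrArg Discrete.mk ?_
    change rowMat (b i) * F = (G i).as
    rw [rowMat_mul, hF]
    refine Matrix.ext fun a j => ?_
    obtain rfl : a = 0 := Subsingleton.elim _ _
    exact congrFun (b.constr_basis ℤ c i) j

namespace TwoAlgebra

variable {C : Type u} [Category.{v} C] {J : GrothendieckTopology C} {U : C}
  (A : TwoAlgebra.{max u v w₁, max v w₂} (J.over U)) {n k l : ℕ}

/-- The isomorphism between the actions of a product of matrices and of its factors. -/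
noncomputable abbrev mulIso {M : Matrix (Fin k) (Fin n) ℤ} {N : Matrix (Fin l) (Fin k) ℤ}
    {L : Matrix (Fin l) (Fin n) ℤ} (h : L = N * M) :
    A.A.map (TOne.arrow L) ≅ A.A.map (TOne.arrow M) ≫ A.A.map (TOne.arrow N) :=
  A.A.mapComp' (TOne.arrow M) (TOne.arrow N) (TOne.arrow L) (congrArg Discrete.mk h.symm)

theorem mulIso_one {M : Matrix (Fin k) (Fin n) ℤ} (h : M = M * 1) (z : (A.A.obj (TOne.pow n)).X) :
    (Stk.isoApp (A.mulIso h) z).hom ≫ (A.A.map (TOne.arrow M)).F.map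
      (Stk.isoApp (A.A.mapId (TOne.pow n)) z).hom = 𝟙 _ := by
  have e := NatTrans.congr_app (congrArg Stk.Hom₂.τ (A.A.mapComp'_id_comp_inv (TOne.arrow M))) z
  have e' : (Stk.isoApp (A.mulIso h) z).inv = (A.A.map (TOne.arrow M)).F.map
      (Stk.isoApp (A.A.mapId (TOne.pow n)) z).hom ≫ 𝟙 _ := e
  rw [Category.comp_id] at e'
  exact (congrArg (_ ≫ ·) e'.symm).trans (Iso.hom_inv_id _)

/-- The action of integral matrices on a 2-algebra. -/
noncomputable def action : MatrixAction (Y := fun n => (A.A.obj (TOne.pow n)).X)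
    fun n => (A.A.obj (TOne.pow n)).p where
  act M := ⟨(A.A.map (TOne.arrow M)).F, (A.A.map (TOne.arrow M)).w⟩
  c {n k l M N L} h z := Stk.isoApp (A.mulIso h) z
  c_lies {n k l M N L} h z := Stk.isoApp_lies (A.mulIso h) rfl
  c_nat {n k l M N L} h {z z'} f := (Stk.Hom₂.τ (A.mulIso h).hom).naturality f
  c_assoc {n k l m M N K NM KN L} h₁ h₂ h₃ h₄ z := by
    have e := A.A.mapComp'₀₁₃_hom_comp_whiskerLeft_mapComp'_hom (TOne.arrow M) (TOne.arrow N)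
      (TOne.arrow K) (TOne.arrow NM) (TOne.arrow KN) (TOne.arrow L) (congrArg Discrete.mk h₁.symm)
      (congrArg Discrete.mk h₃.symm) (congrArg Discrete.mk h₄.symm)
    exact ((NatTrans.congr_app (congrArg Stk.Hom₂.τ e) z).trans
      (congrArg _ (Category.comp_id _))).symm
  unit {n} z := Stk.isoApp (A.A.mapId (TOne.pow n)) z
  c_unit h z := A.mulIso_one h z
  exists_hom {n k} b {S T} f z z' φ := Stk.exists_hom_of_isProduct
    (A.preserves _ _ _ _ (TOne.isProduct_rowMat b)) z z' φ
  hom_ext {n k} b {S T f z z' h h'} l l' e := Stk.hom_ext_of_isProduct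
    (A.preserves _ _ _ _ (TOne.isProduct_rowMat b)) l l' e
  exists_obj {n k} b {T} x := Stk.exists_obj_of_isProduct
    (A.preserves _ _ _ _ (TOne.isProduct_rowMat b)) x

/-- The Picard stack of the values at `1` of a 2-algebra. -/
noncomputable def picard : PicardStack.{max u v w₁, max v w₂} (J.over U) where
  toStk := A.A.obj (TOne.pow 1)
  str := A.action.picardStr

end TwoAlgebra

end PicardMatrix

namespace PicardMatrix

theorem conj_inv_cancel {V : Type*} [Category* V] {a b c d : V} (i : a ≅ b) (j : c ≅ d)
    (h : a ⟶ c) : i.hom ≫ (i.inv ≫ h ≫ j.hom) ≫ j.inv = h := by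
  simp

theorem isHomLift_eqToHom_id {B : Type*} [Category* B] {X : Type*} [Category* X] {p : X ⥤ B}
    {S T : B} (e : S = T) {x : X} (h : p.obj x = S) : p.IsHomLift (eqToHom e) (𝟙 x) := by
  subst e
  exact IsHomLift.id h

namespace MatrixAction

variable {B : Type u} [Category.{v} B] {Y : ℕ → Type w} [∀ n, Category.{w'} (Y n)]
  {q : ∀ n, Y n ⥤ B} (A : MatrixAction q) {n k m : ℕ} {T T' : B}

/-- The family of the values of an object of `Y n`. -/
noncomputable def toFam (n : ℕ) : Y n ⥤ Fam A.picardStr (Fin n → ℤ) where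
  obj z := ⟨(q n).obj z, A.famAt ⟨z, rfl⟩⟩
  map {z z'} f := ⟨(q n).map f, fun r => (A.act (rowMat r)).F.map f,
    fun r => isHomLift_map_of_eq (A.act (rowMat r)).w f,
    fun h => A.σ_nat (z := ⟨z, rfl⟩) (z' := ⟨z', rfl⟩) (b := (q n).map f)
      ⟨f, IsHomLift.map (q n) f⟩ h⟩
  map_id z := Fam.hom_ext fun r => (A.act (rowMat r)).F.map_id z
  map_comp f g := Fam.hom_ext fun r => (A.act (rowMat r)).F.map_comp f g

/-- The family of the values of `M z` is the restriction along `M` of the family of the values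
of `z`. -/
noncomputable def famRow (M : Matrix (Fin k) (Fin n) ℤ) (z : Y n) :
    (Fam.comap (rowHom M)).obj ((A.toFam n).obj z) ⟶ (A.toFam k).obj ((A.act M).F.obj z) :=
  let f : FibHom (q k) (eqToHom (OverFunctor.obj_eq (A.act M) z).symm)
      (A.on M (⟨z, rfl⟩ : (q n).Fiber _)) (⟨(A.act M).F.obj z, rfl⟩ : (q k).Fiber _) :=
    ⟨𝟙 _, isHomLift_eqToHom_id _ (OverFunctor.obj_eq (A.act M) z)⟩
  { base := eqToHom (OverFunctor.obj_eq (A.act M) z).symm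
    arr r := (A.θ f (r' := r) rfl).1
    lies r := (A.θ f (r' := r) rfl).2
    compat {r s _} h := A.θ_σ f rfl rfl rfl ((congrArg (rowHom M) h).trans (map_add _ r s)) h }

theorem famRow_arr (M : Matrix (Fin k) (Fin n) ℤ) (z : Y n) (r : Fin k → ℤ) :
    (A.famRow M z).arr r = (A.μ rfl (⟨z, rfl⟩ : (q n).Fiber _)).hom.1 :=
  (congrArg ((A.μ rfl (⟨z, rfl⟩ : (q n).Fiber _)).hom.1 ≫ ·)
    ((A.act (rowMat r)).F.map_id ((A.act M).F.obj z))).trans (Category.comp_id _)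

theorem famRow_nat (M : Matrix (Fin k) (Fin n) ℤ) {z z' : Y n} (f : z ⟶ z') :
    (Fam.comap (rowHom M)).map ((A.toFam n).map f) ≫ A.famRow M z' =
      A.famRow M z ≫ (A.toFam k).map ((A.act M).F.map f) :=
  Fam.hom_ext fun r => (congrArg _ (A.famRow_arr M z' r)).trans
    ((A.μ_nat rfl (z := ⟨z, rfl⟩) (z' := ⟨z', rfl⟩) ⟨f, IsHomLift.map (q n) f⟩).trans
      (congrArg (· ≫ (A.act (rowMat r)).F.map ((A.act M).F.map f)) (A.famRow_arr M z r).symm))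

theorem μ_ptIso {M : Matrix (Fin k) (Fin n) ℤ} {r : Fin k → ℤ} {s s' : Fin n → ℤ}
    (h : s = rowHom M r) (h' : s' = rowHom M r) (e : s = s') (z : (q n).Fiber T) :
    ((A.famAt z).ptIso e).hom.1 ≫ (A.μ h' z).hom.1 = (A.μ h z).hom.1 := by
  subst e
  exact Category.id_comp _

theorem famRow_comp (M : Matrix (Fin k) (Fin n) ℤ) (N : Matrix (Fin m) (Fin k) ℤ) (z : Y n) :
    Fam.comapCongr (rowHom_mul M N) ((A.toFam n).obj z) ≫
      (Fam.comap (rowHom N)).map (A.famRow M z) ≫ A.famRow N ((A.act M).F.obj z) =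
    A.famRow (N * M) z ≫ (A.toFam m).map (A.c rfl z).hom := by
  refine Fam.hom_ext fun r => ?_
  have h : rowHom (N * M) r = rowHom M (rowHom N r) := DFunLike.congr_fun (rowHom_mul M N) r
  have e₁ := A.μ_comp (r := r) (s := rowHom N r) rfl rfl h rfl (⟨z, rfl⟩ : (q n).Fiber _)
  have e₂ := A.μ_ptIso h rfl h (⟨z, rfl⟩ : (q n).Fiber _)
  refine Eq.trans ?_ (e₁.symm.trans (congrArg (· ≫ _) (A.famRow_arr (N * M) z r).symm))
  refine Eq.trans ?_ (congrArg (· ≫ _) e₂)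
  refine Eq.trans ?_ (Category.assoc _ _ _).symm
  exact congrArg (((A.famAt ⟨z, rfl⟩).ptIso h).hom.1 ≫ ·)
    (congrArg₂ (· ≫ ·) (A.famRow_arr M z (rowHom N r)) (A.famRow_arr N _ r))

theorem famRow_one (z : Y n) :
    A.famRow 1 z ≫ (A.toFam n).map (A.unit z).hom =
      Fam.comapCongr (rowHom_one n) ((A.toFam n).obj z) := by
  refine Fam.hom_ext fun r => ?_
  have h : rowHom 1 r = r := DFunLike.congr_fun (rowHom_one n) r
  have e₁ := A.c_unit (M := rowMat r) (Matrix.mul_one _).symm z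
  have e₂ := A.μ_ptIso rfl h.symm h (⟨z, rfl⟩ : (q n).Fiber _)
  refine (congrArg (· ≫ _) ((A.famRow_arr 1 z r).trans e₂.symm)).trans ?_
  refine (Category.assoc _ _ _).trans ?_
  exact (congrArg _ e₁).trans (Category.comp_id _)

theorem isIso_famRow (M : Matrix (Fin k) (Fin n) ℤ) (z : Y n) : IsIso (A.famRow M z) := by
  have h₁ : ∀ r, IsIso ((A.famRow M z).arr r) := fun r => by
    rw [famRow_arr]
    exact (fiberIsoVal (A.μ rfl (⟨z, rfl⟩ : (q n).Fiber _))).isIso_hom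
  have h₂ : IsIso (A.famRow M z).base :=
    inferInstanceAs (IsIso (eqToHom (OverFunctor.obj_eq (A.act M) z).symm))
  exact Fam.isIso_of_arr _

/-! ### Evaluation of an action of matrices -/

/-- The presented family with the same values as `z` at the standard basis. -/
noncomputable def ev (z : Y n) : SmallFam A.picardStr n :=
  ⟨⟨(q n).obj z, fun i => A.pt ⟨z, rfl⟩ (stdBasis n i)⟩, AddMonoidHom.id _⟩

variable (hq : (q 1).IsFibered)

include hq in
/-- The presented family with the same values as `z` at the standard basis is isomorphic to the
family of all values of `z`. -/
theorem exists_evIso (z : Y n) : ∃ i : (A.ev z).fam ≅ (A.toFam n).obj z,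
    i.hom.base = 𝟙 _ ∧ i.inv.base = 𝟙 _ :=
  Fam.exists_iso (stdBasis n) hq (((A.ev z).z.fam A.picardStr).comap (AddMonoidHom.id _))
    (A.famAt ⟨z, rfl⟩) fun i => (A.ev z).z.famIso A.picardStr i

/-- The comparison between the families with the same values at the standard basis. -/
noncomputable def evIso (z : Y n) : (A.ev z).fam ≅ (A.toFam n).obj z :=
  (A.exists_evIso hq z).choose

/-- The arrow between the presented families of values defined by an arrow of `Y n`. -/
noncomputable def evMap {z z' : Y n} (f : z ⟶ z') : (A.ev z).fam ⟶ (A.ev z').fam :=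
  (A.evIso hq z).hom ≫ (A.toFam n).map f ≫ (A.evIso hq z').inv

/-- The functor sending an object of `Y n` to the family of its values. -/
noncomputable def evFunctor (n : ℕ) : Y n ⥤ SmallFam A.picardStr n where
  obj z := A.ev z
  map f := SmallFam.homMk (A.evMap hq f)
  map_id z := by
    refine Eq.trans (congrArg (fun h => (A.evIso hq z).hom ≫ h ≫ (A.evIso hq z).inv)
      ((A.toFam n).map_id z)) ?_
    rw [Category.id_comp, Iso.hom_inv_id]
    rfl
  map_comp {z z' z''} f g := by
    refine Eq.trans (congrArg (fun h => (A.evIso hq z).hom ≫ h ≫ (A.evIso hq z'').inv)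
      ((A.toFam n).map_comp f g)) ?_
    change _ = ((A.evIso hq z).hom ≫ (A.toFam n).map f ≫ (A.evIso hq z').inv) ≫
      ((A.evIso hq z').hom ≫ (A.toFam n).map g ≫ (A.evIso hq z'').inv)
    simp only [Category.assoc, Iso.inv_hom_id_assoc]

/-- The functor sending an object of `Y n` to the family of its values, over the base. -/
noncomputable def evOver (n : ℕ) : OverFunctor (q n) (SmallFam.proj A.picardStr n) where
  F := A.evFunctor hq n
  w := by
    refine CategoryTheory.Functor.ext (fun z => rfl) fun z z' f => ?_
    change (A.evIso hq z).hom.base ≫ (q n).map f ≫ (A.evIso hq z').inv.base = _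
    exact congrArg₂ (fun a b => a ≫ (q n).map f ≫ b) (A.exists_evIso hq z).choose_spec.1
      (A.exists_evIso hq z').choose_spec.2

theorem toFam_faithful : (A.toFam n).Faithful :=
  ⟨fun {z z' f g} e => by
    have h : (q n).IsHomLift ((q n).map f) g := by
      rw [show (q n).map f = (q n).map g from congrArg Fam.Hom.base e]
      exact IsHomLift.map (q n) g
    exact A.hom_ext (stdBasis n) (IsHomLift.map (q n) f) h fun i =>
      congrArg (fun h => Fam.Hom.arr h (stdBasis n i)) e⟩

include hq in
theorem toFam_full : (A.toFam n).Full :=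
  ⟨fun {z z'} h => by
    obtain ⟨f, hf⟩ := A.exists_hom (stdBasis n) h.base ⟨z, rfl⟩ ⟨z', rfl⟩
      fun i => ⟨h.arr (stdBasis n i), h.lies (stdBasis n i)⟩
    exact ⟨f.1, Fam.hom_ext_basis (stdBasis n) hq
      (@IsHomLift.eq_of_isHomLift _ _ _ _ (q n) _ _ h.base f.1 f.2).symm hf⟩⟩

include hq in
/-- Every additive family for the sum defined by the action is the family of values of an object. -/
theorem exists_toFam_iso (y : FamAt A.picardStr (Fin n → ℤ) T) :
    ∃ (z : (q n).Fiber T) (i : (A.toFam n).obj z.1 ≅ ⟨T, y⟩), i.hom.base = eqToHom z.2 := by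
  obtain ⟨⟨z, hz⟩, i⟩ := A.exists_obj (stdBasis n) fun i => y.pt (stdBasis n i)
  subst hz
  obtain ⟨h, hb, -⟩ := Fam.exists_iso (stdBasis n) hq (A.famAt ⟨z, rfl⟩) y fun j => (i j).some
  exact ⟨⟨z, rfl⟩, h, hb⟩

/-- Evaluation is an equivalence from the stack of exponent `n` to the families indexed by `ℤⁿ`:
both are determined by the values at a basis. -/
theorem evOver_isFibEquiv : IsFibEquiv (A.evOver hq n) where
  full := ⟨fun {z z'} h => by
    obtain ⟨f, hf⟩ := (A.toFam_full hq (n := n)).map_surjective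
      ((A.evIso hq z).inv ≫ h ≫ (A.evIso hq z').hom)
    refine ⟨f, ?_⟩
    change (A.evIso hq z).hom ≫ (A.toFam n).map f ≫ (A.evIso hq z').inv = h
    rw [hf]
    exact conj_inv_cancel (A.evIso hq z) (A.evIso hq z') h⟩
  faithful := ⟨fun {z z' f g} e => (A.toFam_faithful (n := n)).map_injective (by
    have e' : (A.evIso hq z).hom ≫ (A.toFam n).map f ≫ (A.evIso hq z').inv =
      (A.evIso hq z).hom ≫ (A.toFam n).map g ≫ (A.evIso hq z').inv := e
    rwa [cancel_epi, cancel_mono] at e')⟩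
  surj {T} c := by
    obtain ⟨c, rfl⟩ := c
    obtain ⟨z, i, hi⟩ := A.exists_toFam_iso hq c.fam.fam
    refine ⟨z, SmallFam.isoMk (A.evIso hq z.1 ≪≫ i), IsHomLift.of_fac' _ _ _ z.2 rfl ?_⟩
    exact ((congrArg₂ (· ≫ ·) (A.exists_evIso hq z.1).choose_spec.1 hi).trans
      (Category.id_comp _)).trans ((Category.comp_id _).symm.trans (congrArg _ (Category.id_comp _).symm))

end MatrixAction

end PicardMatrix

namespace PicardMatrix

/-! ### The arrow from a 2-algebra to the families of its Picard stack -/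

theorem conj_iso_naturality {V W : Type*} [Category* V] [Category* W] (H : V ⥤ W) {e x e' x' : V}
    (i : e ≅ x) (i' : e' ≅ x') {b y b' y' : W} (j : b ≅ y) (j' : b' ≅ y') (ρ : H.obj x ≅ y)
    (ρ' : H.obj x' ≅ y') {g : x ⟶ x'} {g' : y ⟶ y'} (h : H.map g ≫ ρ'.hom = ρ.hom ≫ g') :
    (j.hom ≫ g' ≫ j'.inv) ≫ (j' ≪≫ ρ'.symm ≪≫ (H.mapIso i').symm).hom =
      (j ≪≫ ρ.symm ≪≫ (H.mapIso i).symm).hom ≫ H.map (i.hom ≫ g ≫ i'.inv) := by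
  have h' : g' ≫ ρ'.inv = ρ.inv ≫ H.map g := by
    rw [Iso.comp_inv_eq, Category.assoc, h, Iso.inv_hom_id_assoc]
  simp [reassoc_of% h']

theorem conj_iso_comp {V V' W : Type*} [Category* V] [Category* V'] [Category* W] (H : V ⥤ W)
    (H₁ : V ⥤ V') (H₂ : V' ⥤ W) {e x : V} (i : e ≅ x) {e' y : V'} (i' : e' ≅ y) {d t b s : W}
    (j : d ≅ t) (k : b ≅ s) (ρ₁ : H₁.obj x ≅ y) (ρ₂ : H₂.obj y ≅ t) (ρ : H.obj x ≅ s)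
    {c : s ⟶ t} (γ : H.obj e ⟶ H₂.obj (H₁.obj e)) (γ' : H.obj x ⟶ H₂.obj (H₁.obj x))
    (hγ : H.map i.hom ≫ γ' = γ ≫ H₂.map (H₁.map i.hom))
    (h : γ' ≫ H₂.map ρ₁.hom ≫ ρ₂.hom = ρ.hom ≫ c) :
    (k ≪≫ ρ.symm ≪≫ (H.mapIso i).symm).hom ≫ γ =
      (k.hom ≫ c ≫ j.inv) ≫ (j ≪≫ ρ₂.symm ≪≫ (H₂.mapIso i').symm).hom ≫
        H₂.map (i' ≪≫ ρ₁.symm ≪≫ (H₁.mapIso i).symm).hom := by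
  have h' : c ≫ ρ₂.inv ≫ H₂.map ρ₁.inv = ρ.inv ≫ γ' := by
    rw [← cancel_epi ρ.hom, ← reassoc_of% h]
    simp [← Functor.map_comp]
  have hγ' : H.map i.inv ≫ γ = γ' ≫ H₂.map (H₁.map i.inv) := by
    rw [← cancel_epi (H.map i.hom), reassoc_of% hγ]
    simp [← Functor.map_comp, ← Functor.map_comp_assoc]
  simp [reassoc_of% h', hγ']

theorem conj_iso_unit {V : Type*} [Category* V] (H : V ⥤ V) {e x : V} (i : e ≅ x) {b s : V}
    (k : b ≅ s) (ρ : H.obj x ≅ s) {c : s ⟶ x} (γ : H.obj e ⟶ e) (γ' : H.obj x ⟶ x)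
    (hγ : H.map i.hom ≫ γ' = γ ≫ i.hom) (h : ρ.hom ≫ c = γ') :
    (k ≪≫ ρ.symm ≪≫ (H.mapIso i).symm).hom ≫ γ = k.hom ≫ c ≫ i.inv := by
  have hγ' : H.map i.inv ≫ γ = γ' ≫ i.inv := by
    rw [Iso.eq_comp_inv, Category.assoc, ← hγ, ← Functor.map_comp_assoc]
    simp
  simp [hγ', ← h]

theorem Fam.comapCongr_naturality {B : Type u} [Category.{v} B] {X : Type w} [Category.{w'} X]
    {p : X ⥤ B} {P : PicardStr p} {G H : Type} [AddCommGroup G] [AddCommGroup H] {f f' : G →+ H}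
    (e : f = f') {x y : Fam P H} (h : x ⟶ y) :
    (comap f).map h ≫ comapCongr e y = comapCongr e x ≫ (comap f').map h :=
  Fam.hom_ext fun r => Fam.arr_ptIso h (DFunLike.congr_fun e r)

namespace MatrixAction

variable {B : Type u} [Category.{v} B] {Y : ℕ → Type w} [∀ n, Category.{w'} (Y n)]
  {q : ∀ n, Y n ⥤ B} (A : MatrixAction q) {n k m : ℕ} (hq : (q 1).IsFibered)

/-- The presented family of `M z` is the restriction along `M` of the one of `z`. -/
noncomputable def evRow (M : Matrix (Fin k) (Fin n) ℤ) (z : Y n) :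
    (A.ev ((A.act M).F.obj z)).fam ≅ (Fam.comap (rowHom M)).obj (A.ev z).fam :=
  A.evIso hq ((A.act M).F.obj z) ≪≫ (@asIso _ _ _ _ (A.famRow M z) (A.isIso_famRow M z)).symm ≪≫
    ((Fam.comap (rowHom M)).mapIso (A.evIso hq z)).symm

theorem evRow_nat (M : Matrix (Fin k) (Fin n) ℤ) {z z' : Y n} (f : z ⟶ z') :
    A.evMap hq ((A.act M).F.map f) ≫ (A.evRow hq M z').hom =
      (A.evRow hq M z).hom ≫ (Fam.comap (rowHom M)).map (A.evMap hq f) :=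
  conj_iso_naturality (Fam.comap (rowHom M)) (A.evIso hq z) (A.evIso hq z') (A.evIso hq _)
    (A.evIso hq _) (@asIso _ _ _ _ (A.famRow M z) (A.isIso_famRow M z))
    (@asIso _ _ _ _ (A.famRow M z') (A.isIso_famRow M z')) (A.famRow_nat M f)

theorem evRow_comp (M : Matrix (Fin k) (Fin n) ℤ) (N : Matrix (Fin m) (Fin k) ℤ) (z : Y n) :
    (A.evRow hq (N * M) z).hom ≫ Fam.comapCongr (rowHom_mul M N) (A.ev z).fam =
      A.evMap hq (A.c rfl z).hom ≫ (A.evRow hq N ((A.act M).F.obj z)).hom ≫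
        (Fam.comap (rowHom N)).map (A.evRow hq M z).hom :=
  conj_iso_comp (Fam.comap (rowHom (N * M))) (Fam.comap (rowHom M)) (Fam.comap (rowHom N))
    (A.evIso hq z) (A.evIso hq _) (A.evIso hq _) (A.evIso hq _)
    (@asIso _ _ _ _ (A.famRow M z) (A.isIso_famRow M z))
    (@asIso _ _ _ _ (A.famRow N _) (A.isIso_famRow N _))
    (@asIso _ _ _ _ (A.famRow (N * M) z) (A.isIso_famRow (N * M) z)) _ _
    (Fam.comapCongr_naturality (rowHom_mul M N) (A.evIso hq z).hom) (A.famRow_comp M N z)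

theorem evRow_one (z : Y n) :
    (A.evRow hq 1 z).hom ≫ Fam.comapCongr (rowHom_one n) (A.ev z).fam =
      A.evMap hq (A.unit z).hom :=
  conj_iso_unit (Fam.comap (rowHom 1)) (A.evIso hq z) (A.evIso hq _)
    (@asIso _ _ _ _ (A.famRow 1 z) (A.isIso_famRow 1 z)) _ _
    (Fam.comapCongr_naturality (rowHom_one n) (A.evIso hq z).hom) (A.famRow_one z)

theorem evRow_base (M : Matrix (Fin k) (Fin n) ℤ) (z : Y n) :
    (A.evRow hq M z).hom.base = eqToHom (OverFunctor.obj_eq (A.act M) z) := by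
  have h : (inv (I := A.isIso_famRow M z) (A.famRow M z)).base =
      eqToHom (OverFunctor.obj_eq (A.act M) z) := by
    have e : eqToHom (OverFunctor.obj_eq (A.act M) z).symm ≫ _ = _ :=
      congrArg Fam.Hom.base (@IsIso.hom_inv_id _ _ _ _ (A.famRow M z) (A.isIso_famRow M z))
    exact (eqToHom_comp_iff _ _ _).1 e |>.trans (Category.comp_id _)
  exact (congrArg₂ (· ≫ ·) (A.exists_evIso hq _).choose_spec.1 (congrArg₂ (· ≫ ·) h
    (A.exists_evIso hq z).choose_spec.2)).trans ((Category.id_comp _).trans (Category.comp_id _))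

end MatrixAction

namespace TwoAlgebra

variable {C : Type u} [Category.{v} C] {J : GrothendieckTopology C} {U : C}
  (X : TwoAlgebra.{max u v w₁, max v w₂} (J.over U))

theorem c_app {a b c : TOne} (M : a ⟶ b) (N : b ⟶ c) (z : (X.A.obj a).X) :
    (X.action.c (M := M.as) (N := N.as) rfl z).hom =
      (Stk.Hom₂.τ (X.A.mapComp M N).hom).app z :=
  congrArg (fun i => (Stk.Hom₂.τ (Iso.hom i)).app z) (X.A.mapComp'_eq_mapComp M N)

/-- The arrow from a 2-algebra to the families of its Picard stack of values at `1`. -/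
noncomputable def toFamilies :
    (⟨U, X⟩ : Alg.{w₁, w₂} J) ⟶ (⟨U, X.picard⟩ : Picard.{w₁, w₂} J).toAlg :=
  Alg.homMk (A := ⟨U, X⟩) (A' := (⟨U, X.picard⟩ : Picard.{w₁, w₂} J).toAlg) (𝟙 U)
    (fun t =>
      { F := X.action.evFunctor X.picard.isStack.fibered t.as.exp
        w := (X.action.evOver X.picard.isStack.fibered t.as.exp).w.trans
          (congrArg (_ ⋙ ·) (Over.mapId_eq U).symm)
        cart _ _ := SmallFam.cart X.picard.isStack (IsHomLift.map _ _) })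
    (fun M =>
      { app z := (X.action.evRow X.picard.isStack.fibered M.as z).hom
        naturality _ _ f := X.action.evRow_nat X.picard.isStack.fibered M.as f })
    (fun M z => Picard.isHomLift_of_base (P := ⟨U, X.picard⟩) _ _
      (X.action.evRow_base X.picard.isStack.fibered M.as z))
    (fun M z => (SmallFam.isoMk (c := X.action.ev _)
      (c' := (SmallFam.comap (rowHom M.as)).obj (X.action.ev z))
      (X.action.evRow X.picard.isStack.fibered M.as z)).isIso_hom)
    (fun _ z => X.action.evRow_one X.picard.isStack.fibered z)
    (fun M N z => (X.action.evRow_comp X.picard.isStack.fibered M.as N.as z).trans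
      (congrArg (fun f => X.action.evMap X.picard.isStack.fibered f ≫
        (X.action.evRow X.picard.isStack.fibered N.as _).hom ≫ (Fam.comap (rowHom N.as)).map
          (X.action.evRow X.picard.isStack.fibered M.as z).hom) (X.c_app M N z)))

end TwoAlgebra

end PicardMatrix

namespace PicardMatrix

/-! ### Arrows of 2-algebras which are equivalences -/

theorem inverse_nat_naturality {V W : Type*} [Category* V] [Category* W] (L : V ⥤ W)
    {m m' s s' : V} {ν : m ⟶ s} {ν' : m' ⟶ s'} {μ : m ⟶ m'} {σ : s ⟶ s'} {d d' r r' : W}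
    {c : L.obj m ⟶ d} {c' : L.obj m' ⟶ d'} {a : d ⟶ r} {a' : d' ⟶ r'} {f : d ⟶ d'} {g : r ⟶ r'}
    (n : L.obj s ≅ r) (n' : L.obj s' ≅ r') (hν : L.map ν = c ≫ a ≫ n.inv)
    (hν' : L.map ν' = c' ≫ a' ≫ n'.inv) (k₁ : L.map μ ≫ c' = c ≫ f) (k₂ : f ≫ a' = a ≫ g)
    (k₃ : L.map σ ≫ n'.hom = n.hom ≫ g) : L.map (μ ≫ ν') = L.map (ν ≫ σ) := by
  rw [L.map_comp, L.map_comp, hν, hν', reassoc_of% k₁, reassoc_of% k₂, ← cancel_mono n'.hom]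
  simp [k₃]

theorem inverse_nat_id {V W : Type*} [Category* V] [Category* W] (L : V ⥤ W) {m s v : V}
    {ν : m ⟶ s} {ι : s ⟶ v} {μ : m ⟶ v} {d w r : W} {c : L.obj m ⟶ d} {a : d ⟶ r}
    (c' : L.obj v ≅ w) {i : d ⟶ w} {i' : r ⟶ L.obj v} (n : L.obj s ≅ r)
    (hν : L.map ν = c ≫ a ≫ n.inv) (k₁ : L.map μ ≫ c'.hom = c ≫ i) (k₂ : a ≫ i' = i ≫ c'.inv)
    (k₃ : n.hom ≫ i' = L.map ι) : L.map (ν ≫ ι) = L.map μ := by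
  rw [L.map_comp, hν, ← k₃, ← cancel_mono c'.hom, k₁]
  simp [k₂]

theorem inverse_nat_comp {V W' W : Type*} [Category* V] [Category* W'] [Category* W] (L : V ⥤ W)
    (T : W' ⥤ W) {m m' t s s' : V} {ν : m ⟶ s} {ι : s ⟶ s'} {μ : m ⟶ m'} {ν' : m' ⟶ t}
    {σ : t ⟶ s'} {p q r l : W'} (b : p ≅ q) {a : q ⟶ r} (n : l ≅ r) {τ : p ⟶ l}
    (hτ : τ = b.hom ≫ a ≫ n.inv) {d f : W} {c : L.obj m ⟶ d} {c' : L.obj m' ⟶ T.obj q}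
    {i : d ⟶ T.obj q} {a₁ : d ⟶ f} {i' : f ⟶ T.obj r} (n₁ : L.obj s ≅ f) (n₂ : L.obj t ≅ T.obj p)
    (n₃ : L.obj s' ≅ T.obj l) (hν : L.map ν = c ≫ a₁ ≫ n₁.inv)
    (hν' : L.map ν' = c' ≫ T.map b.inv ≫ n₂.inv) (k₁ : L.map μ ≫ c' = c ≫ i)
    (k₂ : a₁ ≫ i' = i ≫ T.map a) (k₃ : L.map σ ≫ n₃.hom = n₂.hom ≫ T.map τ)
    (k₄ : n₁.hom ≫ i' = L.map ι ≫ n₃.hom ≫ T.map n.hom) :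
    L.map (ν ≫ ι) = L.map (μ ≫ ν' ≫ σ) := by
  rw [L.map_comp, L.map_comp, L.map_comp, hν, hν', ← cancel_mono n₃.hom,
    ← cancel_mono (T.map n.hom)]
  simp only [Category.assoc]
  rw [reassoc_of% k₁]
  rw [← k₄, reassoc_of% k₃, hτ, Iso.inv_hom_id_assoc, k₂]
  simp [← Functor.map_comp]


theorem inverse_nat_counit {V W : Type*} [Category* V] [Category* W] (L : V ⥤ W) {m s : V}
    {ν : m ⟶ s} {d r : W} {c : L.obj m ⟶ d} {k : d ⟶ r} {k' : r ⟶ d} (n : L.obj s ≅ r)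
    (hν : L.map ν = c ≫ k ≫ n.inv) (hk : k ≫ k' = 𝟙 d) : c ≫ 𝟙 d = (L.map ν ≫ n.hom) ≫ k' := by
  rw [hν]
  simp [hk]

theorem inverse_nat_unit {V W : Type*} [Category* V] [Category* W] (L : V ⥤ W) {a b s v : V}
    {m : a ⟶ v} {μ : a ⟶ b} {ν : b ⟶ s} {σ : s ⟶ v} {c e : W} {η : L.obj a ⟶ L.obj v}
    {η' : L.obj b ⟶ c} {k : c ⟶ e} {k' : e ⟶ c} (n : L.obj v ≅ c) (n' : L.obj s ≅ e)
    (hm : L.map m = η) (hν : L.map ν = η' ≫ k ≫ n'.inv) (h₁ : L.map μ ≫ η' = η ≫ n.hom)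
    (h₂ : L.map σ ≫ n.hom = n'.hom ≫ k') (hk : k ≫ k' = 𝟙 c) :
    L.map (m ≫ 𝟙 v) = L.map ((μ ≫ ν) ≫ σ) := by
  rw [← cancel_mono n.hom, L.map_comp (μ ≫ ν), L.map_comp μ, hν, Category.comp_id, hm]
  simp only [Category.assoc]
  rw [reassoc_of% h₁, h₂]
  simp [hk, ← h₁]

theorem map_comp_eq_map_comp {V W : Type*} [Category* V] [Category* W] (H : V ⥤ W) {a b b' c : V}
    {f : a ⟶ b} {g : b ⟶ c} {f' : a ⟶ b'} {g' : b' ⟶ c} (h : f ≫ g = f' ≫ g') :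
    H.map f ≫ H.map g = H.map f' ≫ H.map g' := by
  rw [← H.map_comp, h, H.map_comp]

theorem IsFibEquiv.inverse_cart {B X E : Type*} [Category* B] [Category* X] [Category* E]
    {p : X ⥤ B} {e : E ⥤ B} {L : OverFunctor e p} (h : IsFibEquiv L) {M : X ⥤ E}
    (η : M ⋙ L.F ≅ 𝟭 X) (hη : ∀ x, p.IsHomLift (𝟙 (p.obj x)) (η.hom.app x)) {x y : X} {φ : x ⟶ y}
    (hφ : p.IsStronglyCartesian (p.map φ) φ) : e.IsStronglyCartesian (p.map φ) (M.map φ) := by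
  refine h.cart_of_map ?_
  have k : L.F.map (M.map φ) = (η.app x).hom ≫ φ ≫ (η.app y).inv := by
    rw [← Category.assoc, Iso.eq_comp_inv]
    exact η.hom.naturality φ
  have h₁ : p.IsHomLift (𝟙 (p.obj x)) (η.app x).hom := hη x
  have h₂ : p.IsHomLift (𝟙 (p.obj y)) (η.app y).symm.hom := isHomLift_inv (η.app y) (hη y)
  rw [k]
  exact isStronglyCartesian_comp (Category.id_comp _)
    (Functor.IsStronglyCartesian.of_iso p (𝟙 (p.obj x)) (η.app x))
    (isStronglyCartesian_comp (Category.comp_id _) hφ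
      (Functor.IsStronglyCartesian.of_iso p (𝟙 (p.obj y)) (η.app y).symm))

/-- A quasi-inverse over the base of an equivalence over the base, given with its counit, has a unit
satisfying one triangle identity. -/
theorem IsFibEquiv.exists_unitIso {B X E : Type*} [Category* B] [Category* X] [Category* E]
    {p : X ⥤ B} {e : E ⥤ B} {L : OverFunctor e p} (h : IsFibEquiv L) {M : X ⥤ E}
    (η : M ⋙ L.F ≅ 𝟭 X) (hη : IsVertical p η.hom) :
    ∃ κ : L.F ⋙ M ≅ 𝟭 E, IsVertical e κ.hom ∧
      ∀ z, L.F.map (κ.hom.app z) = η.hom.app (L.F.obj z) := by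
  have := h.full
  have := h.faithful
  let κ : L.F ⋙ M ≅ 𝟭 E := NatIso.ofComponents (fun z => L.F.preimageIso (η.app (L.F.obj z)))
    fun {z z'} f => h.map_inj (by
      refine (L.F.map_comp _ _).trans (Eq.trans ?_ (L.F.map_comp _ _).symm)
      exact (congrArg (_ ≫ ·) (L.F.map_preimage _)).trans
        ((η.hom.naturality (L.F.map f)).trans (congrArg (· ≫ _) (L.F.map_preimage _)).symm))
  have hκ : ∀ z, L.F.map (κ.hom.app z) = η.hom.app (L.F.obj z) := fun z => L.F.map_preimage _
  refine ⟨κ, fun z => ?_, hκ⟩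
  have l := hη (L.F.obj z)
  rw [← hκ, L.isHomLift_iff] at l
  exact isHomLift_congr _ l rfl

namespace Alg

variable {C : Type u} [Category.{v} C] {J : GrothendieckTopology C} {U : C}
  {X X' : TwoAlgebra.{max u v w₁, max v w₂} (J.over U)}

/-- The compatibility of an arrow of 2-algebras with a matrix, at an object. -/
noncomputable abbrev natIso {A A' : Alg.{w₁, w₂} J} (α : A ⟶ A') {a b : TOne} (M : a ⟶ b)
    (z : (A.alg.A.obj a).X) :
    (comp α b).obj ((A.alg.A.map M).F.obj z) ≅ (A'.alg.A.map M).F.obj ((comp α a).obj z) :=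
  asIso ((nat α M).app z)


/-- An arrow of 2-algebras over the identity is an equivalence as soon as its components are
equivalences of stacks. The quasi-inverses of the components, with the transposed coherence
isomorphisms, form the inverse. -/
theorem exists_equivalence (α : (⟨U, X⟩ : Alg.{w₁, w₂} J) ⟶ ⟨U, X'⟩) (hα : α.base = 𝟙 U)
    (w : ∀ t, comp α t ⋙ (X'.A.obj t).p = (X.A.obj t).p)
    (h : ∀ t, IsFibEquiv (⟨comp α t, w t⟩ : OverFunctor (X.A.obj t).p (X'.A.obj t).p)) :
    ∃ e : (⟨U, X⟩ : Alg.{w₁, w₂} J) ≌ ⟨U, X'⟩, e.hom = α := by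
  choose M η hη hη' using fun t => (h t).exists_inverse
  choose ν hν using fun (a b : TOne) (N : a ⟶ b) (z : (X'.A.obj a).X) =>
    (h b).exists_map (x := (M b).F.obj ((X'.A.map N).F.obj z))
      (y := (X.A.map N).F.obj ((M a).F.obj z)) ((η b).hom.app ((X'.A.map N).F.obj z) ≫
        (X'.A.map N).F.map ((η a).inv.app z) ≫ (natIso α N ((M a).F.obj z)).inv)
  have lν : ∀ (a b : TOne) (N : a ⟶ b) (z : (X'.A.obj a).X),
      (X.A.obj b).p.IsHomLift (𝟙 ((X'.A.obj b).p.obj ((X'.A.map N).F.obj z))) (ν a b N z) :=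
    fun a b N z => by
      rw [← (⟨comp α b, w b⟩ : OverFunctor (X.A.obj b).p (X'.A.obj b).p).isHomLift_iff, hν]
      refine isHomLift_id_comp (hη' b _) (isHomLift_id_comp ((X'.A.map N).lift_id
        ((X'.A.map N).obj_eq z).symm _ (isHomLift_inv ((η a).app z) (hη' a z)))
        (isHomLift_inv (natIso α N _) (isHomLift_congr _ (nat_vert α N _) ?_)))
      exact (OverFunctor.obj_eq ⟨comp α b, w b⟩ _).trans (((X.A.map N).obj_eq _).trans
        ((OverFunctor.obj_eq (M a) z).trans ((X'.A.map N).obj_eq z).symm))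
  have iν : ∀ (a b : TOne) (N : a ⟶ b) (z : (X'.A.obj a).X), IsIso (ν a b N z) :=
    fun a b N z => by
      have := (h b).full
      have := (h b).faithful
      have k : IsIso ((comp α b).map (ν a b N z)) := by
        rw [hν]
        infer_instance
      exact isIso_of_reflects_iso _ (comp α b)
  let β : (⟨U, X'⟩ : Alg.{w₁, w₂} J) ⟶ ⟨U, X⟩ :=
    homMk (A := ⟨U, X'⟩) (A' := ⟨U, X⟩) (𝟙 U)
      (fun t =>
        { F := (M t).F
          w := (M t).w.trans (congrArg (_ ⋙ ·) (Over.mapId_eq U).symm)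
          cart φ hφ := isStronglyCartesian_of_isHomLift ((h t).inverse_cart (η t) (hη' t) hφ)
            (IsHomLift.map _ _) })
      (fun {a b} N =>
        { app z := ν a b N z
          naturality z z' f := (h b).map_inj (inverse_nat_naturality (comp α b)
            (natIso α N ((M a).F.obj z)) (natIso α N ((M a).F.obj z')) (hν a b N z) (hν a b N z')
            ((η b).hom.naturality ((X'.A.map N).F.map f))
            (map_comp_eq_map_comp (X'.A.map N).F ((η a).inv.naturality f))
            ((nat α N).naturality ((M a).F.map f))) })
      (fun {a b} N z => isHomLift_congr _ (lν a b N z) rfl)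
      (fun {a b} N z => iν a b N z)
      (fun a z => (h a).map_inj (inverse_nat_id (comp α a) ((η a).app z)
        (natIso α (𝟙 a) ((M a).F.obj z)) (hν a a (𝟙 a) z)
          ((η a).hom.naturality ((Stk.Hom₂.τ (X'.A.mapId a).hom).app z))
          ((Stk.Hom₂.τ (X'.A.mapId a).hom).naturality ((η a).inv.app z))
          (nat_id α a ((M a).F.obj z))))
      (fun {a b c} N K z => (h c).map_inj (inverse_nat_comp (comp α c) (X'.A.map K).F
        ((η b).app ((X'.A.map N).F.obj z)) (natIso α N ((M a).F.obj z)) (hν a b N z)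
        (natIso α (N ≫ K) ((M a).F.obj z)) (natIso α K _) (natIso α K _)
        (hν a c (N ≫ K) z) (hν b c K _)
        ((η c).hom.naturality ((Stk.Hom₂.τ (X'.A.mapComp N K).hom).app z))
        ((Stk.Hom₂.τ (X'.A.mapComp N K).hom).naturality ((η a).inv.app z))
        ((nat α K).naturality (ν a b N z))
        (nat_comp α N K ((M a).F.obj z))))
  let κ : β ≫ α ≅ 𝟙 _ := modIso ((Category.id_comp _).trans hα) η hη fun {a b} N z => by
    refine Eq.trans ?_ (congrArg (· ≫ _) (nat_comp_app β α N z)).symm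
    refine (congrArg (_ ≫ ·) (nat_id_app (⟨U, X'⟩ : Alg.{w₁, w₂} J) N z)).trans ?_
    exact inverse_nat_counit (comp α b) (natIso α N ((M a).F.obj z)) (hν a b N z)
      ((X'.A.map N).F.mapIso ((η a).app z)).inv_hom_id
  choose m hm hm' using fun t => (h t).exists_unitIso (η t) (hη t)
  let υ : α ≫ β ≅ 𝟙 _ := modIso ((Category.comp_id _).trans hα) m hm fun {a b} N z => by
    refine Eq.trans ?_ (congrArg (· ≫ _) (nat_comp_app α β N z)).symm
    refine (congrArg (_ ≫ ·) (nat_id_app (⟨U, X⟩ : Alg.{w₁, w₂} J) N z)).trans ?_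
    exact (h b).map_inj (inverse_nat_unit (comp α b) (natIso α N z)
      (natIso α N ((M a).F.obj ((comp α a).obj z))) (hm' b _) (hν a b N _)
      ((η b).hom.naturality _)
      (((nat α N).naturality ((m a).hom.app z)).trans (congrArg
        (fun f => (natIso α N _).hom ≫ (X'.A.map N).F.map f) (hm' a z)))
      ((X'.A.map N).F.mapIso ((η a).app ((comp α a).obj z))).inv_hom_id)
  exact ⟨Bicategory.Equivalence.mkOfAdjointifyCounit υ.symm κ, rfl⟩

end Alg

end PicardMatrix

namespace PicardMatrix

/-! ### Every 2-algebra comes from a Picard stack -/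

/-- The 2-algebra of families of a Picard stack. -/
noncomputable abbrev PicardStack.famAlgebra {C : Type u} [Category.{v} C]
    {J : GrothendieckTopology C} {U : C} (P : PicardStack.{max u v w₁, max v w₂} (J.over U)) :
    TwoAlgebra.{max u v w₁, max v w₂} (J.over U) :=
  ⟨P.famPseudofunctor, P.preserves_famPseudofunctor⟩

/-- Every 2-algebra is equivalent over its base to the algebra of families of its Picard stack of
values at `1`. -/
theorem Alg.exists_toAlg {C : Type u} [Category.{v} C] {J : GrothendieckTopology C}
    (y : Alg.{w₁, w₂} J) : ∃ (x : Picard.{w₁, w₂} J) (h : Over2.base x.toAlg = Over2.base y)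
      (e : x.toAlg ≌ y), Over2.proj e.hom = eqToHom h := by
  obtain ⟨U, X⟩ := y
  have hq := X.picard.isStack.fibered
  obtain ⟨e, he⟩ := Alg.exists_equivalence (X' := X.picard.famAlgebra) X.toFamilies rfl
    (fun t => (X.action.evOver hq t.as.exp).w) fun t => X.action.evOver_isFibEquiv hq
  refine ⟨⟨U, X.picard⟩, rfl, Bicategory.Equivalence.mkOfAdjointifyCounit e.counit.symm e.unit.symm, ?_⟩
  have k := Over2.proj_hom_inv e
  have k' : Over2.proj e.hom = 𝟙 U := congrArg Over2.proj he
  exact (Category.id_comp _).symm.trans ((congrArg (· ≫ _) k'.symm).trans k)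

theorem Picard.isLocalEquiv_toAlgPseudofunctor {C : Type u} [Category.{v} C]
    {J : GrothendieckTopology C} :
    IsLocalEquiv (Picard.toAlgPseudofunctor (J := J) : Picard.{w₁, w₂} J ⥤ᵖ Alg.{w₁, w₂} J) where
  full m := Picard.exists_toAlgMap₂ m
  inj h := Picard.toAlgMap₂_injective h
  surj α := ⟨Picard.ofAlg α, ⟨Picard.toAlgMapOfAlg α⟩⟩

/-! ### Matrices act by linear combinations -/

namespace OverFunctor

variable {B : Type u} [Category.{v} B] {X : Type w} [Category.{w'} X] {p : X ⥤ B}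
  {E : Type*} [Category* E] {e : E ⥤ B} {E' : Type*} [Category* E'] {e' : E' ⥤ B}

theorem Isom.symm {L L' : OverFunctor e p} (h : L.Isom L') : L'.Isom L := by
  obtain ⟨i, hi⟩ := h
  refine ⟨i.symm, fun z => isHomLift_congr _ (isHomLift_inv (i.app z) (hi z)) ?_⟩
  exact (L'.obj_eq z).trans (L.obj_eq z).symm |>.trans ((L.obj_eq z).trans (L'.obj_eq z).symm)

theorem Isom.comp_left (K : OverFunctor e' e) {L L' : OverFunctor e p} (h : L.Isom L') :
    (K.comp L).Isom (K.comp L') := by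
  obtain ⟨i, hi⟩ := h
  exact ⟨Functor.isoWhiskerLeft K.F i, fun z => hi (K.F.obj z)⟩

theorem comp_add (P : Law p) (K : OverFunctor e' e) (L L' : OverFunctor e p) :
    K.comp (L.add P L') = (K.comp L).add P (K.comp L') := by
  obtain ⟨F, rfl⟩ := K
  rfl

end OverFunctor

namespace SmallFam

variable {B : Type u} [Category.{v} B] {X : Type w} [Category.{w'} X] {p : X ⥤ B}
  (P : PicardStr p) {n : ℕ}

/-- Evaluation at an element of the indexing group. -/
noncomputable def evalAt (r : Fin n → ℤ) : OverFunctor (proj P n) p where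
  F :=
    { obj c := (c.fam.fam.pt r).1
      map h := h.arr r }
  w := by
    refine CategoryTheory.Functor.ext (fun c => (c.fam.fam.pt r).2) fun c c' h => ?_
    have := h.lies r
    exact IsHomLift.fac' p h.base (h.arr r)

theorem evalAt_add {r s t : Fin n → ℤ} (h : t = r + s) :
    ((evalAt P r).add P.toLaw (evalAt P s)).Isom (evalAt P t) :=
  OverFunctor.Isom.symm ⟨NatIso.ofComponents (fun c => fiberIsoVal (c.fam.fam.σ h))
    fun f => f.compat h, fun c => isHomLift_congr _ (c.fam.fam.σ h).hom.2 rfl⟩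

/-- Evaluation at `r` of the family with given values at the standard basis is a linear combination
with coefficients `r`: the vectors for which this holds contain the basis and form a subgroup. -/
theorem isLinComb_evalAt (E : OverFunctor (Pow.proj p n) (proj P n))
    (h : (E.comp (eval P (stdBasis n))).F ≅ 𝟭 _) (h' : IsVertical (Pow.proj p n) h.hom)
    (r : Fin n → ℤ) : IsLinComb P.toLaw r (E.comp (evalAt P r)) := by
  have a : ∀ {r s t : Fin n → ℤ}, t = r + s →
      ((E.comp (evalAt P r)).add P.toLaw (E.comp (evalAt P s))).Isom (E.comp (evalAt P t)) :=
    fun e => E.comp_add P.toLaw (evalAt P _) (evalAt P _) ▸ (evalAt_add P e).comp_left E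
  have h₀ : IsLinComb P.toLaw 0 (E.comp (evalAt P 0)) := IsLinComb.zero (a (add_zero 0).symm)
  let H : AddSubgroup (Fin n → ℤ) :=
    { carrier := {r | IsLinComb P.toLaw r (E.comp (evalAt P r))}
      zero_mem' := h₀
      add_mem' := fun x y => IsLinComb.iso (a rfl) (IsLinComb.add x y)
      neg_mem' := fun {r} x => IsLinComb.neg x (IsLinComb.iso (a (add_neg_cancel r).symm).symm h₀) }
  have hH : Submodule.span ℤ (Set.range (stdBasis n)) ≤ AddSubgroup.toIntSubmodule H := by
    rw [Submodule.span_le]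
    rintro _ ⟨j, rfl⟩
    have k : IsLinComb P.toLaw (stdBasis n j) (Pow.pr p n j) := by
      rw [Pi.basisFun_apply]
      exact IsLinComb.pr j
    refine IsLinComb.iso (OverFunctor.Isom.symm ?_) k
    exact ⟨Functor.isoWhiskerRight h (Pow.pr p n j).F, fun z =>
      isHomLift_congr _ ((Pow.pr p n j).isHomLift_iff.2 (h' z)) rfl⟩
  exact hH ((stdBasis n).mem_span r)

end SmallFam

/-- The algebra of families is, up to equivalence, `n ↦ Pⁿ` with matrices acting by linear
combinations. -/
theorem PicardStack.isMatrixAlgebra {C : Type u} [Category.{v} C] {J : GrothendieckTopology C}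
    {U : C} (P : PicardStack.{max u v w₁, max v w₂} (J.over U)) :
    IsMatrixAlgebra P P.famAlgebra := by
  have hp := P.isStack.fibered
  have he : ∀ n, IsFibEquiv (SmallFam.eval P.str (stdBasis n)) := fun n =>
    SmallFam.eval_isFibEquiv hp (stdBasis n)
  choose E η hη hη' using fun n => (he n).exists_inverse
  choose κ hκ hκ' using fun n => (he n).exists_unitIso (η n) (hη n)
  refine ⟨E, fun n => ?_, fun n k M => ?_⟩
  · have := (he n).isEquivalence
    exact (CategoryTheory.Equivalence.mk (E n).F (SmallFam.eval P.str (stdBasis n)).F (η n).symm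
      (κ n)).isEquivalence_functor
  · let R : OverFunctor (SmallFam.proj P.str n) (SmallFam.proj P.str k) :=
      ⟨SmallFam.comap (rowHom M), rfl⟩
    refine ⟨(E n).comp (R.comp (SmallFam.eval P.str (stdBasis k))), fun i => ?_, ?_⟩
    · exact (congrArg (fun m => IsLinComb P.str.toLaw m _) (rowHom_stdBasis M i)).mp
        (SmallFam.isLinComb_evalAt P.str (E n) (η n) (hη n) (rowHom M (stdBasis k i)))
    · exact OverFunctor.Isom.symm ⟨Functor.isoWhiskerLeft ((E n).comp R).F (κ k), fun z => hκ k _⟩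

end PicardMatrix

theorem theorem1 {C : Type u} [Category.{v} C] (J : GrothendieckTopology C) :
    PicardMatrix.IsFibred2 (PicardMatrix.Picard.{w₁, w₂} J) ∧
    PicardMatrix.IsFibred2 (PicardMatrix.Alg.{w₁, w₂} J) ∧
    ∃ Φ : PicardMatrix.CartPseudofunctor (PicardMatrix.Picard.{w₁, w₂} J)
        (PicardMatrix.Alg.{w₁, w₂} J),
      Φ.IsTwoEquivalence ∧
      ∀ (U : C) (P : PicardMatrix.PicardStack.{max u v w₁, max v w₂} (J.over U)),
        ∃ A : PicardMatrix.TwoAlgebra.{max u v w₁, max v w₂} (J.over U),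
          Φ.obj ⟨U, P⟩ = ⟨U, A⟩ ∧ PicardMatrix.IsMatrixAlgebra P A := by
  have h := PicardMatrix.Picard.isLocalEquiv_toAlgPseudofunctor.{w₁, w₂} (J := J)
  have e : ∀ {P Q : PicardMatrix.Picard.{w₁, w₂} J} (F : P ⟶ Q), F.hom.base =
      eqToHom rfl ≫ F.hom.base ≫ eqToHom rfl := fun F =>
    ((Category.id_comp _).trans (Category.comp_id _)).symm
  refine ⟨PicardMatrix.Picard.isFibred2 J, h.isFibred2 (fun _ => rfl) e PicardMatrix.Alg.exists_toAlg
    (PicardMatrix.Picard.isFibred2 J), h.toCartPseudofunctor (fun _ => rfl) e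
      PicardMatrix.Alg.exists_toAlg, h.isTwoEquivalence _ _ _, fun U P => ⟨P.famAlgebra, rfl,
        P.isMatrixAlgebra⟩⟩
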